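/- **Setting.** Let $M$ be a smooth manifold and $V=\bigoplus_{k\in\mathbb Z}V^k$ a smooth $\mathbb Z$-graded real vector bundle of finite rank over $M$. Let $D=\nabla-A_0-A_2-A_3-\cdots$ be a superconnection on $V$: $(-1)^k\nabla$ is a connection on $V^k$ for every $k$, and $A_p\in\Omega^p(M,\mathrm{End}^{1-p}(V))$ for $p\neq1$. In a local chart and a local homogeneous frame of $V$ write $D=d-A_0-A_1-A_2-\cdots$, with $A_1\in\Omega^1(\mathrm{End}^0(V))$. The element $f\otimes\alpha$, where $\alpha$ is a differential form, has the value $\alpha(v_1,\dots,v_p)f$ on tangent vectors. The usual sign rules are used: $(f\otimes\alpha)(g\otimes\beta)=(-1)^{|\alpha||g|}fg\otimes\alpha\beta$, and $d$ is $(-1)^{|f|}$ times the exterior derivative on forms with coefficients of degree $|f|$, both for $\mathrm{Hom}$-valued and for $V$-valued forms. $D$ acts on the $V$-valued forms, and is *flat* if $D^2=0$. Let $P(M,x_0,x_1)$ be the space of smooth paths $\gamma:[0,1]\to M$ from $x_0$ to $x_1$; forms on it are determined by their pull-backs along smooth families of paths, parametrized by open subsets of the spaces $\mathbb R^n$, and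 $d$ is computed on these pull-backs. The parallel transport of $D$ is the unique family of $p$-forms $\Psi_p(t,s)$, $0\le s\le t\le1$, on the space of paths, with values in $\mathrm{Hom}^{-p}(V_{\gamma(s)},V_{\gamma(t)})$ at $\gamma$, such that $\Psi_0(s,s)=\mathrm{id}$, $\Psi_p(s,s)=0$ for $p>0$ and, in local frames, $$\frac{\partial}{\partial t}\Psi_p(t,s)=\sum_{i=0}^p(A_{i+1}/t)\,\Psi_{p-i}(t,s),\qquad (A_{i+1}/t)_\gamma(\eta_1,\dots,\eta_i)=A_{i+1}(\eta_1(t),\dots,\eta_i(t),\gamma'(t)).$$ Put $\Psi_p=\Psi_p(1,0)$ and $\Psi_{-1}=0$. In products with $\Psi_q$ on $P(M,x_0,x_1)$, the factor $A_0$ on the left is $A_0(x_1)$ and the factor $A_0$ on the right is $A_0(x_0)$. For a smooth map $h:I^q\to P(M,x_0,x_1)$ (that is, $(u,t)\mapsto h(u)(t)$ is smooth on $I^q\times[0,1]$), $\int_{I^q}\Psi_q\in\mathrm{Hom}(V_{x_0},V_{x_1})$ is the integral of the pull-back of $\Psi_q$, with $\int(g\otimes\beta)=g\int\beta$, and $$\int_{\partial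 I^q}\Psi_{q-1}:=\sum_{i=1}^q(-1)^{q-i}\Big(\int_{\{u_i=1\}}\Psi_{q-1}-\int_{\{u_i=0\}}\Psi_{q-1}\Big),$$ each face being parametrized by the remaining coordinates in their order. Consider, for $q\ge0$, the conditions * $(\mathrm{H}_q;x_0,x_1)$: for all smooth maps $h:I^q\to P(M,x_0,x_1)$, $$A_0\int_{I^q}\Psi_q-(-1)^q\Big(\int_{I^q}\Psi_q\Big)A_0=\int_{\partial I^q}\Psi_{q-1};$$ * $(\mathrm{P}_q;x_0,x_1)$: $A_0\Psi_q-\Psi_qA_0=d\Psi_{q-1}$ on $P(M,x_0,x_1)$; * $(\mathrm{S}_q;z)$: $dA_q=\sum_{i=0}^{q+1}A_iA_{q-i+1}$ at the point $z\in M$. **Theorem 3.5.** (a) Suppose that $A_0^2=0$ at all points of $M$. Let $k\ge1$, and let $x_0,x_1$ be points of the same connected component $C$ of $M$. Then the following three conditions are equivalent. 1. $(\mathrm{H}_q;x_0,x_1)$ holds for all $1\le q\le k$, and $(\mathrm{H}_0;y_0,y_1)$ holds for all $y_0,y_1\in C$. 2. $(\mathrm{P}_q;x_0,x_1)$ holds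 for all $1\le q\le k$, and $(\mathrm{P}_0;y_0,y_1)$ holds for all $y_0,y_1\in C$. 3. $(\mathrm{S}_q;z)$ holds for all $0\le q\le k$ and all $z\in C$. (The conditions with $q=0$ in 1 and 2 both say that $\Psi_0$, the parallel transport of $\nabla$, commutes with $A_0$ for all smooth paths in $C$.) (b) $D$ is flat if and only if $A_0^2=0$ at all points of $M$ and one (equivalently, each) of the following holds: $(\mathrm{H}_q;x_0,x_1)$ for all $q\ge 0$ and all $x_0,x_1$ in the same component of $M$; $(\mathrm{P}_q;x_0,x_1)$ for all $q\ge0$ and all $x_0,x_1$ in the same component of $M$; $(\mathrm{S}_q;z)$ for all $q\ge0$ and all $z\in M$. -/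

import Mathlib

open Set MeasureTheory Bundle
open scoped Manifold ContDiff

noncomputable section

namespace SuperTransport

/-! ## Vector-valued alternating forms -/

/-- The wedge product `α ∧ β` of vector-valued alternating forms, the values being multiplied by the
bilinear map `B`:
`(α ∧ β)(v₁, …, vₙ) = ∑ sign(σ) B (α (v_σ(1), …, v_σ(i))) (β (v_σ(i+1), …, v_σ(n)))`,
the sum being over the `(i, j)`-shuffles `σ`, where `n = i + j`. -/
def wedge {X N₁ N₂ N : Type*} [AddCommGroup X] [Module ℝ X] [AddCommGroup N₁] [Module ℝ N₁]
    [AddCommGroup N₂] [Module ℝ N₂] [AddCommGroup N] [Module ℝ N]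
    (B : N₁ →ₗ[ℝ] N₂ →ₗ[ℝ] N) {i j n : ℕ} (h : i + j = n)
    (α : X [⋀^Fin i]→ₗ[ℝ] N₁) (β : X [⋀^Fin j]→ₗ[ℝ] N₂) : X [⋀^Fin n]→ₗ[ℝ] N :=
  ((TensorProduct.lift B).compAlternatingMap (α.domCoprod β)).domDomCongr
    (finSumFinEquiv.trans (finCongr h))

theorem continuous_multilinear {X N : Type*} [NormedAddCommGroup X] [NormedSpace ℝ X]
    [FiniteDimensional ℝ X] [NormedAddCommGroup N] [NormedSpace ℝ N] {n : ℕ}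
    (f : MultilinearMap ℝ (fun _ : Fin n => X) N) : Continuous f := by
  classical
  let b := Module.finBasis ℝ X
  have h : ∀ v : Fin n → X, f v =
      ∑ r : Fin n → Fin (Module.finrank ℝ X), (∏ i, b.repr (v i) (r i)) • f (fun i => b (r i)) := by
    intro v
    have hv : v = fun i => ∑ j, b.repr (v i) j • b j := by
      funext i; exact (b.sum_repr (v i)).symm
    conv_lhs => rw [hv]
    rw [f.map_sum]
    refine Finset.sum_congr rfl fun r _ => ?_
    exact f.map_smul_univ (fun i => b.repr (v i) (r i)) (fun i => b (r i))
  have hc : ∀ j, Continuous fun x : X => b.repr x j := fun j =>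
    (b.coord j).continuous_of_finiteDimensional
  rw [show (⇑f) = _ from funext h]
  refine continuous_finsetSum _ fun r _ => ?_
  exact (continuous_finsetProd _ fun i _ => (hc (r i)).comp (continuous_apply i)).smul
    continuous_const

/-- An alternating form on a finite-dimensional space, with the (automatic) continuity recorded. -/
def toCont {X N : Type*} [NormedAddCommGroup X] [NormedSpace ℝ X] [FiniteDimensional ℝ X]
    [NormedAddCommGroup N] [NormedSpace ℝ N] {n : ℕ} (f : X [⋀^Fin n]→ₗ[ℝ] N) :
    X [⋀^Fin n]→L[ℝ] N :=
  { f with cont := continuous_multilinear f.toMultilinearMap }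

/-! ## Graded bundles and superconnections -/

section Bundles

variable {ι : Type} [Fintype ι] [DecidableEq ι] {m : ℕ}
  {M : Type*} [TopologicalSpace M] [ChartedSpace (EuclideanSpace ℝ (Fin m)) M]
  (V : M → Type*) [TopologicalSpace (TotalSpace (ι → ℝ) V)]
  [∀ x, AddCommGroup (V x)] [∀ x, Module ℝ (V x)] [∀ x, TopologicalSpace (V x)]
  [∀ x, IsTopologicalAddGroup (V x)] [∀ x, ContinuousSMul ℝ (V x)]
  [FiberBundle (ι → ℝ) V] [VectorBundle ℝ (ι → ℝ) V]

/-- A `ℤ`-grading `V = ⨁ₖ Vᵏ` of a vector bundle by smooth subbundles: the members of the local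
frame given by each preferred trivialization are homogeneous, the `a`-th one being of degree `deg a`,
so that `Vᵏ` is spanned by the members of degree `k`. -/
structure Grading where
  /-- the degrees of the members of the local frames -/
  deg : ι → ℤ
  /-- the fibre of the homogeneous subbundle `Vᵏ` -/
  piece : ℤ → ∀ x : M, Submodule ℝ (V x)
  mem_piece_iff : ∀ (c x : M), x ∈ (trivializationAt (ι → ℝ) V c).baseSet →
    ∀ (k : ℤ) (v : V x), v ∈ piece k x ↔
      ∀ a, deg a ≠ k → (trivializationAt (ι → ℝ) V c ⟨x, v⟩).2 a = 0

variable {V}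

/-- The `a`-th member of the local frame given by the trivialization at `c`. -/
def frame (c : M) (a : ι) (x : M) : V x :=
  (trivializationAt (ι → ℝ) V c).symm x (Pi.single a 1)

/-- The matrix of a linear map `V_x → V_x'`, with respect to the frames at `c` and `c'`, as a
continuous linear map. -/
def toMat (c c' x x' : M) : (V x →ₗ[ℝ] V x') →ₗ[ℝ] ((ι → ℝ) →L[ℝ] (ι → ℝ)) where
  toFun f := LinearMap.toContinuousLinearMap
    ((trivializationAt (ι → ℝ) V c').linearMapAt ℝ x' ∘ₗ f ∘ₗ
      (trivializationAt (ι → ℝ) V c).symmₗ ℝ x)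
  map_add' f g := by ext; simp
  map_smul' r f := by ext; simp

variable (V) in
/-- The objects `∇, A₀, A₂, A₃, …` in `D = ∇ - A₀ - A₂ - A₃ - ⋯`. On `Vᵏ` the graded connection `∇`
is `(-1)ᵏ` times the connection `conn`. The value of `A p x` on tangent vectors is an endomorphism of
the fibre: `f ⊗ α` has the value `α(v₁, …, v_p) f`. -/
structure SuperconnectionData where
  /-- the connection which is `(-1)ᵏ ∇` on `Vᵏ` -/
  conn : CovariantDerivative (𝓡 m) (ι → ℝ) V
  /-- the `End V`-valued `p`-forms `A_p` for `p ≠ 1` (there is no `A 1`, see `A_one`) -/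
  A : ∀ (p : ℕ) (x : M), TangentSpace (𝓡 m) x [⋀^Fin p]→ₗ[ℝ] (V x →ₗ[ℝ] V x)
  A_one : ∀ x, A 1 x = 0

namespace SuperconnectionData

variable (D : SuperconnectionData (ι := ι) (m := m) V)

/-- The connection form `A₁` of `∇` in the local frame at `c`, where `∇ = d - A₁`. So the connection
`conn` sends the `a`-th member `s` of the frame to `-A₁ s`. -/
def connForm (c x : M) : TangentSpace (𝓡 m) x →ₗ[ℝ] (V x →ₗ[ℝ] V x) where
  toFun X := -∑ a, (LinearMap.proj a ∘ₗ
    (trivializationAt (ι → ℝ) V c).linearMapAt ℝ x).smulRight (D.conn (frame c a) x X)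
  map_add' X Y := by
    ext v; simp [smul_add, Finset.sum_add_distrib, add_comm]
  map_smul' r X := by
    ext v; simp [Finset.smul_sum, smul_comm r]

/-- The forms `A₀, A₁, A₂, …` such that `D = d - A₀ - A₁ - A₂ - ⋯` in the local frame at `c`. -/
def frameForm (c : M) : ∀ (p : ℕ) (x : M),
    TangentSpace (𝓡 m) x [⋀^Fin p]→ₗ[ℝ] (V x →ₗ[ℝ] V x)
  | 0, x => D.A 0 x
  | 1, x => AlternatingMap.ofSubsingleton ℝ (TangentSpace (𝓡 m) x) (V x →ₗ[ℝ] V x) (0 : Fin 1)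
      (D.connForm c x)
  | (p + 2), x => D.A (p + 2) x

/-- The endomorphism `A₀` of the fibre at `x`. -/
def A₀ (x : M) : V x →ₗ[ℝ] V x := D.A 0 x ![]

/-- The forms `A_p` with `D = d - A₀ - A₁ - A₂ - ⋯`, as matrix-valued forms in the chart and the
frame at `c`. -/
def chartForm (c : M) (p : ℕ) (y : EuclideanSpace ℝ (Fin m)) :
    EuclideanSpace ℝ (Fin m) [⋀^Fin p]→L[ℝ] ((ι → ℝ) →L[ℝ] (ι → ℝ)) :=
  let x : M := (chartAt (EuclideanSpace ℝ (Fin m)) c).symm y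
  toCont ((toMat c c x x).compAlternatingMap ((D.frameForm c p x).compLinearMap
    (mfderiv (𝓡 m) (𝓡 m) (chartAt (EuclideanSpace ℝ (Fin m)) c).symm y).toLinearMap))

end SuperconnectionData

variable (V) in
/-- The part of the chart at `c` over which the trivialization at `c` is defined, in coordinates. -/
def chartDomain (c : M) : Set (EuclideanSpace ℝ (Fin m)) :=
  (chartAt (EuclideanSpace ℝ (Fin m)) c).target ∩
    (chartAt (EuclideanSpace ℝ (Fin m)) c).symm ⁻¹' (trivializationAt (ι → ℝ) V c).baseSet

/-- A (smooth) superconnection `D = ∇ - A₀ - A₂ - A₃ - ⋯` of total degree `1` on a graded bundle. -/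
structure Superconnection (G : Grading (ι := ι) V) extends
    SuperconnectionData (ι := ι) (m := m) V where
  conn_degree : ∀ (k : ℤ) (σ : ∀ x : M, V x), (∀ x, σ x ∈ G.piece k x) → ∀ x : M,
    MDifferentiableAt (𝓡 m) ((𝓡 m).prod 𝓘(ℝ, ι → ℝ))
      (fun y => (⟨y, σ y⟩ : TotalSpace (ι → ℝ) V)) x →
    ∀ X : TangentSpace (𝓡 m) x, conn σ x X ∈ G.piece k x
  A_degree : ∀ (p : ℕ) (x : M) (w : Fin p → TangentSpace (𝓡 m) x) (k : ℤ),
    ∀ v ∈ G.piece k x, A p x w v ∈ G.piece (k + 1 - p) x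
  smooth : ∀ (c : M) (p : ℕ),
    ContDiffOn ℝ ∞ (toSuperconnectionData.chartForm c p) (chartDomain (ι := ι) V c)

/-! ## Flatness -/

variable {G : Grading (ι := ι) V}

/-- The parity operator `(-1)ᵏ` on `Vᵏ`, in a homogeneous frame. -/
def Grading.parity (G : Grading (ι := ι) V) : (ι → ℝ) →L[ℝ] (ι → ℝ) :=
  LinearMap.toContinuousLinearMap
    (LinearMap.pi fun a => ((-1 : ℝ) ^ G.deg a) • LinearMap.proj a)

namespace Superconnection

variable (D : Superconnection (ι := ι) (m := m) G)

/-- `D = d - A₀ - A₁ - A₂ - ⋯` as an operator on the `V`-valued forms over the chart at `c`; a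
`V`-valued form `θ` is given by its parts `θ p` of form degree `p`, in coordinates. The element
`s ⊗ β` has the value `β(v₁, …, v_p) s`, so that `d (s ⊗ β)` is `(-1)ᵏ` times the exterior derivative
and `(f ⊗ α)(s ⊗ β) = (-1)^(k i) f s ⊗ α β`, for `s` in `Vᵏ` and an `i`-form `α`. -/
def op (c : M)
    (θ : ∀ p : ℕ, EuclideanSpace ℝ (Fin m) → EuclideanSpace ℝ (Fin m) [⋀^Fin p]→L[ℝ] (ι → ℝ)) :
    ∀ p : ℕ, EuclideanSpace ℝ (Fin m) → EuclideanSpace ℝ (Fin m) [⋀^Fin p]→L[ℝ] (ι → ℝ) :=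
  let AA : ∀ p : ℕ, EuclideanSpace ℝ (Fin m) →
      EuclideanSpace ℝ (Fin m) [⋀^Fin p]→L[ℝ] (ι → ℝ) := fun p y =>
    toCont (∑ i : Fin (p + 1), wedge (ContinuousLinearMap.coeLM ℝ) (Nat.add_sub_of_le i.is_le)
      (D.chartForm c i y).toAlternatingMap
      (((G.parity ^ (i : ℕ)).toLinearMap).compAlternatingMap (θ (p - i) y).toAlternatingMap))
  fun
  | 0, y => -AA 0 y
  | (p + 1), y => G.parity.compContinuousAlternatingMap (extDeriv (θ p) y) - AA (p + 1) y

/-- `D` is flat: `D² = 0` on the smooth `V`-valued forms over every chart. -/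
def IsFlat : Prop :=
  ∀ (c : M)
    (θ : ∀ p : ℕ, EuclideanSpace ℝ (Fin m) → EuclideanSpace ℝ (Fin m) [⋀^Fin p]→L[ℝ] (ι → ℝ)),
    (∀ p, ContDiffOn ℝ ∞ (θ p) (chartDomain (ι := ι) V c)) →
    ∀ p, ∀ y ∈ chartDomain (ι := ι) V c, D.op c (D.op c θ) p y = 0

/-- `dA_q = ∑ A_i A_{q-i+1}` at the point `z`, in all the local coordinates around `z`. Here, for an
`End V`-valued form `f ⊗ α`, `d (f ⊗ α)` is `(-1)^|f|` times the exterior derivative, and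
`(f ⊗ α)(g ⊗ β) = (-1)^(|α| |g|) f g ⊗ α β`. -/
def StructureEq (q : ℕ) (z : M) : Prop :=
  ∀ c : M, z ∈ (chartAt (EuclideanSpace ℝ (Fin m)) c).source →
    z ∈ (trivializationAt (ι → ℝ) V c).baseSet →
    let y := chartAt (EuclideanSpace ℝ (Fin m)) c z
    (-1 : ℝ) ^ (q + 1) • (extDeriv (D.chartForm c q) y).toAlternatingMap =
      ∑ i : Fin (q + 1 + 1), (-1 : ℝ) ^ ((i : ℕ) * (q + 1 - i + 1)) •
        wedge (LinearMap.mul ℝ ((ι → ℝ) →L[ℝ] (ι → ℝ))) (Nat.add_sub_of_le i.is_le)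
          (D.chartForm c i y).toAlternatingMap (D.chartForm c (q + 1 - i) y).toAlternatingMap

end Superconnection

/-! ## Parallel transport along paths -/

namespace Superconnection

variable (D : Superconnection (ι := ι) (m := m) G)

/-- The contraction `A_{p+1}/t` of the form `A_{p+1}` by the velocity `γ'(t) = v`, at `x = γ(t)` and in
the local frame at `c`, pulled back along a linear map `η` from a space `X` to the tangent space:
`(w₁, …, w_p) ↦ A_{p+1}(η w₁, …, η w_p, v)`. -/
def contraction {X : Type*} [AddCommGroup X] [Module ℝ X] (c : M) (p : ℕ) {x : M}
    (v : TangentSpace (𝓡 m) x) (η : X →ₗ[ℝ] TangentSpace (𝓡 m) x) :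
    X [⋀^Fin p]→ₗ[ℝ] (V x →ₗ[ℝ] V x) :=
  (-1 : ℝ) ^ p • ((D.frameForm c (p + 1) x).curryLeft v).compLinearMap η

/-- The forms `Ψ p t` are the parallel transport `Ψ_p(t, s)` of `D` at the path `γ : [0, 1] → M`,
pulled back along a linear map `w ↦ (t ↦ η t w)` from a space `X` to the vector fields along `γ` (that
is, to the tangent space of the path space at `γ`). The initial value is the identity in degree `0`
and zero in positive degree, and
`∂/∂t Ψ_p(t, s) = ∑ᵢ (A_{i+1}/t) Ψ_{p-i}(t, s)`
in every local frame, where `(f ⊗ α)(g ⊗ β) = (-1)^(|α| |g|) f g ⊗ α β` and `Ψ_{p-i}` has the degree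
`-(p - i)` as a homomorphism. -/
structure IsTransport {X : Type*} [AddCommGroup X] [Module ℝ X] (γ : ℝ → M)
    (η : ∀ t, X →ₗ[ℝ] TangentSpace (𝓡 m) (γ t)) (s : ℝ)
    (Ψ : ∀ (p : ℕ) (t : ℝ), X [⋀^Fin p]→ₗ[ℝ] (V (γ s) →ₗ[ℝ] V (γ t))) : Prop where
  init_zero : ∀ w, Ψ 0 s w = LinearMap.id
  init_pos : ∀ p, 0 < p → Ψ p s = 0
  ode : ∀ (p : ℕ), ∀ t ∈ Icc s 1, ∀ c : M, γ t ∈ (trivializationAt (ι → ℝ) V c).baseSet →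
    ∀ (w : Fin p → X) (v : V (γ s)),
    HasDerivWithinAt
      (fun τ => (trivializationAt (ι → ℝ) V c ⟨γ τ, Ψ p τ w v⟩).2)
      (trivializationAt (ι → ℝ) V c ⟨γ t, (∑ i : Fin (p + 1), (-1 : ℝ) ^ ((i : ℕ) * (p - i)) •
        wedge (LinearMap.llcomp ℝ (V (γ s)) (V (γ t)) (V (γ t))) (Nat.add_sub_of_le i.is_le)
          (D.contraction c i (mfderivWithin 𝓘(ℝ, ℝ) (𝓡 m) γ (Icc 0 1) t (1 : ℝ)) (η t))
          (Ψ (p - i) t)) w v⟩).2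
      (Icc s 1) t

open Classical in
/-- The parallel transport `Ψ_p(t, s)` at the path `γ`, pulled back along `η`: the unique family
satisfying the initial value problem for `0 ≤ s ≤ t ≤ 1`, when `γ` and `η` are smooth. -/
def transport {X : Type*} [AddCommGroup X] [Module ℝ X] (γ : ℝ → M)
    (η : ∀ t, X →ₗ[ℝ] TangentSpace (𝓡 m) (γ t)) (s : ℝ) (p : ℕ) (t : ℝ) :
    X [⋀^Fin p]→ₗ[ℝ] (V (γ s) →ₗ[ℝ] V (γ t)) :=
  if h : ∃ Ψ, D.IsTransport γ η s Ψ then h.choose p t else 0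

end Superconnection

/-! ## Families of paths -/

variable (m) in
/-- `h` is a smooth family, parametrized by the subset `S` of `ℝⁿ`, of paths `t ↦ h u t` in `M`,
`t ∈ [0, 1]`, from `x₀` to `x₁`, i.e., a smooth map from `S` to the path space `P(M, x₀, x₁)`. -/
structure IsPathFamily {n : ℕ} (S : Set (Fin n → ℝ)) (h : (Fin n → ℝ) → ℝ → M) (x₀ x₁ : M) :
    Prop where
  smooth : ContMDiffOn 𝓘(ℝ, (Fin n → ℝ) × ℝ) (𝓡 m) ∞ (fun z => h z.1 z.2) (S ×ˢ Icc 0 1)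
  source : ∀ u ∈ S, h u 0 = x₀
  target : ∀ u ∈ S, h u 1 = x₁

namespace Superconnection

variable (D : Superconnection (ι := ι) (m := m) G)

/-- The pull-back of `Ψ_p = Ψ_p(1, 0)` along a family of paths from `x₀` to `x₁` parametrized by `S`,
a `p`-form on `S` with values in `Hom(V_x₀, V_x₁)`, as a matrix with respect to the frames at `x₀`
and `x₁`. -/
def Psi {n : ℕ} (S : Set (Fin n → ℝ)) (h : (Fin n → ℝ) → ℝ → M) (x₀ x₁ : M) (p : ℕ)
    (u : Fin n → ℝ) : (Fin n → ℝ) [⋀^Fin p]→L[ℝ] ((ι → ℝ) →L[ℝ] (ι → ℝ)) :=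
  toCont ((toMat x₀ x₁ (h u 0) (h u 1)).compAlternatingMap
    (D.transport (h u)
      (fun t => (mfderivWithin 𝓘(ℝ, Fin n → ℝ) (𝓡 m) (fun u' => h u' t) S u).toLinearMap) 0 p 1))

/-- The matrix of `A₀` at `x`, in the frame at `x`. -/
def A₀mat (x : M) : (ι → ℝ) →L[ℝ] (ι → ℝ) := toMat x x x x (D.A₀ x)

/-- The integral of `Ψ_p` over the cube `I^p`, for a family of paths parametrized by the cube. -/
def cubeIntegral {p : ℕ} (h : (Fin p → ℝ) → ℝ → M) (x₀ x₁ : M) : (ι → ℝ) →L[ℝ] (ι → ℝ) :=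
  ∫ u in Icc (0 : Fin p → ℝ) 1,
    D.Psi (Icc (0 : Fin p → ℝ) 1) h x₀ x₁ p u (fun j => Pi.single j 1)

/-- The signed sum of the integrals of `Ψ_{q-1}` over the codimension one faces of `I^q`:
`∑ᵢ (-1)^(q-i) (∫_{u_i = 1} Ψ_{q-1} - ∫_{u_i = 0} Ψ_{q-1})`, `1 ≤ i ≤ q`. (In the code `i` starts from
`0`.) By Stokes' theorem this is the integral over `I^q` of `dΨ_{q-1}`, where `d (f ⊗ α)` is
`(-1)^|f|` times the exterior derivative. -/
def boundaryIntegral : ∀ {q : ℕ} (_ : (Fin q → ℝ) → ℝ → M) (_ _ : M), (ι → ℝ) →L[ℝ] (ι → ℝ)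
  | 0, _, _, _ => 0
  | q + 1, h, x₀, x₁ => ∑ i : Fin (q + 1), (-1 : ℝ) ^ (q - (i : ℕ)) •
      (D.cubeIntegral (fun u => h (i.insertNth (1 : ℝ) u)) x₀ x₁ -
        D.cubeIntegral (fun u => h (i.insertNth (0 : ℝ) u)) x₀ x₁)

/-- For all smooth families of paths from `x₀` to `x₁` parametrized by the cube `I^q`,
`A₀ ∫_{I^q} Ψ_q - (-1)^q (∫_{I^q} Ψ_q) A₀ = ∫_{∂ I^q} Ψ_{q-1}`. -/
def NullHomotopy (q : ℕ) (x₀ x₁ : M) : Prop :=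
  ∀ h : (Fin q → ℝ) → ℝ → M, IsPathFamily m (Icc 0 1) h x₀ x₁ →
    (D.A₀mat x₁).comp (D.cubeIntegral h x₀ x₁) -
        (-1 : ℝ) ^ q • (D.cubeIntegral h x₀ x₁).comp (D.A₀mat x₀) =
      D.boundaryIntegral h x₀ x₁

/-- `dΨ_{q-1}`, pulled back to `S ⊆ ℝⁿ`; this is `(-1)^(q-1)` times the exterior derivative, since
`Ψ_{q-1}` has the degree `-(q-1)` as a homomorphism. It is zero for `q = 0`. -/
def dPsi {n : ℕ} (S : Set (Fin n → ℝ)) (h : (Fin n → ℝ) → ℝ → M) (x₀ x₁ : M) :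
    ∀ (q : ℕ) (_ : Fin n → ℝ), (Fin n → ℝ) [⋀^Fin q]→L[ℝ] ((ι → ℝ) →L[ℝ] (ι → ℝ))
  | 0, _ => 0
  | q + 1, u => (-1 : ℝ) ^ q • extDeriv (D.Psi S h x₀ x₁ q) u

/-- `A₀ Ψ_q - Ψ_q A₀ = dΨ_{q-1}` as forms on the path space `P(M, x₀, x₁)`, that is, after pull-back
to every smooth family of paths parametrized by an open subset of some `ℝⁿ`. Here
`(f ⊗ α)(g ⊗ β) = (-1)^(|α| |g|) f g ⊗ α β`, and `A₀` has the degree `1` as an endomorphism. -/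
def PathSpaceEq (q : ℕ) (x₀ x₁ : M) : Prop :=
  ∀ (n : ℕ) (S : Set (Fin n → ℝ)) (h : (Fin n → ℝ) → ℝ → M), IsOpen S →
    IsPathFamily m S h x₀ x₁ → ∀ u ∈ S, ∀ w : Fin q → Fin n → ℝ,
      (D.A₀mat x₁).comp (D.Psi S h x₀ x₁ q u w) -
          (-1 : ℝ) ^ q • (D.Psi S h x₀ x₁ q u w).comp (D.A₀mat x₀) =
        D.dPsi S h x₀ x₁ q u w

end Superconnection

end Bundles

end SuperTransport

end

/-! The sign rules are removed first. Multiplying a form of degree n by `tw n`, the sign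
(-1)^(n(n-1)/2), turns the graded products into plain wedge products, written * below. Let a and Y
denote the families `tw n` A_n and `tw n` Ψ_n, and let ε be the sign (-1)^n in degree n. Over the
product of the parameter space of a family of paths with the time axis, the transport equation
becomes ∂_t Y = (ι_t a) * Y. The structure equation S_q says that the part of degree q+1 of the
curvature K = da + ε(a) * a vanishes, and the part of degree 0 of K is A₀².

Everything is read off from the defect E = a * Y - ε(Y A₀(x₀)) - dY. The paths are reparametrized so
that they rest at x₀ for t ≤ 0 and at x₁ for t ≥ 1. While a path rests at x₀, Y is the identity and
E = 0; while it rests at x₁, a reduces to A₀(x₁) and E_q = 0 is the condition P_q. The transport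
equation amounts to ι_t E = 0 (`iota_defect`), so Cartan's formula gives ∂_t E = ι_t dE, and
computing dE yields the linear equation ∂_t E = ε(ι_t a) * E + (ι_t K) * Y (`fderiv_defect`).

S implies P: the source term vanishes in the relevant degrees, and E stays zero by uniqueness
(`pathDefect_eq_zero`).

P implies S, by induction on q: if K vanishes up to degree q and E below degree q, variation of
constants gives (Y₀⁻¹ E_q)' = Y₀⁻¹ (ι_t K_{q+1}) Y₀ (`hasDerivAt_holonomyDefect`). For q = 0 the
condition P_0 is available for every initial piece of a path, so the left side vanishes identically
(`chartCurv_one_eq_zero`). For q ≥ 1 only the end points x₀ and x₁ are available. If K_{q+1}(v, w_1,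
…, w_q) ≠ 0 at z, a path from x₀ to x₁ is led through z with a velocity proportional to v and varied
near z by bumps in the directions w_j. For a suitable functional the derivative of Y₀⁻¹ E_q is then
nonnegative along the path and positive at z, although Y₀⁻¹ E_q vanishes at both ends
(`structure_equation_step`).

H is equivalent to P by Stokes' theorem on the cube: the integral of the defect of Ψ over I^q is, up
to sign, the defect in H_q. From H to P, the defect is tested on small parallelepipeds
(`pathSpaceEq_of_nullHomotopy`); from P to H, the closed cube is first parametrized by all of ℝ^q
through cosines.

Flatness: a similar change of signs, involving the parity operator, turns D into φ ↦ dφ - a * φ, up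
to ε. Its square is the action of K, so D² = 0 if and only if K = 0 in all degrees (`isFlat_iff`).
-/

set_option linter.unusedSectionVars false

noncomputable section

namespace SuperTransport

/-! ## Algebra of the wedge product -/

section Algebra

variable {X Y N₁ N₂ N₃ N₁₂ N₂₃ N N' : Type*} [AddCommGroup X] [Module ℝ X]
  [AddCommGroup Y] [Module ℝ Y]
  [AddCommGroup N₁] [Module ℝ N₁] [AddCommGroup N₂] [Module ℝ N₂] [AddCommGroup N₃] [Module ℝ N₃]
  [AddCommGroup N₁₂] [Module ℝ N₁₂] [AddCommGroup N₂₃] [Module ℝ N₂₃]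
  [AddCommGroup N] [Module ℝ N] [AddCommGroup N'] [Module ℝ N']

/-- The product of multilinear maps, the values being multiplied by `B`. -/
def mulMap (B : N₁ →ₗ[ℝ] N₂ →ₗ[ℝ] N) {i j n : ℕ} (h : i + j = n)
    (a : MultilinearMap ℝ (fun _ : Fin i => X) N₁) (b : MultilinearMap ℝ (fun _ : Fin j => X) N₂) :
    MultilinearMap ℝ (fun _ : Fin n => X) N :=
  ((TensorProduct.lift B).compMultilinearMap (a.domCoprod b)).domDomCongr
    (finSumFinEquiv.trans (finCongr h))

theorem mulMap_apply (B : N₁ →ₗ[ℝ] N₂ →ₗ[ℝ] N) {i j n : ℕ} (h : i + j = n)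
    (a : MultilinearMap ℝ (fun _ : Fin i => X) N₁) (b : MultilinearMap ℝ (fun _ : Fin j => X) N₂)
    (v : Fin n → X) :
    mulMap B h a b v = B (a fun k => v (Fin.cast h (Fin.castAdd j k)))
      (b fun k => v (Fin.cast h (Fin.natAdd i k))) := by
  simp [mulMap, MultilinearMap.domCoprod_apply]

theorem alternatization_domDomCongr {κ κ' : Type*} [Fintype κ] [DecidableEq κ] [Fintype κ']
    [DecidableEq κ'] (e : κ ≃ κ') (f : MultilinearMap ℝ (fun _ : κ => X) N) :
    MultilinearMap.alternatization (f.domDomCongr e) =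
      (MultilinearMap.alternatization f).domDomCongr e := by
  ext v
  simp only [MultilinearMap.alternatization_apply, AlternatingMap.domDomCongr_apply,
    MultilinearMap.domDomCongr_apply]
  refine Fintype.sum_equiv e.symm.permCongr _ _ fun σ => ?_
  simp [Equiv.permCongr_apply]

theorem alternatization_domDomCongr_perm {n : ℕ} (σ : Equiv.Perm (Fin n))
    (f : MultilinearMap ℝ (fun _ : Fin n => X) N) :
    MultilinearMap.alternatization (f.domDomCongr σ) =
      Equiv.Perm.sign σ • MultilinearMap.alternatization f := by
  rw [alternatization_domDomCongr, AlternatingMap.domDomCongr_perm]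

/-- The sum over all permutations splits into a sum over shuffles and sums over the permutations of
the two blocks. No factorials appear, because the alternatization is not normalized. -/
theorem wedge_alternatization (B : N₁ →ₗ[ℝ] N₂ →ₗ[ℝ] N) {i j n : ℕ} (h : i + j = n)
    (a : MultilinearMap ℝ (fun _ : Fin i => X) N₁) (b : MultilinearMap ℝ (fun _ : Fin j => X) N₂) :
    wedge B h (MultilinearMap.alternatization a) (MultilinearMap.alternatization b) =
      MultilinearMap.alternatization (mulMap B h a b) := by
  rw [wedge, mulMap, alternatization_domDomCongr, LinearMap.compMultilinearMap_alternatization,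
    MultilinearMap.domCoprod_alternization]

/-- Alternatization as a linear map. -/
def altₗ (n : ℕ) : MultilinearMap ℝ (fun _ : Fin n => X) N →ₗ[ℝ] X [⋀^Fin n]→ₗ[ℝ] N where
  toFun f := MultilinearMap.alternatization f
  map_add' := map_add _
  map_smul' r f := by
    ext v
    simp [MultilinearMap.alternatization_apply, Finset.smul_sum, smul_comm r]

/-- A linear right inverse of the alternatization. -/
def altSection (n : ℕ) : X [⋀^Fin n]→ₗ[ℝ] N →ₗ[ℝ] MultilinearMap ℝ (fun _ : Fin n => X) N where
  toFun α := ((n.factorial : ℝ)⁻¹) • α.toMultilinearMap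
  map_add' α β := by ext; simp
  map_smul' r α := by ext; simp [smul_comm r]

/-- The unnormalized alternatization multiplies an alternating map by n!. Every form is thus the
alternatization of a multilinear map, which reduces the identities for `wedge` to identities for
`mulMap`. -/
theorem altₗ_altSection {n : ℕ} (α : X [⋀^Fin n]→ₗ[ℝ] N) : altₗ n (altSection n α) = α := by
  have h := AlternatingMap.coe_alternatization α
  have h0 : (n.factorial : ℝ) ≠ 0 := by positivity
  change altₗ n (((n.factorial : ℝ)⁻¹) • α.toMultilinearMap) = α
  rw [map_smul]
  change ((n.factorial : ℝ)⁻¹) • MultilinearMap.alternatization (α : MultilinearMap _ _ _) = α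
  rw [h, Fintype.card_fin, ← Nat.cast_smul_eq_nsmul ℝ, smul_smul, inv_mul_cancel₀ h0, one_smul]

theorem wedge_altₗ (B : N₁ →ₗ[ℝ] N₂ →ₗ[ℝ] N) {i j n : ℕ} (h : i + j = n)
    (a : MultilinearMap ℝ (fun _ : Fin i => X) N₁) (b : MultilinearMap ℝ (fun _ : Fin j => X) N₂) :
    wedge B h (altₗ i a) (altₗ j b) = altₗ n (mulMap B h a b) :=
  wedge_alternatization B h a b

theorem wedge_eq_altₗ (B : N₁ →ₗ[ℝ] N₂ →ₗ[ℝ] N) {i j n : ℕ} (h : i + j = n)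
    (α : X [⋀^Fin i]→ₗ[ℝ] N₁) (β : X [⋀^Fin j]→ₗ[ℝ] N₂) :
    wedge B h α β = altₗ n (mulMap B h (altSection i α) (altSection j β)) := by
  rw [← wedge_altₗ, altₗ_altSection, altₗ_altSection]

/-- The wedge product as a bilinear map. -/
def wedgeₗ (B : N₁ →ₗ[ℝ] N₂ →ₗ[ℝ] N) {i j n : ℕ} (h : i + j = n) :
    X [⋀^Fin i]→ₗ[ℝ] N₁ →ₗ[ℝ] X [⋀^Fin j]→ₗ[ℝ] N₂ →ₗ[ℝ] X [⋀^Fin n]→ₗ[ℝ] N :=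
  LinearMap.mk₂ ℝ (wedge B h)
    (fun α α' β => by
      simp only [wedge_eq_altₗ, ← map_add]; congr 1; ext v; simp [mulMap_apply])
    (fun r α β => by
      simp only [wedge_eq_altₗ, ← map_smul]; congr 1; ext v; simp [mulMap_apply])
    (fun α β β' => by
      simp only [wedge_eq_altₗ, ← map_add]; congr 1; ext v; simp [mulMap_apply])
    (fun r α β => by
      simp only [wedge_eq_altₗ, ← map_smul]; congr 1; ext v; simp [mulMap_apply])

@[simp]
theorem wedgeₗ_apply (B : N₁ →ₗ[ℝ] N₂ →ₗ[ℝ] N) {i j n : ℕ} (h : i + j = n)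
    (α : X [⋀^Fin i]→ₗ[ℝ] N₁) (β : X [⋀^Fin j]→ₗ[ℝ] N₂) : wedgeₗ B h α β = wedge B h α β := rfl

/-- Once the three forms are written as alternatizations, both sides alternatize the same
multilinear map. The degrees are independent variables tied by equations, so that no form has to be
transported along an equality of degrees. -/
theorem wedge_assoc (B : N₁₂ →ₗ[ℝ] N₃ →ₗ[ℝ] N) (B' : N₁ →ₗ[ℝ] N₂ →ₗ[ℝ] N₁₂)
    (C : N₁ →ₗ[ℝ] N₂₃ →ₗ[ℝ] N) (C' : N₂ →ₗ[ℝ] N₃ →ₗ[ℝ] N₂₃)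
    (hB : ∀ x y z, B (B' x y) z = C x (C' y z)) {i j k ij jk n : ℕ}
    (h₁ : ij + k = n) (h₂ : i + j = ij) (h₃ : i + jk = n) (h₄ : j + k = jk)
    (α : X [⋀^Fin i]→ₗ[ℝ] N₁) (β : X [⋀^Fin j]→ₗ[ℝ] N₂) (γ : X [⋀^Fin k]→ₗ[ℝ] N₃) :
    wedge B h₁ (wedge B' h₂ α β) γ = wedge C h₃ α (wedge C' h₄ β γ) := by
  rw [← altₗ_altSection α, ← altₗ_altSection β, ← altₗ_altSection γ, wedge_altₗ, wedge_altₗ,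
    wedge_altₗ, wedge_altₗ]
  congr 1
  ext v
  simp only [mulMap_apply, hB]
  subst h₂ h₄ h₁
  congr 2
  · congr 2
    ext k
    congr 1
    ext
    simp; omega

theorem wedge_compLinearMap (B : N₁ →ₗ[ℝ] N₂ →ₗ[ℝ] N) {i j n : ℕ} (h : i + j = n)
    (α : X [⋀^Fin i]→ₗ[ℝ] N₁) (β : X [⋀^Fin j]→ₗ[ℝ] N₂) (f : Y →ₗ[ℝ] X) :
    (wedge B h α β).compLinearMap f = wedge B h (α.compLinearMap f) (β.compLinearMap f) := by
  simp only [wedge_eq_altₗ]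
  ext v
  simp [altₗ, MultilinearMap.alternatization_apply, mulMap_apply, altSection]

theorem wedge_comp_values {M₁ M₂ M : Type*} [AddCommGroup M₁] [Module ℝ M₁] [AddCommGroup M₂]
    [Module ℝ M₂] [AddCommGroup M] [Module ℝ M] (B : N₁ →ₗ[ℝ] N₂ →ₗ[ℝ] N)
    (C : M₁ →ₗ[ℝ] M₂ →ₗ[ℝ] M) (f : N →ₗ[ℝ] M) (f₁ : N₁ →ₗ[ℝ] M₁) (f₂ : N₂ →ₗ[ℝ] M₂)
    (hf : ∀ x y, f (B x y) = C (f₁ x) (f₂ y)) {i j n : ℕ} (h : i + j = n)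
    (α : X [⋀^Fin i]→ₗ[ℝ] N₁) (β : X [⋀^Fin j]→ₗ[ℝ] N₂) :
    f.compAlternatingMap (wedge B h α β) =
      wedge C h (f₁.compAlternatingMap α) (f₂.compAlternatingMap β) := by
  simp only [wedge_eq_altₗ]
  ext v
  simp [altₗ, MultilinearMap.alternatization_apply, mulMap_apply, altSection, hf, map_sum,
    map_zsmul, Units.smul_def]

theorem wedge_zero_left (B : N₁ →ₗ[ℝ] N₂ →ₗ[ℝ] N) {n : ℕ} (h : 0 + n = n)
    (α : X [⋀^Fin 0]→ₗ[ℝ] N₁) (β : X [⋀^Fin n]→ₗ[ℝ] N₂) :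
    wedge B h α β = (B (α ![])).compAlternatingMap β := by
  conv_rhs => rw [← altₗ_altSection β]
  rw [wedge_eq_altₗ]
  change _ = (B (α ![])).compAlternatingMap (MultilinearMap.alternatization _)
  rw [← LinearMap.compMultilinearMap_alternatization]
  change MultilinearMap.alternatization _ = _
  congr 1
  ext v
  simp only [mulMap_apply, LinearMap.compMultilinearMap_apply]
  congr 2
  · simp only [altSection, LinearMap.coe_mk, AddHom.coe_mk, Nat.factorial_zero,
      Nat.cast_one, inv_one, one_smul]
    exact congrArg α (Subsingleton.elim _ _)
  · ext k
    congr 1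
    ext
    simp

/-- The alternatization of a multilinear map with a distinguished first argument. -/
theorem alternatizeUncurryFin_altₗ {n : ℕ}
    (f : X →ₗ[ℝ] MultilinearMap ℝ (fun _ : Fin n => X) N) :
    AlternatingMap.alternatizeUncurryFin (altₗ n ∘ₗ f) =
      altₗ (n + 1) (LinearMap.uncurryLeft (R := ℝ) (M := fun _ : Fin (n + 1) => X) f) := by
  set G := LinearMap.uncurryLeft (R := ℝ) (M := fun _ : Fin (n + 1) => X) f with hG
  set H := LinearMap.uncurryLeft (R := ℝ) (M := fun _ : Fin (n + 1) => X)
    (AlternatingMap.toMultilinearMapLM (S := ℝ) ∘ₗ altₗ n ∘ₗ f) with hH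
  set L := AlternatingMap.alternatizeUncurryFin (altₗ n ∘ₗ f) with hL
  -- The alternating sum over the place of the distinguished argument is a signed sum over the
  -- inverses of the cycles `Fin.cycleRange k`.
  have h1 : (L : MultilinearMap ℝ (fun _ : Fin (n + 1) => X) N) =
      ∑ k : Fin (n + 1), (-1 : ℤ) ^ (k : ℕ) • H.domDomCongr (Fin.cycleRange k).symm := by
    ext v
    simp only [AlternatingMap.coe_multilinearMap, hL, AlternatingMap.alternatizeUncurryFin_apply,
      sum_apply, smul_apply, MultilinearMap.domDomCongr_apply, hH,
      LinearMap.uncurryLeft_apply]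
    refine Finset.sum_congr rfl fun k _ => ?_
    congr 1
    simp only [LinearMap.comp_apply,
      AlternatingMap.toMultilinearMapLM_apply, AlternatingMap.coe_multilinearMap]
    congr 1
    · rw [Fin.cycleRange_symm_zero]
    · ext j
      exact congrArg v (Fin.cycleRange_symm_succ k j).symm
  -- The inner alternatization is a sum over the n! permutations fixing the first place. The outer
  -- alternatization absorbs each of them together with its sign.
  have h2 : altₗ (n + 1) H = (n.factorial : ℝ) • altₗ (n + 1) G := by
    have : H = ∑ σ : Equiv.Perm (Fin n), (Equiv.Perm.sign σ : ℤ) •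
        G.domDomCongr (Equiv.Perm.decomposeFin.symm (0, σ)) := by
      ext v
      simp only [hH, LinearMap.uncurryLeft_apply, LinearMap.comp_apply,
        AlternatingMap.toMultilinearMapLM_apply, AlternatingMap.coe_multilinearMap,
        sum_apply, smul_apply, MultilinearMap.domDomCongr_apply, hG]
      change MultilinearMap.alternatization (f (v 0)) (Fin.tail v) = _
      rw [MultilinearMap.alternatization_apply]
      refine Finset.sum_congr rfl fun σ _ => ?_
      rw [Units.smul_def]
      congr 1
    rw [this, map_sum]
    have hs : ∀ σ : Equiv.Perm (Fin n), altₗ (n + 1) ((Equiv.Perm.sign σ : ℤ) •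
        G.domDomCongr (Equiv.Perm.decomposeFin.symm (0, σ))) = altₗ (n + 1) G := by
      intro σ
      rw [map_zsmul]
      change (Equiv.Perm.sign σ : ℤ) • MultilinearMap.alternatization _ = _
      rw [alternatization_domDomCongr_perm, Equiv.Perm.decomposeFin.symm_sign]
      simp only [if_true, one_mul, Units.smul_def, smul_smul]
      rw [← Units.val_mul, Int.units_mul_self]
      simp [altₗ]
    rw [Finset.sum_congr rfl fun σ _ => hs σ]
    simp [Fintype.card_perm, ← Nat.cast_smul_eq_nsmul ℝ]
  have h3 : altₗ (n + 1) (L : MultilinearMap ℝ (fun _ : Fin (n + 1) => X) N) =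
      ((n + 1 : ℕ) : ℝ) • altₗ (n + 1) H := by
    rw [h1, map_sum]
    have hs : ∀ k : Fin (n + 1), altₗ (n + 1)
        ((-1 : ℤ) ^ (k : ℕ) • H.domDomCongr (Fin.cycleRange k).symm) = altₗ (n + 1) H := by
      intro k
      rw [map_zsmul]
      change (-1 : ℤ) ^ (k : ℕ) • MultilinearMap.alternatization _ = _
      rw [alternatization_domDomCongr_perm, Equiv.Perm.sign_symm, Fin.sign_cycleRange]
      simp only [Units.smul_def, smul_smul, Units.val_pow_eq_pow_val, Units.val_neg, Units.val_one]
      rw [← mul_pow]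
      simp [altₗ]
    rw [Finset.sum_congr rfl fun k _ => hs k]
    simp [← Nat.cast_smul_eq_nsmul ℝ]
  have h4 : altₗ (n + 1) (L : MultilinearMap ℝ (fun _ : Fin (n + 1) => X) N) =
      ((n + 1).factorial : ℝ) • L := by
    change MultilinearMap.alternatization _ = _
    rw [AlternatingMap.coe_alternatization, Fintype.card_fin, Nat.cast_smul_eq_nsmul ℝ]
  have h0 : ((n + 1).factorial : ℝ) ≠ 0 := by positivity
  -- Since L is alternating, alternatizing it multiplies it by (n+1)!. The count above gives (n+1) ·
  -- n! times the alternatization of G, so the factor cancels.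
  have : ((n + 1).factorial : ℝ) • L = ((n + 1).factorial : ℝ) • altₗ (n + 1) G := by
    rw [← h4, h3, h2, smul_smul, Nat.factorial_succ, Nat.cast_mul]
  exact smul_right_injective _ h0 this

/-- One half of the Leibniz rule at a single point, `a` playing the role of the derivative of the
left factor. There is no sign because the direction of differentiation already stands in front. -/
theorem alternatizeUncurryFin_wedge_left (B : N₁ →ₗ[ℝ] N₂ →ₗ[ℝ] N) {i j n : ℕ} (h : i + j = n)
    (h' : i + 1 + j = n + 1) (a : X →ₗ[ℝ] X [⋀^Fin i]→ₗ[ℝ] N₁) (β : X [⋀^Fin j]→ₗ[ℝ] N₂) :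
    AlternatingMap.alternatizeUncurryFin ((wedgeₗ B h).flip β ∘ₗ a) =
      wedge B h' (AlternatingMap.alternatizeUncurryFin a) β := by
  have ha : a = altₗ i ∘ₗ altSection i ∘ₗ a := by ext1 x; simp [altₗ_altSection]
  have hw : (wedgeₗ B h).flip β ∘ₗ a = altₗ n ∘ₗ
      { toFun := fun x => mulMap B h (altSection i (a x)) (altSection j β)
        map_add' := fun x y => by ext v; simp [mulMap_apply]
        map_smul' := fun r x => by ext v; simp [mulMap_apply] } := by
    ext1 x
    simp [wedge_eq_altₗ]
  rw [hw, alternatizeUncurryFin_altₗ]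
  conv_rhs => rw [ha, alternatizeUncurryFin_altₗ, ← altₗ_altSection β, wedge_altₗ]
  congr 1
  ext v
  simp only [LinearMap.uncurryLeft_apply, LinearMap.coe_mk, AddHom.coe_mk, mulMap_apply,
    LinearMap.comp_apply]
  subst h
  congr 2
  ext k
  simp only [Fin.tail]
  congr 1
  ext
  simp
  omega

/-- The other half of the Leibniz rule: the direction of differentiation has to pass the `i`
arguments of `α`, by a cycle of sign (-1)^i. -/
theorem alternatizeUncurryFin_wedge_right (B : N₁ →ₗ[ℝ] N₂ →ₗ[ℝ] N) {i j n : ℕ} (h : i + j = n)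
    (h' : i + (j + 1) = n + 1) (α : X [⋀^Fin i]→ₗ[ℝ] N₁) (b : X →ₗ[ℝ] X [⋀^Fin j]→ₗ[ℝ] N₂) :
    AlternatingMap.alternatizeUncurryFin (wedgeₗ B h α ∘ₗ b) =
      (-1 : ℝ) ^ i • wedge B h' α (AlternatingMap.alternatizeUncurryFin b) := by
  have hb : b = altₗ j ∘ₗ altSection j ∘ₗ b := by ext1 x; simp [altₗ_altSection]
  have hw : wedgeₗ B h α ∘ₗ b = altₗ n ∘ₗ
      { toFun := fun x => mulMap B h (altSection i α) (altSection j (b x))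
        map_add' := fun x y => by ext v; simp [mulMap_apply]
        map_smul' := fun r x => by ext v; simp [mulMap_apply] } := by
    ext1 x
    simp [wedge_eq_altₗ]
  rw [hw, alternatizeUncurryFin_altₗ]
  conv_rhs => rw [hb, alternatizeUncurryFin_altₗ, ← altₗ_altSection α, wedge_altₗ]
  set G := LinearMap.uncurryLeft (R := ℝ) (M := fun _ : Fin (n + 1) => X)
    { toFun := fun x => mulMap B h (altSection i α) (altSection j (b x))
      map_add' := fun x y => by ext v; simp [mulMap_apply]
      map_smul' := fun r x => by ext v; simp [mulMap_apply] } with hG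
  have hi : i < n + 1 := by omega
  have : mulMap B h' (altSection i α) (LinearMap.uncurryLeft (R := ℝ)
      (M := fun _ : Fin (j + 1) => X) (altSection j ∘ₗ b)) =
      G.domDomCongr (Fin.cycleRange ⟨i, hi⟩).symm := by
    ext v
    simp only [hG, mulMap_apply, MultilinearMap.domDomCongr_apply, LinearMap.uncurryLeft_apply,
      LinearMap.coe_mk, AddHom.coe_mk, LinearMap.comp_apply]
    congr 2
    · congr 1
      ext k
      refine congrArg v (Eq.trans ?_ (Fin.cycleRange_symm_succ _ _).symm)
      rw [Fin.succAbove_of_castSucc_lt _ _ (by simp [Fin.lt_def])]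
      ext; simp
    · rw [Fin.cycleRange_symm_zero]
      congr 3
    · ext k
      refine congrArg v (Eq.trans ?_ (Fin.cycleRange_symm_succ _ _).symm)
      rw [Fin.succAbove_of_le_castSucc _ _ (by simp [Fin.le_def])]
      ext; simp; omega
  rw [this]
  change _ = (-1 : ℝ) ^ i • MultilinearMap.alternatization _
  rw [alternatization_domDomCongr_perm, Equiv.Perm.sign_symm, Fin.sign_cycleRange]
  have : ((-1 : ℤˣ) ^ i • MultilinearMap.alternatization G) =
      (-1 : ℝ) ^ i • MultilinearMap.alternatization G := by
    rcases Nat.even_or_odd i with h2 | h2 <;> simp [h2.neg_one_pow]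
  rw [this, smul_smul, ← mul_pow]
  simp [altₗ]

theorem curryLeft_alternatizeUncurryFin_zero (F : X →ₗ[ℝ] X [⋀^Fin 0]→ₗ[ℝ] N) (v : X) :
    (AlternatingMap.alternatizeUncurryFin F).curryLeft v = F v := by
  ext w
  simp only [AlternatingMap.curryLeft_apply_apply, AlternatingMap.alternatizeUncurryFin_apply]
  simp

/-- The interior product by `v`, for linear families of forms. -/
def curryLeftₗ (n : ℕ) (v : X) : X [⋀^Fin (n + 1)]→ₗ[ℝ] N →ₗ[ℝ] X [⋀^Fin n]→ₗ[ℝ] N where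
  toFun α := α.curryLeft v
  map_add' α β := by ext; simp
  map_smul' r α := by ext; simp

@[simp]
theorem curryLeftₗ_apply {n : ℕ} (v : X) (α : X [⋀^Fin (n + 1)]→ₗ[ℝ] N) :
    curryLeftₗ n v α = α.curryLeft v := rfl

/-- The algebraic content of Cartan's formula. In the alternating sum, the term where `v` is the
distinguished argument gives `F v`; in all the others `v` is contracted into a value of `F`, and the
shift of the index by one produces the minus sign. -/
theorem curryLeft_alternatizeUncurryFin_succ {n : ℕ}
    (F : X →ₗ[ℝ] X [⋀^Fin (n + 1)]→ₗ[ℝ] N) (v : X) :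
    (AlternatingMap.alternatizeUncurryFin F).curryLeft v =
      F v - AlternatingMap.alternatizeUncurryFin (curryLeftₗ n v ∘ₗ F) := by
  ext w
  simp only [AlternatingMap.curryLeft_apply_apply, AlternatingMap.alternatizeUncurryFin_apply,
    AlternatingMap.sub_apply]
  rw [Fin.sum_univ_succ, sub_eq_add_neg, ← Finset.sum_neg_distrib]
  congr 1
  · simp
  · refine Finset.sum_congr rfl fun k _ => ?_
    simp only [Fin.val_succ, pow_succ, Matrix.cons_val_succ, LinearMap.comp_apply,
      curryLeftₗ_apply, AlternatingMap.curryLeft_apply_apply, mul_neg, mul_one, neg_smul]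
    congr 3
    ext l
    refine Fin.cases ?_ (fun l => ?_) l <;> simp [Fin.removeNth]

/-- This makes an induction on the degree possible: a form of degree n + 1 is replaced by a linear
family of forms of degree n. -/
theorem exists_eq_alternatizeUncurryFin {n : ℕ} (α : X [⋀^Fin (n + 1)]→ₗ[ℝ] N) :
    ∃ a, α = AlternatingMap.alternatizeUncurryFin a := by
  refine ⟨((n + 1 : ℕ) : ℝ)⁻¹ • α.curryLeft, ?_⟩
  have h0 : ((n + 1 : ℕ) : ℝ) ≠ 0 := by positivity
  rw [AlternatingMap.alternatizeUncurryFin_smul, AlternatingMap.alternatizeUncurryFin_curryLeft,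
    ← Nat.cast_smul_eq_nsmul ℝ, smul_smul, inv_mul_cancel₀ h0, one_smul]

/-- The interior product is an antiderivation (products with a form of degree `0` on the left). -/
theorem curryLeft_wedge_zero_left (B : N₁ →ₗ[ℝ] N₂ →ₗ[ℝ] N) {n : ℕ} (h : 0 + (n + 1) = n + 1)
    (h' : 0 + n = n) (α : X [⋀^Fin 0]→ₗ[ℝ] N₁) (β : X [⋀^Fin (n + 1)]→ₗ[ℝ] N₂) (v : X) :
    (wedge B h α β).curryLeft v = wedge B h' α (β.curryLeft v) := by
  rw [wedge_zero_left, wedge_zero_left]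
  rfl

/-- Induction on the degree of `α`: with `α` the alternatization of a linear family `a`, the product
is the alternatization of the products with `a x`, and the algebraic Cartan formula reduces the
claim to the forms `a x`. -/
theorem curryLeft_wedge_zero_right (B : N₁ →ₗ[ℝ] N₂ →ₗ[ℝ] N) {i : ℕ} :
    ∀ {n : ℕ} (h : i + 1 + 0 = n + 1) (h' : i + 0 = n) (α : X [⋀^Fin (i + 1)]→ₗ[ℝ] N₁)
      (β : X [⋀^Fin 0]→ₗ[ℝ] N₂) (v : X),
      (wedge B h α β).curryLeft v = wedge B h' (α.curryLeft v) β := by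
  induction i with
  | zero =>
    intro n h h' α β v
    obtain rfl : 0 = n := by omega
    obtain ⟨a, rfl⟩ := exists_eq_alternatizeUncurryFin α
    rw [← alternatizeUncurryFin_wedge_left B h',
      curryLeft_alternatizeUncurryFin_zero, curryLeft_alternatizeUncurryFin_zero]
    rfl
  | succ i ih =>
    intro n h h' α β v
    obtain ⟨n, rfl⟩ : ∃ k, n = k + 1 := ⟨i, by omega⟩
    obtain ⟨a, rfl⟩ := exists_eq_alternatizeUncurryFin α
    rw [← alternatizeUncurryFin_wedge_left B h',
      curryLeft_alternatizeUncurryFin_succ, curryLeft_alternatizeUncurryFin_succ,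
      ← wedgeₗ_apply, map_sub, LinearMap.sub_apply, wedgeₗ_apply, wedgeₗ_apply,
      ← alternatizeUncurryFin_wedge_left B (by omega : i + 0 = n) h']
    congr 2
    ext1 x
    simp only [LinearMap.comp_apply, curryLeftₗ_apply, LinearMap.flip_apply, wedgeₗ_apply]
    exact ih (by omega) (by omega) (a x) β v

/-- The same induction as for a right factor of degree 0. Both degrees are positive here; the cases
in which one of the two terms is missing are treated separately. -/
theorem curryLeft_wedge (B : N₁ →ₗ[ℝ] N₂ →ₗ[ℝ] N) {i j : ℕ} :
    ∀ {n : ℕ} (h : i + 1 + (j + 1) = n + 1) (h₁ : i + (j + 1) = n) (h₂ : i + 1 + j = n)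
      (α : X [⋀^Fin (i + 1)]→ₗ[ℝ] N₁) (β : X [⋀^Fin (j + 1)]→ₗ[ℝ] N₂) (v : X),
      (wedge B h α β).curryLeft v = wedge B h₁ (α.curryLeft v) β +
        (-1 : ℝ) ^ (i + 1) • wedge B h₂ α (β.curryLeft v) := by
  induction i with
  | zero =>
    intro n h h₁ h₂ α β v
    obtain ⟨n, rfl⟩ : ∃ k, n = k + 1 := ⟨j, by omega⟩
    obtain rfl : j = n := by omega
    obtain ⟨a, rfl⟩ := exists_eq_alternatizeUncurryFin α
    rw [← alternatizeUncurryFin_wedge_left B h₁,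
      curryLeft_alternatizeUncurryFin_succ, curryLeft_alternatizeUncurryFin_zero,
      ← alternatizeUncurryFin_wedge_left B (by omega : 0 + j = j) h₂]
    simp only [zero_add, pow_one, neg_smul, one_smul, ← sub_eq_add_neg]
    congr 2
    ext1 x
    simp only [LinearMap.comp_apply, curryLeftₗ_apply, LinearMap.flip_apply, wedgeₗ_apply]
    exact curryLeft_wedge_zero_left B _ _ (a x) β v
  | succ i ih =>
    intro n h h₁ h₂ α β v
    obtain ⟨n, rfl⟩ : ∃ k, n = k + 1 := ⟨i + 1 + j, by omega⟩
    obtain ⟨a, rfl⟩ := exists_eq_alternatizeUncurryFin α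
    rw [← alternatizeUncurryFin_wedge_left B h₁,
      curryLeft_alternatizeUncurryFin_succ, curryLeft_alternatizeUncurryFin_succ,
      ← wedgeₗ_apply (h := h₁), map_sub, LinearMap.sub_apply, wedgeₗ_apply, wedgeₗ_apply,
      ← alternatizeUncurryFin_wedge_left B (by omega : i + (j + 1) = n) h₁,
      ← alternatizeUncurryFin_wedge_left B (by omega : i + 1 + j = n) h₂]
    have key : curryLeftₗ n v ∘ₗ (wedgeₗ B h₁).flip β ∘ₗ a =
        (wedgeₗ B (by omega : i + (j + 1) = n)).flip β ∘ₗ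
            (curryLeftₗ i v ∘ₗ a) +
          (-1 : ℝ) ^ (i + 1) • ((wedgeₗ B (by omega : i + 1 + j = n)).flip (β.curryLeft v) ∘ₗ
            a) := by
      ext1 x
      simp only [LinearMap.comp_apply, curryLeftₗ_apply, LinearMap.flip_apply, wedgeₗ_apply,
        LinearMap.add_apply, LinearMap.smul_apply]
      exact ih (by omega) (by omega) (by omega) (a x) β v
    rw [key, AlternatingMap.alternatizeUncurryFin_add, AlternatingMap.alternatizeUncurryFin_smul,
      pow_succ (-1 : ℝ) (i + 1)]
    simp only [LinearMap.comp_apply, LinearMap.flip_apply, wedgeₗ_apply]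
    module

end Algebra

/-! ## Graded families of continuous alternating forms -/

section Shortcuts

variable {X N : Type*} [NormedAddCommGroup X] [NormedSpace ℝ X] [NormedAddCommGroup N]
  [NormedSpace ℝ N]

instance normedAddCommGroupCLM : NormedAddCommGroup (X →L[ℝ] N) :=
  ContinuousLinearMap.toNormedAddCommGroup

instance normedSpaceCLM : NormedSpace ℝ (X →L[ℝ] N) :=
  ContinuousLinearMap.toNormedSpace

instance normedAddCommGroupForm (n : ℕ) : NormedAddCommGroup (X [⋀^Fin n]→L[ℝ] N) :=
  ContinuousAlternatingMap.instNormedAddCommGroup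

instance normedSpaceForm (n : ℕ) : NormedSpace ℝ (X [⋀^Fin n]→L[ℝ] N) :=
  ContinuousAlternatingMap.instNormedSpace

end Shortcuts

section Forms

variable {X Y N₁ N₂ N₃ N₁₂ N₂₃ N N' : Type*}
  [NormedAddCommGroup X] [NormedSpace ℝ X] [FiniteDimensional ℝ X]
  [NormedAddCommGroup Y] [NormedSpace ℝ Y] [FiniteDimensional ℝ Y]
  [NormedAddCommGroup N₁] [NormedSpace ℝ N₁] [FiniteDimensional ℝ N₁]
  [NormedAddCommGroup N₂] [NormedSpace ℝ N₂] [FiniteDimensional ℝ N₂]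
  [NormedAddCommGroup N₃] [NormedSpace ℝ N₃] [FiniteDimensional ℝ N₃]
  [NormedAddCommGroup N₁₂] [NormedSpace ℝ N₁₂] [FiniteDimensional ℝ N₁₂]
  [NormedAddCommGroup N₂₃] [NormedSpace ℝ N₂₃] [FiniteDimensional ℝ N₂₃]
  [NormedAddCommGroup N] [NormedSpace ℝ N] [FiniteDimensional ℝ N]
  [NormedAddCommGroup N'] [NormedSpace ℝ N'] [FiniteDimensional ℝ N']

/-- Finite dimension makes every linear map on a space of forms continuous, so products of forms are
continuous bilinear without any estimate. -/
instance finiteDimensional_alternatingMap (n : ℕ) : FiniteDimensional ℝ (X [⋀^Fin n]→ₗ[ℝ] N) :=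
  Module.Finite.of_injective (AlternatingMap.toMultilinearMapLM (S := ℝ) (R := ℝ) (M := X) (N := N)
    (ι := Fin n)) AlternatingMap.coe_multilinearMap_injective

instance finiteDimensional_continuousAlternatingMap (n : ℕ) :
    FiniteDimensional ℝ (X [⋀^Fin n]→L[ℝ] N) :=
  Module.Finite.of_injective
    ({ toFun := ContinuousAlternatingMap.toAlternatingMap
       map_add' := fun _ _ => rfl
       map_smul' := fun _ _ => rfl } : (X [⋀^Fin n]→L[ℝ] N) →ₗ[ℝ] (X [⋀^Fin n]→ₗ[ℝ] N))
    ContinuousAlternatingMap.toAlternatingMap_injective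

@[simp]
theorem toCont_apply {n : ℕ} (f : X [⋀^Fin n]→ₗ[ℝ] N) (v : Fin n → X) : toCont f v = f v := rfl

/-- The wedge product of continuous forms, as a continuous bilinear map; it is zero unless the
degrees add up. -/
def wdg (B : N₁ →ₗ[ℝ] N₂ →ₗ[ℝ] N) (i j n : ℕ) :
    (X [⋀^Fin i]→L[ℝ] N₁) →L[ℝ] (X [⋀^Fin j]→L[ℝ] N₂) →L[ℝ] (X [⋀^Fin n]→L[ℝ] N) :=
  if h : i + j = n then
    LinearMap.toContinuousLinearMap
      { toFun := fun α => LinearMap.toContinuousLinearMap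
          { toFun := fun β => toCont (wedge B h α.toAlternatingMap β.toAlternatingMap)
            map_add' := fun β β' => ContinuousAlternatingMap.toAlternatingMap_injective
              (map_add (wedgeₗ B h α.toAlternatingMap) β.toAlternatingMap β'.toAlternatingMap)
            map_smul' := fun r β => ContinuousAlternatingMap.toAlternatingMap_injective
              (map_smul (wedgeₗ B h α.toAlternatingMap) r β.toAlternatingMap) }
        map_add' := fun α α' => by
          ext1 β
          exact ContinuousAlternatingMap.toAlternatingMap_injective
            (LinearMap.map_add₂ (wedgeₗ B h) α.toAlternatingMap α'.toAlternatingMap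
              β.toAlternatingMap)
        map_smul' := fun r α => by
          ext1 β
          exact ContinuousAlternatingMap.toAlternatingMap_injective
            (LinearMap.map_smul₂ (wedgeₗ B h) r α.toAlternatingMap β.toAlternatingMap) }
  else 0

theorem wdg_eq (B : N₁ →ₗ[ℝ] N₂ →ₗ[ℝ] N) {i j n : ℕ} (h : i + j = n)
    (α : X [⋀^Fin i]→L[ℝ] N₁) (β : X [⋀^Fin j]→L[ℝ] N₂) :
    wdg B i j n α β = toCont (wedge B h α.toAlternatingMap β.toAlternatingMap) := by
  simp [wdg, h]

theorem wdg_sum_left {κ : Type*} (s : Finset κ) (B : N₁ →ₗ[ℝ] N₂ →ₗ[ℝ] N) (i j n : ℕ)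
    (α : κ → X [⋀^Fin i]→L[ℝ] N₁) (β : X [⋀^Fin j]→L[ℝ] N₂) :
    wdg B i j n (∑ k ∈ s, α k) β = ∑ k ∈ s, wdg B i j n (α k) β := by
  classical
  induction s using Finset.induction_on with
  | empty => rw [Finset.sum_empty, Finset.sum_empty, map_zero]; rfl
  | insert k s hk ih => rw [Finset.sum_insert hk, Finset.sum_insert hk, map_add, ← ih]; rfl

theorem wdg_add_left (B : N₁ →ₗ[ℝ] N₂ →ₗ[ℝ] N) (i j n : ℕ)
    (α α' : X [⋀^Fin i]→L[ℝ] N₁) (β : X [⋀^Fin j]→L[ℝ] N₂) :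
    wdg B i j n (α + α') β = wdg B i j n α β + wdg B i j n α' β := by
  rw [map_add]; rfl

theorem wdg_neg_left (B : N₁ →ₗ[ℝ] N₂ →ₗ[ℝ] N) (i j n : ℕ)
    (α : X [⋀^Fin i]→L[ℝ] N₁) (β : X [⋀^Fin j]→L[ℝ] N₂) :
    wdg B i j n (-α) β = -wdg B i j n α β := by
  rw [map_neg]; rfl

theorem wdg_zero_left (B : N₁ →ₗ[ℝ] N₂ →ₗ[ℝ] N) (i j n : ℕ) (β : X [⋀^Fin j]→L[ℝ] N₂) :
    wdg B i j n (0 : X [⋀^Fin i]→L[ℝ] N₁) β = 0 := by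
  rw [map_zero]; rfl

theorem wdg_smul_left (B : N₁ →ₗ[ℝ] N₂ →ₗ[ℝ] N) (i j n : ℕ) (r : ℝ)
    (α : X [⋀^Fin i]→L[ℝ] N₁) (β : X [⋀^Fin j]→L[ℝ] N₂) :
    wdg B i j n (r • α) β = r • wdg B i j n α β := by
  rw [map_smul]; rfl

theorem wdg_smul_right (B : N₁ →ₗ[ℝ] N₂ →ₗ[ℝ] N) (i j n : ℕ) (r : ℝ)
    (α : X [⋀^Fin i]→L[ℝ] N₁) (β : X [⋀^Fin j]→L[ℝ] N₂) :
    wdg B i j n α (r • β) = r • wdg B i j n α β :=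
  map_smul _ _ _

/-- The product of graded families of forms. -/
def star (B : N₁ →ₗ[ℝ] N₂ →ₗ[ℝ] N) (a : ∀ n, X [⋀^Fin n]→L[ℝ] N₁)
    (b : ∀ n, X [⋀^Fin n]→L[ℝ] N₂) (n : ℕ) : X [⋀^Fin n]→L[ℝ] N :=
  ∑ p ∈ Finset.HasAntidiagonal.antidiagonal n, wdg B p.1 p.2 n (a p.1) (b p.2)

/-- The bridge between sums over the antidiagonal and the sums over `Fin` in the statements about
`op`, `StructureEq` and `IsTransport`. -/
theorem star_eq_sum_fin (B : N₁ →ₗ[ℝ] N₂ →ₗ[ℝ] N) (a : ∀ n, X [⋀^Fin n]→L[ℝ] N₁)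
    (b : ∀ n, X [⋀^Fin n]→L[ℝ] N₂) (n : ℕ) :
    star B a b n = ∑ i : Fin (n + 1), toCont (wedge B (Nat.add_sub_of_le i.is_le)
      (a i).toAlternatingMap (b (n - i)).toAlternatingMap) := by
  rw [star, Finset.Nat.sum_antidiagonal_eq_sum_range_succ
    (f := fun i j => wdg B i j n (a i) (b j)), ← Fin.sum_univ_eq_sum_range
    (fun k => wdg B k (n - k) n (a k) (b (n - k)))]
  exact Finset.sum_congr rfl fun i _ => wdg_eq B _ _ _

/-- The sign `(-1)ⁿ` on forms of degree `n`. -/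
def eps (a : ∀ n, X [⋀^Fin n]→L[ℝ] N) (n : ℕ) : X [⋀^Fin n]→L[ℝ] N := (-1 : ℝ) ^ n • a n

/-- The interior product of a graded family of forms with a vector. -/
def iota (v : X) (a : ∀ n, X [⋀^Fin n]→L[ℝ] N) (n : ℕ) : X [⋀^Fin n]→L[ℝ] N :=
  (a (n + 1)).curryLeft v

/-- The pull-back of a graded family of forms. -/
def pull (f : Y →L[ℝ] X) (a : ∀ n, X [⋀^Fin n]→L[ℝ] N) (n : ℕ) : Y [⋀^Fin n]→L[ℝ] N :=
  (a n).compContinuousLinearMap f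

/-- Both sides are sums over the triples of degrees with sum `n`, and agree term by term. The four
bilinear maps are kept apart so that the identity serves products of matrices as well as matrices
acting on vectors. -/
theorem star_assoc (B : N₁₂ →ₗ[ℝ] N₃ →ₗ[ℝ] N) (B' : N₁ →ₗ[ℝ] N₂ →ₗ[ℝ] N₁₂)
    (C : N₁ →ₗ[ℝ] N₂₃ →ₗ[ℝ] N) (C' : N₂ →ₗ[ℝ] N₃ →ₗ[ℝ] N₂₃)
    (hB : ∀ x y z, B (B' x y) z = C x (C' y z)) (a : ∀ n, X [⋀^Fin n]→L[ℝ] N₁)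
    (b : ∀ n, X [⋀^Fin n]→L[ℝ] N₂) (c : ∀ n, X [⋀^Fin n]→L[ℝ] N₃) (n : ℕ) :
    star B (star B' a b) c n = star C a (star C' b c) n := by
  have h1 : star B (star B' a b) c n = ∑ p ∈ Finset.HasAntidiagonal.antidiagonal n,
      ∑ r ∈ Finset.HasAntidiagonal.antidiagonal p.1,
        wdg B (r.1 + r.2) p.2 n (wdg B' r.1 r.2 (r.1 + r.2) (a r.1) (b r.2)) (c p.2) := by
    refine Finset.sum_congr rfl fun p _ => ?_
    simp only [star, wdg_sum_left]
    refine Finset.sum_congr rfl fun r hr => ?_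
    rw [← Finset.HasAntidiagonal.mem_antidiagonal.1 hr]
  have h2 : star C a (star C' b c) n = ∑ p ∈ Finset.HasAntidiagonal.antidiagonal n,
      ∑ r ∈ Finset.HasAntidiagonal.antidiagonal p.2,
        wdg C p.1 (r.1 + r.2) n (a p.1) (wdg C' r.1 r.2 (r.1 + r.2) (b r.1) (c r.2)) := by
    refine Finset.sum_congr rfl fun p _ => ?_
    simp only [star, map_sum]
    refine Finset.sum_congr rfl fun r hr => ?_
    rw [← Finset.HasAntidiagonal.mem_antidiagonal.1 hr]
  rw [h1, h2, Finset.sum_sigma', Finset.sum_sigma']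
  refine Finset.sum_nbij' (fun ⟨⟨_i, j⟩, ⟨k, l⟩⟩ ↦ ⟨(k, l + j), (l, j)⟩)
    (fun ⟨⟨i, _j⟩, ⟨k, l⟩⟩ ↦ ⟨(i + k, l), (i, k)⟩) ?_ ?_ ?_ ?_ ?_
  · rintro ⟨⟨i, j⟩, ⟨k, l⟩⟩ h
    simp only [Finset.mem_sigma, Finset.HasAntidiagonal.mem_antidiagonal, and_true] at h ⊢
    omega
  · rintro ⟨⟨i, j⟩, ⟨k, l⟩⟩ h
    simp only [Finset.mem_sigma, Finset.HasAntidiagonal.mem_antidiagonal, and_true] at h ⊢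
    omega
  · rintro ⟨⟨i, j⟩, ⟨k, l⟩⟩ h
    simp only [Finset.mem_sigma, Finset.HasAntidiagonal.mem_antidiagonal] at h ⊢
    obtain ⟨h, rfl⟩ := h
    rfl
  · rintro ⟨⟨i, j⟩, ⟨k, l⟩⟩ h
    simp only [Finset.mem_sigma, Finset.HasAntidiagonal.mem_antidiagonal] at h ⊢
    obtain ⟨h, rfl⟩ := h
    rfl
  · rintro ⟨⟨i, j⟩, ⟨k, l⟩⟩ h
    simp only [Finset.mem_sigma, Finset.HasAntidiagonal.mem_antidiagonal] at h ⊢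
    rw [wdg_eq B (by omega), wdg_eq B' rfl, wdg_eq C (by omega), wdg_eq C' rfl]
    congr 1
    exact wedge_assoc B B' C C' hB _ _ _ _ _ _ _

theorem pull_star (B : N₁ →ₗ[ℝ] N₂ →ₗ[ℝ] N) (f : Y →L[ℝ] X) (a : ∀ n, X [⋀^Fin n]→L[ℝ] N₁)
    (b : ∀ n, X [⋀^Fin n]→L[ℝ] N₂) (n : ℕ) :
    pull f (star B a b) n = star B (pull f a) (pull f b) n := by
  simp only [pull, star]
  rw [← ContinuousAlternatingMap.compContinuousLinearMapCLM_apply, map_sum]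
  refine Finset.sum_congr rfl fun p hp => ?_
  rw [wdg_eq B (Finset.HasAntidiagonal.mem_antidiagonal.1 hp), wdg_eq B (Finset.HasAntidiagonal.mem_antidiagonal.1 hp)]
  exact ContinuousAlternatingMap.toAlternatingMap_injective
    (wedge_compLinearMap B _ _ _ f.toLinearMap)

theorem comp_star {M₁ M₂ M : Type*} [NormedAddCommGroup M₁] [NormedSpace ℝ M₁]
    [FiniteDimensional ℝ M₁] [NormedAddCommGroup M₂] [NormedSpace ℝ M₂] [FiniteDimensional ℝ M₂]
    [NormedAddCommGroup M] [NormedSpace ℝ M] [FiniteDimensional ℝ M]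
    (B : N₁ →ₗ[ℝ] N₂ →ₗ[ℝ] N) (C : M₁ →ₗ[ℝ] M₂ →ₗ[ℝ] M) (f : N →L[ℝ] M) (f₁ : N₁ →L[ℝ] M₁)
    (f₂ : N₂ →L[ℝ] M₂) (hf : ∀ x y, f (B x y) = C (f₁ x) (f₂ y))
    (a : ∀ n, X [⋀^Fin n]→L[ℝ] N₁) (b : ∀ n, X [⋀^Fin n]→L[ℝ] N₂) (n : ℕ) :
    f.compContinuousAlternatingMap (star B a b n) =
      star C (fun n => f₁.compContinuousAlternatingMap (a n))
        (fun n => f₂.compContinuousAlternatingMap (b n)) n := by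
  simp only [star]
  change ContinuousLinearMap.compContinuousAlternatingMapCLM ℝ X N M (Fin n) f _ = _
  rw [map_sum]
  refine Finset.sum_congr rfl fun p hp => ?_
  rw [wdg_eq B (Finset.HasAntidiagonal.mem_antidiagonal.1 hp), wdg_eq C (Finset.HasAntidiagonal.mem_antidiagonal.1 hp)]
  exact ContinuousAlternatingMap.toAlternatingMap_injective
    (wedge_comp_values B C f.toLinearMap f₁.toLinearMap f₂.toLinearMap hf _ _ _)

/-- The interior product is an antiderivation. -/
theorem iota_star (B : N₁ →ₗ[ℝ] N₂ →ₗ[ℝ] N) (v : X) (a : ∀ n, X [⋀^Fin n]→L[ℝ] N₁)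
    (b : ∀ n, X [⋀^Fin n]→L[ℝ] N₂) (n : ℕ) :
    iota v (star B a b) n = star B (iota v a) b n + star B (eps a) (iota v b) n := by
  have key : ∀ p ∈ Finset.HasAntidiagonal.antidiagonal (n + 1),
      (wdg B p.1 p.2 (n + 1) (a p.1) (b p.2)).curryLeft v =
      (match p with
        | (0, _) => 0
        | (i + 1, j) => wdg B i j n (iota v a i) (b j)) +
      (match p with
        | (_, 0) => 0
        | (i, j + 1) => wdg B i j n (eps a i) (iota v b j)) := by
    rintro ⟨i, j⟩ hp
    have hp' := Finset.HasAntidiagonal.mem_antidiagonal.1 hp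
    dsimp only at hp'
    rw [wdg_eq B hp']
    rcases i with _ | i <;> rcases j with _ | j
    · omega
    · obtain rfl : j = n := by omega
      simp only [zero_add, eps, pow_zero, one_smul]
      rw [wdg_eq B (zero_add j)]
      exact ContinuousAlternatingMap.toAlternatingMap_injective
        (curryLeft_wedge_zero_left B _ _ _ _ v)
    · simp only [add_zero]
      rw [wdg_eq B (by omega : i + 0 = n)]
      exact ContinuousAlternatingMap.toAlternatingMap_injective
        (curryLeft_wedge_zero_right B _ _ _ _ v)
    · simp only [eps, wdg_smul_left]
      rw [wdg_eq B (by omega : i + (j + 1) = n), wdg_eq B (by omega : i + 1 + j = n)]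
      exact ContinuousAlternatingMap.toAlternatingMap_injective
        (curryLeft_wedge B _ _ _ _ _ v)
  have h0 : iota v (star B a b) n = ∑ p ∈ Finset.HasAntidiagonal.antidiagonal (n + 1),
      (wdg B p.1 p.2 (n + 1) (a p.1) (b p.2)).curryLeft v := by
    ext w
    simp [iota, star, ContinuousAlternatingMap.sum_apply]
  rw [h0, Finset.sum_congr rfl key, Finset.sum_add_distrib]
  congr 1
  · rw [Finset.Nat.sum_antidiagonal_succ]
    simp [star]
  · rw [Finset.Nat.sum_antidiagonal_succ']
    simp [star]

theorem star_add_left (B : N₁ →ₗ[ℝ] N₂ →ₗ[ℝ] N) (a a' : ∀ n, X [⋀^Fin n]→L[ℝ] N₁)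
    (b : ∀ n, X [⋀^Fin n]→L[ℝ] N₂) (n : ℕ) :
    star B (fun n => a n + a' n) b n = star B a b n + star B a' b n := by
  simp only [star, wdg_add_left, Finset.sum_add_distrib]

theorem star_add_right (B : N₁ →ₗ[ℝ] N₂ →ₗ[ℝ] N) (a : ∀ n, X [⋀^Fin n]→L[ℝ] N₁)
    (b b' : ∀ n, X [⋀^Fin n]→L[ℝ] N₂) (n : ℕ) :
    star B a (fun n => b n + b' n) n = star B a b n + star B a b' n := by
  simp only [star, map_add, Finset.sum_add_distrib]

theorem star_sub_right (B : N₁ →ₗ[ℝ] N₂ →ₗ[ℝ] N) (a : ∀ n, X [⋀^Fin n]→L[ℝ] N₁)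
    (b b' : ∀ n, X [⋀^Fin n]→L[ℝ] N₂) (n : ℕ) :
    star B a (fun n => b n - b' n) n = star B a b n - star B a b' n := by
  simp only [star, map_sub, Finset.sum_sub_distrib]

theorem star_neg_left (B : N₁ →ₗ[ℝ] N₂ →ₗ[ℝ] N) (a : ∀ n, X [⋀^Fin n]→L[ℝ] N₁)
    (b : ∀ n, X [⋀^Fin n]→L[ℝ] N₂) (n : ℕ) :
    star B (fun n => -a n) b n = -star B a b n := by
  simp only [star, wdg_neg_left, Finset.sum_neg_distrib]

theorem star_congr (B : N₁ →ₗ[ℝ] N₂ →ₗ[ℝ] N) {a a' : ∀ n, X [⋀^Fin n]→L[ℝ] N₁}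
    {b b' : ∀ n, X [⋀^Fin n]→L[ℝ] N₂} {n : ℕ} (ha : ∀ i ≤ n, a i = a' i)
    (hb : ∀ i ≤ n, b i = b' i) : star B a b n = star B a' b' n := by
  refine Finset.sum_congr rfl fun p hp => ?_
  have := Finset.HasAntidiagonal.mem_antidiagonal.1 hp
  rw [ha _ (by omega), hb _ (by omega)]

theorem eps_star (B : N₁ →ₗ[ℝ] N₂ →ₗ[ℝ] N) (a : ∀ n, X [⋀^Fin n]→L[ℝ] N₁)
    (b : ∀ n, X [⋀^Fin n]→L[ℝ] N₂) (n : ℕ) :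
    eps (star B a b) n = star B (eps a) (eps b) n := by
  simp only [eps, star, Finset.smul_sum]
  refine Finset.sum_congr rfl fun p hp => ?_
  rw [← Finset.HasAntidiagonal.mem_antidiagonal.1 hp]
  simp only [wdg_smul_left, wdg_smul_right, pow_add, smul_smul, mul_comm]

/-- The exterior derivative of a graded family of forms. -/
def dext (a : ∀ n, X → X [⋀^Fin n]→L[ℝ] N) : ∀ n, X → X [⋀^Fin n]→L[ℝ] N
  | 0, _ => 0
  | n + 1, x => extDeriv (a n) x

/-- The derivative of a continuous bilinear expression has two terms, and the two algebraic lemmas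
on `alternatizeUncurryFin` alternatize them one by one. -/
theorem extDeriv_wdg (B : N₁ →ₗ[ℝ] N₂ →ₗ[ℝ] N) {i j n : ℕ} (h : i + j = n)
    {a : X → X [⋀^Fin i]→L[ℝ] N₁} {b : X → X [⋀^Fin j]→L[ℝ] N₂} {x : X}
    (ha : DifferentiableAt ℝ a x) (hb : DifferentiableAt ℝ b x) :
    extDeriv (fun x => wdg B i j n (a x) (b x)) x =
      wdg B (i + 1) j (n + 1) (extDeriv a x) (b x) +
        (-1 : ℝ) ^ i • wdg B i (j + 1) (n + 1) (a x) (extDeriv b x) := by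
  have hd : fderiv ℝ (fun x => wdg B i j n (a x) (b x)) x =
      ((wdg B i j n).flip (b x)).comp (fderiv ℝ a x) + (wdg B i j n (a x)).comp (fderiv ℝ b x) := by
    have := ((wdg (X := X) B i j n).hasFDerivAt_of_bilinear ha.hasFDerivAt hb.hasFDerivAt).fderiv
    rw [this]
    ext u : 1
    simp [add_comm]
  rw [extDeriv, hd, ContinuousAlternatingMap.alternatizeUncurryFin_add]
  have h1 := alternatizeUncurryFin_wedge_left B h (by omega : i + 1 + j = n + 1)
    { toFun := fun u => (fderiv ℝ a x u).toAlternatingMap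
      map_add' := fun u w => by rw [map_add]; rfl
      map_smul' := fun r u => by rw [map_smul]; rfl } (b x).toAlternatingMap
  have h2 := alternatizeUncurryFin_wedge_right B h (by omega : i + (j + 1) = n + 1)
    (a x).toAlternatingMap
    { toFun := fun u => (fderiv ℝ b x u).toAlternatingMap
      map_add' := fun u w => by rw [map_add]; rfl
      map_smul' := fun r u => by rw [map_smul]; rfl }
  rw [wdg_eq B (by omega : i + 1 + j = n + 1), wdg_eq B (by omega : i + (j + 1) = n + 1)]
  congr 1
  · ext w
    have h3 := congrArg (fun f => f w) h1
    simp only [AlternatingMap.alternatizeUncurryFin_apply] at h3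
    simp only [ContinuousAlternatingMap.alternatizeUncurryFin_apply, toCont_apply]
    refine Eq.trans ?_ (h3.trans ?_)
    · refine Finset.sum_congr rfl fun k _ => ?_
      simp [wdg_eq B h]
    · rw [extDeriv, ContinuousAlternatingMap.toAlternatingMap_alternatizeUncurryFin]
      rfl
  · ext w
    have h3 := congrArg (fun f => f w) h2
    simp only [AlternatingMap.alternatizeUncurryFin_apply] at h3
    simp only [ContinuousAlternatingMap.alternatizeUncurryFin_apply]
    refine Eq.trans ?_ (h3.trans ?_)
    · refine Finset.sum_congr rfl fun k _ => ?_
      simp [wdg_eq B h]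
    · rw [extDeriv, ContinuousAlternatingMap.toAlternatingMap_alternatizeUncurryFin]
      rw [ContinuousAlternatingMap.smul_apply, AlternatingMap.smul_apply]
      rfl

/-- The Leibniz rule. -/
theorem dext_star (B : N₁ →ₗ[ℝ] N₂ →ₗ[ℝ] N) {a : ∀ n, X → X [⋀^Fin n]→L[ℝ] N₁}
    {b : ∀ n, X → X [⋀^Fin n]→L[ℝ] N₂} {x : X} (n : ℕ)
    (ha : ∀ k, DifferentiableAt ℝ (a k) x) (hb : ∀ k, DifferentiableAt ℝ (b k) x) :
    dext (fun n x => star B (fun n => a n x) (fun n => b n x) n) n x =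
      star B (fun n => dext a n x) (fun n => b n x) n +
        star B (eps fun n => a n x) (fun n => dext b n x) n := by
  rcases n with _ | n
  · simp [dext, star]
  · change extDeriv (fun x => ∑ p ∈ Finset.HasAntidiagonal.antidiagonal n, wdg B p.1 p.2 n (a p.1 x) (b p.2 x)) x = _
    have hs : extDeriv (fun x => ∑ p ∈ Finset.HasAntidiagonal.antidiagonal n,
        wdg B p.1 p.2 n (a p.1 x) (b p.2 x)) x = ∑ p ∈ Finset.HasAntidiagonal.antidiagonal n,
        extDeriv (fun x => wdg B p.1 p.2 n (a p.1 x) (b p.2 x)) x := by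
      simp only [extDeriv]
      rw [fderiv_fun_sum fun p _ => ((wdg (X := X) B p.1 p.2 n).hasFDerivAt_of_bilinear
        (ha p.1).hasFDerivAt (hb p.2).hasFDerivAt).differentiableAt]
      exact map_sum (ContinuousAlternatingMap.alternatizeUncurryFinCLM ℝ X N) _ _
    rw [hs, Finset.sum_congr rfl fun p hp => extDeriv_wdg B (Finset.HasAntidiagonal.mem_antidiagonal.1 hp)
      (ha p.1) (hb p.2), Finset.sum_add_distrib]
    congr 1
    · rw [star, Finset.Nat.sum_antidiagonal_succ]
      simp [dext]
    · rw [star, Finset.Nat.sum_antidiagonal_succ']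
      simp [dext, eps]

end Forms

theorem wedge_zero_right {X N₁ N₂ N : Type*} [AddCommGroup X] [Module ℝ X] [AddCommGroup N₁]
    [Module ℝ N₁] [AddCommGroup N₂] [Module ℝ N₂] [AddCommGroup N] [Module ℝ N]
    (B : N₁ →ₗ[ℝ] N₂ →ₗ[ℝ] N) {n : ℕ} (h : n + 0 = n)
    (α : X [⋀^Fin n]→ₗ[ℝ] N₁) (β : X [⋀^Fin 0]→ₗ[ℝ] N₂) :
    wedge B h α β = (B.flip (β ![])).compAlternatingMap α := by
  conv_rhs => rw [← altₗ_altSection α]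
  rw [wedge_eq_altₗ]
  change _ = (B.flip (β ![])).compAlternatingMap (MultilinearMap.alternatization _)
  rw [← LinearMap.compMultilinearMap_alternatization]
  change MultilinearMap.alternatization _ = _
  congr 1
  ext v
  simp only [mulMap_apply, LinearMap.compMultilinearMap_apply, LinearMap.flip_apply]
  have hβ : ∀ w, altSection 0 β w = β ![] := fun w => by
    change ((Nat.factorial 0 : ℝ)⁻¹ • β.toMultilinearMap) w = _
    rw [Nat.factorial_zero, Nat.cast_one, inv_one, one_smul]
    exact congrArg β (Subsingleton.elim _ _)
  rw [hβ]
  rfl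

/-! ### Curvature, the defect and its evolution -/

section Calculus

variable {X Y 𝓐 F N₁ N₂ N N' : Type*}
  [NormedAddCommGroup X] [NormedSpace ℝ X] [FiniteDimensional ℝ X]
  [NormedAddCommGroup Y] [NormedSpace ℝ Y] [FiniteDimensional ℝ Y]
  [NormedAddCommGroup 𝓐] [NormedSpace ℝ 𝓐] [FiniteDimensional ℝ 𝓐]
  [NormedAddCommGroup F] [NormedSpace ℝ F] [FiniteDimensional ℝ F]
  [NormedAddCommGroup N₁] [NormedSpace ℝ N₁] [FiniteDimensional ℝ N₁]
  [NormedAddCommGroup N₂] [NormedSpace ℝ N₂] [FiniteDimensional ℝ N₂]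
  [NormedAddCommGroup N] [NormedSpace ℝ N] [FiniteDimensional ℝ N]
  [NormedAddCommGroup N'] [NormedSpace ℝ N'] [FiniteDimensional ℝ N']

theorem contDiffAt_star (B : N₁ →ₗ[ℝ] N₂ →ₗ[ℝ] N) {a : ∀ n, Y → X [⋀^Fin n]→L[ℝ] N₁}
    {b : ∀ n, Y → X [⋀^Fin n]→L[ℝ] N₂} {x : Y} {r : WithTop ℕ∞} (n : ℕ)
    (ha : ∀ k, ContDiffAt ℝ r (a k) x) (hb : ∀ k, ContDiffAt ℝ r (b k) x) :
    ContDiffAt ℝ r (fun x => star B (fun n => a n x) (fun n => b n x) n) x := by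
  refine ContDiffAt.sum fun p _ => ?_
  exact (wdg B p.1 p.2 n).isBoundedBilinearMap.contDiff.contDiffAt.comp x
    ((ha p.1).prodMk (hb p.2))

theorem extDeriv_zero_fun {n : ℕ} (x : X) :
    extDeriv (fun _ : X => (0 : X [⋀^Fin n]→L[ℝ] N)) x = 0 := by
  have := extDeriv_smul (0 : ℝ) (fun _ : X => (0 : X [⋀^Fin n]→L[ℝ] N)) (x := x)
  rw [zero_smul, zero_smul] at this
  exact this

theorem contDiffAt_extDeriv {n : ℕ} {a : X → X [⋀^Fin n]→L[ℝ] N} {x : X} {r r' : WithTop ℕ∞}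
    (ha : ContDiffAt ℝ r a x) (hr : r' + 1 ≤ r) : ContDiffAt ℝ r' (extDeriv a) x :=
  (ContinuousAlternatingMap.alternatizeUncurryFinCLM ℝ X N).contDiff.contDiffAt.comp x
    (ha.fderiv_right hr)

theorem contDiffAt_dext {a : ∀ n, X → X [⋀^Fin n]→L[ℝ] N} {x : X} {r r' : WithTop ℕ∞}
    (ha : ∀ n, ContDiffAt ℝ r (a n) x) (hr : r' + 1 ≤ r) (n : ℕ) :
    ContDiffAt ℝ r' (dext a n) x := by
  rcases n with _ | n
  · exact contDiffAt_const
  · exact contDiffAt_extDeriv (ha n) hr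

theorem dext_dext {a : ∀ n, X → X [⋀^Fin n]→L[ℝ] N} {x : X}
    (ha : ∀ n, ContDiffAt ℝ 2 (a n) x) (n : ℕ) : dext (dext a) n x = 0 := by
  rcases n with _ | _ | n
  · rfl
  · exact extDeriv_zero_fun x
  · exact extDeriv_extDeriv_apply (ha n) (by simp)

theorem dext_congr {a b : ∀ n, X → X [⋀^Fin n]→L[ℝ] N} {x : X} (n : ℕ)
    (h : ∀ k, k + 1 = n → a k =ᶠ[nhds x] b k) : dext a n x = dext b n x := by
  rcases n with _ | n
  · rfl
  · exact (h n rfl).extDeriv_eq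

theorem dext_sub {a b : ∀ n, X → X [⋀^Fin n]→L[ℝ] N} {x : X}
    (ha : ∀ n, DifferentiableAt ℝ (a n) x) (hb : ∀ n, DifferentiableAt ℝ (b n) x) (n : ℕ) :
    dext (fun n x => a n x - b n x) n x = dext a n x - dext b n x := by
  rcases n with _ | n
  · simp [dext]
  · have h1 : extDeriv (fun x => a n x - b n x) x = extDeriv (fun x => a n x + -(1 : ℝ) • b n x) x :=
      by simp [sub_eq_add_neg]
    change extDeriv (fun x => a n x - b n x) x = extDeriv (a n) x - extDeriv (b n) x
    have h2 : extDeriv (fun x => -(1 : ℝ) • b n x) x = -(1 : ℝ) • extDeriv (b n) x :=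
      extDeriv_smul _ _
    have h3 : DifferentiableAt ℝ (fun x => -(1 : ℝ) • b n x) x := (hb n).const_smul (-(1 : ℝ))
    rw [h1, extDeriv_fun_add (ha n) h3, h2]
    simp [sub_eq_add_neg]

theorem dext_eps (a : ∀ n, X → X [⋀^Fin n]→L[ℝ] N) (x : X) (n : ℕ) :
    dext (fun n x => eps (fun n => a n x) n) n x = -eps (fun n => dext a n x) n := by
  rcases n with _ | n
  · simp [dext, eps]
  · change extDeriv (fun x => (-1 : ℝ) ^ n • a n x) x = -((-1 : ℝ) ^ (n + 1) • extDeriv (a n) x)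
    have h2 : extDeriv (fun x => (-1 : ℝ) ^ n • a n x) x = (-1 : ℝ) ^ n • extDeriv (a n) x :=
      extDeriv_smul _ _
    rw [h2, pow_succ]
    simp

theorem extDeriv_comp {n : ℕ} (R : N →L[ℝ] N') {a : X → X [⋀^Fin n]→L[ℝ] N} {x : X}
    (ha : DifferentiableAt ℝ a x) :
    extDeriv (fun x => R.compContinuousAlternatingMap (a x)) x =
      R.compContinuousAlternatingMap (extDeriv a x) := by
  have h : fderiv ℝ (fun x => R.compContinuousAlternatingMap (a x)) x =
      (ContinuousLinearMap.compContinuousAlternatingMapCLM ℝ X N N' (Fin n) R).comp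
        (fderiv ℝ a x) :=
    ((ContinuousLinearMap.compContinuousAlternatingMapCLM ℝ X N N' (Fin n) R).hasFDerivAt.comp x
      ha.hasFDerivAt).fderiv
  ext w
  simp [extDeriv, h, ContinuousAlternatingMap.alternatizeUncurryFin_apply]

theorem dext_comp (R : N →L[ℝ] N') {a : ∀ n, X → X [⋀^Fin n]→L[ℝ] N} {x : X}
    (ha : ∀ n, DifferentiableAt ℝ (a n) x) (n : ℕ) :
    dext (fun n x => R.compContinuousAlternatingMap (a n x)) n x =
      R.compContinuousAlternatingMap (dext a n x) := by
  rcases n with _ | n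
  · ext; simp [dext]
  · exact extDeriv_comp R (ha n)

theorem toAlternatingMap_alternatizeUncurryFin {n : ℕ} (F : X →L[ℝ] X [⋀^Fin n]→L[ℝ] N) :
    (ContinuousAlternatingMap.alternatizeUncurryFin F).toAlternatingMap =
      AlternatingMap.alternatizeUncurryFin
        { toFun := fun u => (F u).toAlternatingMap
          map_add' := fun u w => by rw [map_add]; rfl
          map_smul' := fun r u => by rw [map_smul]; rfl } := by
  rw [ContinuousAlternatingMap.toAlternatingMap_alternatizeUncurryFin]
  rfl

/-- Cartan's formula for a constant vector field. -/
theorem iota_dext {a : ∀ n, X → X [⋀^Fin n]→L[ℝ] N} {x : X}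
    (ha : ∀ n, DifferentiableAt ℝ (a n) x) (v : X) (n : ℕ) :
    iota v (fun n => dext a n x) n =
      fderiv ℝ (a n) x v - dext (fun n x => iota v (fun n => a n x) n) n x := by
  refine ContinuousAlternatingMap.toAlternatingMap_injective ?_
  rcases n with _ | n
  · have h := curryLeft_alternatizeUncurryFin_zero (N := N)
      { toFun := fun u => (fderiv ℝ (a 0) x u).toAlternatingMap
        map_add' := fun u w => by rw [map_add]; rfl
        map_smul' := fun r u => by rw [map_smul]; rfl } v
    rw [← toAlternatingMap_alternatizeUncurryFin] at h
    change _ = (fderiv ℝ (a 0) x v - 0).toAlternatingMap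
    rw [sub_zero]
    exact h
  · have h := curryLeft_alternatizeUncurryFin_succ (N := N)
      { toFun := fun u => (fderiv ℝ (a (n + 1)) x u).toAlternatingMap
        map_add' := fun u w => by rw [map_add]; rfl
        map_smul' := fun r u => by rw [map_smul]; rfl } v
    rw [← toAlternatingMap_alternatizeUncurryFin] at h
    refine Eq.trans h ?_
    let cl : (X [⋀^Fin (n + 1)]→L[ℝ] N) →L[ℝ] (X [⋀^Fin n]→L[ℝ] N) :=
      LinearMap.toContinuousLinearMap
        { toFun := fun α => α.curryLeft v
          map_add' := fun _ _ => rfl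
          map_smul' := fun _ _ => rfl }
    have h2 : fderiv ℝ (fun x => (a (n + 1) x).curryLeft v) x =
        cl.comp (fderiv ℝ (a (n + 1)) x) :=
      (cl.hasFDerivAt.comp x (ha (n + 1)).hasFDerivAt).fderiv
    change _ = (fderiv ℝ (a (n + 1)) x v).toAlternatingMap -
      (extDeriv (fun x => (a (n + 1) x).curryLeft v) x).toAlternatingMap
    rw [extDeriv, h2, toAlternatingMap_alternatizeUncurryFin]
    rfl

/-- The curvature `dA + (-1)^i A_i A_j` of a graded family of forms. -/
def curv (B₀ : 𝓐 →ₗ[ℝ] 𝓐 →ₗ[ℝ] 𝓐) (a : ∀ n, X → X [⋀^Fin n]→L[ℝ] 𝓐) (n : ℕ) (x : X) :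
    X [⋀^Fin n]→L[ℝ] 𝓐 :=
  dext a n x + star B₀ (eps fun n => a n x) (fun n => a n x) n

theorem star_curv {B₀ : 𝓐 →ₗ[ℝ] 𝓐 →ₗ[ℝ] 𝓐} {B : 𝓐 →ₗ[ℝ] F →ₗ[ℝ] F}
    (hB : ∀ x y f, B (B₀ x y) f = B x (B y f)) {a : ∀ n, X → X [⋀^Fin n]→L[ℝ] 𝓐} (x : X)
    (θ : ∀ n, X [⋀^Fin n]→L[ℝ] F) (n : ℕ) :
    star B (fun n => curv B₀ a n x) θ n = star B (fun n => dext a n x) θ n +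
      star B (eps fun n => a n x) (star B (fun n => a n x) θ) n := by
  simp only [curv]
  rw [star_add_left, star_assoc B B₀ B B hB]

/-- The square of the covariant derivative is minus the action of the curvature. -/
theorem covariant_square {B₀ : 𝓐 →ₗ[ℝ] 𝓐 →ₗ[ℝ] 𝓐} {B : 𝓐 →ₗ[ℝ] F →ₗ[ℝ] F}
    (hB : ∀ x y f, B (B₀ x y) f = B x (B y f)) {a : ∀ n, X → X [⋀^Fin n]→L[ℝ] 𝓐}
    {θ : ∀ n, X → X [⋀^Fin n]→L[ℝ] F} {x : X} (ha : ∀ n, ContDiffAt ℝ 1 (a n) x)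
    (hθ : ∀ n, ContDiffAt ℝ 2 (θ n) x) (n : ℕ) :
    dext (fun n x => dext θ n x - star B (fun n => a n x) (fun n => θ n x) n) n x +
      star B (eps fun n => a n x)
        (fun n => dext θ n x - star B (fun n => a n x) (fun n => θ n x) n) n =
      -star B (fun n => curv B₀ a n x) (fun n => θ n x) n := by
  have ha' : ∀ n, DifferentiableAt ℝ (a n) x := fun n => (ha n).differentiableAt one_ne_zero
  have hθ1 : ∀ n, ContDiffAt ℝ 1 (θ n) x := fun n => (hθ n).of_le (by norm_num)
  have hθ' : ∀ n, DifferentiableAt ℝ (θ n) x := fun n => (hθ1 n).differentiableAt one_ne_zero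
  -- The terms ε(a) * dθ from the Leibniz rule and from the second application of a cancel, and d²θ
  -- = 0. What remains is da * θ + ε(a) * (a * θ), with a minus sign.
  rw [dext_sub (fun n => (contDiffAt_dext hθ (by norm_num) n).differentiableAt one_ne_zero)
    (fun n => (contDiffAt_star B n ha hθ1).differentiableAt one_ne_zero), dext_dext hθ,
    dext_star B n ha' hθ', star_sub_right, star_curv hB]
  abel_nf

/-- The failure of `Y` to intertwine the covariant derivatives. -/
def defect (B : 𝓐 →ₗ[ℝ] F →ₗ[ℝ] F) (R : F →L[ℝ] F) (a : ∀ n, X → X [⋀^Fin n]→L[ℝ] 𝓐)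
    (Y : ∀ n, X → X [⋀^Fin n]→L[ℝ] F) (n : ℕ) (x : X) : X [⋀^Fin n]→L[ℝ] F :=
  star B (fun n => a n x) (fun n => Y n x) n -
    eps (fun n => R.compContinuousAlternatingMap (Y n x)) n - dext Y n x

theorem iota_sub (v : X) (a b : ∀ n, X [⋀^Fin n]→L[ℝ] N) (n : ℕ) :
    iota v (fun n => a n - b n) n = iota v a n - iota v b n := rfl

theorem iota_eps (v : X) (a : ∀ n, X [⋀^Fin n]→L[ℝ] N) (n : ℕ) :
    iota v (eps a) n = -eps (iota v a) n := by
  have : iota v (eps a) n = (-1 : ℝ) ^ (n + 1) • iota v a n := rfl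
  rw [this, eps, pow_succ]
  simp

theorem iota_comp (v : X) (R : N →L[ℝ] N') (a : ∀ n, X [⋀^Fin n]→L[ℝ] N) (n : ℕ) :
    iota v (fun n => R.compContinuousAlternatingMap (a n)) n =
      R.compContinuousAlternatingMap (iota v a n) := rfl

theorem eps_eps (a : ∀ n, X [⋀^Fin n]→L[ℝ] N) (n : ℕ) : eps (eps a) n = a n := by
  simp [eps, smul_smul, ← mul_pow]

theorem star_zero_right (B : N₁ →ₗ[ℝ] N₂ →ₗ[ℝ] N) (a : ∀ n, X [⋀^Fin n]→L[ℝ] N₁)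
    {b : ∀ n, X [⋀^Fin n]→L[ℝ] N₂} (hb : ∀ n, b n = 0) (n : ℕ) : star B a b n = 0 := by
  simp only [star, hb, map_zero, Finset.sum_const_zero]

/-- Since ι_v Y = 0, contraction of a * Y with v gives (ι_v a) * Y, and Cartan's formula gives ι_v
dY = ∂_v Y. The differential equation for the transport is therefore the vanishing of ι_v of the
defect. -/
theorem iota_defect {B : 𝓐 →ₗ[ℝ] F →ₗ[ℝ] F} {R : F →L[ℝ] F}
    {a : ∀ n, X → X [⋀^Fin n]→L[ℝ] 𝓐} {Y : ∀ n, X → X [⋀^Fin n]→L[ℝ] F} {x v : X}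
    (hY : ∀ n, DifferentiableAt ℝ (Y n) x)
    (hι : ∀ n, ∀ᶠ z in nhds x, iota v (fun n => Y n z) n = 0)
    (hode : ∀ n, fderiv ℝ (Y n) x v = star B (iota v fun n => a n x) (fun n => Y n x) n) (n : ℕ) :
    iota v (fun n => defect B R a Y n x) n = 0 := by
  have hι' : ∀ n, iota v (fun n => Y n x) n = 0 := fun n => (hι n).self_of_nhds
  have h0 : dext (fun n x => iota v (fun n => Y n x) n) n x = 0 := by
    rw [dext_congr (b := fun _ _ => 0) n fun k _ => hι k]
    rcases n with _ | n
    · rfl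
    · exact extDeriv_zero_fun x
  simp only [defect]
  rw [iota_sub, iota_sub, iota_star, star_zero_right B _ hι', iota_eps, iota_dext hY, hode, h0]
  have : eps (iota v fun n => R.compContinuousAlternatingMap (Y n x)) n = 0 := by
    simp only [eps, iota_comp, hι']
    ext; simp
  rw [this]
  abel

/-- The evolution of the defect. -/
theorem fderiv_defect {B₀ : 𝓐 →ₗ[ℝ] 𝓐 →ₗ[ℝ] 𝓐} {B : 𝓐 →ₗ[ℝ] F →ₗ[ℝ] F}
    (hB : ∀ x y f, B (B₀ x y) f = B x (B y f)) {R : F →L[ℝ] F} (hR : ∀ b f, R (B b f) = B b (R f))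
    {a : ∀ n, X → X [⋀^Fin n]→L[ℝ] 𝓐} {Y : ∀ n, X → X [⋀^Fin n]→L[ℝ] F} {x v : X}
    (ha : ∀ n, ContDiffAt ℝ 1 (a n) x) (hY : ∀ n, ContDiffAt ℝ 2 (Y n) x)
    (hι : ∀ᶠ z in nhds x, ∀ n, iota v (fun n => Y n z) n = 0)
    (hYd : ∀ᶠ z in nhds x, ∀ n, DifferentiableAt ℝ (Y n) z)
    (hode : ∀ᶠ z in nhds x, ∀ n,
      fderiv ℝ (Y n) z v = star B (iota v fun n => a n z) (fun n => Y n z) n) (n : ℕ) :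
    fderiv ℝ (defect B R a Y n) x v =
      star B (eps (iota v fun n => a n x)) (fun n => defect B R a Y n x) n +
        star B (iota v fun n => curv B₀ a n x) (fun n => Y n x) n := by
  have ha' : ∀ n, DifferentiableAt ℝ (a n) x := fun n => (ha n).differentiableAt one_ne_zero
  have hY1 : ∀ n, ContDiffAt ℝ 1 (Y n) x := fun n => (hY n).of_le (by norm_num)
  have hY' : ∀ n, DifferentiableAt ℝ (Y n) x := fun n => (hY1 n).differentiableAt one_ne_zero
  have hdY : ∀ n, DifferentiableAt ℝ (dext Y n) x := fun n =>
    (contDiffAt_dext hY (by norm_num) n).differentiableAt one_ne_zero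
  have hS : ∀ n, DifferentiableAt ℝ (fun x => star B (fun n => a n x) (fun n => Y n x) n) x :=
    fun n => (contDiffAt_star B n ha hY1).differentiableAt one_ne_zero
  have hRY : ∀ n, DifferentiableAt ℝ (fun x => R.compContinuousAlternatingMap (Y n x)) x :=
    fun n => ((ContinuousLinearMap.compContinuousAlternatingMapCLM ℝ X F F (Fin n)
      R).differentiableAt).comp x (hY' n)
  have heRY : ∀ n, DifferentiableAt ℝ
      (fun x => eps (fun n => R.compContinuousAlternatingMap (Y n x)) n) x :=
    fun n => (hRY n).const_smul ((-1 : ℝ) ^ n)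
  have hE : ∀ n, DifferentiableAt ℝ (defect B R a Y n) x := fun n =>
    ((hS n).sub (heRY n)).sub (hdY n)
  have hιY : ∀ n, iota v (fun n => Y n x) n = 0 := hι.self_of_nhds
  have hιE : ∀ᶠ z in nhds x, ∀ n, iota v (fun n => defect B R a Y n z) n = 0 := by
    filter_upwards [hι.eventually_nhds, hYd, hode] with z h1 h2 h3
    exact iota_defect h2 (fun n => h1.mono fun y hy => hy n) h3
  have hιE0 : ∀ n, iota v (fun n => defect B R a Y n x) n = 0 := hιE.self_of_nhds
  have h0 : dext (fun n x => iota v (fun n => defect B R a Y n x) n) n x = 0 := by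
    rw [dext_congr (b := fun _ _ => 0) n fun k _ => hιE.mono fun z hz => hz k]
    rcases n with _ | n
    · rfl
    · exact extDeriv_zero_fun x
  -- As ι_v E vanishes near x, Cartan's formula identifies the derivative of E along v with ι_v dE.
  have h1 := iota_dext hE v n
  rw [h0, sub_zero] at h1
  rw [← h1]
  -- the exterior derivative of the defect
  have hRstar : ∀ n, R.compContinuousAlternatingMap
      (star B (fun n => a n x) (fun n => Y n x) n) =
      star B (fun n => a n x) (fun n => R.compContinuousAlternatingMap (Y n x)) n := fun n => by
    rw [comp_star B B R (ContinuousLinearMap.id ℝ 𝓐) R (fun b f => hR b f)]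
    exact star_congr B (fun i _ => by ext; rfl) (fun i _ => rfl)
  have hReps : ∀ (b : ∀ n, X [⋀^Fin n]→L[ℝ] F) n, R.compContinuousAlternatingMap (eps b n) =
      eps (fun n => R.compContinuousAlternatingMap (b n)) n := fun b n => by
    ext; simp [eps]
  have hd : ∀ n, dext Y n x = star B (fun n => a n x) (fun n => Y n x) n -
      eps (fun n => R.compContinuousAlternatingMap (Y n x)) n - defect B R a Y n x := fun n => by
    simp only [defect]; abel
  -- In dE, every dY is replaced by a * Y - ε(R Y) - E. The terms mixing a and R cancel because R
  -- commutes with the action of a.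
  have hdE : ∀ n, dext (defect B R a Y) n x =
      star B (fun n => curv B₀ a n x) (fun n => Y n x) n -
        star B (eps fun n => a n x) (fun n => defect B R a Y n x) n -
        R.compContinuousAlternatingMap (R.compContinuousAlternatingMap (Y n x)) -
        eps (fun n => R.compContinuousAlternatingMap (defect B R a Y n x)) n := fun n => by
    have e1 : dext (defect B R a Y) n x =
        star B (fun n => dext a n x) (fun n => Y n x) n +
          star B (eps fun n => a n x) (fun n => dext Y n x) n +
          eps (fun n => R.compContinuousAlternatingMap (dext Y n x)) n := by
      change dext (fun n x => (star B (fun n => a n x) (fun n => Y n x) n -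
        eps (fun n => R.compContinuousAlternatingMap (Y n x)) n) - dext Y n x) n x = _
      have hSR : ∀ n, DifferentiableAt ℝ (fun x => star B (fun n => a n x) (fun n => Y n x) n -
          eps (fun n => R.compContinuousAlternatingMap (Y n x)) n) x :=
        fun n => (hS n).sub (heRY n)
      rw [dext_sub hSR hdY, dext_sub hS heRY, dext_dext hY,
        dext_star B n ha' hY', dext_eps (fun n x => R.compContinuousAlternatingMap (Y n x))]
      have : eps (fun n => dext (fun n x => R.compContinuousAlternatingMap (Y n x)) n x) n =
          eps (fun n => R.compContinuousAlternatingMap (dext Y n x)) n := by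
        simp only [eps, dext_comp R hY']
      rw [this]
      abel
    rw [e1, star_congr (b := fun n => dext Y n x) B (fun _ _ => rfl) (fun i _ => hd i),
      star_sub_right B (eps fun n => a n x) (fun n => star B (fun n => a n x) (fun n => Y n x) n -
        eps (fun n => R.compContinuousAlternatingMap (Y n x)) n), star_sub_right, ← eps_star,
      star_curv hB]
    have e2 : eps (fun n => R.compContinuousAlternatingMap (dext Y n x)) n =
        eps (star B (fun n => a n x) (fun n => R.compContinuousAlternatingMap (Y n x))) n -
        R.compContinuousAlternatingMap (R.compContinuousAlternatingMap (Y n x)) -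
        eps (fun n => R.compContinuousAlternatingMap (defect B R a Y n x)) n := by
      have e3 : R.compContinuousAlternatingMap (R.compContinuousAlternatingMap (Y n x)) =
          eps (fun n => R.compContinuousAlternatingMap
            (eps (fun n => R.compContinuousAlternatingMap (Y n x)) n)) n := by
        simp only [hReps]
        exact (eps_eps (fun n => R.compContinuousAlternatingMap
          (R.compContinuousAlternatingMap (Y n x))) n).symm
      rw [e3]
      simp only [eps]
      rw [hd, ← hRstar, ← smul_sub, ← smul_sub]
      congr 1
      ext w
      simp [eps]
    rw [e2]
    abel
  -- After contraction with v only the terms in which v meets a or the curvature survive. The term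
  -- R²Y disappears as well, so the square of `R` does not have to vanish.
  have h2 : iota v (fun n => dext (defect B R a Y) n x) n =
      iota v (fun n => star B (fun n => curv B₀ a n x) (fun n => Y n x) n -
        star B (eps fun n => a n x) (fun n => defect B R a Y n x) n -
        R.compContinuousAlternatingMap (R.compContinuousAlternatingMap (Y n x)) -
        eps (fun n => R.compContinuousAlternatingMap (defect B R a Y n x)) n) n := by
    simp only [iota, hdE]
  rw [h2, iota_sub, iota_sub, iota_sub, iota_star, iota_star, iota_eps, star_zero_right B _ hιY,
    star_zero_right B _ hιE0]
  have e4 : eps (iota v fun n => R.compContinuousAlternatingMap (defect B R a Y n x)) n = 0 := by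
    simp only [eps, iota_comp, hιE0]
    ext; simp
  have e5 : iota v (fun n => R.compContinuousAlternatingMap
      (R.compContinuousAlternatingMap (Y n x))) n = 0 := by
    simp only [iota_comp, hιY]
    ext; simp
  have e6 : star B (iota v (eps fun n => a n x)) (fun n => defect B R a Y n x) n =
      -star B (eps (iota v fun n => a n x)) (fun n => defect B R a Y n x) n := by
    rw [← star_neg_left]
    exact star_congr B (fun i _ => iota_eps _ _ _) fun _ _ => rfl
  rw [e4, e5, e6]
  abel

end Calculus

/-! ### Changes of frames, pull-backs, and smoothness tested on values -/

section Gauge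

variable {X Y 𝓐 F N₁ N₂ N N' : Type*}
  [NormedAddCommGroup X] [NormedSpace ℝ X] [FiniteDimensional ℝ X]
  [NormedAddCommGroup Y] [NormedSpace ℝ Y] [FiniteDimensional ℝ Y]
  [NormedAddCommGroup 𝓐] [NormedSpace ℝ 𝓐] [FiniteDimensional ℝ 𝓐]
  [NormedAddCommGroup F] [NormedSpace ℝ F] [FiniteDimensional ℝ F]
  [NormedAddCommGroup N₁] [NormedSpace ℝ N₁] [FiniteDimensional ℝ N₁]
  [NormedAddCommGroup N₂] [NormedSpace ℝ N₂] [FiniteDimensional ℝ N₂]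
  [NormedAddCommGroup N] [NormedSpace ℝ N] [FiniteDimensional ℝ N]
  [NormedAddCommGroup N'] [NormedSpace ℝ N'] [FiniteDimensional ℝ N']

/-- The graded family of forms with a single component, of degree `0`. -/
def zform (g : N) : ∀ n : ℕ, X [⋀^Fin n]→L[ℝ] N
  | 0 => ContinuousAlternatingMap.constOfIsEmpty ℝ X (Fin 0) g
  | _ + 1 => 0

theorem eps_zform (g : N) : eps (zform (X := X) g) = zform g := by
  funext n
  rcases n with _ | n <;> simp [eps, zform]

theorem star_zform_left (B : N₁ →ₗ[ℝ] N₂ →ₗ[ℝ] N) (g : N₁) (b : ∀ n, X [⋀^Fin n]→L[ℝ] N₂)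
    (n : ℕ) : star B (zform g) b n =
      (LinearMap.toContinuousLinearMap (B g)).compContinuousAlternatingMap (b n) := by
  rw [star, Finset.sum_eq_single_of_mem (0, n) (by simp)]
  · dsimp only
    rw [wdg_eq B (zero_add n), wedge_zero_left]
    rfl
  · rintro ⟨i, j⟩ hp hne
    rcases i with _ | i
    · have := Finset.HasAntidiagonal.mem_antidiagonal.1 hp
      simp at this
      simp [this] at hne
    · exact wdg_zero_left B _ _ _ _

theorem star_zform_right (B : N₁ →ₗ[ℝ] N₂ →ₗ[ℝ] N) (a : ∀ n, X [⋀^Fin n]→L[ℝ] N₁) (g : N₂)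
    (n : ℕ) : star B a (zform g) n =
      (LinearMap.toContinuousLinearMap (B.flip g)).compContinuousAlternatingMap (a n) := by
  rw [star, Finset.sum_eq_single_of_mem (n, 0) (by simp)]
  · dsimp only
    rw [wdg_eq B (add_zero n), wedge_zero_right]
    rfl
  · rintro ⟨i, j⟩ hp hne
    rcases j with _ | j
    · have := Finset.HasAntidiagonal.mem_antidiagonal.1 hp
      simp at this
      simp [this] at hne
    · exact map_zero _

theorem contDiffAt_zform {g : Y → N} {x : Y} {r : WithTop ℕ∞} (hg : ContDiffAt ℝ r g x) (n : ℕ) :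
    ContDiffAt ℝ r (fun x => zform (X := X) (g x) n) x := by
  rcases n with _ | n
  · exact (ContinuousAlternatingMap.constOfIsEmptyLIE ℝ X N (Fin 0)).contDiff.contDiffAt.comp x hg
  · exact contDiffAt_const

theorem dext_zform_one (g : X → N) (x : X) : dext (fun n x => zform (X := X) (g x) n) 1 x =
    .ofSubsingleton _ _ _ (0 : Fin 1) (fderiv ℝ g x) :=
  extDeriv_constOfIsEmpty g x

theorem dext_zform_of_ne (g : X → N) (x : X) {n : ℕ} (hn : n ≠ 1) :
    dext (fun n x => zform (X := X) (g x) n) n x = 0 := by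
  rcases n with _ | _ | n
  · rfl
  · exact absurd rfl hn
  · exact extDeriv_zero_fun x

theorem defect_congr {B : 𝓐 →ₗ[ℝ] F →ₗ[ℝ] F} {R : F →L[ℝ] F}
    {a a' : ∀ n, X → X [⋀^Fin n]→L[ℝ] 𝓐} {Y Y' : ∀ n, X → X [⋀^Fin n]→L[ℝ] F} {x : X}
    (ha : ∀ n, a n x = a' n x) (hY : ∀ n, Y n =ᶠ[nhds x] Y' n) (n : ℕ) :
    defect B R a Y n x = defect B R a' Y' n x := by
  simp only [defect, eps]
  rw [dext_congr n fun k _ => hY k, (hY n).self_of_nhds,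
    star_congr B (fun i _ => ha i) fun i _ => (hY i).self_of_nhds]

/-- The defect is covariant under changes of frames. -/
theorem defect_gauge {B₀ : 𝓐 →ₗ[ℝ] 𝓐 →ₗ[ℝ] 𝓐} {B : 𝓐 →ₗ[ℝ] F →ₗ[ℝ] F}
    (hB : ∀ x y f, B (B₀ x y) f = B x (B y f)) {R : F →L[ℝ] F} (hR : ∀ b f, R (B b f) = B b (R f))
    {a a' : ∀ n, X → X [⋀^Fin n]→L[ℝ] 𝓐} {Y : ∀ n, X → X [⋀^Fin n]→L[ℝ] F} {g : X → 𝓐} {x : X}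
    (hg : ContDiffAt ℝ 1 g x) (hY : ∀ n, DifferentiableAt ℝ (Y n) x)
    (h : ∀ n, star B₀ (fun n => a' n x) (zform (g x)) n =
      star B₀ (zform (g x)) (fun n => a n x) n + dext (fun n x => zform (g x) n) n x) (n : ℕ) :
    defect B R a' (fun n x => star B (zform (g x)) (fun n => Y n x) n) n x =
      star B (zform (g x)) (fun n => defect B R a Y n x) n := by
  have hRstar : ∀ n, R.compContinuousAlternatingMap
      (star B (zform (g x)) (fun n => Y n x) n) =
      star B (zform (g x)) (fun n => R.compContinuousAlternatingMap (Y n x)) n := fun n => by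
    rw [comp_star B B R (ContinuousLinearMap.id ℝ 𝓐) R (fun b f => hR b f)]
    exact star_congr B (fun i _ => by ext; rfl) (fun i _ => rfl)
  -- The term dg * Y in d(g * Y) cancels against the inhomogeneous term in the transformation law of
  -- a.
  simp only [defect]
  rw [dext_star B (a := fun n x => zform (g x) n) n
    (fun k => (contDiffAt_zform hg k).differentiableAt one_ne_zero) hY, star_sub_right,
    star_sub_right, ← star_assoc B B₀ B B hB, star_congr B (fun i _ => h i) fun _ _ => rfl,
    star_add_left, star_assoc B B₀ B B hB, eps_zform]
  have : eps (fun n => R.compContinuousAlternatingMap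
      (star B (zform (g x)) (fun n => Y n x) n)) n =
      star B (zform (g x)) (eps fun n => R.compContinuousAlternatingMap (Y n x)) n := by
    simp only [hRstar]
    have := eps_star B (zform (g x)) (fun n => R.compContinuousAlternatingMap (Y n x)) n
    rwa [eps_zform] at this
  rw [this]
  abel

/-- A form on a finite-dimensional space is determined by its values at basis vectors. -/
theorem form_apply_eq_sum {n : ℕ} (α : X [⋀^Fin n]→L[ℝ] N) (v : Fin n → X) :
    α v = ∑ r : Fin n → Fin (Module.finrank ℝ X),
      (∏ i, (Module.finBasis ℝ X).repr (v i) (r i)) • α fun i => Module.finBasis ℝ X (r i) := by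
  have hv : v = fun i => ∑ j, (Module.finBasis ℝ X).repr (v i) j • Module.finBasis ℝ X j := by
    funext i; exact ((Module.finBasis ℝ X).sum_repr (v i)).symm
  conv_lhs => rw [hv]
  have h1 := α.toMultilinearMap.map_sum
    (fun i j => (Module.finBasis ℝ X).repr (v i) j • Module.finBasis ℝ X j)
  refine h1.trans (Finset.sum_congr rfl fun r _ => ?_)
  exact α.toMultilinearMap.map_smul_univ (fun i => (Module.finBasis ℝ X).repr (v i) (r i))
    (fun i => Module.finBasis ℝ X (r i))

/-- A form is recovered by a continuous linear map from its finitely many values at basis vectors.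
Smoothness, continuity and differentiability of families of forms can therefore be tested on values.
-/
theorem exists_leftInverse_evaluation (n : ℕ) :
    ∃ g : ((Fin n → Fin (Module.finrank ℝ X)) → N) →L[ℝ] (X [⋀^Fin n]→L[ℝ] N),
      ∀ α : X [⋀^Fin n]→L[ℝ] N, g (fun r => α fun i => Module.finBasis ℝ X (r i)) = α := by
  let e : (X [⋀^Fin n]→L[ℝ] N) →ₗ[ℝ] ((Fin n → Fin (Module.finrank ℝ X)) → N) :=
    { toFun := fun α r => α fun i => Module.finBasis ℝ X (r i)
      map_add' := fun _ _ => rfl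
      map_smul' := fun _ _ => rfl }
  have he : LinearMap.ker e = ⊥ := by
    rw [LinearMap.ker_eq_bot']
    intro α hα
    ext v
    rw [form_apply_eq_sum]
    refine Finset.sum_eq_zero fun r _ => ?_
    have : α (fun i => Module.finBasis ℝ X (r i)) = 0 := congrFun hα r
    rw [this, smul_zero]
  obtain ⟨g, hg⟩ := e.exists_leftInverse_of_injective he
  exact ⟨LinearMap.toContinuousLinearMap g, fun α => LinearMap.congr_fun hg α⟩

/-- A family of forms is smooth if its values are. -/
theorem contDiffWithinAt_form {n : ℕ} {a : Y → X [⋀^Fin n]→L[ℝ] N} {s : Set Y} {y : Y}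
    {r : WithTop ℕ∞} (h : ∀ v, ContDiffWithinAt ℝ r (fun y => a y v) s y) :
    ContDiffWithinAt ℝ r a s y := by
  obtain ⟨g, hg⟩ := exists_leftInverse_evaluation (X := X) (N := N) n
  have : a = fun y => g fun r => a y fun i => Module.finBasis ℝ X (r i) :=
    funext fun y => (hg (a y)).symm
  rw [this]
  exact g.contDiff.contDiffAt.comp_contDiffWithinAt y (contDiffWithinAt_pi.2 fun r => h _)

theorem continuousWithinAt_form {T : Type*} [TopologicalSpace T] {n : ℕ}
    {a : T → X [⋀^Fin n]→L[ℝ] N} {s : Set T} {y : T}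
    (h : ∀ v, ContinuousWithinAt (fun y => a y v) s y) : ContinuousWithinAt a s y := by
  obtain ⟨g, hg⟩ := exists_leftInverse_evaluation (X := X) (N := N) n
  have : a = fun y => g fun r => a y fun i => Module.finBasis ℝ X (r i) :=
    funext fun y => (hg (a y)).symm
  rw [this]
  exact g.continuous.continuousAt.comp_continuousWithinAt (continuousWithinAt_pi.2 fun r => h _)

theorem hasDerivWithinAt_form {n : ℕ} {a : ℝ → X [⋀^Fin n]→L[ℝ] N}
    {a' : X [⋀^Fin n]→L[ℝ] N} {s : Set ℝ} {t : ℝ}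
    (h : ∀ v, HasDerivWithinAt (fun y => a y v) (a' v) s t) : HasDerivWithinAt a a' s t := by
  obtain ⟨g, hg⟩ := exists_leftInverse_evaluation (X := X) (N := N) n
  have h1 : HasDerivWithinAt (fun y => fun r : Fin n → Fin (Module.finrank ℝ X) =>
      a y fun i => Module.finBasis ℝ X (r i)) (fun r => a' fun i => Module.finBasis ℝ X (r i)) s t :=
    hasDerivWithinAt_pi.2 fun r => h _
  have h2 := g.hasFDerivAt.comp_hasDerivWithinAt t h1
  rw [hg] at h2
  exact h2.congr (fun y _ => (hg (a y)).symm) (hg (a t)).symm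

theorem contDiffWithinAt_form_apply {n : ℕ} {a : Y → X [⋀^Fin n]→L[ℝ] N} {v : Fin n → Y → X}
    {s : Set Y} {y : Y} {r : WithTop ℕ∞} (ha : ContDiffWithinAt ℝ r a s y)
    (hv : ∀ i, ContDiffWithinAt ℝ r (v i) s y) :
    ContDiffWithinAt ℝ r (fun y => a y fun i => v i y) s y := by
  rw [show (fun y => a y fun i => v i y) = _ from
    funext fun y => form_apply_eq_sum (a y) fun i => v i y]
  refine ContDiffWithinAt.sum fun r _ => ContDiffWithinAt.smul ?_ ?_
  · exact contDiffWithinAt_prod fun i _ =>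
      (LinearMap.toContinuousLinearMap
        ((Module.finBasis ℝ X).coord (r i))).contDiff.contDiffAt.comp_contDiffWithinAt y (hv i)
  · exact (ContinuousAlternatingMap.apply ℝ X N fun i =>
      Module.finBasis ℝ X (r i)).contDiff.contDiffAt.comp_contDiffWithinAt y ha

theorem contDiffWithinAt_compContinuousLinearMap {n : ℕ} {L : N' → Y →L[ℝ] X}
    {a : N' → X [⋀^Fin n]→L[ℝ] N} {s : Set N'} {y : N'} {r : WithTop ℕ∞}
    (hL : ContDiffWithinAt ℝ r L s y) (ha : ContDiffWithinAt ℝ r a s y) :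
    ContDiffWithinAt ℝ r (fun y => (a y).compContinuousLinearMap (L y)) s y :=
  contDiffWithinAt_form fun v =>
    contDiffWithinAt_form_apply (v := fun i y => L y (v i)) ha fun _ =>
      hL.clm_apply contDiffWithinAt_const

theorem dext_pull {f : Y → X} {a : ∀ n, X → X [⋀^Fin n]→L[ℝ] N} {y : Y}
    (hf : ContDiffAt ℝ 2 f y) (ha : ∀ n, DifferentiableAt ℝ (a n) (f y)) (n : ℕ) :
    dext (fun n y => pull (fderiv ℝ f y) (fun n => a n (f y)) n) n y =
      pull (fderiv ℝ f y) (fun n => dext a n (f y)) n := by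
  rcases n with _ | n
  · ext; simp [dext, pull]
  · exact extDeriv_pullback (ha n) hf (by simp)

theorem curv_pull (B₀ : 𝓐 →ₗ[ℝ] 𝓐 →ₗ[ℝ] 𝓐) {f : Y → X} {a : ∀ n, X → X [⋀^Fin n]→L[ℝ] 𝓐} {y : Y}
    (hf : ContDiffAt ℝ 2 f y) (ha : ∀ n, DifferentiableAt ℝ (a n) (f y)) (n : ℕ) :
    curv B₀ (fun n y => pull (fderiv ℝ f y) (fun n => a n (f y)) n) n y =
      pull (fderiv ℝ f y) (fun n => curv B₀ a n (f y)) n := by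
  have h : ∀ n, pull (fderiv ℝ f y) (fun n => curv B₀ a n (f y)) n =
      pull (fderiv ℝ f y) (fun n => dext a n (f y)) n +
        pull (fderiv ℝ f y) (star B₀ (eps fun n => a n (f y)) (fun n => a n (f y))) n :=
    fun n => by ext; simp [pull, curv]
  rw [h, curv, dext_pull hf ha, pull_star]
  congr 1

theorem curv_congr (B₀ : 𝓐 →ₗ[ℝ] 𝓐 →ₗ[ℝ] 𝓐) {a a' : ∀ n, X → X [⋀^Fin n]→L[ℝ] 𝓐} {x : X}
    (ha : ∀ n, a n =ᶠ[nhds x] a' n) (n : ℕ) : curv B₀ a n x = curv B₀ a' n x := by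
  rw [curv, curv, dext_congr n fun k _ => ha k, star_congr B₀ (a' := eps fun n => a' n x)
    (fun i _ => by simp only [eps, (ha i).self_of_nhds]) fun i _ => (ha i).self_of_nhds]

end Gauge

instance normedAddCommGroupC {N : Type*} [NormedAddCommGroup N] :
    NormedAddCommGroup C(unitInterval, N) :=
  ContinuousMap.instNormedAddCommGroup

instance normedSpaceC {N : Type*} [NormedAddCommGroup N] [NormedSpace ℝ N] :
    NormedSpace ℝ C(unitInterval, N) :=
  ContinuousMap.normedSpace

/-! ### Smooth functions of a parameter with values in curves on the unit interval -/

section Curry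

universe u

variable {P N : Type u} [NormedAddCommGroup P] [NormedSpace ℝ P]
  [NormedAddCommGroup N] [NormedSpace ℝ N]

open Classical in
/-- The restriction of a function to the unit interval, as a continuous function. -/
def toC (f : ℝ → N) : C(unitInterval, N) :=
  if h : ContinuousOn f (Icc 0 1) then ⟨fun t => f t, h.domRestrict⟩ else 0

theorem toC_apply {f : ℝ → N} (h : ContinuousOn f (Icc 0 1)) (t : unitInterval) :
    toC f t = f t := by
  simp only [toC, h, dite_true]
  rfl

theorem isOpen_tube {Ω : Set (P × ℝ)} (hΩ : IsOpen Ω) :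
    IsOpen {p : P | ∀ t ∈ Icc (0 : ℝ) 1, (p, t) ∈ Ω} := by
  rw [isOpen_iff_mem_nhds]
  intro p hp
  obtain ⟨u, v, hu, _, hpu, hv, huv⟩ := generalized_tube_lemma (isCompact_singleton (x := p))
    (isCompact_Icc (a := (0 : ℝ)) (b := 1)) hΩ (by
      rintro ⟨q, t⟩ ⟨hq, ht⟩
      obtain rfl : q = p := hq
      exact hp t ht)
  exact Filter.mem_of_superset (hu.mem_nhds (hpu rfl)) fun q hq t ht => huv ⟨hq, hv ht⟩

theorem continuousOn_section {Ω : Set (P × ℝ)} {G : P × ℝ → N} (hG : ContinuousOn G Ω) {p : P}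
    (hp : ∀ t ∈ Icc (0 : ℝ) 1, (p, t) ∈ Ω) : ContinuousOn (fun t => G (p, t)) (Icc 0 1) :=
  hG.comp (by fun_prop) fun t ht => hp t ht

theorem continuousOn_toC {Ω : Set (P × ℝ)} {G : P × ℝ → N} (hG : ContinuousOn G Ω) :
    ContinuousOn (fun p => toC fun t => G (p, t))
      {p : P | ∀ t ∈ Icc (0 : ℝ) 1, (p, t) ∈ Ω} := by
  rw [continuousOn_iff_continuous_domRestrict]
  refine ContinuousMap.continuous_of_continuous_uncurry _ ?_
  have : (Function.uncurry fun (p : {p : P | ∀ t ∈ Icc (0 : ℝ) 1, (p, t) ∈ Ω})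
      (t : unitInterval) => toC (fun t => G (p, t)) t) = fun z => G (z.1, z.2) := by
    funext ⟨p, t⟩
    exact toC_apply (continuousOn_section hG p.2) t
  exact this ▸ hG.comp_continuous (by fun_prop) fun z => z.1.2 z.2 z.2.2

/-- Evaluation of a curve of linear maps. -/
def evalC : C(unitInterval, P →L[ℝ] N) →L[ℝ] (P →L[ℝ] C(unitInterval, N)) :=
  LinearMap.mkContinuous₂
    (LinearMap.mk₂ ℝ (fun (T : C(unitInterval, P →L[ℝ] N)) (v : P) =>
      (⟨fun t => T t v, by fun_prop⟩ : C(unitInterval, N)))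
      (fun _ _ _ => rfl) (fun _ _ _ => rfl) (fun _ _ _ => by ext; simp) (fun _ _ _ => by ext; simp))
    1 (fun T v => by
      rw [one_mul]
      refine (ContinuousMap.norm_le _ (by positivity)).2 fun t => ?_
      exact (T t).le_of_opNorm_le (T.norm_coe_le_norm t) v)

theorem evalC_apply (T : C(unitInterval, P →L[ℝ] N)) (v : P) (t : unitInterval) :
    evalC T v t = T t v := rfl

/-- By compactness of the interval, the partial derivative is within `c` of its value at `p`,
uniformly in time, on a ball around `p`. The mean value inequality on this ball bounds the remainder
uniformly in time. -/
theorem hasFDerivAt_toC {Ω : Set (P × ℝ)} (hΩ : IsOpen Ω) {G : P × ℝ → N}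
    (hG : ContDiffOn ℝ 1 G Ω) {p : P} (hp : ∀ t ∈ Icc (0 : ℝ) 1, (p, t) ∈ Ω) :
    HasFDerivAt (fun p => toC fun t => G (p, t))
      (evalC (toC fun t => (fderiv ℝ G (p, t)).comp (ContinuousLinearMap.inl ℝ P ℝ))) p := by
  have hD : ContinuousOn (fun z : P × ℝ =>
      (fderiv ℝ G z).comp (ContinuousLinearMap.inl ℝ P ℝ)) Ω :=
    (hG.continuousOn_fderiv_of_isOpen hΩ le_rfl).clm_comp continuousOn_const
  have hcont := (continuousOn_toC hD).continuousAt ((isOpen_tube hΩ).mem_nhds hp)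
  rw [hasFDerivAt_iff_isLittleO, Asymptotics.isLittleO_iff]
  intro c hc
  obtain ⟨ε, hε, hball⟩ := Metric.mem_nhds_iff.1 (Filter.inter_mem
    ((isOpen_tube hΩ).mem_nhds hp) (hcont.preimage_mem_nhds (Metric.ball_mem_nhds _ hc)))
  filter_upwards [Metric.ball_mem_nhds p hε] with q hq
  refine (ContinuousMap.norm_le _ (by positivity)).2 fun t => ?_
  have hmem : ∀ x ∈ Metric.ball p ε, ∀ t ∈ Icc (0 : ℝ) 1, (x, t) ∈ Ω := fun x hx => (hball hx).1
  have h1 := (convex_ball p ε).norm_image_sub_le_of_norm_hasFDerivWithin_le'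
    (f := fun x => G (x, t)) (C := c) (x := p) (y := q)
    (f' := fun x => (fderiv ℝ G (x, t)).comp (ContinuousLinearMap.inl ℝ P ℝ))
    (φ := (fderiv ℝ G (p, t)).comp (ContinuousLinearMap.inl ℝ P ℝ))
    (fun x hx => by
      have h2 : HasFDerivAt G (fderiv ℝ G (x, t)) (x, (t : ℝ)) :=
        ((hG.differentiableOn one_ne_zero).differentiableAt
          (hΩ.mem_nhds (hmem x hx t t.2))).hasFDerivAt
      exact (h2.comp x (hasFDerivAt_prodMk_left x (t : ℝ))).hasFDerivWithinAt)
    (fun x hx => by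
      have h3 := (hball hx).2
      rw [mem_preimage, Metric.mem_ball, dist_eq_norm] at h3
      have h4 := ContinuousMap.norm_coe_le_norm ((toC fun t => (fderiv ℝ G (x, t)).comp
        (ContinuousLinearMap.inl ℝ P ℝ)) - toC fun t => (fderiv ℝ G (p, t)).comp
        (ContinuousLinearMap.inl ℝ P ℝ)) t
      rw [ContinuousMap.sub_apply, toC_apply (continuousOn_section hD (hmem x hx)),
        toC_apply (continuousOn_section hD hp)] at h4
      exact h4.trans h3.le)
    (Metric.mem_ball_self hε) hq
  rw [ContinuousMap.sub_apply, ContinuousMap.sub_apply, evalC_apply,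
    toC_apply (continuousOn_section hG.continuousOn (hmem q hq)),
    toC_apply (continuousOn_section hG.continuousOn hp), toC_apply (continuousOn_section hD hp)]
  exact h1

/-- Induction on the order: the derivative is again of the same kind, with values in linear maps `P
→L[ℝ] N`. The space `N` thus varies in the induction, which is why the two spaces share a universe.
-/
theorem contDiffOn_toC {Ω : Set (P × ℝ)} (hΩ : IsOpen Ω) (n : ℕ) : ∀ {N : Type u}
    [NormedAddCommGroup N] [NormedSpace ℝ N] {G : P × ℝ → N} (_ : ContDiffOn ℝ n G Ω),
    ContDiffOn ℝ n (fun p => toC fun t => G (p, t))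
      {p : P | ∀ t ∈ Icc (0 : ℝ) 1, (p, t) ∈ Ω} := by
  induction n with
  | zero =>
    intro N _ _ G hG
    rw [Nat.cast_zero, contDiffOn_zero] at *
    exact continuousOn_toC hG
  | succ n ih =>
    intro N _ _ G hG
    have hG1 : ContDiffOn ℝ 1 G Ω := hG.of_le (by exact_mod_cast Nat.le_add_left 1 n)
    rw [Nat.cast_succ, contDiffOn_succ_iff_fderiv_of_isOpen (isOpen_tube hΩ)]
    refine ⟨fun p hp => (hasFDerivAt_toC hΩ hG1 hp).differentiableAt.differentiableWithinAt,
      fun h => by simp at h, ?_⟩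
    have hD : ContDiffOn ℝ n (fun z : P × ℝ =>
        (fderiv ℝ G z).comp (ContinuousLinearMap.inl ℝ P ℝ)) Ω :=
      (hG.fderiv_of_isOpen hΩ (by simp)).clm_comp contDiffOn_const
    have h1 := (evalC (P := P) (N := N)).contDiff.comp_contDiffOn (ih hD)
    exact h1.congr fun p hp => (hasFDerivAt_toC hΩ hG1 hp).fderiv

theorem contDiffOn_infty_toC {Ω : Set (P × ℝ)} (hΩ : IsOpen Ω) {G : P × ℝ → N}
    (hG : ContDiffOn ℝ ∞ G Ω) : ContDiffOn ℝ ∞ (fun p => toC fun t => G (p, t))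
      {p : P | ∀ t ∈ Icc (0 : ℝ) 1, (p, t) ∈ Ω} :=
  contDiffOn_infty.2 fun n => contDiffOn_toC hΩ n (hG.of_le (by exact_mod_cast le_top))

end Curry

/-! ## Linear differential equations -/

section Volterra

variable {𝓨 : Type*} [NormedAddCommGroup 𝓨] [NormedSpace ℝ 𝓨] [CompleteSpace 𝓨]

theorem continuous_volterra_integrand (L : C(unitInterval, 𝓨 →L[ℝ] 𝓨)) (y : C(unitInterval, 𝓨)) :
    Continuous fun τ : ℝ => L (projIcc 0 1 zero_le_one τ) (y (projIcc 0 1 zero_le_one τ)) := by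
  have : Continuous fun τ : unitInterval => L τ (y τ) := by fun_prop
  exact this.comp continuous_projIcc

/-- The Volterra operator `y ↦ (t ↦ ∫₀ᵗ L y)`. -/
def volterra : C(unitInterval, 𝓨 →L[ℝ] 𝓨) →L[ℝ] (C(unitInterval, 𝓨) →L[ℝ] C(unitInterval, 𝓨)) :=
  LinearMap.mkContinuous₂
    (LinearMap.mk₂ ℝ (fun (L : C(unitInterval, 𝓨 →L[ℝ] 𝓨)) (y : C(unitInterval, 𝓨)) =>
      (⟨fun t => ∫ τ in (0 : ℝ)..t, L (projIcc 0 1 zero_le_one τ) (y (projIcc 0 1 zero_le_one τ)),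
        (intervalIntegral.continuous_primitive
          (fun a b => (continuous_volterra_integrand L y).intervalIntegrable a b) 0).comp
          continuous_subtype_val⟩ : C(unitInterval, 𝓨)))
      (fun L L' y => by
        ext t
        exact intervalIntegral.integral_add
          ((continuous_volterra_integrand L y).intervalIntegrable _ _)
          ((continuous_volterra_integrand L' y).intervalIntegrable _ _))
      (fun r L y => by
        ext t
        exact intervalIntegral.integral_smul r _)
      (fun L y y' => by
        ext t
        simp only [ContinuousMap.coe_mk, ContinuousMap.add_apply, map_add]
        exact intervalIntegral.integral_add
          ((continuous_volterra_integrand L y).intervalIntegrable _ _)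
          ((continuous_volterra_integrand L y').intervalIntegrable _ _))
      (fun r L y => by
        ext t
        simp only [ContinuousMap.coe_mk, ContinuousMap.smul_apply, map_smul]
        exact intervalIntegral.integral_smul r _))
    1 (fun L y => by
      rw [one_mul]
      refine (ContinuousMap.norm_le _ (by positivity)).2 fun t => ?_
      have h1 := intervalIntegral.norm_integral_le_of_norm_le_const (a := 0) (b := (t : ℝ))
        (f := fun τ => L (projIcc 0 1 zero_le_one τ) (y (projIcc 0 1 zero_le_one τ)))
        (C := ‖L‖ * ‖y‖) fun τ _ => (L _).le_of_opNorm_le_of_le (L.norm_coe_le_norm _)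
          (y.norm_coe_le_norm _)
      refine h1.trans ?_
      rw [sub_zero, abs_of_nonneg t.2.1]
      exact mul_le_of_le_one_right (by positivity) t.2.2)

/-- This crude bound replaces the factorial estimates for the iterates: the equation is solved by a
Neumann series only for `‖L‖ < 1`, that is, on short intervals. -/
theorem norm_volterra_le (L : C(unitInterval, 𝓨 →L[ℝ] 𝓨)) : ‖volterra L‖ ≤ ‖L‖ := by
  refine ContinuousLinearMap.opNorm_le_bound _ (norm_nonneg L) fun y => ?_
  refine (ContinuousMap.norm_le _ (by positivity)).2 fun t => ?_
  have h1 := intervalIntegral.norm_integral_le_of_norm_le_const (a := 0) (b := (t : ℝ))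
    (f := fun τ => L (projIcc 0 1 zero_le_one τ) (y (projIcc 0 1 zero_le_one τ)))
    (C := ‖L‖ * ‖y‖) fun τ _ => (L _).le_of_opNorm_le_of_le (L.norm_coe_le_norm _)
      (y.norm_coe_le_norm _)
  refine h1.trans ?_
  rw [sub_zero, abs_of_nonneg t.2.1]
  exact mul_le_of_le_one_right (by positivity) t.2.2

/-- The solution on the unit interval of `y' = L y`, for small `L`. -/
def volterraSolve (L : C(unitInterval, 𝓨 →L[ℝ] 𝓨)) (y₀ : 𝓨) : C(unitInterval, 𝓨) :=
  Ring.inverse (1 - volterra L) (ContinuousMap.const _ y₀)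

theorem isUnit_one_sub_volterra {L : C(unitInterval, 𝓨 →L[ℝ] 𝓨)} (hL : ‖L‖ < 1) :
    IsUnit (1 - volterra L) :=
  ⟨Units.oneSub (volterra L) ((norm_volterra_le L).trans_lt hL), rfl⟩

theorem volterra_unique {L : C(unitInterval, 𝓨 →L[ℝ] 𝓨)} (hL : ‖L‖ < 1) {y₀ : 𝓨}
    {y : C(unitInterval, 𝓨)} (hy : y = ContinuousMap.const _ y₀ + volterra L y) :
    y = volterraSolve L y₀ := by
  have h1 : (1 - volterra L) y = ContinuousMap.const _ y₀ := by
    change y - volterra L y = _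
    nth_rewrite 1 [hy]
    simp
  rw [volterraSolve, ← h1]
  change y = (Ring.inverse (1 - volterra L) * (1 - volterra L)) y
  rw [Ring.inverse_mul_cancel _ (isUnit_one_sub_volterra hL)]
  rfl

theorem volterraSolve_eq {L : C(unitInterval, 𝓨 →L[ℝ] 𝓨)} (hL : ‖L‖ < 1) (y₀ : 𝓨) :
    volterraSolve L y₀ = ContinuousMap.const _ y₀ + volterra L (volterraSolve L y₀) := by
  have h1 : (1 - volterra L) (volterraSolve L y₀) = ContinuousMap.const _ y₀ := by
    change ((1 - volterra L) * Ring.inverse (1 - volterra L)) (ContinuousMap.const _ y₀) = _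
    rw [Ring.mul_inverse_cancel _ (isUnit_one_sub_volterra hL)]
    rfl
  rw [← h1]
  change volterraSolve L y₀ = volterraSolve L y₀ - _ + _
  simp

/-- Inversion in the Banach algebra of operators is smooth, so the solution depends smoothly on the
coefficients and on the initial value. -/
theorem contDiffAt_volterraSolve {P : Type*} [NormedAddCommGroup P] [NormedSpace ℝ P]
    {L : P → C(unitInterval, 𝓨 →L[ℝ] 𝓨)} {y₀ : P → 𝓨} {p : P} (hL : ContDiffAt ℝ ∞ L p)
    (hy₀ : ContDiffAt ℝ ∞ y₀ p) (hp : ‖L p‖ < 1) :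
    ContDiffAt ℝ ∞ (fun p => volterraSolve (L p) (y₀ p)) p := by
  obtain ⟨w, hw⟩ := isUnit_one_sub_volterra hp
  have h0 : ContDiffAt ℝ ∞ (fun p => volterra (L p)) p :=
    (volterra (𝓨 := 𝓨)).contDiff.contDiffAt.comp p hL
  have h1 : ContDiffAt ℝ ∞ (fun p => 1 - volterra (L p)) p :=
    contDiffAt_const.sub h0
  have h2 : ContDiffAt ℝ ∞ Ring.inverse (1 - volterra (L p)) := by
    rw [← hw]; exact contDiffAt_ringInverse ℝ w
  have h3 : ContDiffAt ℝ ∞ (fun p => ContinuousMap.const unitInterval (y₀ p)) p := by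
    let c : 𝓨 →L[ℝ] C(unitInterval, 𝓨) := LinearMap.mkContinuous
      { toFun := fun y => ContinuousMap.const unitInterval y
        map_add' := fun _ _ => rfl
        map_smul' := fun _ _ => rfl } 1 fun y => by
          rw [one_mul]; exact (ContinuousMap.norm_le _ (by positivity)).2 fun _ => le_rfl
    exact c.contDiff.contDiffAt.comp p hy₀
  exact (h2.comp p h1).clm_apply h3

end Volterra

section LinearODE

theorem linearODE_unique {𝓨 : Type*} [NormedAddCommGroup 𝓨] [NormedSpace ℝ 𝓨]
    {L : ℝ → 𝓨 →L[ℝ] 𝓨} {a b : ℝ} (hL : ContinuousOn L (Icc a b)) {y z : ℝ → 𝓨}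
    (hy : ∀ t ∈ Icc a b, HasDerivWithinAt y (L t (y t)) (Icc a b) t)
    (hz : ∀ t ∈ Icc a b, HasDerivWithinAt z (L t (z t)) (Icc a b) t) (h : y a = z a) :
    EqOn y z (Icc a b) := by
  obtain ⟨C, hC⟩ := isCompact_Icc.exists_bound_of_continuousOn hL
  have hmem : ∀ t ∈ Ico a b, Icc a b ∈ nhdsWithin t (Ici t) := fun t ht =>
    Icc_mem_nhdsGE_of_mem ht
  refine ODE_solution_unique_of_mem_Icc_right (v := fun t y => L t y) (K := Real.toNNReal C)
    (s := fun _ => univ) (fun t ht => ?_) (fun t ht => (hy t ht).continuousWithinAt)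
    (fun t ht => ((hy t (Ico_subset_Icc_self ht)).mono_of_mem_nhdsWithin (hmem t ht)))
    (fun _ _ => trivial) (fun t ht => (hz t ht).continuousWithinAt)
    (fun t ht => ((hz t (Ico_subset_Icc_self ht)).mono_of_mem_nhdsWithin (hmem t ht)))
    (fun _ _ => trivial) h
  refine ((L t).lipschitz.weaken ?_).lipschitzOnWith
  rw [← NNReal.coe_le_coe]
  exact (hC t (Ico_subset_Icc_self ht)).trans (Real.le_coe_toNNReal C)

theorem linearODE_exists {𝓨 : Type*} [NormedAddCommGroup 𝓨] [NormedSpace ℝ 𝓨] [CompleteSpace 𝓨]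
    {L : ℝ → 𝓨 →L[ℝ] 𝓨} {a₀ b₀ : ℝ} (hL : ContinuousOn L (Icc a₀ b₀)) :
    ∃ δ > 0, ∀ a b, a₀ ≤ a → a ≤ b → b ≤ b₀ → b ≤ a + δ → ∀ y₀ : 𝓨,
      ∃ y : ℝ → 𝓨, y a = y₀ ∧ ∀ t ∈ Icc a b, HasDerivWithinAt y (L t (y t)) (Icc a b) t := by
  obtain ⟨C, hC⟩ := isCompact_Icc.exists_bound_of_continuousOn hL
  -- Linearity makes the length independent of the initial value: in the ball of radius ‖y₀‖ + 1
  -- around y₀ the speed is at most (|C| + 1)(2‖y₀‖ + 1), so within this time the solution moves by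
  -- at most ‖y₀‖ + 1/2.
  refine ⟨1 / (2 * (|C| + 1)), by positivity, fun a b ha hab hb hδ y₀ => ?_⟩
  have hsub : Icc a b ⊆ Icc a₀ b₀ := Icc_subset_Icc ha hb
  have hC' : ∀ t ∈ Icc a b, ‖L t‖ ≤ |C| + 1 := fun t ht =>
    (hC t (hsub ht)).trans ((le_abs_self C).trans (by linarith))
  have hp : IsPicardLindelof (fun t y => L t y) (⟨a, left_mem_Icc.2 hab⟩ : Icc a b) y₀
      (Real.toNNReal (‖y₀‖ + 1)) 0 (Real.toNNReal ((|C| + 1) * (2 * ‖y₀‖ + 1)))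
      (Real.toNNReal (|C| + 1)) := by
    constructor
    · intro t ht
      refine ((L t).lipschitz.weaken ?_).lipschitzOnWith
      rw [← NNReal.coe_le_coe]
      exact (hC' t ht).trans (Real.le_coe_toNNReal _)
    · intro y _
      exact (hL.mono hsub).clm_apply continuousOn_const
    · intro t ht y hy
      rw [Real.coe_toNNReal _ (by positivity)]
      refine (L t).le_of_opNorm_le_of_le (hC' t ht) ?_
      rw [Metric.mem_closedBall, Real.coe_toNNReal _ (by positivity), dist_eq_norm] at hy
      have := norm_le_norm_add_norm_sub' y y₀
      linarith
    · simp only [sub_self]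
      rw [Real.coe_toNNReal _ (by positivity), Real.coe_toNNReal _ (by positivity),
        max_eq_left (by linarith)]
      have h1 : (b - a) * (2 * (|C| + 1)) ≤ 1 := by
        have : b - a ≤ 1 / (2 * (|C| + 1)) := by linarith
        rwa [le_div_iff₀ (by positivity)] at this
      simp only [NNReal.coe_zero, sub_zero]
      nlinarith [norm_nonneg y₀, abs_nonneg C, mul_nonneg (sub_nonneg.2 hab) (abs_nonneg C)]
  obtain ⟨y, hy, hy'⟩ := hp.exists_eq_forall_mem_Icc_hasDerivWithinAt₀
  exact ⟨y, hy, hy'⟩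

universe u

variable {Λ 𝓨 : Type u} [NormedAddCommGroup Λ] [NormedSpace ℝ Λ]
  [NormedAddCommGroup 𝓨] [NormedSpace ℝ 𝓨] [CompleteSpace 𝓨]

/-- Smooth dependence of the solutions of linear differential equations on parameters. -/
theorem linearODE_smooth {Ω : Set (Λ × ℝ)} (hΩ : IsOpen Ω) {F : Λ × ℝ → 𝓨 →L[ℝ] 𝓨}
    (hF : ContDiffOn ℝ ∞ F Ω) {l₀ : Λ} {t₀ : ℝ} (h0 : (l₀, t₀) ∈ Ω) :
    ∃ W : Set Λ, IsOpen W ∧ l₀ ∈ W ∧ ∃ δ > 0, W ×ˢ Ioo (t₀ - δ) (t₀ + δ) ⊆ Ω ∧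
      ∀ a ∈ Ioo (t₀ - δ) (t₀ + δ), ∀ W' ⊆ W, IsOpen W' → ∀ y₀ : Λ → 𝓨, ContDiffOn ℝ ∞ y₀ W' →
        ∃ y : Λ × ℝ → 𝓨, ContDiffOn ℝ ∞ y (W' ×ˢ Ioo (t₀ - δ) (t₀ + δ)) ∧
          (∀ l ∈ W', y (l, a) = y₀ l) ∧ ∀ l ∈ W', ∀ t ∈ Ioo (t₀ - δ) (t₀ + δ),
            HasDerivAt (fun t => y (l, t)) (F (l, t) (y (l, t))) t := by
  set C : ℝ := ‖F (l₀, t₀)‖ + 1 with hCdef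
  have hC : 0 < C := by positivity
  have hnear : ∀ᶠ z in nhds (l₀, t₀), z ∈ Ω ∧ ‖F z‖ < C := by
    have hc : ContinuousAt F (l₀, t₀) := hF.continuousOn.continuousAt (hΩ.mem_nhds h0)
    exact Filter.Eventually.and (hΩ.mem_nhds h0)
      (hc.norm.eventually_lt_const (by rw [hCdef]; linarith))
  rw [nhds_prod_eq, Filter.eventually_prod_iff] at hnear
  obtain ⟨p, hp, q, hq, hpq⟩ := hnear
  obtain ⟨W, hWp, hW, hlW⟩ := mem_nhds_iff.1 hp
  obtain ⟨δ₁, hδ₁, hball⟩ := Metric.mem_nhds_iff.1 hq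
  -- Two times in the interval differ by at most 2δ ≤ 1/(2C), so the rescaled coefficients have norm
  -- at most 1/2 and the Volterra equation is solvable.
  set δ : ℝ := min δ₁ (1 / (4 * C)) with hδdef
  have hδ : 0 < δ := lt_min hδ₁ (by positivity)
  have hδC : 2 * δ * C ≤ 1 / 2 := by
    have : δ ≤ 1 / (4 * C) := min_le_right _ _
    rw [le_div_iff₀ (by positivity)] at this
    linarith
  have hIoo : ∀ t ∈ Ioo (t₀ - δ) (t₀ + δ), q t := fun t ht => hball (by
    rw [Metric.mem_ball, Real.dist_eq, abs_lt]
    have : δ ≤ δ₁ := min_le_left _ _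
    constructor <;> linarith [ht.1, ht.2])
  refine ⟨W, hW, hlW, δ, hδ, fun z hz => (hpq (hWp hz.1) (hIoo _ hz.2)).1,
    fun a ha W' hW' hW'o y₀ hy₀ => ?_⟩
  set J := Ioo (t₀ - δ) (t₀ + δ) with hJ
  have hFJ : ContDiffOn ℝ ∞ F (W' ×ˢ J) := hF.mono fun z hz =>
    (hpq (hWp (hW' hz.1)) (hIoo _ hz.2)).1
  have hFn : ∀ l ∈ W', ∀ t ∈ J, ‖F (l, t)‖ ≤ C := fun l hl t ht =>
    (hpq (hWp (hW' hl)) (hIoo t ht)).2.le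
  -- the rescaled coefficients
  let G : (Λ × ℝ) × ℝ → 𝓨 →L[ℝ] 𝓨 := fun z => (z.1.2 - a) • F (z.1.1, a + z.2 * (z.1.2 - a))
  let f : (Λ × ℝ) × ℝ → Λ × ℝ := fun z => (z.1.1, a + z.2 * (z.1.2 - a))
  have hfs : ContDiff ℝ ∞ f := by fun_prop
  have hΩ' : IsOpen (f ⁻¹' (W' ×ˢ J)) := (hW'o.prod isOpen_Ioo).preimage hfs.continuous
  have hG : ContDiffOn ℝ ∞ G (f ⁻¹' (W' ×ˢ J)) := by
    have h1 : ContDiff ℝ ∞ fun z : (Λ × ℝ) × ℝ => z.1.2 - a := by fun_prop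
    refine h1.contDiffOn.smul ?_
    exact hFJ.comp hfs.contDiffOn fun z hz => hz
  have hseg : ∀ t ∈ J, ∀ τ ∈ Icc (0 : ℝ) 1, a + τ * (t - a) ∈ J := fun t ht τ hτ => by
    have := (convex_Ioo (t₀ - δ) (t₀ + δ)) ha ht (sub_nonneg.2 hτ.2) hτ.1 (by ring)
    have e : (1 - τ) • a + τ • t = a + τ * (t - a) := by simp only [smul_eq_mul]; ring
    rwa [e] at this
  have htube : ∀ l ∈ W', ∀ t ∈ J, ∀ τ ∈ Icc (0 : ℝ) 1, ((l, t), τ) ∈ f ⁻¹' (W' ×ˢ J) :=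
    fun l hl t ht τ hτ => ⟨hl, hseg t ht τ hτ⟩
  let L : Λ × ℝ → C(unitInterval, 𝓨 →L[ℝ] 𝓨) := fun z => toC fun τ => G (z, τ)
  have hLapp : ∀ l ∈ W', ∀ t ∈ J, ∀ τ : unitInterval,
      L (l, t) τ = (t - a) • F (l, a + τ * (t - a)) := fun l hl t ht τ =>
    toC_apply (continuousOn_section hG.continuousOn (htube l hl t ht)) τ
  have hLsmooth : ∀ l ∈ W', ∀ t ∈ J, ContDiffAt ℝ ∞ L (l, t) := fun l hl t ht =>
    (contDiffOn_infty_toC hΩ' hG).contDiffAt ((isOpen_tube hΩ').mem_nhds (htube l hl t ht))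
  have hLn : ∀ l ∈ W', ∀ t ∈ J, ‖L (l, t)‖ < 1 := fun l hl t ht => by
    refine ((ContinuousMap.norm_le _ (by norm_num : (0 : ℝ) ≤ 1 / 2)).2 fun τ => ?_).trans_lt
      (by norm_num)
    rw [hLapp l hl t ht, norm_smul, Real.norm_eq_abs]
    refine le_trans ?_ hδC
    refine mul_le_mul ?_ (hFn l hl _ (hseg t ht τ τ.2)) (norm_nonneg _) (by positivity)
    rw [abs_le]
    constructor <;> linarith [ht.1, ht.2, ha.1, ha.2]
  -- The final time is made a parameter: the solution on the segment from a to t is rescaled to the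
  -- unit interval and later evaluated at 1. Joint smoothness in the parameter and the time follows
  -- at once.
  let sol : Λ × ℝ → C(unitInterval, 𝓨) := fun z => volterraSolve (L z) (y₀ z.1)
  have hsol : ContDiffOn ℝ ∞ sol (W' ×ˢ J) := fun z hz =>
    (contDiffAt_volterraSolve (hLsmooth z.1 hz.1 z.2 hz.2)
      ((hy₀.contDiffAt (hW'o.mem_nhds hz.1)).comp z contDiffAt_fst)
      (hLn z.1 hz.1 z.2 hz.2)).contDiffWithinAt
  let y : Λ × ℝ → 𝓨 := fun z => sol z 1
  have hy : ContDiffOn ℝ ∞ y (W' ×ˢ J) := by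
    let ev : C(unitInterval, 𝓨) →L[ℝ] 𝓨 := LinearMap.mkContinuous
      { toFun := fun g => g 1
        map_add' := fun _ _ => rfl
        map_smul' := fun _ _ => rfl } 1 fun g => by rw [one_mul]; exact g.norm_coe_le_norm 1
    exact ev.contDiff.comp_contDiffOn hsol
  have hint : ∀ l ∈ W', ∀ t ∈ J, ∀ τ : unitInterval, sol (l, t) τ = y₀ l +
      ∫ s in (0 : ℝ)..τ, L (l, t) (projIcc 0 1 zero_le_one s)
        (sol (l, t) (projIcc 0 1 zero_le_one s)) := fun l hl t ht τ => by
    have h1 := volterraSolve_eq (hLn l hl t ht) (y₀ l)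
    exact DFunLike.congr_fun h1 τ
  -- By uniqueness for the Volterra equation, the rescaled solutions for different final times are
  -- restrictions of one function. Hence y satisfies the integral equation in the original time.
  have hscale : ∀ l ∈ W', ∀ t ∈ J, ∀ σ : unitInterval,
      sol (l, t) σ = y (l, a + σ * (t - a)) := fun l hl t ht σ => by
    have ht' := hseg t ht σ σ.2
    let z : C(unitInterval, 𝓨) := (sol (l, t)).comp ⟨fun τ => σ * τ, by fun_prop⟩
    have hz : z = volterraSolve (L (l, a + σ * (t - a))) (y₀ l) := by
      refine volterra_unique (hLn l hl _ ht') ?_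
      ext τ
      change sol (l, t) (σ * τ) = y₀ l + ∫ s in (0 : ℝ)..τ, _
      rw [hint l hl t ht, add_right_inj]
      have e : ((σ * τ : unitInterval) : ℝ) = (σ : ℝ) * τ := rfl
      rw [e]
      have h2 := intervalIntegral.smul_integral_comp_mul_left (a := 0) (b := (τ : ℝ))
        (fun s => L (l, t) (projIcc 0 1 zero_le_one s)
          (sol (l, t) (projIcc 0 1 zero_le_one s))) (σ : ℝ)
      rw [mul_zero] at h2
      rw [← h2, ← intervalIntegral.integral_smul]
      refine intervalIntegral.integral_congr fun s hs => ?_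
      rw [uIcc_of_le τ.2.1] at hs
      have hs1 : s ∈ Icc (0 : ℝ) 1 := ⟨hs.1, hs.2.trans τ.2.2⟩
      have hs2 : (σ : ℝ) * s ∈ Icc (0 : ℝ) 1 :=
        ⟨mul_nonneg σ.2.1 hs1.1, mul_le_one₀ σ.2.2 hs1.1 hs1.2⟩
      rw [projIcc_of_mem zero_le_one hs1, projIcc_of_mem zero_le_one hs2, hLapp l hl t ht,
        hLapp l hl _ ht']
      change (σ : ℝ) • ((t - a) • F (l, a + σ * s * (t - a))) (sol (l, t) ⟨σ * s, hs2⟩) =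
        ((a + σ * (t - a) - a) • F (l, a + s * (a + σ * (t - a) - a)))
          (sol (l, t) (σ * ⟨s, hs1⟩))
      rw [← smul_apply, smul_smul]
      have e1 : a + σ * (t - a) - a = σ * (t - a) := by ring
      have e2 : a + s * (a + σ * (t - a) - a) = a + σ * s * (t - a) := by ring
      rw [e2, e1]
      rfl
    change _ = volterraSolve (L (l, a + σ * (t - a))) (y₀ l) 1
    rw [← hz]
    change sol (l, t) σ = sol (l, t) (σ * 1)
    rw [mul_one]
  have hyint : ∀ l ∈ W', ∀ t ∈ J, y (l, t) = y₀ l + ∫ s in a..t, F (l, s) (y (l, s)) :=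
    fun l hl t ht => by
    change sol (l, t) 1 = _
    rw [hint l hl t ht, add_right_inj]
    have h2 := intervalIntegral.smul_integral_comp_mul_add (a := 0) (b := 1)
      (fun s => F (l, s) (y (l, s))) (t - a) a
    have e1 : (t - a) * 0 + a = a := by ring
    have e2 : (t - a) * 1 + a = t := by ring
    rw [e1, e2] at h2
    rw [← h2, ← intervalIntegral.integral_smul]
    refine intervalIntegral.integral_congr fun s hs => ?_
    rw [uIcc_of_le (by norm_num)] at hs
    rw [projIcc_of_mem zero_le_one hs, hLapp l hl t ht, hscale l hl t ht]
    change ((t - a) • F (l, a + s * (t - a))) (y (l, a + s * (t - a))) = _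
    have e3 : a + s * (t - a) = (t - a) * s + a := by ring
    rw [e3]
    rfl
  refine ⟨y, hy, fun l hl => ?_, fun l hl t ht => ?_⟩
  · rw [hyint l hl a ha]
    simp
  · have hcont : ContinuousOn (fun s => F (l, s) (y (l, s))) J := by
      have h1 : ContinuousOn (fun s : ℝ => (l, s)) J := by fun_prop
      exact (hFJ.continuousOn.comp h1 fun s hs => ⟨hl, hs⟩).clm_apply
        (hy.continuousOn.comp h1 fun s hs => ⟨hl, hs⟩)
    have hJn : J ∈ nhds t := isOpen_Ioo.mem_nhds ht
    have h1 := intervalIntegral.integral_hasDerivAt_right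
      (ContinuousOn.intervalIntegrable (hcont.mono (ordConnected_Ioo.uIcc_subset ha ht)))
      (hcont.stronglyMeasurableAtFilter isOpen_Ioo t ht) (hcont.continuousAt hJn)
    refine (h1.const_add (y₀ l)).congr_of_eventuallyEq ?_
    filter_upwards [hJn] with s hs using hyint l hl s hs

/-- Induction on a compact interval by local steps. -/
theorem interval_induction {a b : ℝ} {Q : ℝ → Prop} (h0 : Q a)
    (h : ∀ t ∈ Icc a b, ∃ δ > 0, ∀ s s', s ∈ Icc a b → s' ∈ Icc a b → t - δ < s → s ≤ s' →
      s' < t + δ → Q s → Q s') : ∀ t ∈ Icc a b, Q t := by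
  -- The step is applied around c itself, starting from a point slightly to its left; so Q holds at
  -- the infimum of its counterexamples, and the step there leads past it.
  have hclosed : ∀ c ∈ Icc a b, (∀ s ∈ Ico a c, Q s) → Q c := fun c hc hs => by
    rcases hc.1.eq_or_lt with rfl | hac
    · exact h0
    obtain ⟨δ, hδ, hstep⟩ := h c hc
    have h1 : max a (c - δ / 2) ∈ Ico a c := ⟨le_max_left _ _, max_lt hac (by linarith)⟩
    exact hstep _ c ⟨h1.1, h1.2.le.trans hc.2⟩ hc
      (lt_of_lt_of_le (by linarith) (le_max_right _ _)) h1.2.le (by linarith) (hs _ h1)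
  by_contra! hne
  obtain ⟨t, ht, hQt⟩ := hne
  set B := {s | s ∈ Icc a b ∧ ¬ Q s} with hB
  have hBne : B.Nonempty := ⟨t, ht, hQt⟩
  have hBb : BddBelow B := ⟨a, fun s hs => hs.1.1⟩
  set c := sInf B with hc
  have hcI : c ∈ Icc a b := ⟨le_csInf hBne fun s hs => hs.1.1, (csInf_le hBb ⟨ht, hQt⟩).trans ht.2⟩
  have hQc : Q c := hclosed c hcI fun s hs => by
    by_contra hn
    exact absurd (csInf_le hBb ⟨⟨hs.1, hs.2.le.trans hcI.2⟩, hn⟩) (not_le.2 hs.2)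
  obtain ⟨δ, hδ, hstep⟩ := h c hcI
  obtain ⟨s, hs, hsc⟩ := exists_lt_of_csInf_lt hBne (by linarith : sInf B < c + δ)
  exact hs.2 (hstep c s hcI hs.1 (by linarith) (csInf_le hBb hs) hsc hQc)

end LinearODE

/-! ### Graded linear equations as equations for truncated families -/

section GradedODE

universe u

variable {Λ X F : Type u} {𝓐 : Type*} [NormedAddCommGroup Λ] [NormedSpace ℝ Λ]
  [NormedAddCommGroup X] [NormedSpace ℝ X] [FiniteDimensional ℝ X]
  [NormedAddCommGroup 𝓐] [NormedSpace ℝ 𝓐] [FiniteDimensional ℝ 𝓐]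
  [NormedAddCommGroup F] [NormedSpace ℝ F] [FiniteDimensional ℝ F]

variable (X F) in
/-- Graded families of forms, truncated in the degrees above `K`. -/
abbrev Truncated (K : ℕ) : Type u := ∀ p : Fin (K + 1), X [⋀^Fin p]→L[ℝ] F

/-- The extension by zero of a truncated family. -/
def Truncated.extend {K : ℕ} (y : Truncated X F K) (n : ℕ) : X [⋀^Fin n]→L[ℝ] F :=
  if h : n < K + 1 then y ⟨n, h⟩ else 0

theorem Truncated.extend_of_le {K : ℕ} (Y : ∀ n, X [⋀^Fin n]→L[ℝ] F) {n : ℕ} (hn : n ≤ K) :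
    Truncated.extend (K := K) (fun p => Y p) n = Y n := by
  simp [Truncated.extend, Nat.lt_succ_of_le hn]

instance normedAddCommGroupTruncated (K : ℕ) : NormedAddCommGroup (Truncated X F K) :=
  Pi.normedAddCommGroup

instance normedSpaceTruncated (K : ℕ) : NormedSpace ℝ (Truncated X F K) :=
  Pi.normedSpace

instance finiteDimensionalTruncated (K : ℕ) : FiniteDimensional ℝ (Truncated X F K) :=
  inferInstanceAs (FiniteDimensional ℝ (∀ p : Fin (K + 1), X [⋀^Fin p]→L[ℝ] F))

/-- The product with a graded family of forms, as an operator on truncated families. -/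
def starOp (B : 𝓐 →ₗ[ℝ] F →ₗ[ℝ] F) (K : ℕ) (c : ∀ n, X [⋀^Fin n]→L[ℝ] 𝓐) :
    Truncated X F K →L[ℝ] Truncated X F K :=
  LinearMap.toContinuousLinearMap
    { toFun := fun y p => star B c y.extend p
      map_add' := fun y z => by
        funext p
        change _ = star B c y.extend p + star B c z.extend p
        rw [← star_add_right]
        refine star_congr B (fun _ _ => rfl) fun i hi => ?_
        have : i < K + 1 := lt_of_le_of_lt hi p.2
        simp [Truncated.extend, this]
      map_smul' := fun r y => by
        funext p
        change _ = r • star B c y.extend p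
        simp only [star, Finset.smul_sum, ← wdg_smul_right]
        refine Finset.sum_congr rfl fun q hq => ?_
        have : q.2 < K + 1 :=
          by
          have := Finset.HasAntidiagonal.mem_antidiagonal.1 hq; omega
        simp [Truncated.extend, this] }

theorem starOp_apply (B : 𝓐 →ₗ[ℝ] F →ₗ[ℝ] F) (K : ℕ) (c : ∀ n, X [⋀^Fin n]→L[ℝ] 𝓐)
    (y : Truncated X F K) (p : Fin (K + 1)) : starOp B K c y p = star B c y.extend p := rfl

theorem contDiffOn_starOp (B : 𝓐 →ₗ[ℝ] F →ₗ[ℝ] F) (K : ℕ) {P : Type u} [NormedAddCommGroup P]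
    [NormedSpace ℝ P] {c : ∀ n, P → X [⋀^Fin n]→L[ℝ] 𝓐} {S : Set P} {r : WithTop ℕ∞}
    (hc : ∀ n, ContDiffOn ℝ r (c n) S) :
    ContDiffOn ℝ r (fun z => starOp B K fun n => c n z) S := by
  rw [contDiffOn_clm_apply]
  intro y
  rw [contDiffOn_pi]
  intro p
  change ContDiffOn ℝ r (fun z => ∑ q ∈ Finset.HasAntidiagonal.antidiagonal (p : ℕ),
    wdg B q.1 q.2 p (c q.1 z) (Truncated.extend y q.2)) S
  refine ContDiffOn.sum fun q _ => ?_
  exact ((wdg B q.1 q.2 p).contDiff.comp_contDiffOn (hc q.1)).clm_apply contDiffOn_const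

theorem continuousOn_starOp (B : 𝓐 →ₗ[ℝ] F →ₗ[ℝ] F) (K : ℕ) {T : Type*} [TopologicalSpace T]
    {c : ∀ n, T → X [⋀^Fin n]→L[ℝ] 𝓐} {S : Set T} (hc : ∀ n, ContinuousOn (c n) S) :
    ContinuousOn (fun z => starOp B K fun n => c n z) S := by
  rw [continuousOn_clm_apply]
  intro y
  rw [continuousOn_pi]
  intro p
  change ContinuousOn (fun z => ∑ q ∈ Finset.HasAntidiagonal.antidiagonal (p : ℕ),
    wdg B q.1 q.2 p (c q.1 z) (Truncated.extend y q.2)) S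
  refine continuousOn_finsetSum _ fun q _ => ?_
  exact ((wdg B q.1 q.2 p).continuous.comp_continuousOn (hc q.1)).clm_apply continuousOn_const

/-- This justifies the truncation: above the dimension of `X` nothing is lost, and a graded equation
becomes one linear equation in a finite-dimensional space. -/
theorem form_eq_zero {n : ℕ} (h : Module.finrank ℝ X < n) (α : X [⋀^Fin n]→L[ℝ] F) : α = 0 := by
  ext v
  refine α.toAlternatingMap.map_linearDependent v fun hv => ?_
  have := hv.fintype_card_le_finrank
  simp at this
  omega

/-- Uniqueness of the solutions of graded linear differential equations. -/
theorem graded_unique (B : 𝓐 →ₗ[ℝ] F →ₗ[ℝ] F) {c : ∀ n, ℝ → X [⋀^Fin n]→L[ℝ] 𝓐} {a b : ℝ}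
    (hc : ∀ n, ContinuousOn (c n) (Icc a b)) {K : ℕ} {Y Z : ∀ n, ℝ → X [⋀^Fin n]→L[ℝ] F}
    (hY : ∀ n ≤ K, ∀ t ∈ Icc a b, HasDerivWithinAt (Y n)
      (star B (fun n => c n t) (fun n => Y n t) n) (Icc a b) t)
    (hZ : ∀ n ≤ K, ∀ t ∈ Icc a b, HasDerivWithinAt (Z n)
      (star B (fun n => c n t) (fun n => Z n t) n) (Icc a b) t)
    (h : ∀ n ≤ K, Y n a = Z n a) : ∀ n ≤ K, ∀ t ∈ Icc a b, Y n t = Z n t := by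
  have key : ∀ W : ∀ n, ℝ → X [⋀^Fin n]→L[ℝ] F,
      (∀ n ≤ K, ∀ t ∈ Icc a b, HasDerivWithinAt (W n)
        (star B (fun n => c n t) (fun n => W n t) n) (Icc a b) t) →
      ∀ t ∈ Icc a b, HasDerivWithinAt (fun t => (fun p => W p t : Truncated X F K))
        (starOp B K (fun n => c n t) (fun p => W p t)) (Icc a b) t := fun W hW t ht => by
    rw [hasDerivWithinAt_pi]
    intro p
    have hp : (p : ℕ) ≤ K := Nat.lt_succ_iff.1 p.2
    have h1 := hW p hp t ht
    rw [starOp_apply, star_congr B (fun _ _ => rfl) fun i hi =>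
      Truncated.extend_of_le (fun n => W n t) (hi.trans hp)]
    exact h1
  intro n hn t ht
  have h2 := linearODE_unique (continuousOn_starOp B K hc) (key Y hY) (key Z hZ)
    (funext fun p => h p (Nat.lt_succ_iff.1 p.2)) ht
  exact congrFun h2 ⟨n, Nat.lt_succ_of_le hn⟩

/-- A solution of a truncated graded equation gives a solution of the full equation. -/
theorem extend_solution (B : 𝓐 →ₗ[ℝ] F →ₗ[ℝ] F) {c : ∀ n, X [⋀^Fin n]→L[ℝ] 𝓐}
    {y : ℝ → Truncated X F (Module.finrank ℝ X)} {s : Set ℝ} {t : ℝ}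
    (hy : HasDerivWithinAt y (starOp B _ c (y t)) s t) (n : ℕ) :
    HasDerivWithinAt (fun t => (y t).extend n) (star B c (y t).extend n) s t := by
  by_cases hn : n < Module.finrank ℝ X + 1
  · have h1 := (hasDerivWithinAt_pi.1 hy) ⟨n, hn⟩
    rw [starOp_apply] at h1
    have h2 : (fun t => (y t).extend n) = fun t => y t ⟨n, hn⟩ := by
      funext t; simp [Truncated.extend, hn]
    rw [h2]
    exact h1
  · have h1 : ∀ α : X [⋀^Fin n]→L[ℝ] F, α = 0 := form_eq_zero (by omega)
    have h2 : (fun t => (y t).extend n) = fun _ => 0 := funext fun t => h1 _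
    rw [h2, h1 (star B c (y t).extend n)]
    exact hasDerivWithinAt_const _ _ _

theorem truncated_extend_eq (Y : ∀ n, X [⋀^Fin n]→L[ℝ] F) (n : ℕ) :
    Truncated.extend (K := Module.finrank ℝ X) (fun p => Y p) n = Y n := by
  by_cases hn : n ≤ Module.finrank ℝ X
  · exact Truncated.extend_of_le Y hn
  · have h1 : ∀ α : X [⋀^Fin n]→L[ℝ] F, α = 0 := form_eq_zero (by omega)
    rw [h1 (Y n), h1 (Truncated.extend _ n)]

theorem graded_exists (B : 𝓐 →ₗ[ℝ] F →ₗ[ℝ] F) {c : ∀ n, ℝ → X [⋀^Fin n]→L[ℝ] 𝓐} {a₀ b₀ : ℝ}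
    (hc : ∀ n, ContinuousOn (c n) (Icc a₀ b₀)) :
    ∃ δ > 0, ∀ a b, a₀ ≤ a → a ≤ b → b ≤ b₀ → b ≤ a + δ → ∀ y₀ : ∀ n, X [⋀^Fin n]→L[ℝ] F,
      ∃ Y : ∀ n, ℝ → X [⋀^Fin n]→L[ℝ] F, (∀ n, Y n a = y₀ n) ∧ ∀ n, ∀ t ∈ Icc a b,
        HasDerivWithinAt (Y n) (star B (fun n => c n t) (fun n => Y n t) n) (Icc a b) t := by
  obtain ⟨δ, hδ, h⟩ := linearODE_exists (continuousOn_starOp B (Module.finrank ℝ X) hc)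
  refine ⟨δ, hδ, fun a b ha hab hb hd y₀ => ?_⟩
  obtain ⟨y, hy, hy'⟩ := h a b ha hab hb hd fun p => y₀ p
  refine ⟨fun n t => (y t).extend n, fun n => ?_, fun n t ht => extend_solution B (hy' t ht) n⟩
  simp only [hy]
  exact truncated_extend_eq y₀ n

/-- Smooth dependence for graded linear differential equations. -/
theorem graded_smooth (B : 𝓐 →ₗ[ℝ] F →ₗ[ℝ] F) {Ω : Set (Λ × ℝ)} (hΩ : IsOpen Ω)
    {c : ∀ n, Λ × ℝ → X [⋀^Fin n]→L[ℝ] 𝓐} (hc : ∀ n, ContDiffOn ℝ ∞ (c n) Ω) {l₀ : Λ} {t₀ : ℝ}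
    (h0 : (l₀, t₀) ∈ Ω) :
    ∃ W : Set Λ, IsOpen W ∧ l₀ ∈ W ∧ ∃ δ > 0, W ×ˢ Ioo (t₀ - δ) (t₀ + δ) ⊆ Ω ∧
      ∀ a ∈ Ioo (t₀ - δ) (t₀ + δ), ∀ W' ⊆ W, IsOpen W' → ∀ Y : ∀ n, Λ × ℝ → X [⋀^Fin n]→L[ℝ] F,
        (∀ n, ContDiffOn ℝ ∞ (fun l => Y n (l, a)) W') →
        (∀ n, ∀ l ∈ W', ∀ t ∈ Ioo (t₀ - δ) (t₀ + δ), HasDerivAt (fun t => Y n (l, t))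
          (star B (fun n => c n (l, t)) (fun n => Y n (l, t)) n) t) →
        ∀ n, ContDiffOn ℝ ∞ (Y n) (W' ×ˢ Ioo a (t₀ + δ)) := by
  obtain ⟨W, hW, hlW, δ, hδ, hsub, h⟩ := linearODE_smooth hΩ
    (contDiffOn_starOp B (Module.finrank ℝ X) hc) h0
  refine ⟨W, hW, hlW, δ, hδ, hsub, fun a ha W' hW' hW'o Y hYa hY n => ?_⟩
  obtain ⟨y, hy, hya, hyd⟩ := h a ha W' hW' hW'o (fun l p => Y p (l, a))
    (contDiffOn_pi.2 fun p => hYa p)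
  -- Uniqueness is used forwards from a, which is why smoothness is asserted for later times only.
  have heq : ∀ l ∈ W', ∀ t ∈ Ioo a (t₀ + δ), ∀ n, Y n (l, t) = (y (l, t)).extend n :=
    fun l hl t ht n => by
    have hIcc : Icc a t ⊆ Ioo (t₀ - δ) (t₀ + δ) := fun s hs =>
      ⟨ha.1.trans_le hs.1, hs.2.trans_lt ht.2⟩
    refine graded_unique B (c := fun n t => c n (l, t)) (K := n) (a := a) (b := t)
      (Y := fun n t => Y n (l, t)) (Z := fun n t => (y (l, t)).extend n)
      (fun n => ?_) (fun n _ s hs => (hY n l hl s (hIcc hs)).hasDerivWithinAt)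
      (fun n _ s hs => extend_solution B (hyd l hl s (hIcc hs)).hasDerivWithinAt n)
      (fun n _ => ?_) n le_rfl t (right_mem_Icc.2 ht.1.le)
    · exact (hc n).continuousOn.comp (by fun_prop) fun s hs => hsub ⟨hW' hl, hIcc hs⟩
    · simp only [hya l hl]
      exact (truncated_extend_eq (fun n => Y n (l, a)) n).symm
  have hsm : ContDiffOn ℝ ∞ (fun z => (y z).extend n) (W' ×ˢ Ioo a (t₀ + δ)) := by
    have hy' : ContDiffOn ℝ ∞ y (W' ×ˢ Ioo a (t₀ + δ)) :=
      hy.mono (prod_mono le_rfl (Ioo_subset_Ioo_left ha.1.le))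
    by_cases hn : n < Module.finrank ℝ X + 1
    · have h2 : (fun z => (y z).extend n) = fun z => y z ⟨n, hn⟩ := by
        funext t; simp [Truncated.extend, hn]
      rw [h2]
      exact contDiffOn_pi.1 hy' ⟨n, hn⟩
    · have h2 : (fun z => (y z).extend n) = fun _ => 0 := by
        funext t; simp [Truncated.extend, hn]
      rw [h2]
      exact contDiffOn_const
  exact hsm.congr fun z hz => heq z.1 hz.1 z.2 hz.2 n

end GradedODE

/-- Square matrices, as operators. -/
abbrev Mat (ι : Type) : Type := (ι → ℝ) →L[ℝ] (ι → ℝ)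

/-! ### Frames, transition matrices and the connection form -/

section Frames

variable {ι : Type} [Fintype ι] [DecidableEq ι] {m : ℕ}
  {M : Type*} [TopologicalSpace M] [ChartedSpace (EuclideanSpace ℝ (Fin m)) M]
  {V : M → Type*} [TopologicalSpace (TotalSpace (ι → ℝ) V)]
  [∀ x, AddCommGroup (V x)] [∀ x, Module ℝ (V x)] [∀ x, TopologicalSpace (V x)]
  [∀ x, IsTopologicalAddGroup (V x)] [∀ x, ContinuousSMul ℝ (V x)]
  [FiberBundle (ι → ℝ) V] [VectorBundle ℝ (ι → ℝ) V]

variable (ι V) in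
/-- The domain of the preferred trivialization at `c`. -/
abbrev base (c : M) : Set M := (trivializationAt (ι → ℝ) V c).baseSet

theorem toMat_apply (c c' x x' : M) (f : V x →ₗ[ℝ] V x') (w : ι → ℝ) :
    toMat (ι := ι) c c' x x' f w = (trivializationAt (ι → ℝ) V c').linearMapAt ℝ x'
      (f ((trivializationAt (ι → ℝ) V c).symmₗ ℝ x w)) := rfl

theorem toMat_comp {c c' c'' x x' x'' : M} (h : x' ∈ base ι V c') (f : V x' →ₗ[ℝ] V x'')
    (g : V x →ₗ[ℝ] V x') :
    toMat (ι := ι) c c'' x x'' (f ∘ₗ g) = (toMat (ι := ι) c' c'' x' x'' f) * (toMat (ι := ι) c c' x x' g) := by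
  ext1 w
  change toMat (ι := ι) c c'' x x'' (f ∘ₗ g) w = toMat (ι := ι) c' c'' x' x'' f (toMat (ι := ι) c c' x x' g w)
  simp only [toMat_apply]
  rw [Trivialization.symmₗ_linearMapAt _ h]
  rfl

theorem toMat_id {c x : M} (h : x ∈ base ι V c) : toMat (ι := ι) c c x x (LinearMap.id : V x →ₗ[ℝ] V x) = 1 := by
  ext1 w
  change toMat (ι := ι) c c x x (LinearMap.id : V x →ₗ[ℝ] V x) w = w
  rw [toMat_apply, LinearMap.id_apply, Trivialization.linearMapAt_symmₗ _ h]

/-- The linear map with a given matrix. -/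
def ofMat (c c' x x' : M) : Mat ι →ₗ[ℝ] (V x →ₗ[ℝ] V x') where
  toFun A := (trivializationAt (ι → ℝ) V c').symmₗ ℝ x' ∘ₗ A.toLinearMap ∘ₗ
    (trivializationAt (ι → ℝ) V c).linearMapAt ℝ x
  map_add' A B := by ext; simp
  map_smul' r A := by ext; simp

theorem toMat_ofMat {c c' x x' : M} (h : x ∈ base ι V c) (h' : x' ∈ base ι V c') (A : Mat ι) :
    toMat (ι := ι) (V := V) c c' x x' (ofMat c c' x x' A) = A := by
  ext1 w
  rw [toMat_apply]
  change (trivializationAt (ι → ℝ) V c').linearMapAt ℝ x'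
    ((trivializationAt (ι → ℝ) V c').symmₗ ℝ x' (A ((trivializationAt (ι → ℝ) V c).linearMapAt ℝ x
      ((trivializationAt (ι → ℝ) V c).symmₗ ℝ x w)))) = _
  rw [Trivialization.linearMapAt_symmₗ _ h', Trivialization.linearMapAt_symmₗ _ h]

theorem ofMat_toMat {c c' x x' : M} (h : x ∈ base ι V c) (h' : x' ∈ base ι V c')
    (f : V x →ₗ[ℝ] V x') : ofMat c c' x x' (toMat (ι := ι) c c' x x' f) = f := by
  ext1 v
  change (trivializationAt (ι → ℝ) V c').symmₗ ℝ x'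
    (toMat (ι := ι) c c' x x' f ((trivializationAt (ι → ℝ) V c).linearMapAt ℝ x v)) = _
  rw [toMat_apply, Trivialization.symmₗ_linearMapAt _ h', Trivialization.symmₗ_linearMapAt _ h]

theorem toMat_injective {c c' x x' : M} (h : x ∈ base ι V c) (h' : x' ∈ base ι V c') :
    Function.Injective (toMat (ι := ι) (V := V) c c' x x') := fun f g hfg => by
  rw [← ofMat_toMat h h' f, hfg, ofMat_toMat h h']

variable (ι V) in
/-- The transition matrix from the frame at `c` to the frame at `c'`. -/
def transition (c c' x : M) : Mat ι := toMat (ι := ι) (V := V) c c' x x (LinearMap.id : V x →ₗ[ℝ] V x)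

theorem transition_mul_toMat {c c' c₀ x x₀ : M} (h : x ∈ base ι V c) (f : V x₀ →ₗ[ℝ] V x) :
    transition ι V c c' x * toMat (ι := ι) c₀ c x₀ x f = toMat (ι := ι) c₀ c' x₀ x f := by
  rw [transition, ← toMat_comp h, LinearMap.id_comp]

theorem toMat_mul_transition {c c' c₀ x x₀ : M} (h : x ∈ base ι V c') (f : V x →ₗ[ℝ] V x₀) :
    toMat (ι := ι) c' c₀ x x₀ f * transition ι V c c' x = toMat (ι := ι) c c₀ x x₀ f := by
  rw [transition, ← toMat_comp h, LinearMap.comp_id]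

theorem transition_mul_transition {c c' x : M} (h : x ∈ base ι V c) (h' : x ∈ base ι V c') :
    transition ι V c' c x * transition ι V c c' x = 1 := by
  rw [transition, transition, ← toMat_comp h', LinearMap.comp_id, toMat_id h]

theorem transition_apply_eq_sum {c c' x : M} (h : x ∈ base ι V c) (h' : x ∈ base ι V c') (a : ι) :
    frame (V := V) c a x = ∑ b, transition ι V c c' x (Pi.single a 1) b • frame c' b x := by
  have h1 : frame (V := V) c a x = (trivializationAt (ι → ℝ) V c').symmₗ ℝ x
      (transition ι V c c' x (Pi.single a 1)) := by
    rw [transition, toMat_apply, Trivialization.symmₗ_linearMapAt _ h', LinearMap.id_apply,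
      Trivialization.symmₗ_apply _ h]
    rfl
  have h2 : ∀ b, frame (V := V) c' b x =
      (trivializationAt (ι → ℝ) V c').symmₗ ℝ x (Pi.single b 1) := fun b => by
    rw [Trivialization.symmₗ_apply _ h']
    rfl
  rw [h1]
  simp only [h2, ← map_smul, ← map_sum]
  congr 1
  funext b
  simp [Finset.sum_apply, Pi.single_apply]

variable [IsManifold (𝓡 m) ∞ M] [ContMDiffVectorBundle ∞ (ι → ℝ) V (𝓡 m)]

theorem contMDiffAt_transition {c c' x : M} (h : x ∈ base ι V c) (h' : x ∈ base ι V c') :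
    ContMDiffAt (𝓡 m) 𝓘(ℝ, Mat ι) ∞ (transition ι V c c') x := by
  have h1 := contMDiffAt_coordChangeL (n := ∞) (IB := 𝓡 m) h h'
  refine h1.congr_of_eventuallyEq ?_
  filter_upwards [((trivializationAt (ι → ℝ) V c).open_baseSet.inter
    (trivializationAt (ι → ℝ) V c').open_baseSet).mem_nhds ⟨h, h'⟩] with y hy
  ext1 w
  rw [transition, toMat_apply, LinearMap.id_apply, Trivialization.symmₗ_apply _ hy.1,
    ContinuousLinearEquiv.coe_coe, Trivialization.coordChangeL_apply _ _ hy,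
    Trivialization.coe_linearMapAt_of_mem _ hy.2]

theorem mdifferentiableAt_frame {c x : M} (h : x ∈ base ι V c) (a : ι) :
    MDifferentiableAt (𝓡 m) ((𝓡 m).prod 𝓘(ℝ, ι → ℝ))
      (fun y => (⟨y, frame c a y⟩ : TotalSpace (ι → ℝ) V)) x := by
  rw [(trivializationAt (ι → ℝ) V c).mdifferentiableAt_section_iff (𝓡 m) (frame c a) h]
  refine MDifferentiableAt.congr_of_eventuallyEq
    (mdifferentiableAt_const (c := (Pi.single a 1 : ι → ℝ))) ?_
  filter_upwards [(trivializationAt (ι → ℝ) V c).open_baseSet.mem_nhds h] with y hy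
  have := (trivializationAt (ι → ℝ) V c).linearMapAt_symm (R := ℝ) hy (Pi.single a 1 : ι → ℝ)
  rw [Trivialization.coe_linearMapAt_of_mem _ hy] at this
  exact this


/-- Differentiability of the partial sums is carried through the induction because additivity of the
connection requires it. -/
theorem conn_sum {κ : Type*} (cov : CovariantDerivative (𝓡 m) (ι → ℝ) V) (s : Finset κ)
    (g : κ → M → ℝ) (σ : κ → ∀ x : M, V x) {x : M}
    (hg : ∀ k, MDifferentiableAt (𝓡 m) 𝓘(ℝ, ℝ) (g k) x)
    (hσ : ∀ k, MDifferentiableAt (𝓡 m) ((𝓡 m).prod 𝓘(ℝ, ι → ℝ))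
      (fun y => (⟨y, σ k y⟩ : TotalSpace (ι → ℝ) V)) x) :
    MDifferentiableAt (𝓡 m) ((𝓡 m).prod 𝓘(ℝ, ι → ℝ))
      (fun y => (⟨y, (∑ k ∈ s, g k • σ k) y⟩ : TotalSpace (ι → ℝ) V)) x ∧
    cov (∑ k ∈ s, g k • σ k) x =
      ∑ k ∈ s, (g k x • cov (σ k) x + (mvfderiv (𝓡 m) (g k) x).smulRight (σ k x)) := by
  classical
  induction s using Finset.induction_on with
  | empty =>
    simp only [Finset.sum_empty]
    exact ⟨mdifferentiableAt_zeroSection .., by rw [cov.zero]; rfl⟩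
  | insert a s ha ih =>
    have h1 : MDifferentiableAt (𝓡 m) ((𝓡 m).prod 𝓘(ℝ, ι → ℝ))
      (fun y => (⟨y, (g a • σ a) y⟩ : TotalSpace (ι → ℝ) V)) x := (hg a).smul_section (hσ a)
    simp only [Finset.sum_insert ha]
    refine ⟨mdifferentiableAt_add_section h1 ih.1, ?_⟩
    rw [cov.isCovariantDerivativeOnUniv.add h1 ih.1, ih.2,
      cov.isCovariantDerivativeOnUniv.leibniz (hσ a) (hg a)]

theorem toMat_connForm_apply (D : SuperconnectionData (ι := ι) (m := m) V) {c x : M} (c' : M)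
    (h : x ∈ base ι V c) (X : TangentSpace (𝓡 m) x) (a : ι) :
    toMat (ι := ι) c c' x x (D.connForm c x X) (Pi.single a 1) =
      -(trivializationAt (ι → ℝ) V c').linearMapAt ℝ x (D.conn (frame c a) x X) := by
  rw [toMat_apply, ← map_neg]
  congr 1
  change (-∑ b, (LinearMap.proj b ∘ₗ (trivializationAt (ι → ℝ) V c).linearMapAt ℝ x).smulRight
    (D.conn (frame c b) x X)) _ = _
  simp only [LinearMap.neg_apply, LinearMap.sum_apply, LinearMap.smulRight_apply,
    LinearMap.comp_apply, LinearMap.proj_apply]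
  rw [Trivialization.linearMapAt_symmₗ _ h]
  simp [Pi.single_apply]

/-- The classical law A' g = g A + dg for ∇ = d - A: the frame at `c` is expanded in the frame at
`c'`, with the columns of the transition matrix as coefficients, and the Leibniz rule is applied. -/
theorem connForm_gauge (D : SuperconnectionData (ι := ι) (m := m) V) {c c' x : M}
    (h : x ∈ base ι V c) (h' : x ∈ base ι V c') (X : TangentSpace (𝓡 m) x) :
    toMat (ι := ι) c' c' x x (D.connForm c' x X) * transition ι V c c' x =
      transition ι V c c' x * toMat (ι := ι) c c x x (D.connForm c x X) +
        mvfderiv (𝓡 m) (transition ι V c c') x X := by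
  have hG := (contMDiffAt_transition (m := m) h h').mdifferentiableAt (by simp)
  rw [transition_mul_toMat h]
  apply ContinuousLinearMap.coe_injective
  refine LinearMap.pi_ext' fun a => LinearMap.ext_ring ?_
  change toMat (ι := ι) c' c' x x (D.connForm c' x X) (transition ι V c c' x (Pi.single a 1)) =
    toMat (ι := ι) c c' x x (D.connForm c x X) (Pi.single a 1) +
    mvfderiv (𝓡 m) (transition ι V c c') x X (Pi.single a 1)
  let g : ι → M → ℝ := fun b y => transition ι V c c' y (Pi.single a 1) b
  let L : ι → Mat ι →L[ℝ] ℝ := fun b => (ContinuousLinearMap.proj b).comp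
    (ContinuousLinearMap.apply ℝ (ι → ℝ) (Pi.single a 1 : ι → ℝ))
  have hL : ∀ b, HasMFDerivAt (𝓡 m) 𝓘(ℝ, ℝ) (g b) x
      ((L b).comp (mfderiv (𝓡 m) 𝓘(ℝ, Mat ι) (transition ι V c c') x)) := fun b =>
    HasMFDerivAt.comp x (L b).hasMFDerivAt hG.hasMFDerivAt
  have hg : ∀ b, MDifferentiableAt (𝓡 m) 𝓘(ℝ, ℝ) (g b) x := fun b => (hL b).mdifferentiableAt
  obtain ⟨h1, h2⟩ := conn_sum D.conn Finset.univ g (frame c') hg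
    (fun b => mdifferentiableAt_frame h' b)
  have h3 : D.conn (frame c a) x = D.conn (∑ b, g b • frame c' b) x := by
    refine D.conn.isCovariantDerivativeOnUniv.congr_of_eventuallyEq
      (mdifferentiableAt_frame h a) h1 Filter.univ_mem ?_
    filter_upwards [((trivializationAt (ι → ℝ) V c).open_baseSet.inter
      (trivializationAt (ι → ℝ) V c').open_baseSet).mem_nhds ⟨h, h'⟩] with y hy
    rw [transition_apply_eq_sum hy.1 hy.2]
    simp [g, Finset.sum_apply]
  have h4 : ∀ b, mvfderiv (𝓡 m) (g b) x X =
      mvfderiv (𝓡 m) (transition ι V c c') x X (Pi.single a 1) b := fun b => by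
    change (mfderiv (𝓡 m) 𝓘(ℝ, ℝ) (g b) x X : ℝ) = _
    rw [(hL b).mfderiv]
    rfl
  have h5 : ∀ b, (trivializationAt (ι → ℝ) V c').linearMapAt ℝ x (frame c' b x) =
      Pi.single b 1 := fun b => (trivializationAt (ι → ℝ) V c').linearMapAt_symm h' _
  rw [toMat_connForm_apply D c' h, h3, h2]
  have h6 : (∑ b, (g b x • D.conn (frame c' b) x +
      (mvfderiv (𝓡 m) (g b) x).smulRight (frame c' b x)) : TangentSpace (𝓡 m) x →L[ℝ] V x) X =
      ∑ b, (g b x • D.conn (frame c' b) x X + mvfderiv (𝓡 m) (g b) x X • frame c' b x) := by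
    rw [sum_apply]
    rfl
  rw [h6, map_sum]
  simp only [map_add, map_smul, h5, h4]
  rw [Finset.sum_add_distrib, neg_add, add_assoc]
  have h7 : ∀ w : ι → ℝ, ∑ b, w b • (Pi.single b 1 : ι → ℝ) = w := fun w => by
    funext b; simp [Finset.sum_apply, Pi.single_apply]
  rw [h7, neg_add_cancel, add_zero]
  conv_lhs => rw [← h7 (transition ι V c c' x (Pi.single a 1))]
  simp only [map_sum, map_smul, toMat_connForm_apply D c' h', smul_neg, Finset.sum_neg_distrib]
  rfl

end Frames

/-- The sign `(-1)^(n (n - 1) / 2)`. -/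
def tw (n : ℕ) : ℝ := (-1) ^ n.choose 2

theorem tw_zero : tw 0 = 1 := by simp [tw]

theorem tw_one : tw 1 = 1 := by simp [tw]

theorem tw_succ (n : ℕ) : tw (n + 1) = (-1) ^ n * tw n := by
  rw [tw, tw, ← pow_add, Nat.choose_succ_succ' n 1, Nat.choose_one_right]

theorem tw_mul_self (n : ℕ) : tw n * tw n = 1 := by
  rw [tw, ← mul_pow]; norm_num

theorem tw_ne_zero (n : ℕ) : tw n ≠ 0 := left_ne_zero_of_mul_eq_one (tw_mul_self n)

/-- This is what `tw` is made for: scaling forms of degree n by `tw n` absorbs the sign (-1)^(ij) in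
the product of forms of degrees i and j. -/
theorem tw_add (i j : ℕ) : tw (i + j) = (-1) ^ (i * j) * (tw i * tw j) := by
  induction j with
  | zero => simp [tw_zero]
  | succ j ih => rw [← add_assoc, tw_succ, ih, tw_succ]; ring

theorem alternatingMap_sum_apply {X N κ : Type*} [AddCommGroup X] [Module ℝ X] [AddCommGroup N]
    [Module ℝ N] {n : ℕ} (s : Finset κ) (f : κ → X [⋀^Fin n]→ₗ[ℝ] N) (w : Fin n → X) :
    (∑ k ∈ s, f k) w = ∑ k ∈ s, f k w :=
  map_sum ({ toFun := fun g => g w, map_zero' := rfl, map_add' := fun _ _ => rfl } :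
    (X [⋀^Fin n]→ₗ[ℝ] N) →+ N) f s

section Matrices

variable {ι : Type} [Fintype ι] [DecidableEq ι]

variable (ι) in
/-- The product of matrices as a bilinear map. -/
abbrev mulB : Mat ι →ₗ[ℝ] Mat ι →ₗ[ℝ] Mat ι := LinearMap.mul ℝ (Mat ι)

theorem mulB_assoc (x y f : Mat ι) : mulB ι (mulB ι x y) f = mulB ι x (mulB ι y f) := mul_assoc x y f

theorem mat_eq_sum (A : Mat ι) :
    A = ∑ a, (ContinuousLinearMap.proj (R := ℝ) (φ := fun _ : ι => ℝ) a).smulRight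
      (A (Pi.single a 1)) := by
  apply ContinuousLinearMap.coe_injective
  refine LinearMap.pi_ext' fun a => LinearMap.ext_ring ?_
  change A (Pi.single a 1) = (∑ b, (ContinuousLinearMap.proj (R := ℝ) (φ := fun _ : ι => ℝ) b).smulRight
      (A (Pi.single b 1))) (Pi.single a 1)
  rw [sum_apply]
  simp [Pi.single_apply]

theorem hasDerivWithinAt_mat {A : ℝ → Mat ι} {A' : Mat ι} {s : Set ℝ} {t : ℝ}
    (h : ∀ w, HasDerivWithinAt (fun τ => A τ w) (A' w) s t) : HasDerivWithinAt A A' s t := by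
  rw [show A = _ from funext fun τ => mat_eq_sum (A τ), mat_eq_sum A']
  refine HasDerivWithinAt.fun_sum fun a _ => ?_
  exact (ContinuousLinearMap.smulRightL ℝ (ι → ℝ) (ι → ℝ)
    (ContinuousLinearMap.proj (R := ℝ) (φ := fun _ : ι => ℝ) a)).hasFDerivAt.comp_hasDerivWithinAt t
      (h _)

section

variable {X : Type*} [NormedAddCommGroup X] [NormedSpace ℝ X]

instance normedAddCommGroupMat : NormedAddCommGroup (Mat ι) := normedAddCommGroupCLM

instance normedSpaceMat : NormedSpace ℝ (Mat ι) := normedSpaceCLM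

instance normedAddCommGroupMatForm (n : ℕ) : NormedAddCommGroup (X [⋀^Fin n]→L[ℝ] Mat ι) :=
  normedAddCommGroupForm n

instance addCommGroupMatForm (n : ℕ) : AddCommGroup (X [⋀^Fin n]→L[ℝ] Mat ι) :=
  (normedAddCommGroupForm n).toAddCommGroup

instance addCommMonoidMatForm (n : ℕ) : AddCommMonoid (X [⋀^Fin n]→L[ℝ] Mat ι) :=
  (normedAddCommGroupForm n).toAddCommGroup.toAddCommMonoid

instance normedSpaceMatForm (n : ℕ) : NormedSpace ℝ (X [⋀^Fin n]→L[ℝ] Mat ι) :=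
  normedSpaceForm n

end

end Matrices

/-! ### The transport equation in matrix form -/

section Frames

variable {ι : Type} [Fintype ι] [DecidableEq ι] {m : ℕ}
  {M : Type*} [TopologicalSpace M] [ChartedSpace (EuclideanSpace ℝ (Fin m)) M]
  {V : M → Type*} [TopologicalSpace (TotalSpace (ι → ℝ) V)]
  [∀ x, AddCommGroup (V x)] [∀ x, Module ℝ (V x)] [∀ x, TopologicalSpace (V x)]
  [∀ x, IsTopologicalAddGroup (V x)] [∀ x, ContinuousSMul ℝ (V x)]
  [FiberBundle (ι → ℝ) V] [VectorBundle ℝ (ι → ℝ) V]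
  {X : Type*} [NormedAddCommGroup X] [NormedSpace ℝ X] [FiniteDimensional ℝ X]

namespace SuperconnectionData

variable (D : SuperconnectionData (ι := ι) (m := m) V)

/-- The matrix of the form `A_n` in the frame at `c`, with the sign `(-1)^(n (n - 1) / 2)`. -/
def formMat (c : M) (n : ℕ) (x : M) : TangentSpace (𝓡 m) x [⋀^Fin n]→ₗ[ℝ] Mat ι :=
  tw n • (toMat (ι := ι) c c x x).compAlternatingMap (D.frameForm c n x)

/-- The pull-back of the matrices of the forms `A_n` along a linear map to the tangent space. -/
def connMat (c x : M) (L : X →ₗ[ℝ] TangentSpace (𝓡 m) x) (n : ℕ) : X [⋀^Fin n]→L[ℝ] Mat ι :=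
  toCont ((D.formMat c n x).compLinearMap L)

/-- The coefficients of the equation for the parallel transport. -/
def coef (c x : M) (v : TangentSpace (𝓡 m) x) (η : X →ₗ[ℝ] TangentSpace (𝓡 m) x) (n : ℕ) :
    X [⋀^Fin n]→L[ℝ] Mat ι :=
  toCont (((D.formMat c (n + 1) x).curryLeft v).compLinearMap η)

end SuperconnectionData

variable [IsManifold (𝓡 m) ∞ M] [ContMDiffVectorBundle ∞ (ι → ℝ) V (𝓡 m)]

namespace SuperconnectionData

variable (D : SuperconnectionData (ι := ι) (m := m) V)

theorem formMat_gauge_one {c c' x : M} (h : x ∈ base ι V c) (h' : x ∈ base ι V c')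
    (w : Fin 1 → TangentSpace (𝓡 m) x) :
    D.formMat c' 1 x w * transition ι V c c' x = transition ι V c c' x * D.formMat c 1 x w +
      mvfderiv (𝓡 m) (transition ι V c c') x (w 0) := by
  have key : ∀ c'', D.formMat c'' 1 x w = toMat (ι := ι) c'' c'' x x (D.connForm c'' x (w 0)) :=
    fun c'' => by
      change tw 1 • toMat (ι := ι) c'' c'' x x (D.connForm c'' x (w 0)) = _
      rw [tw_one, one_smul]
  rw [key, key, connForm_gauge D h h']

theorem formMat_gauge_of_ne {c c' x : M} (h : x ∈ base ι V c) (h' : x ∈ base ι V c') {n : ℕ}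
    (hn : n ≠ 1) (w : Fin n → TangentSpace (𝓡 m) x) :
    D.formMat c' n x w * transition ι V c c' x = transition ι V c c' x * D.formMat c n x w := by
  have h1 : D.frameForm c' n x = D.frameForm c n x := by
    rcases n with _ | _ | n
    · rfl
    · exact absurd rfl hn
    · rfl
  change tw n • toMat (ι := ι) c' c' x x (D.frameForm c' n x w) * _ =
    _ * (tw n • toMat (ι := ι) c c x x (D.frameForm c n x w))
  rw [smul_mul_assoc, toMat_mul_transition h', mul_smul_comm, transition_mul_toMat h, h1]

theorem connMat_gauge {c c' x : M} (h : x ∈ base ι V c) (h' : x ∈ base ι V c')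
    (L : X →ₗ[ℝ] TangentSpace (𝓡 m) x) {g : X → Mat ι} {z : X} (hg : g z = transition ι V c c' x)
    (hg' : ∀ w, fderiv ℝ g z w = mvfderiv (𝓡 m) (transition ι V c c') x (L w)) (n : ℕ) :
    star (mulB ι) (D.connMat c' x L) (zform (g z)) n =
      star (mulB ι) (zform (g z)) (D.connMat c x L) n + dext (fun n z => zform (g z) n) n z := by
  rw [star_zform_left, star_zform_right, hg]
  ext1 w
  by_cases hn : n = 1
  · subst hn
    rw [dext_zform_one]
    refine (D.formMat_gauge_one h h' fun i => L (w i)).trans ?_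
    rw [← hg']
    rfl
  · rw [dext_zform_of_ne g z hn, add_zero]
    exact D.formMat_gauge_of_ne h h' hn fun i => L (w i)

/-- Contraction with the velocity lowers the degree by one. The inhomogeneous term of A₁ therefore
lands in degree 0, and the contractions of all other forms transform tensorially. -/
theorem coef_gauge {c c' x : M} (h : x ∈ base ι V c) (h' : x ∈ base ι V c')
    (v : TangentSpace (𝓡 m) x) (η : X →ₗ[ℝ] TangentSpace (𝓡 m) x) (n : ℕ) :
    star (mulB ι) (D.coef c' x v η) (zform (transition ι V c c' x)) n =
      star (mulB ι) (zform (transition ι V c c' x)) (D.coef c x v η) n +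
        zform (mvfderiv (𝓡 m) (transition ι V c c') x v) n := by
  rw [star_zform_left, star_zform_right]
  ext1 w
  rcases n with _ | n
  · exact D.formMat_gauge_one h h' _
  · refine (D.formMat_gauge_of_ne (n := n + 2) h h' (by simp) _).trans ?_
    exact (add_zero _).symm

end SuperconnectionData

/-- The matrices of homomorphism-valued forms, with the sign `(-1)^(n (n - 1) / 2)`. -/
def transportMat (c₀ c x₀ x : M) (Ψ : ∀ n, X [⋀^Fin n]→ₗ[ℝ] (V x₀ →ₗ[ℝ] V x)) (n : ℕ) :
    X [⋀^Fin n]→L[ℝ] Mat ι :=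
  tw n • toCont ((toMat (ι := ι) c₀ c x₀ x).compAlternatingMap (Ψ n))

theorem transportMat_gauge {c₀ c c' x₀ x : M} (h : x ∈ base ι V c)
    (Ψ : ∀ n, X [⋀^Fin n]→ₗ[ℝ] (V x₀ →ₗ[ℝ] V x)) (n : ℕ) :
    transportMat (ι := ι) c₀ c' x₀ x Ψ n =
      star (mulB ι) (zform (transition ι V c c' x)) (transportMat c₀ c x₀ x Ψ) n := by
  rw [star_zform_left]
  ext1 w
  change tw n • toMat (ι := ι) c₀ c' x₀ x (Ψ n w) =
    transition ι V c c' x * (tw n • toMat (ι := ι) c₀ c x₀ x (Ψ n w))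
  rw [mul_smul_comm, transition_mul_toMat h]

/-- Covariance of the differential equation under changes of frames. -/
theorem ode_gauge {G : ℝ → Mat ι} {G' : Mat ι} {c c' Y : ∀ n, ℝ → X [⋀^Fin n]→L[ℝ] Mat ι}
    {s : Set ℝ} {t : ℝ} (hG : HasDerivWithinAt G G' s t)
    (hY : ∀ n, HasDerivWithinAt (Y n) (star (mulB ι) (fun n => c n t) (fun n => Y n t) n) s t)
    (hc : ∀ n, star (mulB ι) (fun n => c' n t) (zform (G t)) n =
      star (mulB ι) (zform (G t)) (fun n => c n t) n + zform G' n) (n : ℕ) :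
    HasDerivWithinAt (fun τ => star (mulB ι) (zform (G τ)) (fun n => Y n τ) n)
      (star (mulB ι) (fun n => c' n t)
        (fun n => star (mulB ι) (zform (G t)) (fun n => Y n t) n) n) s t := by
  have h1 : star (mulB ι) (fun n => c' n t)
        (fun n => star (mulB ι) (zform (G t)) (fun n => Y n t) n) n =
      star (mulB ι) (zform G') (fun n => Y n t) n + star (mulB ι) (zform (G t))
        (star (mulB ι) (fun n => c n t) fun n => Y n t) n := by
    rw [← star_assoc (mulB ι) (mulB ι) (mulB ι) (mulB ι) mulB_assoc, 
      ← star_assoc (mulB ι) (mulB ι) (mulB ι) (mulB ι) mulB_assoc,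
      star_congr _ (fun i _ => hc i) fun _ _ => rfl, star_add_left, add_comm]
  rw [h1]
  refine hasDerivWithinAt_form fun w => ?_
  simp only [star_zform_left]
  have h2 : HasDerivWithinAt (fun τ => Y n τ w)
      (star (mulB ι) (fun n => c n t) (fun n => Y n t) n w) s t :=
    (ContinuousAlternatingMap.apply ℝ X (Mat ι) w).hasFDerivAt.comp_hasDerivWithinAt t (hY n)
  exact hG.mul h2

/-- All the signs of the transport equation cancel: moving the velocity from the last place to the
first costs (-1)^i, which turns `tw i` into `tw (i + 1)`, and `tw_add` takes care of the product. -/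
theorem transportMat_rhs {G : Grading (ι := ι) V} (D : Superconnection (ι := ι) (m := m) G)
    {c₀ c x₀ x : M} (h : x ∈ base ι V c) (v : TangentSpace (𝓡 m) x)
    (η : X →ₗ[ℝ] TangentSpace (𝓡 m) x) (Ψ : ∀ n, X [⋀^Fin n]→ₗ[ℝ] (V x₀ →ₗ[ℝ] V x)) (n : ℕ) :
    tw n • toCont ((toMat (ι := ι) c₀ c x₀ x).compAlternatingMap
      (∑ i : Fin (n + 1), (-1 : ℝ) ^ ((i : ℕ) * (n - i)) •
        wedge (LinearMap.llcomp ℝ (V x₀) (V x) (V x)) (Nat.add_sub_of_le i.is_le)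
          (D.contraction c i v η) (Ψ (n - i)))) =
    star (mulB ι) (D.coef c x v η) (transportMat c₀ c x₀ x Ψ) n := by
  rw [star_eq_sum_fin]
  have key : ∀ i : Fin (n + 1), wedge (mulB ι) (Nat.add_sub_of_le i.is_le)
      (D.coef c x v η i).toAlternatingMap (transportMat (ι := ι) c₀ c x₀ x Ψ (n - i)).toAlternatingMap =
      tw n • (-1 : ℝ) ^ ((i : ℕ) * (n - i)) • (toMat (ι := ι) c₀ c x₀ x).compAlternatingMap
        (wedge (LinearMap.llcomp ℝ (V x₀) (V x) (V x)) (Nat.add_sub_of_le i.is_le)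
          (D.contraction c i v η) (Ψ (n - i))) := fun i => by
    have h1 : (D.coef c x v η i).toAlternatingMap =
        tw i • (toMat (ι := ι) c c x x).compAlternatingMap (D.contraction c i v η) := by
      ext1 w
      change tw (i + 1) • toMat (ι := ι) c c x x (D.frameForm c (i + 1) x _) =
        tw i • toMat (ι := ι) c c x x ((-1 : ℝ) ^ (i : ℕ) • D.frameForm c (i + 1) x _)
      rw [map_smul, smul_smul, tw_succ, mul_comm]
    have h2 : (transportMat (ι := ι) c₀ c x₀ x Ψ (n - i)).toAlternatingMap =
        tw (n - i) • (toMat (ι := ι) c₀ c x₀ x).compAlternatingMap (Ψ (n - i)) := rfl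
    rw [wedge_comp_values (LinearMap.llcomp ℝ (V x₀) (V x) (V x)) (mulB ι)
      (toMat (ι := ι) c₀ c x₀ x) (toMat (ι := ι) c c x x) (toMat (ι := ι) c₀ c x₀ x)
      (fun f g => toMat_comp h f g), h1, h2]
    have h3 : ∀ (α : X [⋀^Fin i]→ₗ[ℝ] Mat ι) (β : X [⋀^Fin (n - i)]→ₗ[ℝ] Mat ι) (r r' : ℝ),
        wedgeₗ (mulB ι) (Nat.add_sub_of_le i.is_le) (r • α) (r' • β) =
          r' • r • wedgeₗ (mulB ι) (Nat.add_sub_of_le i.is_le) α β := fun α β r r' => by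
      rw [map_smul, LinearMap.map_smul₂]
    have h3 := h3 ((toMat (ι := ι) c c x x).compAlternatingMap (D.contraction c i v η))
      ((toMat (ι := ι) c₀ c x₀ x).compAlternatingMap (Ψ (n - i))) (tw i) (tw (n - i))
    refine h3.trans ?_
    rw [smul_smul, smul_smul]
    have h4 := tw_add i (n - i)
    rw [Nat.add_sub_of_le i.is_le] at h4
    have h5 : tw n * (-1 : ℝ) ^ ((i : ℕ) * (n - i)) = tw i * tw (n - i) := by
      rw [h4, mul_comm, ← mul_assoc, ← mul_pow]; norm_num
    rw [h5, mul_comm]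
    rfl
  simp only [key]
  ext1 w
  rw [ContinuousAlternatingMap.sum_apply]
  change tw n • toMat (ι := ι) c₀ c x₀ x ((∑ i : Fin (n + 1), (-1 : ℝ) ^ ((i : ℕ) * (n - i)) •
        wedge (LinearMap.llcomp ℝ (V x₀) (V x) (V x)) (Nat.add_sub_of_le i.is_le)
          (D.contraction c i v η) (Ψ (n - i))) w) = _
  rw [alternatingMap_sum_apply, map_sum, Finset.smul_sum]
  refine Finset.sum_congr rfl fun i _ => ?_
  rw [AlternatingMap.smul_apply, map_smul]
  rfl


theorem trivialization_snd {c x : M} (h : x ∈ base ι V c) (v : V x) :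
    (trivializationAt (ι → ℝ) V c ⟨x, v⟩).2 = (trivializationAt (ι → ℝ) V c).linearMapAt ℝ x v := by
  rw [Trivialization.coe_linearMapAt_of_mem _ h]

theorem hasDerivWithinAt_transportMat_iff {γ : ℝ → M} {s : Set ℝ} {t : ℝ} {c₀ c : M}
    (hγ : ContinuousWithinAt γ s t) (h0 : γ 0 ∈ base ι V c₀) (ht : γ t ∈ base ι V c)
    (Ψ : ∀ (n : ℕ) (t : ℝ), X [⋀^Fin n]→ₗ[ℝ] (V (γ 0) →ₗ[ℝ] V (γ t))) {n : ℕ}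
    (R : X [⋀^Fin n]→ₗ[ℝ] (V (γ 0) →ₗ[ℝ] V (γ t))) :
    (∀ (w : Fin n → X) (v : V (γ 0)), HasDerivWithinAt
      (fun τ => (trivializationAt (ι → ℝ) V c ⟨γ τ, Ψ n τ w v⟩).2)
      (trivializationAt (ι → ℝ) V c ⟨γ t, R w v⟩).2 s t) ↔
    HasDerivWithinAt (fun τ => transportMat (ι := ι) c₀ c (γ 0) (γ τ) (fun n => Ψ n τ) n)
      (tw n • toCont ((toMat (ι := ι) c₀ c (γ 0) (γ t)).compAlternatingMap R)) s t := by
  have hev : ∀ᶠ τ in nhdsWithin t s, γ τ ∈ base ι V c :=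
    hγ ((trivializationAt (ι → ℝ) V c).open_baseSet.mem_nhds ht)
  constructor
  · intro h
    refine hasDerivWithinAt_form fun w => hasDerivWithinAt_mat fun e => ?_
    have h1 := (h w ((trivializationAt (ι → ℝ) V c₀).symmₗ ℝ (γ 0) e)).const_smul (tw n)
    rw [trivialization_snd ht] at h1
    refine h1.congr_of_eventuallyEq ?_ ?_
    · filter_upwards [hev] with τ hτ
      rw [Pi.smul_apply, trivialization_snd hτ]
      rfl
    · rw [Pi.smul_apply, trivialization_snd ht]
      rfl
  · intro h w v
    let e : ι → ℝ := (trivializationAt (ι → ℝ) V c₀).linearMapAt ℝ (γ 0) v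
    have he : (trivializationAt (ι → ℝ) V c₀).symmₗ ℝ (γ 0) e = v :=
      Trivialization.symmₗ_linearMapAt _ h0 v
    have key : ∀ (τ : ℝ) (f : V (γ 0) →ₗ[ℝ] V (γ τ)), γ τ ∈ base ι V c →
        (trivializationAt (ι → ℝ) V c ⟨γ τ, f v⟩).2 =
        tw n • ((tw n • toMat (ι := ι) c₀ c (γ 0) (γ τ) f) e) := fun τ f hτ => by
      rw [smul_apply, smul_smul, tw_mul_self, one_smul, toMat_apply, he, trivialization_snd hτ]
    have h1 : HasDerivWithinAt (fun τ => tw n • transportMat (ι := ι) c₀ c (γ 0) (γ τ)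
        (fun n => Ψ n τ) n w e) (tw n • ((tw n • toMat (ι := ι) c₀ c (γ 0) (γ t) (R w)) e)) s t :=
      (((ContinuousLinearMap.apply ℝ (ι → ℝ) e).comp
        (ContinuousAlternatingMap.apply ℝ X (Mat ι) w)).hasFDerivAt.comp_hasDerivWithinAt t
          h).const_smul (tw n)
    rw [← key t (R w) ht] at h1
    refine h1.congr_of_eventuallyEq ?_ (key t _ ht)
    filter_upwards [hev] with τ hτ
    exact key τ _ hτ

/-- The velocity of a path defined on the unit interval. -/
def velocity (m : ℕ) {M : Type*} [TopologicalSpace M] [ChartedSpace (EuclideanSpace ℝ (Fin m)) M]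
    (γ : ℝ → M) (t : ℝ) : TangentSpace (𝓡 m) (γ t) :=
  mfderivWithin 𝓘(ℝ, ℝ) (𝓡 m) γ (Icc 0 1) t (1 : ℝ)

/-- From here on the transport is handled as the solution Y of Y' = `coef` * Y with initial value 1,
in every frame along the path and with the frame at the source fixed. -/
theorem isTransport_iff {G : Grading (ι := ι) V} (D : Superconnection (ι := ι) (m := m) G)
    {γ : ℝ → M} (hγ : ContinuousOn γ (Icc 0 1)) {c₀ : M} (h0 : γ 0 ∈ base ι V c₀)
    (η : ∀ t, X →ₗ[ℝ] TangentSpace (𝓡 m) (γ t))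
    (Ψ : ∀ (n : ℕ) (t : ℝ), X [⋀^Fin n]→ₗ[ℝ] (V (γ 0) →ₗ[ℝ] V (γ t))) :
    D.IsTransport γ η 0 Ψ ↔
      (∀ n, transportMat (ι := ι) c₀ c₀ (γ 0) (γ 0) (fun n => Ψ n 0) n = zform 1 n) ∧
      ∀ n, ∀ t ∈ Icc (0 : ℝ) 1, ∀ c, γ t ∈ base ι V c → HasDerivWithinAt
        (fun τ => transportMat (ι := ι) c₀ c (γ 0) (γ τ) (fun n => Ψ n τ) n)
        (star (mulB ι) (D.coef c (γ t) (velocity m γ t) (η t))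
          (transportMat c₀ c (γ 0) (γ t) fun n => Ψ n t) n) (Icc 0 1) t := by
  have hode : (∀ n, ∀ t ∈ Icc (0 : ℝ) 1, ∀ c, γ t ∈ base ι V c → HasDerivWithinAt
        (fun τ => transportMat (ι := ι) c₀ c (γ 0) (γ τ) (fun n => Ψ n τ) n)
        (star (mulB ι) (D.coef c (γ t) (velocity m γ t) (η t))
          (transportMat c₀ c (γ 0) (γ t) fun n => Ψ n t) n) (Icc 0 1) t) ↔ 
      (∀ (p : ℕ), ∀ t ∈ Icc (0 : ℝ) 1, ∀ c : M, γ t ∈ (trivializationAt (ι → ℝ) V c).baseSet →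
        ∀ (w : Fin p → X) (v : V (γ 0)),
        HasDerivWithinAt
          (fun τ => (trivializationAt (ι → ℝ) V c ⟨γ τ, Ψ p τ w v⟩).2)
          (trivializationAt (ι → ℝ) V c ⟨γ t, (∑ i : Fin (p + 1), (-1 : ℝ) ^ ((i : ℕ) * (p - i)) •
            wedge (LinearMap.llcomp ℝ (V (γ 0)) (V (γ t)) (V (γ t))) (Nat.add_sub_of_le i.is_le)
              (D.contraction c i (mfderivWithin 𝓘(ℝ, ℝ) (𝓡 m) γ (Icc 0 1) t (1 : ℝ)) (η t))
              (Ψ (p - i) t)) w v⟩).2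
          (Icc 0 1) t) := by
    refine forall_congr' fun n => forall_congr' fun t => forall_congr' fun ht =>
      forall_congr' fun c => forall_congr' fun hc => ?_
    rw [← transportMat_rhs D hc]
    exact (hasDerivWithinAt_transportMat_iff (hγ t ht) h0 hc Ψ _).symm
  have hinit : (∀ n, transportMat (ι := ι) c₀ c₀ (γ 0) (γ 0) (fun n => Ψ n 0) n = zform 1 n) ↔
      (∀ w, Ψ 0 0 w = LinearMap.id) ∧ ∀ p, 0 < p → Ψ p 0 = 0 := by
    have hinj := toMat_injective (ι := ι) (V := V) h0 h0
    constructor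
    · intro h
      refine ⟨fun w => hinj ?_, fun p hp => AlternatingMap.ext fun w => hinj ?_⟩
      · have h1 : tw 0 • toMat (ι := ι) c₀ c₀ (γ 0) (γ 0) (Ψ 0 0 w) = 1 :=
          congrArg (fun α : X [⋀^Fin 0]→L[ℝ] Mat ι => α w) (h 0)
        rw [tw_zero, one_smul] at h1
        rw [h1, toMat_id h0]
      · obtain ⟨p, rfl⟩ : ∃ q, p = q + 1 := ⟨p - 1, by omega⟩
        have h1 : tw (p + 1) • toMat (ι := ι) c₀ c₀ (γ 0) (γ 0) (Ψ (p + 1) 0 w) = 0 :=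
          congrArg (fun α : X [⋀^Fin (p + 1)]→L[ℝ] Mat ι => α w) (h (p + 1))
        rw [(smul_eq_zero.1 h1).resolve_left (tw_ne_zero _)]
        exact (map_zero _).symm
    · rintro ⟨h1, h2⟩ n
      ext1 w
      change tw n • toMat (ι := ι) c₀ c₀ (γ 0) (γ 0) (Ψ n 0 w) = _
      rcases n with _ | n
      · rw [h1, toMat_id h0, tw_zero, one_smul]
        rfl
      · rw [h2 _ n.succ_pos, AlternatingMap.zero_apply, map_zero, smul_zero]
        rfl
  rw [hode, hinit]
  exact ⟨fun h => ⟨⟨h.init_zero, h.init_pos⟩, h.ode⟩, fun h => ⟨h.1.1, h.1.2, h.2⟩⟩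

end Frames

/-! ### Existence, uniqueness and naturality of the parallel transport -/

section Transport

variable {ι : Type} [Fintype ι] [DecidableEq ι] {m : ℕ}
  {M : Type*} [TopologicalSpace M] [ChartedSpace (EuclideanSpace ℝ (Fin m)) M]
  {V : M → Type*} [TopologicalSpace (TotalSpace (ι → ℝ) V)]
  [∀ x, AddCommGroup (V x)] [∀ x, Module ℝ (V x)] [∀ x, TopologicalSpace (V x)]
  [∀ x, IsTopologicalAddGroup (V x)] [∀ x, ContinuousSMul ℝ (V x)]
  [FiberBundle (ι → ℝ) V] [VectorBundle ℝ (ι → ℝ) V]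
  {X : Type} [NormedAddCommGroup X] [NormedSpace ℝ X] [FiniteDimensional ℝ X]

variable (ι m V) in
/-- The part of the domain of the chart at `c` over which the trivialization at `c` is defined. -/
def patch (c : M) : Set M := (chartAt (EuclideanSpace ℝ (Fin m)) c).source ∩ base ι V c

theorem isOpen_patch (c : M) : IsOpen (patch ι m V c) :=
  (chartAt (EuclideanSpace ℝ (Fin m)) c).open_source.inter
    (trivializationAt (ι → ℝ) V c).open_baseSet

theorem mem_patch_self (c : M) : c ∈ patch ι m V c :=
  ⟨mem_chart_source _ c, FiberBundle.mem_baseSet_trivializationAt' c⟩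

variable [IsManifold (𝓡 m) ∞ M] [ContMDiffVectorBundle ∞ (ι → ℝ) V (𝓡 m)]
  {G : Grading (ι := ι) V}

namespace Superconnection

variable (D : Superconnection (ι := ι) (m := m) G)

/-- The path `γ` and the vector fields `η` along `γ` are so regular that the parallel transport
exists. -/
structure IsRegular (γ : ℝ → M) (η : ∀ t, X →ₗ[ℝ] TangentSpace (𝓡 m) (γ t)) : Prop where
  mdiff : ∀ t ∈ Icc (0 : ℝ) 1, MDifferentiableWithinAt 𝓘(ℝ, ℝ) (𝓡 m) γ (Icc 0 1) t
  coef : ∀ t ∈ Icc (0 : ℝ) 1, ∀ c, γ t ∈ patch ι m V c → ∀ n, ContinuousWithinAt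
    (fun τ => D.coef c (γ τ) (velocity m γ τ) (η τ) n) (Icc 0 1) t

/-- The differential equation for the parallel transport on the interval `[a, b]`. -/
def IsSolution (γ : ℝ → M) (η : ∀ t, X →ₗ[ℝ] TangentSpace (𝓡 m) (γ t)) (c₀ : M)
    (Ψ : ∀ (n : ℕ) (t : ℝ), X [⋀^Fin n]→ₗ[ℝ] (V (γ 0) →ₗ[ℝ] V (γ t))) (a b : ℝ) : Prop :=
  ∀ n, ∀ t ∈ Icc a b, ∀ c, γ t ∈ base ι V c → HasDerivWithinAt
    (fun τ => transportMat (ι := ι) c₀ c (γ 0) (γ τ) (fun n => Ψ n τ) n)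
    (star (mulB ι) (D.coef c (γ t) (velocity m γ t) (η t))
      (transportMat c₀ c (γ 0) (γ t) fun n => Ψ n t) n) (Icc a b) t

variable {D} {γ : ℝ → M} {η : ∀ t, X →ₗ[ℝ] TangentSpace (𝓡 m) (γ t)}

theorem IsRegular.continuousOn (hr : D.IsRegular γ η) : ContinuousOn γ (Icc 0 1) :=
  fun t ht => (hr.mdiff t ht).continuousWithinAt

theorem IsRegular.hasDerivWithinAt_transition (hr : D.IsRegular γ η) {t : ℝ}
    (ht : t ∈ Icc (0 : ℝ) 1) {s : Set ℝ} (hs : s ⊆ Icc 0 1) {c c' : M} (hc : γ t ∈ base ι V c)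
    (hc' : γ t ∈ base ι V c') : HasDerivWithinAt (fun τ => transition ι V c c' (γ τ))
      (mvfderiv (𝓡 m) (transition ι V c c') (γ t) (velocity m γ t)) s t := by
  have h1 := ((contMDiffAt_transition (m := m) hc hc').mdifferentiableAt
    (by simp)).hasMFDerivAt.comp_hasMFDerivWithinAt t (hr.mdiff t ht).hasMFDerivWithinAt
  have h2 : HasFDerivWithinAt (fun τ => transition ι V c c' (γ τ))
      ((mvfderiv (𝓡 m) (transition ι V c c') (γ t)).comp
        (mfderivWithin 𝓘(ℝ, ℝ) (𝓡 m) γ (Icc 0 1) t) : ℝ →L[ℝ] Mat ι) (Icc 0 1) t :=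
    hasMFDerivWithinAt_iff_hasFDerivWithinAt.1 h1
  exact h2.hasDerivWithinAt.mono hs

theorem IsRegular.ode_change_frame (hr : D.IsRegular γ η) {t : ℝ} (ht : t ∈ Icc (0 : ℝ) 1)
    {s : Set ℝ} (hs : s ⊆ Icc 0 1) {c₀ c c' : M} (hc : γ t ∈ base ι V c)
    (hc' : γ t ∈ base ι V c')
    {Ψ : ∀ (n : ℕ) (t : ℝ), X [⋀^Fin n]→ₗ[ℝ] (V (γ 0) →ₗ[ℝ] V (γ t))}
    (h : ∀ n, HasDerivWithinAt
      (fun τ => transportMat (ι := ι) c₀ c (γ 0) (γ τ) (fun n => Ψ n τ) n)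
      (star (mulB ι) (D.coef c (γ t) (velocity m γ t) (η t))
        (transportMat c₀ c (γ 0) (γ t) fun n => Ψ n t) n) s t) (n : ℕ) :
    HasDerivWithinAt
      (fun τ => transportMat (ι := ι) c₀ c' (γ 0) (γ τ) (fun n => Ψ n τ) n)
      (star (mulB ι) (D.coef c' (γ t) (velocity m γ t) (η t))
        (transportMat c₀ c' (γ 0) (γ t) fun n => Ψ n t) n) s t := by
  have h1 := ode_gauge (c := fun n τ => D.coef c (γ τ) (velocity m γ τ) (η τ) n)
    (c' := fun n τ => D.coef c' (γ τ) (velocity m γ τ) (η τ) n)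
    (Y := fun n τ => transportMat (ι := ι) c₀ c (γ 0) (γ τ) (fun n => Ψ n τ) n)
    (hr.hasDerivWithinAt_transition ht hs hc hc') h
    (fun n => D.coef_gauge hc hc' (velocity m γ t) (η t) n) n
  have h2 := star_congr (mulB ι) (n := n) (fun i _ => (rfl :
    D.coef c' (γ t) (velocity m γ t) (η t) i = D.coef c' (γ t) (velocity m γ t) (η t) i))
    fun i _ => (transportMat_gauge (c₀ := c₀) (c' := c') hc (fun n => Ψ n t) i).symm
  rw [h2] at h1
  refine h1.congr_of_eventuallyEq ?_ (transportMat_gauge hc _ _)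
  have hev : ∀ᶠ τ in nhdsWithin t s, γ τ ∈ base ι V c :=
    ((hr.continuousOn t ht).mono hs) ((trivializationAt (ι → ℝ) V c).open_baseSet.mem_nhds hc)
  filter_upwards [hev] with τ hτ
  exact transportMat_gauge hτ _ _

theorem IsRegular.exists_patch (hr : D.IsRegular γ η) {t : ℝ} (ht : t ∈ Icc (0 : ℝ) 1) :
    ∃ c, ∃ δ > 0, ∀ τ ∈ Icc (0 : ℝ) 1, t - δ < τ → τ < t + δ → γ τ ∈ patch ι m V c := by
  have h1 : ∀ᶠ τ in nhdsWithin t (Icc 0 1), γ τ ∈ patch ι m V (γ t) :=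
    (hr.continuousOn t ht) ((isOpen_patch (γ t)).mem_nhds (mem_patch_self (γ t)))
  rw [eventually_nhdsWithin_iff, Metric.eventually_nhds_iff] at h1
  obtain ⟨δ, hδ, h⟩ := h1
  refine ⟨γ t, δ, hδ, fun τ hτ h1 h2 => h ?_ hτ⟩
  rw [Real.dist_eq, abs_lt]
  exact ⟨by linarith, by linarith⟩

theorem IsRegular.continuousOn_coef (hr : D.IsRegular γ η) {s : Set ℝ} (hs : s ⊆ Icc 0 1) {c : M}
    (hc : ∀ τ ∈ s, γ τ ∈ patch ι m V c) (n : ℕ) :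
    ContinuousOn (fun τ => D.coef c (γ τ) (velocity m γ τ) (η τ) n) s :=
  fun τ hτ => (hr.coef τ (hs hτ) c (hc τ hτ) n).mono hs

theorem transportMat_injective {c₀ c x₀ x : M} (h₀ : x₀ ∈ base ι V c₀) (h : x ∈ base ι V c)
    {Ψ Ψ' : ∀ n, X [⋀^Fin n]→ₗ[ℝ] (V x₀ →ₗ[ℝ] V x)} {n : ℕ}
    (hΨ : transportMat (ι := ι) c₀ c x₀ x Ψ n = transportMat c₀ c x₀ x Ψ' n) : Ψ n = Ψ' n := by
  ext1 w
  refine toMat_injective (ι := ι) h₀ h ?_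
  have h1 : tw n • toMat (ι := ι) c₀ c x₀ x (Ψ n w) = tw n • toMat (ι := ι) c₀ c x₀ x (Ψ' n w) :=
    congrArg (fun α : X [⋀^Fin n]→L[ℝ] Mat ι => α w) hΨ
  exact smul_right_injective _ (tw_ne_zero n) h1

/-- Locally the path stays in one patch, where the equation has continuous coefficients and
uniqueness for graded equations applies. Injectivity of `transportMat` brings the equality back to
the homomorphisms. -/
theorem IsSolution.unique (hr : D.IsRegular γ η) {c₀ : M} (h0 : γ 0 ∈ base ι V c₀)
    {Ψ Ψ' : ∀ (n : ℕ) (t : ℝ), X [⋀^Fin n]→ₗ[ℝ] (V (γ 0) →ₗ[ℝ] V (γ t))}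
    (h : D.IsSolution γ η c₀ Ψ 0 1) (h' : D.IsSolution γ η c₀ Ψ' 0 1)
    (hinit : ∀ n, Ψ n 0 = Ψ' n 0) : ∀ t ∈ Icc (0 : ℝ) 1, ∀ n, Ψ n t = Ψ' n t := by
  refine interval_induction (Q := fun t => ∀ n, Ψ n t = Ψ' n t) hinit fun t ht => ?_
  obtain ⟨c, δ, hδ, hc⟩ := hr.exists_patch ht
  refine ⟨δ, hδ, fun s s' hs hs' h1 hss h2 hQ n => ?_⟩
  have hsub : Icc s s' ⊆ Icc 0 1 := Icc_subset_Icc hs.1 hs'.2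
  have hcs : ∀ τ ∈ Icc s s', γ τ ∈ patch ι m V c := fun τ hτ =>
    hc τ (hsub hτ) (by linarith [hτ.1]) (by linarith [hτ.2])
  have h3 := graded_unique (K := n) (mulB ι) (hr.continuousOn_coef hsub hcs)
    (Y := fun n τ => transportMat (ι := ι) c₀ c (γ 0) (γ τ) (fun n => Ψ n τ) n)
    (Z := fun n τ => transportMat (ι := ι) c₀ c (γ 0) (γ τ) (fun n => Ψ' n τ) n)
    (fun n _ τ hτ => (h n τ (hsub hτ) c (hcs τ hτ).2).mono hsub)
    (fun n _ τ hτ => (h' n τ (hsub hτ) c (hcs τ hτ).2).mono hsub)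
    (fun n _ => by simp only [hQ]) n le_rfl s' (right_mem_Icc.2 hss)
  exact transportMat_injective h0 (hcs s' (right_mem_Icc.2 hss)).2 h3

/-- Families of homomorphisms with given matrices. -/
def ofTransportMat (c₀ c x₀ x : M) (Y : ∀ n, X [⋀^Fin n]→L[ℝ] Mat ι) (n : ℕ) :
    X [⋀^Fin n]→ₗ[ℝ] (V x₀ →ₗ[ℝ] V x) :=
  tw n • (ofMat (V := V) c₀ c x₀ x).compAlternatingMap (Y n).toAlternatingMap

theorem transportMat_ofTransportMat {c₀ c x₀ x : M} (h₀ : x₀ ∈ base ι V c₀) (h : x ∈ base ι V c)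
    (Y : ∀ n, X [⋀^Fin n]→L[ℝ] Mat ι) (n : ℕ) :
    transportMat c₀ c x₀ x (ofTransportMat (V := V) c₀ c x₀ x Y) n = Y n := by
  ext1 w
  change tw n • toMat (ι := ι) c₀ c x₀ x (tw n • ofMat (V := V) c₀ c x₀ x (Y n w)) = Y n w
  rw [map_smul, smul_smul, tw_mul_self, one_smul, toMat_ofMat h₀ h]

-- Solutions are continued patch by patch. The local existence time does not depend on the initial
-- value, so the continuation cannot stop before the time 1.
open Classical in
theorem IsRegular.exists_solution (hr : D.IsRegular γ η) {c₀ : M} (h0 : γ 0 ∈ base ι V c₀) :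
    ∃ Ψ : ∀ (n : ℕ) (t : ℝ), X [⋀^Fin n]→ₗ[ℝ] (V (γ 0) →ₗ[ℝ] V (γ t)),
      (∀ n, transportMat (ι := ι) c₀ c₀ (γ 0) (γ 0) (fun n => Ψ n 0) n = zform 1 n) ∧
      D.IsSolution γ η c₀ Ψ 0 1 := by
  refine interval_induction (a := 0) (b := 1) (Q := fun T =>
    ∃ Ψ : ∀ (n : ℕ) (t : ℝ), X [⋀^Fin n]→ₗ[ℝ] (V (γ 0) →ₗ[ℝ] V (γ t)),
      (∀ n, transportMat (ι := ι) c₀ c₀ (γ 0) (γ 0) (fun n => Ψ n 0) n = zform 1 n) ∧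
      D.IsSolution γ η c₀ Ψ 0 T) ?_ (fun t ht => ?_) 1 (right_mem_Icc.2 zero_le_one)
  -- On the degenerate interval [0, 0] only the initial value matters: every function is
  -- differentiable within a single point, with any derivative.
  · refine ⟨fun n t => ofTransportMat c₀ c₀ (γ 0) (γ t) (zform (X := X) (1 : Mat ι)) n,
      transportMat_ofTransportMat h0 h0 _, fun n t ht c hc => ?_⟩
    have : Icc (0 : ℝ) 0 = {t} := by
      rw [Icc_self, le_antisymm ht.2 ht.1]
    rw [this]
    exact HasFDerivWithinAt.singleton
  obtain ⟨c, δ, hδ, hc⟩ := hr.exists_patch ht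
  have hsub : Icc (max 0 (t - δ / 2)) (min 1 (t + δ / 2)) ⊆ Icc 0 1 :=
    Icc_subset_Icc (le_max_left _ _) (min_le_left _ _)
  have hcs : ∀ τ ∈ Icc (max 0 (t - δ / 2)) (min 1 (t + δ / 2)), γ τ ∈ patch ι m V c := fun τ hτ =>
    hc τ (hsub hτ) (by linarith [(le_max_right 0 (t - δ / 2)).trans hτ.1])
      (by linarith [hτ.2.trans (min_le_right 1 (t + δ / 2))])
  obtain ⟨ε, hε, hex⟩ := graded_exists (F := Mat ι) (mulB ι) (hr.continuousOn_coef hsub hcs)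
  refine ⟨min (δ / 2) (ε / 2), by positivity, fun s s' hs hs' h1 hss h2 => ?_⟩
  have h3 := min_le_left (δ / 2) (ε / 2)
  have h4 := min_le_right (δ / 2) (ε / 2)
  have hsub' : Icc s s' ⊆ Icc (max 0 (t - δ / 2)) (min 1 (t + δ / 2)) :=
    Icc_subset_Icc (max_le hs.1 (by linarith)) (le_min hs'.2 (by linarith))
  rintro ⟨Ψ, hinit, hΨ⟩
  obtain ⟨Y, hY0, hY⟩ := hex s s' (max_le hs.1 (by linarith)) hss (le_min hs'.2 (by linarith))
    (by linarith) (fun n => transportMat (ι := ι) c₀ c (γ 0) (γ s) (fun n => Ψ n s) n)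
  -- The old solution is kept up to the time s, and the local solution started from its value at s
  -- is used afterwards.
  let Ψ' : ∀ (n : ℕ) (t : ℝ), X [⋀^Fin n]→ₗ[ℝ] (V (γ 0) →ₗ[ℝ] V (γ t)) := fun n τ =>
    if τ ≤ s then Ψ n τ else ofTransportMat c₀ c (γ 0) (γ τ) (fun n => Y n τ) n
  have hleft : ∀ n, ∀ τ ≤ s, Ψ' n τ = Ψ n τ := fun n τ hτ => if_pos hτ
  have hright : ∀ n, ∀ τ ∈ Icc s s', transportMat (ι := ι) c₀ c (γ 0) (γ τ) (fun n => Ψ' n τ) n =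
      Y n τ := fun n τ hτ => by
    rcases hτ.1.eq_or_lt with h | h
    · rw [← h, hY0]
      simp only [hleft _ s le_rfl]
    · have : (fun n => Ψ' n τ) = ofTransportMat c₀ c (γ 0) (γ τ) (fun n => Y n τ) :=
        funext fun n => if_neg (not_le.2 h)
      rw [this]
      exact transportMat_ofTransportMat h0 (hcs τ (hsub' hτ)).2 _ n
  have hodeL : ∀ n, ∀ τ ∈ Icc 0 s, ∀ c, γ τ ∈ base ι V c → HasDerivWithinAt
      (fun τ => transportMat (ι := ι) c₀ c (γ 0) (γ τ) (fun n => Ψ' n τ) n)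
      (star (mulB ι) (D.coef c (γ τ) (velocity m γ τ) (η τ))
      (transportMat c₀ c (γ 0) (γ τ) fun n => Ψ' n τ) n) (Icc 0 s) τ := fun n τ hτ c hc => by
    have e : ∀ τ ∈ Icc 0 s, (fun n => Ψ' n τ) = fun n => Ψ n τ := fun τ hτ =>
      funext fun n => hleft n τ hτ.2
    rw [e τ hτ]
    refine (hΨ n τ hτ c hc).congr (fun τ' hτ' => ?_) ?_
    · rw [e τ' hτ']
    · rw [e τ hτ]
  have hodeR : ∀ n, ∀ τ ∈ Icc s s', ∀ c, γ τ ∈ base ι V c → HasDerivWithinAt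
      (fun τ => transportMat (ι := ι) c₀ c (γ 0) (γ τ) (fun n => Ψ' n τ) n)
      (star (mulB ι) (D.coef c (γ τ) (velocity m γ τ) (η τ))
      (transportMat c₀ c (γ 0) (γ τ) fun n => Ψ' n τ) n) (Icc s s') τ := fun n τ hτ c' hc' => by
    refine hr.ode_change_frame (hsub (hsub' hτ)) (hsub'.trans hsub) (hcs τ (hsub' hτ)).2 hc'
      (fun n => ?_) n
    rw [show transportMat c₀ c (γ 0) (γ τ) (fun n => Ψ' n τ) = fun n => Y n τ from
      funext fun n => hright n τ hτ]
    exact (hY n τ hτ).congr (fun τ' hτ' => hright n τ' hτ') (hright n τ hτ)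
  refine ⟨Ψ', fun n => ?_, fun n τ hτ c hc => ?_⟩
  · rw [show (fun n => Ψ' n 0) = fun n => Ψ n 0 from funext fun n => hleft n 0 hs.1]
    exact hinit n
  rcases lt_trichotomy τ s with h | h | h
  · refine (hodeL n τ ⟨hτ.1, h.le⟩ c hc).mono_of_mem_nhdsWithin ?_
    filter_upwards [self_mem_nhdsWithin, mem_nhdsWithin_of_mem_nhds (Iio_mem_nhds h)] with r hr hr'
    exact ⟨hr.1, le_of_lt hr'⟩
  -- At the junction both one-sided derivatives are given by the equation with the same value of Ψ',
  -- hence they agree.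
  · have h5 := (hodeL n τ ⟨hτ.1, h.le⟩ c hc).union (hodeR n τ ⟨h.ge, hτ.2⟩ c hc)
    rwa [Icc_union_Icc_eq_Icc hs.1 hss] at h5
  · refine (hodeR n τ ⟨h.le, hτ.2⟩ c hc).mono_of_mem_nhdsWithin ?_
    filter_upwards [self_mem_nhdsWithin, mem_nhdsWithin_of_mem_nhds (Ioi_mem_nhds h)] with r hr hr'
    exact ⟨le_of_lt hr', hr.2⟩

/-- For regular data the default value 0 in the definition of `transport` does not occur. -/
theorem IsRegular.isTransport_transport (hr : D.IsRegular γ η) :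
    D.IsTransport γ η 0 (D.transport γ η 0) := by
  have h0 : γ 0 ∈ base ι V (γ 0) := FiberBundle.mem_baseSet_trivializationAt' _
  obtain ⟨Ψ, h1, h2⟩ := hr.exists_solution h0
  have hex : ∃ Ψ, D.IsTransport γ η 0 Ψ :=
    ⟨Ψ, (isTransport_iff D hr.continuousOn h0 η Ψ).2 ⟨h1, h2⟩⟩
  have : D.transport γ η 0 = hex.choose := by
    funext p t
    rw [transport, dif_pos hex]
  rw [this]
  exact hex.choose_spec

theorem IsRegular.transport_eq (hr : D.IsRegular γ η)
    {Ψ : ∀ (n : ℕ) (t : ℝ), X [⋀^Fin n]→ₗ[ℝ] (V (γ 0) →ₗ[ℝ] V (γ t))}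
    (h : D.IsTransport γ η 0 Ψ) {t : ℝ} (ht : t ∈ Icc (0 : ℝ) 1) (n : ℕ) :
    D.transport γ η 0 n t = Ψ n t := by
  have h0 : γ 0 ∈ base ι V (γ 0) := FiberBundle.mem_baseSet_trivializationAt' _
  have h1 := (isTransport_iff D hr.continuousOn h0 η _).1 hr.isTransport_transport
  have h2 := (isTransport_iff D hr.continuousOn h0 η _).1 h
  refine IsSolution.unique hr h0 h1.2 h2.2 (fun n => ?_) t ht n
  exact transportMat_injective h0 h0 ((h1.1 n).trans (h2.1 n).symm)

/-- Naturality of the transport under linear maps of the parameter space. -/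
theorem IsRegular.transport_comp {X' : Type} [NormedAddCommGroup X'] [NormedSpace ℝ X']
    [FiniteDimensional ℝ X'] (hr : D.IsRegular γ η) (ℓ : X' →L[ℝ] X)
    (hr' : D.IsRegular γ fun t => η t ∘ₗ ℓ.toLinearMap) {t : ℝ} (ht : t ∈ Icc (0 : ℝ) 1) (n : ℕ) :
    D.transport γ (fun t => η t ∘ₗ ℓ.toLinearMap) 0 n t =
      (D.transport γ η 0 n t).compLinearMap ℓ.toLinearMap := by
  have h0 : γ 0 ∈ base ι V (γ 0) := FiberBundle.mem_baseSet_trivializationAt' _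
  have h1 := (isTransport_iff D hr.continuousOn h0 η _).1 hr.isTransport_transport
  refine hr'.transport_eq (Ψ := fun n t => (D.transport γ η 0 n t).compLinearMap ℓ.toLinearMap)
    ((isTransport_iff D hr.continuousOn h0 _ _).2 ⟨fun n => ?_, fun n t ht c hc => ?_⟩) ht n
  · have h2 := congrArg (fun α : X [⋀^Fin n]→L[ℝ] Mat ι => α.compContinuousLinearMap ℓ) (h1.1 n)
    refine Eq.trans ?_ (h2.trans ?_)
    · rfl
    · rcases n with _ | n <;> rfl
  · have h2 := h1.2 n t ht c hc
    have h3 := (ContinuousAlternatingMap.compContinuousLinearMapCLM ℓ :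
      (X [⋀^Fin n]→L[ℝ] Mat ι) →L[ℝ] (X' [⋀^Fin n]→L[ℝ] Mat ι)).hasFDerivAt.comp_hasDerivWithinAt t h2
    have h4 := pull_star (mulB ι) ℓ (D.coef c (γ t) (velocity m γ t) (η t))
      (transportMat (γ 0) c (γ 0) (γ t) fun n => D.transport γ η 0 n t) n
    exact h3.congr_deriv h4

end Superconnection

end Transport

/-! ### Pull-backs of the forms along families of paths -/

section Families

variable {ι : Type} [Fintype ι] [DecidableEq ι] {m : ℕ}
  {M : Type*} [TopologicalSpace M] [ChartedSpace (EuclideanSpace ℝ (Fin m)) M]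
  {V : M → Type*} [TopologicalSpace (TotalSpace (ι → ℝ) V)]
  [∀ x, AddCommGroup (V x)] [∀ x, Module ℝ (V x)] [∀ x, TopologicalSpace (V x)]
  [∀ x, IsTopologicalAddGroup (V x)] [∀ x, ContinuousSMul ℝ (V x)]
  [FiberBundle (ι → ℝ) V] [VectorBundle ℝ (ι → ℝ) V]
  [IsManifold (𝓡 m) ∞ M] [ContMDiffVectorBundle ∞ (ι → ℝ) V (𝓡 m)]
  {G : Grading (ι := ι) V}
  {X : Type} [NormedAddCommGroup X] [NormedSpace ℝ X] [FiniteDimensional ℝ X]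
  {Z : Type} [NormedAddCommGroup Z] [NormedSpace ℝ Z] [FiniteDimensional ℝ Z]

namespace Superconnection

variable (D : Superconnection (ι := ι) (m := m) G)

/-- The matrices of the forms `A_n` in the chart at `c`, with the sign `(-1)^(n (n - 1) / 2)`. -/
def signedForm (c : M) (n : ℕ) (y : EuclideanSpace ℝ (Fin m)) :
    EuclideanSpace ℝ (Fin m) [⋀^Fin n]→L[ℝ] Mat ι :=
  tw n • D.chartForm c n y

theorem contDiffOn_signedForm (c : M) (n : ℕ) :
    ContDiffOn ℝ ∞ (D.signedForm c n) (chartDomain (ι := ι) V c) :=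
  contDiffOn_const (c := tw n) |>.smul (D.smooth c n)

theorem isOpen_chartDomain (c : M) : IsOpen (chartDomain (ι := ι) (m := m) V c) :=
  (chartAt (EuclideanSpace ℝ (Fin m)) c).isOpen_inter_preimage_symm
    (trivializationAt (ι → ℝ) V c).open_baseSet

theorem contDiffAt_signedForm {c : M} {y : EuclideanSpace ℝ (Fin m)}
    (hy : y ∈ chartDomain (ι := ι) V c) (n : ℕ) : ContDiffAt ℝ ∞ (D.signedForm c n) y :=
  (D.contDiffOn_signedForm c n).contDiffAt ((isOpen_chartDomain c).mem_nhds hy)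

theorem chart_mem_chartDomain {c x : M} (hx : x ∈ patch ι m V c) :
    chartAt (EuclideanSpace ℝ (Fin m)) c x ∈ chartDomain (ι := ι) V c := by
  refine ⟨(chartAt (EuclideanSpace ℝ (Fin m)) c).map_source hx.1, ?_⟩
  rw [mem_preimage, (chartAt (EuclideanSpace ℝ (Fin m)) c).left_inv hx.1]
  exact hx.2

theorem symm_mem_patch {c : M} {y : EuclideanSpace ℝ (Fin m)}
    (hy : y ∈ chartDomain (ι := ι) V c) :
    (chartAt (EuclideanSpace ℝ (Fin m)) c).symm y ∈ patch ι m V c :=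
  ⟨(chartAt (EuclideanSpace ℝ (Fin m)) c).map_target hy.1, hy.2⟩

theorem connMat_symm_eq_pull {c : M} {y : EuclideanSpace ℝ (Fin m)}
    (hy : y ∈ (chartAt (EuclideanSpace ℝ (Fin m)) c).target)
    (L : X →L[ℝ] TangentSpace (𝓡 m) ((chartAt (EuclideanSpace ℝ (Fin m)) c).symm y)) (n : ℕ) :
    D.connMat c ((chartAt (EuclideanSpace ℝ (Fin m)) c).symm y) L.toLinearMap n =
      pull ((mfderiv (𝓡 m) (𝓡 m) (chartAt (EuclideanSpace ℝ (Fin m)) c)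
        ((chartAt (EuclideanSpace ℝ (Fin m)) c).symm y)).comp L : X →L[ℝ] EuclideanSpace ℝ (Fin m))
        (fun n => D.signedForm c n y) n := by
  let φ := chartAt (EuclideanSpace ℝ (Fin m)) c
  let A : EuclideanSpace ℝ (Fin m) →ₗ[ℝ] EuclideanSpace ℝ (Fin m) :=
    (mfderiv (𝓡 m) (𝓡 m) φ (φ.symm y)).toLinearMap
  let B : EuclideanSpace ℝ (Fin m) →ₗ[ℝ] EuclideanSpace ℝ (Fin m) :=
    (mfderiv (𝓡 m) (𝓡 m) φ.symm y).toLinearMap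
  have h1 : A ∘ₗ B = LinearMap.id := by
    ext1 w
    exact congrArg (fun T : EuclideanSpace ℝ (Fin m) →L[ℝ] EuclideanSpace ℝ (Fin m) => T w)
      ((mdifferentiable_chart (I := 𝓡 m) c).comp_symm_deriv hy)
  have h2 : B ∘ₗ A = LinearMap.id := (LinearMap.comp_eq_id_comm ℝ _).1 h1
  ext1 w
  change tw n • toMat (ι := ι) c c _ _ (D.frameForm c n (φ.symm y) fun i => L (w i)) =
    tw n • toMat (ι := ι) c c _ _ (D.frameForm c n (φ.symm y) fun i => B (A (L (w i))))
  congr 4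
  funext i
  exact (LinearMap.congr_fun h2 (L (w i))).symm

theorem connMat_eq_pull {c x : M} (hx : x ∈ (chartAt (EuclideanSpace ℝ (Fin m)) c).source)
    (L : X →L[ℝ] TangentSpace (𝓡 m) x) (n : ℕ) :
    D.connMat c x L.toLinearMap n =
      pull ((mfderiv (𝓡 m) (𝓡 m) (chartAt (EuclideanSpace ℝ (Fin m)) c) x).comp L :
        X →L[ℝ] EuclideanSpace ℝ (Fin m))
        (fun n => D.signedForm c n (chartAt (EuclideanSpace ℝ (Fin m)) c x)) n := by
  obtain ⟨y, hy, rfl⟩ : ∃ y ∈ (chartAt (EuclideanSpace ℝ (Fin m)) c).target,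
      (chartAt (EuclideanSpace ℝ (Fin m)) c).symm y = x :=
    ⟨_, (chartAt (EuclideanSpace ℝ (Fin m)) c).map_source hx,
      (chartAt (EuclideanSpace ℝ (Fin m)) c).left_inv hx⟩
  rw [connMat_symm_eq_pull D hy, (chartAt (EuclideanSpace ℝ (Fin m)) c).right_inv hy]

end Superconnection

variable {H : Z → M} {K : Set Z} {z : Z}

theorem contDiffWithinAt_chart_comp (hH : ContMDiffOn 𝓘(ℝ, Z) (𝓡 m) ∞ H K) (hz : z ∈ K) {c : M}
    (hc : H z ∈ (chartAt (EuclideanSpace ℝ (Fin m)) c).source) :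
    ContDiffWithinAt ℝ ∞ (chartAt (EuclideanSpace ℝ (Fin m)) c ∘ H) K z := by
  rw [← contMDiffWithinAt_iff_contDiffWithinAt]
  exact ((contMDiffOn_chart (I := 𝓡 m) (n := ∞)).contMDiffAt
    ((chartAt (EuclideanSpace ℝ (Fin m)) c).open_source.mem_nhds hc)).comp_contMDiffWithinAt z
      (hH z hz)

variable (m H K z) in
/-- The derivative of a map to the manifold, as a linear map. -/
def tangentLinear : Z →ₗ[ℝ] TangentSpace (𝓡 m) (H z) :=
  (mfderivWithin 𝓘(ℝ, Z) (𝓡 m) H K z).toLinearMap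

theorem mfderiv_chart_comp (hH : ContMDiffOn 𝓘(ℝ, Z) (𝓡 m) ∞ H K) (hK : UniqueDiffOn ℝ K)
    (hz : z ∈ K) {c : M} (hc : H z ∈ (chartAt (EuclideanSpace ℝ (Fin m)) c).source) :
    ((mfderiv (𝓡 m) (𝓡 m) (chartAt (EuclideanSpace ℝ (Fin m)) c) (H z)).comp
      (mfderivWithin 𝓘(ℝ, Z) (𝓡 m) H K z) : Z →L[ℝ] EuclideanSpace ℝ (Fin m)) =
    fderivWithin ℝ (chartAt (EuclideanSpace ℝ (Fin m)) c ∘ H) K z := by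
  rw [← mfderivWithin_eq_fderivWithin]
  exact (mfderiv_comp_mfderivWithin z ((mdifferentiable_chart c).mdifferentiableAt hc)
    ((hH z hz).mdifferentiableWithinAt (by simp)) (hK z hz).uniqueMDiffWithinAt).symm

namespace Superconnection

variable (D : Superconnection (ι := ι) (m := m) G)

/-- The matrices of the pull-backs of the forms `A_n` along a map `H`. -/
def pullMat (H : Z → M) (K : Set Z) (c : M) (n : ℕ) (z : Z) : Z [⋀^Fin n]→L[ℝ] Mat ι :=
  D.connMat c (H z) (tangentLinear m H K z) n

theorem pullMat_eq (hH : ContMDiffOn 𝓘(ℝ, Z) (𝓡 m) ∞ H K) (hK : UniqueDiffOn ℝ K)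
    (hz : z ∈ K) {c : M} (hc : H z ∈ (chartAt (EuclideanSpace ℝ (Fin m)) c).source) (n : ℕ) :
    D.pullMat H K c n z = pull (fderivWithin ℝ (chartAt (EuclideanSpace ℝ (Fin m)) c ∘ H) K z)
      (fun n => D.signedForm c n (chartAt (EuclideanSpace ℝ (Fin m)) c (H z))) n := by
  rw [← mfderiv_chart_comp hH hK hz hc]
  exact D.connMat_eq_pull (X := Z) hc (mfderivWithin 𝓘(ℝ, Z) (𝓡 m) H K z) n

theorem contDiffWithinAt_pullMat (hH : ContMDiffOn 𝓘(ℝ, Z) (𝓡 m) ∞ H K) (hK : UniqueDiffOn ℝ K)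
    (hz : z ∈ K) {c : M} (hc : H z ∈ patch ι m V c) (n : ℕ) :
    ContDiffWithinAt ℝ ∞ (D.pullMat H K c n) K z := by
  have h1 : ContDiffWithinAt ℝ ∞ (fun z => pull
      (fderivWithin ℝ (chartAt (EuclideanSpace ℝ (Fin m)) c ∘ H) K z)
      (fun n => D.signedForm c n (chartAt (EuclideanSpace ℝ (Fin m)) c (H z))) n) K z := by
    have h2 := contDiffWithinAt_chart_comp hH hz hc.1
    have h3 : ContDiffWithinAt ℝ ∞ (fun z => D.signedForm c n
        ((chartAt (EuclideanSpace ℝ (Fin m)) c ∘ H) z)) K z :=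
      ContDiffAt.comp_contDiffWithinAt (g := D.signedForm c n) z
        (D.contDiffAt_signedForm (chart_mem_chartDomain hc) n) h2
    exact contDiffWithinAt_compContinuousLinearMap (h2.fderivWithin_right hK (by simp) hz) h3
  refine h1.congr_of_eventuallyEq ?_ (D.pullMat_eq hH hK hz hc.1 n)
  filter_upwards [self_mem_nhdsWithin, ((hH z hz).continuousWithinAt)
    ((isOpen_patch (ι := ι) (V := V) c).mem_nhds hc)] with z' hz' hc'
  exact D.pullMat_eq hH hK hz' hc'.1 n

end Superconnection

/-! ### Families of paths -/

variable {n : ℕ} {S : Set (Fin n → ℝ)} {h : (Fin n → ℝ) → ℝ → M}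

theorem uniqueDiffOn_Icc_zero_one : UniqueDiffOn ℝ (Icc (0 : ℝ) 1) := uniqueDiffOn_Icc zero_lt_one

theorem velocity_eq
    (hh : ContMDiffOn 𝓘(ℝ, (Fin n → ℝ) × ℝ) (𝓡 m) ∞ (fun z => h z.1 z.2) (S ×ˢ Icc 0 1))
    {u : Fin n → ℝ} (hu : u ∈ S) {t : ℝ} (ht : t ∈ Icc (0 : ℝ) 1) :
    MDifferentiableWithinAt 𝓘(ℝ, ℝ) (𝓡 m) (h u) (Icc 0 1) t ∧
    velocity m (h u) t = mfderivWithin 𝓘(ℝ, (Fin n → ℝ) × ℝ) (𝓡 m) (fun z => h z.1 z.2)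
      (S ×ˢ Icc 0 1) (u, t) ((0, 1) : (Fin n → ℝ) × ℝ) := by
  have h1 : HasFDerivWithinAt (fun t : ℝ => (u, t)) (ContinuousLinearMap.inr ℝ (Fin n → ℝ) ℝ)
      (Icc 0 1) t := (hasFDerivAt_prodMk_right u t).hasFDerivWithinAt
  have h2 := ((hh (u, t) ⟨hu, ht⟩).mdifferentiableWithinAt
    (by simp)).hasMFDerivWithinAt.comp t (hasMFDerivWithinAt_iff_hasFDerivWithinAt.2 h1)
      (fun τ hτ => ⟨hu, hτ⟩ : Icc (0 : ℝ) 1 ⊆ (fun t : ℝ => (u, t)) ⁻¹' (S ×ˢ Icc 0 1))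
  refine ⟨h2.mdifferentiableWithinAt, ?_⟩
  have h3 := h2.mfderivWithin (uniqueDiffOn_Icc_zero_one t ht).uniqueMDiffWithinAt
  have h4 := congrArg (fun T : ℝ →L[ℝ] EuclideanSpace ℝ (Fin m) => T 1) h3
  exact h4

theorem variation_eq (hS : UniqueDiffOn ℝ S)
    (hh : ContMDiffOn 𝓘(ℝ, (Fin n → ℝ) × ℝ) (𝓡 m) ∞ (fun z => h z.1 z.2) (S ×ˢ Icc 0 1))
    {u : Fin n → ℝ} (hu : u ∈ S) {t : ℝ} (ht : t ∈ Icc (0 : ℝ) 1) (w : Fin n → ℝ) :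
    mfderivWithin 𝓘(ℝ, Fin n → ℝ) (𝓡 m) (fun u' => h u' t) S u w =
      mfderivWithin 𝓘(ℝ, (Fin n → ℝ) × ℝ) (𝓡 m) (fun z => h z.1 z.2)
        (S ×ˢ Icc 0 1) (u, t) ((w, 0) : (Fin n → ℝ) × ℝ) := by
  have h1 : HasFDerivWithinAt (fun u : Fin n → ℝ => (u, t)) (ContinuousLinearMap.inl ℝ (Fin n → ℝ) ℝ)
      S u := (hasFDerivAt_prodMk_left u t).hasFDerivWithinAt
  have hsub : S ⊆ (fun u : Fin n → ℝ => (u, t)) ⁻¹' (S ×ˢ Icc (0 : ℝ) 1) := fun τ hτ => ⟨hτ, ht⟩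
  have h2 := ((hh (u, t) ⟨hu, ht⟩).mdifferentiableWithinAt
    (by simp)).hasMFDerivWithinAt.comp u (hasMFDerivWithinAt_iff_hasFDerivWithinAt.2 h1) hsub
  have h3 := h2.mfderivWithin (hS u hu).uniqueMDiffWithinAt
  have h4 := congrArg (fun T : (Fin n → ℝ) →L[ℝ] EuclideanSpace ℝ (Fin m) => T w) h3
  exact h4

namespace Superconnection

variable (D : Superconnection (ι := ι) (m := m) G)

/-- The variation fields and the velocity are the partial derivatives of one map on the product of
the parameter space with the time. The coefficients are therefore obtained from the forms pulled
back to this finite-dimensional product, by contraction with ∂_t and restriction to the parameter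
directions. -/
theorem coef_family (hS : UniqueDiffOn ℝ S)
    (hh : ContMDiffOn 𝓘(ℝ, (Fin n → ℝ) × ℝ) (𝓡 m) ∞ (fun z => h z.1 z.2) (S ×ˢ Icc 0 1))
    {u : Fin n → ℝ} (hu : u ∈ S) {t : ℝ} (ht : t ∈ Icc (0 : ℝ) 1) (c : M) (p : ℕ) :
    D.coef c (h u t) (velocity m (h u) t)
      (tangentLinear m (fun u' => h u' t) S u) p =
    pull (ContinuousLinearMap.inl ℝ (Fin n → ℝ) ℝ) (iota ((0, 1) : (Fin n → ℝ) × ℝ)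
      fun p => D.pullMat (fun z => h z.1 z.2) (S ×ˢ Icc 0 1) c p (u, t)) p := by
  ext1 w
  change D.formMat c (p + 1) (h u t) (Matrix.vecCons (velocity m (h u) t)
    fun i => mfderivWithin 𝓘(ℝ, Fin n → ℝ) (𝓡 m) (fun u' => h u' t) S u (w i)) =
    D.formMat c (p + 1) (h u t) fun i => mfderivWithin 𝓘(ℝ, (Fin n → ℝ) × ℝ) (𝓡 m)
      (fun z => h z.1 z.2) (S ×ˢ Icc 0 1) (u, t)
        (Matrix.vecCons ((0, 1) : (Fin n → ℝ) × ℝ) (fun i => (w i, (0 : ℝ))) i)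
  congr 1
  funext i
  refine Fin.cases ?_ (fun i => ?_) i
  · exact (velocity_eq hh hu ht).2
  · exact variation_eq hS hh hu ht (w i)

theorem isRegular_family (hS : UniqueDiffOn ℝ S)
    (hh : ContMDiffOn 𝓘(ℝ, (Fin n → ℝ) × ℝ) (𝓡 m) ∞ (fun z => h z.1 z.2) (S ×ˢ Icc 0 1))
    {u : Fin n → ℝ} (hu : u ∈ S) :
    D.IsRegular (h u)
      fun t => tangentLinear m (fun u' => h u' t) S u where
  mdiff t ht := (velocity_eq hh hu ht).1
  coef t ht c hc p := by
    have h1 : ContinuousWithinAt (fun τ : ℝ => pull (ContinuousLinearMap.inl ℝ (Fin n → ℝ) ℝ)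
        (iota ((0, 1) : (Fin n → ℝ) × ℝ)
        fun p => D.pullMat (fun z => h z.1 z.2) (S ×ˢ Icc 0 1) c p (u, τ)) p) (Icc 0 1) t := by
      have h2 := (D.contDiffWithinAt_pullMat hh (hS.prod uniqueDiffOn_Icc_zero_one) 
        (z := (u, t)) ⟨hu, ht⟩ hc (p + 1)).continuousWithinAt
      have h3 : ContinuousWithinAt (fun τ => D.pullMat (fun z => h z.1 z.2) (S ×ˢ Icc 0 1) c
          (p + 1) (u, τ)) (Icc 0 1) t :=
        ContinuousWithinAt.comp (t := S ×ˢ Icc (0 : ℝ) 1) (f := fun τ : ℝ => (u, τ))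
          (g := D.pullMat (fun z => h z.1 z.2) (S ×ˢ Icc 0 1) c (p + 1)) h2
          (by fun_prop : ContinuousWithinAt (fun τ : ℝ => (u, τ)) (Icc 0 1) t)
          fun τ hτ => ⟨hu, hτ⟩
      refine continuousWithinAt_form fun w => ?_
      exact (ContinuousAlternatingMap.apply ℝ ((Fin n → ℝ) × ℝ) (Mat ι)
        (Matrix.vecCons ((0, 1) : (Fin n → ℝ) × ℝ)
          fun i => (w i, (0 : ℝ)))).continuous.continuousAt.comp_continuousWithinAt h3
    exact h1.congr (fun τ hτ => D.coef_family hS hh hu hτ c p) (D.coef_family hS hh hu ht c p)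

end Superconnection

end Families

/-! ### Families of paths extended to all times, at rest outside the unit interval -/

section Families

variable {ι : Type} [Fintype ι] [DecidableEq ι] {m : ℕ}
  {M : Type*} [TopologicalSpace M] [ChartedSpace (EuclideanSpace ℝ (Fin m)) M]
  {V : M → Type*} [TopologicalSpace (TotalSpace (ι → ℝ) V)]
  [∀ x, AddCommGroup (V x)] [∀ x, Module ℝ (V x)] [∀ x, TopologicalSpace (V x)]
  [∀ x, IsTopologicalAddGroup (V x)] [∀ x, ContinuousSMul ℝ (V x)]
  [FiberBundle (ι → ℝ) V] [VectorBundle ℝ (ι → ℝ) V]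
  [IsManifold (𝓡 m) ∞ M] [ContMDiffVectorBundle ∞ (ι → ℝ) V (𝓡 m)]
  {G : Grading (ι := ι) V}
  {n : ℕ} {S : Set (Fin n → ℝ)} {h : (Fin n → ℝ) → ℝ → M}

theorem smoothTransition_mem_Icc (t : ℝ) : Real.smoothTransition t ∈ Icc (0 : ℝ) 1 :=
  ⟨Real.smoothTransition.nonneg t, Real.smoothTransition.le_one t⟩

theorem hasDerivAt_smoothTransition (t : ℝ) :
    HasDerivAt Real.smoothTransition (deriv Real.smoothTransition t) t :=
  ((Real.smoothTransition.contDiff (n := 1)).differentiable one_ne_zero t).hasDerivAt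

/-- A family of paths, reparametrized so as to be constant outside the unit interval. -/
def extend (h : (Fin n → ℝ) → ℝ → M) (z : (Fin n → ℝ) × ℝ) : M :=
  h z.1 (Real.smoothTransition z.2)

theorem contMDiffOn_extend
    (hh : ContMDiffOn 𝓘(ℝ, (Fin n → ℝ) × ℝ) (𝓡 m) ∞ (fun z => h z.1 z.2) (S ×ˢ Icc 0 1)) :
    ContMDiffOn 𝓘(ℝ, (Fin n → ℝ) × ℝ) (𝓡 m) ∞ (extend h) (S ×ˢ univ) := by
  have h1 : ContDiff ℝ ∞ fun z : (Fin n → ℝ) × ℝ => (z.1, Real.smoothTransition z.2) :=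
    contDiff_fst.prodMk (Real.smoothTransition.contDiff.comp contDiff_snd)
  exact hh.comp h1.contMDiff.contMDiffOn fun z hz => ⟨hz.1, smoothTransition_mem_Icc _⟩

theorem tangentLinear_extend (hS : IsOpen S)
    (hh : ContMDiffOn 𝓘(ℝ, (Fin n → ℝ) × ℝ) (𝓡 m) ∞ (fun z => h z.1 z.2) (S ×ˢ Icc 0 1))
    {u : Fin n → ℝ} (hu : u ∈ S) (t : ℝ) (w : (Fin n → ℝ) × ℝ) :
    tangentLinear m (extend h) (S ×ˢ univ) (u, t) w =
      mfderivWithin 𝓘(ℝ, (Fin n → ℝ) × ℝ) (𝓡 m) (fun z => h z.1 z.2)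
        (S ×ˢ Icc 0 1) (u, Real.smoothTransition t)
        ((w.1, deriv Real.smoothTransition t * w.2) : (Fin n → ℝ) × ℝ) := by
  have h1 : HasFDerivWithinAt (fun z : (Fin n → ℝ) × ℝ => (z.1, Real.smoothTransition z.2))
      ((ContinuousLinearMap.fst ℝ (Fin n → ℝ) ℝ).prod
        (deriv Real.smoothTransition t • ContinuousLinearMap.snd ℝ (Fin n → ℝ) ℝ))
      (S ×ˢ univ) (u, t) := by
    have h0 : HasFDerivAt (Real.smoothTransition ∘ Prod.snd)
        (deriv Real.smoothTransition t • ContinuousLinearMap.snd ℝ (Fin n → ℝ) ℝ) (u, t) :=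
      HasDerivAt.comp_hasFDerivAt (f := Prod.snd) (u, t) (hasDerivAt_smoothTransition t)
        hasFDerivAt_snd
    exact (hasFDerivAt_fst.prodMk h0).hasFDerivWithinAt
  have hsub : S ×ˢ (univ : Set ℝ) ⊆
      (fun z : (Fin n → ℝ) × ℝ => (z.1, Real.smoothTransition z.2)) ⁻¹' (S ×ˢ Icc (0 : ℝ) 1) :=
    fun z hz => ⟨hz.1, smoothTransition_mem_Icc _⟩
  have h2 := ((hh (u, Real.smoothTransition t)
    ⟨hu, smoothTransition_mem_Icc t⟩).mdifferentiableWithinAt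
    (by simp)).hasMFDerivWithinAt.comp (u, t) (hasMFDerivWithinAt_iff_hasFDerivWithinAt.2 h1) hsub
  have h3 := h2.mfderivWithin
    ((hS.prod isOpen_univ).uniqueDiffOn (u, t) ⟨hu, mem_univ t⟩).uniqueMDiffWithinAt
  exact congrArg (fun T : (Fin n → ℝ) × ℝ →L[ℝ] EuclideanSpace ℝ (Fin m) => T w) h3

namespace Superconnection

variable (D : Superconnection (ι := ι) (m := m) G)

/-- The matrices of the pull-backs of the forms `A_n` along an extended family. -/
def extMat (S : Set (Fin n → ℝ)) (h : (Fin n → ℝ) → ℝ → M) (c : M) (p : ℕ)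
    (z : (Fin n → ℝ) × ℝ) : ((Fin n → ℝ) × ℝ) [⋀^Fin p]→L[ℝ] Mat ι :=
  D.pullMat (extend h) (S ×ˢ univ) c p z

/-- The matrices of the transport from the time `0` for an extended family. -/
def parMat (S : Set (Fin n → ℝ)) (h : (Fin n → ℝ) → ℝ → M) (c₀ c : M) (p : ℕ)
    (z : (Fin n → ℝ) × ℝ) : (Fin n → ℝ) [⋀^Fin p]→L[ℝ] Mat ι :=
  transportMat c₀ c (h z.1 0) (extend h z) (fun p => D.transport (h z.1)
    (fun t => tangentLinear m (fun u' => h u' t) S z.1) 0 p (Real.smoothTransition z.2)) p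

theorem contDiffAt_extMat (hS : IsOpen S)
    (hh : ContMDiffOn 𝓘(ℝ, (Fin n → ℝ) × ℝ) (𝓡 m) ∞ (fun z => h z.1 z.2) (S ×ˢ Icc 0 1))
    {z : (Fin n → ℝ) × ℝ} (hz : z.1 ∈ S) {c : M} (hc : extend h z ∈ patch ι m V c) (p : ℕ) :
    ContDiffAt ℝ ∞ (D.extMat S h c p) z := by
  have hO : IsOpen (S ×ˢ (univ : Set ℝ)) := hS.prod isOpen_univ
  exact (D.contDiffWithinAt_pullMat (contMDiffOn_extend hh) hO.uniqueDiffOn ⟨hz, mem_univ _⟩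
    hc p).contDiffAt (hO.mem_nhds ⟨hz, mem_univ _⟩)

theorem pull_iota_extMat (hS : IsOpen S)
    (hh : ContMDiffOn 𝓘(ℝ, (Fin n → ℝ) × ℝ) (𝓡 m) ∞ (fun z => h z.1 z.2) (S ×ˢ Icc 0 1))
    {u : Fin n → ℝ} (hu : u ∈ S) (t : ℝ) (c : M) (p : ℕ) :
    pull (ContinuousLinearMap.inl ℝ (Fin n → ℝ) ℝ) (iota ((0, 1) : (Fin n → ℝ) × ℝ)
      fun p => D.extMat S h c p (u, t)) p = deriv Real.smoothTransition t •
    D.coef c (extend h (u, t)) (velocity m (h u) (Real.smoothTransition t))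
      (tangentLinear m (fun u' => h u' (Real.smoothTransition t)) S u) p := by
  ext1 w
  have h1 := (D.formMat c (p + 1) (extend h (u, t))).curryLeft.map_smul
    (deriv Real.smoothTransition t) (velocity m (h u) (Real.smoothTransition t))
  have h2 := congrArg (fun α => α fun i =>
    tangentLinear m (fun u' => h u' (Real.smoothTransition t)) S u (w i)) h1
  refine Eq.trans ?_ h2
  change D.formMat c (p + 1) (extend h (u, t)) (fun i =>
      tangentLinear m (extend h) (S ×ˢ univ) (u, t)
        (Matrix.vecCons ((0, 1) : (Fin n → ℝ) × ℝ) (fun i => (w i, (0 : ℝ))) i)) =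
    D.formMat c (p + 1) (extend h (u, t)) (Matrix.vecCons
      (deriv Real.smoothTransition t • velocity m (h u) (Real.smoothTransition t))
      fun i => tangentLinear m (fun u' => h u' (Real.smoothTransition t)) S u (w i))
  congr 1
  funext i
  rw [tangentLinear_extend hS hh hu]
  refine Fin.cases ?_ (fun i => ?_) i
  · have h3 := (velocity_eq hh hu (smoothTransition_mem_Icc t)).2
    change _ = deriv Real.smoothTransition t • velocity m (h u) (Real.smoothTransition t)
    rw [h3]
    refine Eq.trans ?_ (ContinuousLinearMap.map_smul
      (mfderivWithin 𝓘(ℝ, (Fin n → ℝ) × ℝ) (𝓡 m) (fun z => h z.1 z.2) (S ×ˢ Icc 0 1)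
        (u, Real.smoothTransition t)) (deriv Real.smoothTransition t)
      ((0, 1) : (Fin n → ℝ) × ℝ))
    congr 1
    change ((0 : Fin n → ℝ), deriv Real.smoothTransition t * 1) =
      (deriv Real.smoothTransition t • (0 : Fin n → ℝ), deriv Real.smoothTransition t • (1 : ℝ))
    rw [smul_zero, smul_eq_mul]
  · have h3 := variation_eq hS.uniqueDiffOn hh hu (smoothTransition_mem_Icc t) (w i)
    refine Eq.trans ?_ h3.symm
    congr 1
    change (w i, deriv Real.smoothTransition t * 0) = (w i, (0 : ℝ))
    rw [mul_zero]

/-- The speed of the reparametrization multiplies both sides of the transport equation. It vanishes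
outside the unit interval, so the equation holds with two-sided derivatives at all times, the end
points included. -/
theorem hasDerivAt_parMat (hS : IsOpen S)
    (hh : ContMDiffOn 𝓘(ℝ, (Fin n → ℝ) × ℝ) (𝓡 m) ∞ (fun z => h z.1 z.2) (S ×ˢ Icc 0 1))
    {u : Fin n → ℝ} (hu : u ∈ S) {c₀ : M} (h0 : h u 0 ∈ base ι V c₀) {t : ℝ} {c : M}
    (hc : extend h (u, t) ∈ base ι V c) (p : ℕ) :
    HasDerivAt (fun t => D.parMat S h c₀ c p (u, t)) (star (mulB ι)
      (pull (ContinuousLinearMap.inl ℝ (Fin n → ℝ) ℝ) (iota ((0, 1) : (Fin n → ℝ) × ℝ)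
        fun p => D.extMat S h c p (u, t))) (fun p => D.parMat S h c₀ c p (u, t)) p) t := by
  have hr := D.isRegular_family hS.uniqueDiffOn hh hu
  have h1 := ((isTransport_iff D hr.continuousOn h0 _ _).1 hr.isTransport_transport).2 p
    (Real.smoothTransition t) (smoothTransition_mem_Icc t) c hc
  have h2 := HasDerivWithinAt.scomp_hasDerivAt t h1 (hasDerivAt_smoothTransition t)
    fun τ => smoothTransition_mem_Icc τ
  refine h2.congr_deriv ?_
  rw [star_congr (mulB ι) (fun i _ => D.pull_iota_extMat hS hh hu t c i) fun _ _ => rfl]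
  simp only [star, Finset.smul_sum, wdg_smul_left]
  rfl

theorem parMat_gauge {c₀ c c' : M} {z : (Fin n → ℝ) × ℝ} (hc : extend h z ∈ base ι V c) (p : ℕ) :
    D.parMat S h c₀ c' p z = star (mulB ι) (zform (transition ι V c c' (extend h z)))
      (fun p => D.parMat S h c₀ c p z) p :=
  transportMat_gauge hc _ p

theorem parMat_of_nonpos (hS : IsOpen S)
    (hh : ContMDiffOn 𝓘(ℝ, (Fin n → ℝ) × ℝ) (𝓡 m) ∞ (fun z => h z.1 z.2) (S ×ˢ Icc 0 1))
    {u : Fin n → ℝ} (hu : u ∈ S) {c₀ : M} (h0 : h u 0 ∈ base ι V c₀) {t : ℝ} (ht : t ≤ 0) (p : ℕ) :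
    D.parMat S h c₀ c₀ p (u, t) = zform 1 p := by
  have hr := D.isRegular_family hS.uniqueDiffOn hh hu
  have h1 := ((isTransport_iff D hr.continuousOn h0 _ _).1 hr.isTransport_transport).1 p
  have key : ∀ τ : ℝ, τ = 0 → transportMat (ι := ι) c₀ c₀ (h u 0) (h u τ)
      (fun p => D.transport (h u) (fun t => tangentLinear m (fun u' => h u' t) S u) 0 p τ) p =
      zform 1 p := by
    rintro τ rfl
    exact h1
  exact key _ (Real.smoothTransition.zero_of_nonpos ht)

theorem parMat_of_one_le {x₀ x₁ : M} {u : Fin n → ℝ} {t : ℝ} (ht : 1 ≤ t) (p : ℕ) :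
    D.parMat S h x₀ x₁ p (u, t) = tw p • D.Psi S h x₀ x₁ p u := by
  have key : ∀ τ : ℝ, τ = 1 → transportMat (ι := ι) x₀ x₁ (h u 0) (h u τ)
      (fun p => D.transport (h u) (fun t => tangentLinear m (fun u' => h u' t) S u) 0 p τ) p =
      tw p • D.Psi S h x₀ x₁ p u := by
    rintro τ rfl
    rfl
  exact key _ (Real.smoothTransition.one_of_one_le ht)

end Superconnection

end Families

/-! ### Smoothness of the transport in the parameters and the time -/

section Families

variable {ι : Type} [Fintype ι] [DecidableEq ι] {m : ℕ}
  {M : Type*} [TopologicalSpace M] [ChartedSpace (EuclideanSpace ℝ (Fin m)) M]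
  {V : M → Type*} [TopologicalSpace (TotalSpace (ι → ℝ) V)]
  [∀ x, AddCommGroup (V x)] [∀ x, Module ℝ (V x)] [∀ x, TopologicalSpace (V x)]
  [∀ x, IsTopologicalAddGroup (V x)] [∀ x, ContinuousSMul ℝ (V x)]
  [FiberBundle (ι → ℝ) V] [VectorBundle ℝ (ι → ℝ) V]
  [IsManifold (𝓡 m) ∞ M] [ContMDiffVectorBundle ∞ (ι → ℝ) V (𝓡 m)]
  {G : Grading (ι := ι) V}
  {n : ℕ} {S : Set (Fin n → ℝ)} {h : (Fin n → ℝ) → ℝ → M}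

theorem contMDiffAt_extend (hS : IsOpen S)
    (hh : ContMDiffOn 𝓘(ℝ, (Fin n → ℝ) × ℝ) (𝓡 m) ∞ (fun z => h z.1 z.2) (S ×ˢ Icc 0 1))
    {z : (Fin n → ℝ) × ℝ} (hz : z.1 ∈ S) :
    ContMDiffAt 𝓘(ℝ, (Fin n → ℝ) × ℝ) (𝓡 m) ∞ (extend h) z :=
  (contMDiffOn_extend hh).contMDiffAt ((hS.prod isOpen_univ).mem_nhds ⟨hz, mem_univ _⟩)

theorem contDiffAt_transition_extend (hS : IsOpen S)
    (hh : ContMDiffOn 𝓘(ℝ, (Fin n → ℝ) × ℝ) (𝓡 m) ∞ (fun z => h z.1 z.2) (S ×ˢ Icc 0 1))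
    {z : (Fin n → ℝ) × ℝ} (hz : z.1 ∈ S) {c c' : M} (hc : extend h z ∈ base ι V c)
    (hc' : extend h z ∈ base ι V c') :
    ContDiffAt ℝ ∞ (fun z => transition ι V c c' (extend h z)) z :=
  ((contMDiffAt_transition hc hc').comp z (contMDiffAt_extend hS hh hz)).contDiffAt

theorem eventually_extend_mem (hS : IsOpen S)
    (hh : ContMDiffOn 𝓘(ℝ, (Fin n → ℝ) × ℝ) (𝓡 m) ∞ (fun z => h z.1 z.2) (S ×ˢ Icc 0 1))
    {z : (Fin n → ℝ) × ℝ} (hz : z.1 ∈ S) {U : Set M} (hU : IsOpen U) (hzU : extend h z ∈ U) :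
    ∀ᶠ z' in nhds z, z'.1 ∈ S ∧ extend h z' ∈ U := by
  filter_upwards [(hS.preimage continuous_fst).mem_nhds hz,
    (contMDiffAt_extend hS hh hz).continuousAt (hU.mem_nhds hzU)] with z' h1 h2
  exact ⟨h1, h2⟩

theorem isOpen_extend_preimage (hS : IsOpen S)
    (hh : ContMDiffOn 𝓘(ℝ, (Fin n → ℝ) × ℝ) (𝓡 m) ∞ (fun z => h z.1 z.2) (S ×ˢ Icc 0 1))
    {U : Set M} (hU : IsOpen U) : IsOpen {z : (Fin n → ℝ) × ℝ | z.1 ∈ S ∧ extend h z ∈ U} :=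
  isOpen_iff_mem_nhds.2 fun _ hz => eventually_extend_mem hS hh hz.1 hU hz.2

namespace Superconnection

variable (D : Superconnection (ι := ι) (m := m) G)

theorem contDiffAt_parMat_gauge (hS : IsOpen S)
    (hh : ContMDiffOn 𝓘(ℝ, (Fin n → ℝ) × ℝ) (𝓡 m) ∞ (fun z => h z.1 z.2) (S ×ˢ Icc 0 1))
    {z : (Fin n → ℝ) × ℝ} (hz : z.1 ∈ S) {c₀ c c' : M} (hc : extend h z ∈ base ι V c)
    (hc' : extend h z ∈ base ι V c') (hY : ∀ p, ContDiffAt ℝ ∞ (D.parMat S h c₀ c p) z) (p : ℕ) :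
    ContDiffAt ℝ ∞ (D.parMat S h c₀ c' p) z := by
  have h1 := contDiffAt_star (mulB ι) p
    (contDiffAt_zform (X := Fin n → ℝ) (contDiffAt_transition_extend hS hh hz hc hc')) hY
  refine h1.congr_of_eventuallyEq ?_
  filter_upwards [eventually_extend_mem hS hh hz
    (trivializationAt (ι → ℝ) V c).open_baseSet hc] with z' hz'
  exact D.parMat_gauge hz'.2 p

/-- Interval induction on the time, from -1, near which the matrix in the frame at `x₀` is constant.
In each patch the step is the smooth dependence of graded equations on parameters. The interval [-1,
2] contains the unit interval in its interior. -/
theorem contDiffAt_parMat (hS : IsOpen S)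
    (hh : ContMDiffOn 𝓘(ℝ, (Fin n → ℝ) × ℝ) (𝓡 m) ∞ (fun z => h z.1 z.2) (S ×ˢ Icc 0 1))
    {x₀ : M} (hx : ∀ u ∈ S, h u 0 = x₀) {u₀ : Fin n → ℝ} (hu₀ : u₀ ∈ S) :
    ∀ t ∈ Icc (-1 : ℝ) 2, ∀ c, extend h (u₀, t) ∈ base ι V c → ∀ p,
      ContDiffAt ℝ ∞ (D.parMat S h x₀ c p) (u₀, t) := by
  have hb : x₀ ∈ base ι V x₀ := FiberBundle.mem_baseSet_trivializationAt' _
  have hb' : ∀ u ∈ S, h u 0 ∈ base ι V x₀ := fun u hu => by rw [hx u hu]; exact hb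
  -- The statement for the induction concerns a whole neighbourhood of u₀, because the local step
  -- needs smooth initial values on an open set. The neighbourhood may shrink at each step.
  suffices ∀ t ∈ Icc (-1 : ℝ) 2, ∃ W : Set (Fin n → ℝ), IsOpen W ∧ u₀ ∈ W ∧ W ⊆ S ∧ ∀ l ∈ W,
      ∀ c, extend h (l, t) ∈ base ι V c → ∀ p, ContDiffAt ℝ ∞ (D.parMat S h x₀ c p) (l, t) by
    intro t ht
    obtain ⟨W, -, hW, -, h1⟩ := this t ht
    exact h1 u₀ hW
  refine interval_induction ?_ fun t _ => ?_
  · refine ⟨S, hS, hu₀, Subset.rfl, fun l hl c hc => ?_⟩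
    have hext : ∀ u ∈ S, ∀ t ≤ 0, extend h (u, t) = x₀ := fun u hu t ht => by
      simp only [extend, Real.smoothTransition.zero_of_nonpos ht, hx u hu]
    refine D.contDiffAt_parMat_gauge hS hh (c := x₀) hl (by rw [hext l hl _ (by norm_num)]; exact hb)
      hc fun p => ?_
    refine (contDiffAt_const (c := zform (1 : Mat ι) p)).congr_of_eventuallyEq ?_
    filter_upwards [(hS.prod (isOpen_Iio (a := (0 : ℝ)))).mem_nhds
      (⟨hl, by norm_num⟩ : (l, (-1 : ℝ)) ∈ S ×ˢ Iio 0)] with z hz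
    exact D.parMat_of_nonpos hS hh hz.1 (hb' _ hz.1) (le_of_lt hz.2) p
  · set c := extend h (u₀, t)
    have hΩ := isOpen_extend_preimage hS hh (isOpen_patch (ι := ι) (m := m) (V := V) c)
    obtain ⟨W, hW, huW, δ, hδ, hsub, hsm⟩ := graded_smooth (mulB ι) hΩ
      (c := fun p z => pull (ContinuousLinearMap.inl ℝ (Fin n → ℝ) ℝ)
        (iota ((0, 1) : (Fin n → ℝ) × ℝ) fun p => D.extMat S h c p z) p)
      (fun p z hz => by
        refine ContDiffAt.contDiffWithinAt ?_
        refine contDiffWithinAt_univ.1 (contDiffWithinAt_form fun w => ?_)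
        exact ((ContinuousAlternatingMap.apply ℝ ((Fin n → ℝ) × ℝ) (Mat ι)
          (Matrix.vecCons ((0, 1) : (Fin n → ℝ) × ℝ) fun i => (w i, (0 : ℝ)))).contDiff.contDiffAt
          (n := ∞)).comp_contDiffWithinAt z
            (contDiffWithinAt_univ.2 (D.contDiffAt_extMat hS hh hz.1 hz.2 (p + 1))))
      (⟨hu₀, mem_patch_self c⟩ : (u₀, t) ∈ {z : (Fin n → ℝ) × ℝ | z.1 ∈ S ∧ extend h z ∈
        patch ι m V c})
    refine ⟨δ, hδ, fun s s' _ _ h1 hss h2 => ?_⟩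
    rcases hss.eq_or_lt with rfl | hss
    · exact id
    rintro ⟨W₁, hW₁, huW₁, hW₁S, hQ⟩
    have hmem : ∀ l ∈ W, ∀ τ ∈ Ioo (t - δ) (t + δ), l ∈ S ∧ extend h (l, τ) ∈ patch ι m V c :=
      fun l hl τ hτ => hsub (⟨hl, hτ⟩ : (l, τ) ∈ W ×ˢ Ioo (t - δ) (t + δ))
    have hs : s ∈ Ioo (t - δ) (t + δ) := ⟨h1, hss.trans h2⟩
    have h3 := hsm s hs (W ∩ W₁) inter_subset_left (hW.inter hW₁)
      (fun p z => D.parMat S h x₀ c p z)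
      (fun p l hl => (ContDiffAt.comp l (hQ l hl.2 c (hmem l hl.1 s hs).2.2 p)
        (contDiffAt_id.prodMk contDiffAt_const)).contDiffWithinAt)
      (fun p l hl τ hτ => D.hasDerivAt_parMat hS hh (hW₁S hl.2) (hb' l (hW₁S hl.2))
        (hmem l hl.1 τ hτ).2.2 p)
    refine ⟨W ∩ W₁, hW.inter hW₁, ⟨huW, huW₁⟩, inter_subset_right.trans hW₁S,
      fun l hl c' hc' => ?_⟩
    have hs' : s' ∈ Ioo (t - δ) (t + δ) := ⟨h1.trans hss, h2⟩
    refine D.contDiffAt_parMat_gauge hS hh (hW₁S hl.2) (hmem l hl.1 s' hs').2.2 hc' fun p => ?_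
    exact (h3 p).contDiffAt (((hW.inter hW₁).prod isOpen_Ioo).mem_nhds ⟨hl, hss, h2⟩)

end Superconnection

end Families

section Algebra

variable {X N : Type*} [NormedAddCommGroup X] [NormedSpace ℝ X] [NormedAddCommGroup N]
  [NormedSpace ℝ N]

/-- The interior product with `v` only depends on the arguments modulo `v`. -/
theorem iota_apply_of_sub_mem (v : X) {P : X → X} (hP : ∀ w, ∃ r : ℝ, P w = w + r • v)
    (a : ∀ n, X [⋀^Fin n]→L[ℝ] N) (p : ℕ) (w : Fin p → X) :
    iota v a p (fun i => P (w i)) = iota v a p w := by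
  classical
  have h0 : ∀ (f : Fin p → X) (i : Fin p), f i = v → iota v a p f = 0 := fun f i hi =>
    (a (p + 1)).map_eq_zero_of_eq (Matrix.vecCons v f) (i := 0) (j := i.succ)
      (by simp [hi]) (Fin.succ_ne_zero i).symm
  have key : ∀ s : Finset (Fin p), iota v a p (s.piecewise (fun i => P (w i)) w) =
      iota v a p w := fun s => by
    induction s using Finset.induction_on with
    | empty => rw [Finset.piecewise_empty]
    | insert i s hi ih =>
      obtain ⟨r, hr⟩ := hP (w i)
      rw [Finset.piecewise_insert, hr]
      refine ((iota v a p).toMultilinearMap.map_update_add _ _ _ _).trans ?_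
      have h1 := (iota v a p).toMultilinearMap.map_update_smul
        (s.piecewise (fun i => P (w i)) w) i r v
      have h2 : iota v a p (Function.update (s.piecewise (fun i => P (w i)) w) i v) = 0 :=
        h0 _ i (by simp)
      have h3 : Function.update (s.piecewise (fun i => P (w i)) w) i (w i) =
          s.piecewise (fun i => P (w i)) w := by
        rw [Function.update_eq_self_iff]
        exact (Finset.piecewise_eq_of_notMem _ _ _ hi).symm
      rw [h1, h3]
      change iota v a p _ + r • iota v a p _ = _
      rw [h2, smul_zero, add_zero, ih]
  have := key Finset.univ
  rwa [Finset.piecewise_univ] at this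

end Algebra

/-! ### The defect of a family of paths -/

section Families

variable {ι : Type} [Fintype ι] [DecidableEq ι] {m : ℕ}
  {M : Type*} [TopologicalSpace M] [ChartedSpace (EuclideanSpace ℝ (Fin m)) M]
  {V : M → Type*} [TopologicalSpace (TotalSpace (ι → ℝ) V)]
  [∀ x, AddCommGroup (V x)] [∀ x, Module ℝ (V x)] [∀ x, TopologicalSpace (V x)]
  [∀ x, IsTopologicalAddGroup (V x)] [∀ x, ContinuousSMul ℝ (V x)]
  [FiberBundle (ι → ℝ) V] [VectorBundle ℝ (ι → ℝ) V]
  [IsManifold (𝓡 m) ∞ M] [ContMDiffVectorBundle ∞ (ι → ℝ) V (𝓡 m)]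
  {G : Grading (ι := ι) V}
  {n : ℕ} {S : Set (Fin n → ℝ)} {h : (Fin n → ℝ) → ℝ → M}

/-- Right multiplication by a matrix. -/
def rightMul (A : Mat ι) : Mat ι →L[ℝ] Mat ι :=
  LinearMap.toContinuousLinearMap ((mulB ι).flip A)

theorem rightMul_mulB (A b f : Mat ι) : rightMul A (mulB ι b f) = mulB ι b (rightMul A f) :=
  mul_assoc b f A

variable (n) in
/-- The direction of the time. -/
def timeDir : (Fin n → ℝ) × ℝ := (0, 1)

namespace Superconnection

variable (D : Superconnection (ι := ι) (m := m) G)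

/-- The transport matrices, as forms on the product of the parameter space and the time. -/
def hatMat (S : Set (Fin n → ℝ)) (h : (Fin n → ℝ) → ℝ → M) (c₀ c : M) (p : ℕ)
    (z : (Fin n → ℝ) × ℝ) : ((Fin n → ℝ) × ℝ) [⋀^Fin p]→L[ℝ] Mat ι :=
  pull (ContinuousLinearMap.fst ℝ (Fin n → ℝ) ℝ) (fun p => D.parMat S h c₀ c p z) p

/-- The failure of the transport to intertwine the superconnections. -/
def pathDefect (S : Set (Fin n → ℝ)) (h : (Fin n → ℝ) → ℝ → M) (x₀ c : M) :
    ∀ (p : ℕ) (_ : (Fin n → ℝ) × ℝ), ((Fin n → ℝ) × ℝ) [⋀^Fin p]→L[ℝ] Mat ι :=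
  defect (mulB ι) (rightMul (D.A₀mat x₀)) (D.extMat S h c) (D.hatMat S h x₀ c)

/-- A smooth family of paths, parametrized by an open set, starting at `x₀`. -/
structure IsOpenFamily (m : ℕ) {n : ℕ} {M : Type*} [TopologicalSpace M]
    [ChartedSpace (EuclideanSpace ℝ (Fin m)) M] (S : Set (Fin n → ℝ)) (h : (Fin n → ℝ) → ℝ → M)
    (x₀ : M) : Prop where
  isOpen : IsOpen S
  smooth : ContMDiffOn 𝓘(ℝ, (Fin n → ℝ) × ℝ) (𝓡 m) ∞ (fun z => h z.1 z.2) (S ×ˢ Icc 0 1)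
  source : ∀ u ∈ S, h u 0 = x₀

variable {D} {x₀ : M} (hf : IsOpenFamily m S h x₀) {c c' : M} {z : (Fin n → ℝ) × ℝ}

theorem contDiffAt_hatMat (hf : IsOpenFamily m S h x₀) (hz : z.1 ∈ S) (hz' : z.2 ∈ Icc (-1 : ℝ) 2)
    (hc : extend h z ∈ base ι V c) (p : ℕ) : ContDiffAt ℝ ∞ (D.hatMat S h x₀ c p) z :=
  (ContinuousAlternatingMap.compContinuousLinearMapCLM (ContinuousLinearMap.fst ℝ (Fin n → ℝ) ℝ) :
    ((Fin n → ℝ) [⋀^Fin p]→L[ℝ] Mat ι) →L[ℝ]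
      (((Fin n → ℝ) × ℝ) [⋀^Fin p]→L[ℝ] Mat ι)).contDiff.contDiffAt.comp z
      (D.contDiffAt_parMat hf.isOpen hf.smooth hf.source hz z.2 hz' c hc p)

theorem iota_hatMat (z : (Fin n → ℝ) × ℝ) (p : ℕ) :
    iota (timeDir n) (fun p => D.hatMat S h x₀ c p z) p = 0 := by
  ext1 w
  exact (D.parMat S h x₀ c (p + 1) z).map_coord_zero (m := fun i =>
    ContinuousLinearMap.fst ℝ (Fin n → ℝ) ℝ (Matrix.vecCons (timeDir n) w i)) 0 rfl

theorem hatMat_gauge (hc : extend h z ∈ base ι V c) (p : ℕ) :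
    D.hatMat S h x₀ c' p z = star (mulB ι) (zform (transition ι V c c' (extend h z)))
      (fun p => D.hatMat S h x₀ c p z) p := by
  have h1 : (fun p => D.parMat S h x₀ c' p z) =
    star (mulB ι) (zform (transition ι V c c' (extend h z))) (fun p => D.parMat S h x₀ c p z) :=
    funext fun p => D.parMat_gauge hc p
  rw [hatMat, h1, pull_star]
  refine star_congr _ (fun i _ => ?_) fun i _ => rfl
  rcases i with _ | i <;> rfl

theorem fderiv_hatMat (hf : IsOpenFamily m S h x₀) (hz : z.1 ∈ S) (hz' : z.2 ∈ Icc (-1 : ℝ) 2)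
    (hc : extend h z ∈ base ι V c) (p : ℕ) :
    fderiv ℝ (D.hatMat S h x₀ c p) z (timeDir n) = star (mulB ι)
      (iota (timeDir n) fun p => D.extMat S h c p z) (fun p => D.hatMat S h x₀ c p z) p := by
  let L : ((Fin n → ℝ) [⋀^Fin p]→L[ℝ] Mat ι) →L[ℝ] (((Fin n → ℝ) × ℝ) [⋀^Fin p]→L[ℝ] Mat ι) :=
    ContinuousAlternatingMap.compContinuousLinearMapCLM (ContinuousLinearMap.fst ℝ (Fin n → ℝ) ℝ)
  have hY := (D.contDiffAt_parMat hf.isOpen hf.smooth hf.source hz z.2 hz' c hc p).differentiableAt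
    (by simp)
  have h1 : fderiv ℝ (D.hatMat S h x₀ c p) z (timeDir n) =
      L (fderiv ℝ (D.parMat S h x₀ c p) z (timeDir n)) := by
    have h2 := (L.hasFDerivAt.comp z hY.hasFDerivAt).fderiv
    exact congrArg (fun T => T (timeDir n)) h2
  have hb : h z.1 0 ∈ base ι V x₀ := by
    rw [hf.source _ hz]; exact FiberBundle.mem_baseSet_trivializationAt' _
  have h2 : HasDerivAt (fun t : ℝ => (z.1, t)) (timeDir n) z.2 :=
    (hasDerivAt_const _ _).prodMk (hasDerivAt_id _)
  have h3 := (hY.hasFDerivAt.comp_hasDerivAt (f := fun t : ℝ => (z.1, t)) z.2 h2).unique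
    (D.hasDerivAt_parMat hf.isOpen hf.smooth hz hb hc p)
  rw [h1, h3]
  have h4 := pull_star (mulB ι) (ContinuousLinearMap.fst ℝ (Fin n → ℝ) ℝ)
    (pull (ContinuousLinearMap.inl ℝ (Fin n → ℝ) ℝ) (iota (timeDir n)
        fun p => D.extMat S h c p z)) (fun p => D.parMat S h x₀ c p z) p
  refine h4.trans (star_congr _ (fun i _ => ?_) fun i _ => rfl)
  ext1 w
  -- Projecting a vector to the parameter directions changes it by a multiple of the time direction,
  -- which a form contracted with that direction does not notice.
  have hP : ∀ w : (Fin n → ℝ) × ℝ, ∃ r : ℝ, ((w.1, 0) : (Fin n → ℝ) × ℝ) = w + r • timeDir n :=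
    fun w => ⟨-w.2, by ext <;> simp [timeDir]⟩
  exact iota_apply_of_sub_mem (timeDir n) hP (fun p => D.extMat S h c p z) i w

theorem extMat_gauge (hf : IsOpenFamily m S h x₀) (hz : z.1 ∈ S) (hc : extend h z ∈ base ι V c)
    (hc' : extend h z ∈ base ι V c') (p : ℕ) :
    star (mulB ι) (fun p => D.extMat S h c' p z) (zform (transition ι V c c' (extend h z))) p =
      star (mulB ι) (zform (transition ι V c c' (extend h z))) (fun p => D.extMat S h c p z) p +
        dext (fun p z => zform (transition ι V c c' (extend h z)) p) p z := by
  refine D.connMat_gauge hc hc' (tangentLinear m (extend h) (S ×ˢ univ) z)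
    (g := fun z => transition ι V c c' (extend h z)) rfl (fun w => ?_) p
  have h1 : HasMFDerivAt 𝓘(ℝ, (Fin n → ℝ) × ℝ) (𝓡 m) (extend h) z
      (mfderivWithin 𝓘(ℝ, (Fin n → ℝ) × ℝ) (𝓡 m) (extend h) (S ×ˢ univ) z) := by
    rw [mfderivWithin_of_mem_nhds ((hf.isOpen.prod isOpen_univ).mem_nhds ⟨hz, mem_univ _⟩)]
    exact ((contMDiffAt_extend hf.isOpen hf.smooth hz).mdifferentiableAt (by simp)).hasMFDerivAt
  have h2 : HasFDerivAt (fun z => transition ι V c c' (extend h z))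
      ((mvfderiv (𝓡 m) (transition ι V c c') (extend h z)).comp
        (mfderivWithin 𝓘(ℝ, (Fin n → ℝ) × ℝ) (𝓡 m) (extend h) (S ×ˢ univ) z) :
        (Fin n → ℝ) × ℝ →L[ℝ] Mat ι) z :=
    hasMFDerivAt_iff_hasFDerivAt.1 (((contMDiffAt_transition (m := m) hc hc').mdifferentiableAt
      (by simp)).hasMFDerivAt.comp z h1)
  exact congrArg (fun T : (Fin n → ℝ) × ℝ →L[ℝ] Mat ι => T w) h2.fderiv

/-- The defect is multiplied by an invertible matrix when the frame changes, so its vanishing can be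
propagated from one patch to the next. -/
theorem pathDefect_gauge (hf : IsOpenFamily m S h x₀) (hz : z.1 ∈ S) (hz' : z.2 ∈ Icc (-1 : ℝ) 2)
    (hc : extend h z ∈ base ι V c) (hc' : extend h z ∈ base ι V c') (p : ℕ) :
    D.pathDefect S h x₀ c' p z = star (mulB ι) (zform (transition ι V c c' (extend h z)))
      (fun p => D.pathDefect S h x₀ c p z) p := by
  refine Eq.trans ?_ (defect_gauge mulB_assoc (rightMul_mulB (D.A₀mat x₀))
    ((contDiffAt_transition_extend hf.isOpen hf.smooth hz hc hc').of_le (by simp))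
    (fun p => (contDiffAt_hatMat hf hz hz' hc p).differentiableAt (by simp))
    (fun p => extMat_gauge hf hz hc hc' p) p)
  refine defect_congr (fun _ => rfl) (fun p => ?_) p
  filter_upwards [eventually_extend_mem hf.isOpen hf.smooth hz
    (trivializationAt (ι → ℝ) V c).open_baseSet hc] with z' hz'
  exact hatMat_gauge hz'.2 p

theorem fderiv_pathDefect (hf : IsOpenFamily m S h x₀) (hz : z.1 ∈ S)
    (hz' : z.2 ∈ Ioo (-1 : ℝ) 2) (hc : extend h z ∈ patch ι m V c) (p : ℕ) :
    fderiv ℝ (D.pathDefect S h x₀ c p) z (timeDir n) =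
      star (mulB ι) (eps (iota (timeDir n) fun p => D.extMat S h c p z))
        (fun p => D.pathDefect S h x₀ c p z) p +
      star (mulB ι) (iota (timeDir n) fun p => curv (mulB ι) (D.extMat S h c) p z)
        (fun p => D.hatMat S h x₀ c p z) p := by
  have hev : ∀ᶠ z' in nhds z, (z'.1 ∈ S ∧ extend h z' ∈ patch ι m V c) ∧ z'.2 ∈ Ioo (-1 : ℝ) 2 :=
    (eventually_extend_mem hf.isOpen hf.smooth hz (isOpen_patch c) hc).and
      ((isOpen_Ioo.preimage continuous_snd).mem_nhds hz')
  refine fderiv_defect mulB_assoc (rightMul_mulB (D.A₀mat x₀))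
    (fun p => (D.contDiffAt_extMat hf.isOpen hf.smooth hz hc p).of_le (by simp))
    (fun p => (contDiffAt_hatMat hf hz (Ioo_subset_Icc_self hz') hc.2 p).of_le (mod_cast le_top : ((2 : ℕ∞) : WithTop ℕ∞) ≤ ∞))
    (Filter.Eventually.of_forall fun z p => iota_hatMat z p) ?_ ?_ p
  · filter_upwards [hev] with z' h' p
    exact (contDiffAt_hatMat hf h'.1.1 (Ioo_subset_Icc_self h'.2) h'.1.2.2 p).differentiableAt
      (by simp)
  · filter_upwards [hev] with z' h' p
    exact fderiv_hatMat hf h'.1.1 (Ioo_subset_Icc_self h'.2) h'.1.2.2 p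

/-- Where the family is locally constant, its derivative is zero and every form of positive degree
pulls back to zero. Only A₀ remains, and this is how A₀ at the end points enters the equations on
the path space. -/
theorem extMat_of_eventually_const (hz : z.1 ∈ S) (hS : IsOpen S) {x : M}
    (hx : ∀ᶠ z' in nhds z, extend h z' = x) (p : ℕ) :
    D.extMat S h x p z = zform (D.A₀mat x) p := by
  have h0 : tangentLinear m (extend h) (S ×ˢ univ) z = 0 := by
    have h1 : HasMFDerivAt 𝓘(ℝ, (Fin n → ℝ) × ℝ) (𝓡 m) (extend h) z
        (0 : (Fin n → ℝ) × ℝ →L[ℝ] EuclideanSpace ℝ (Fin m)) :=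
      (hasMFDerivAt_const x z).congr_of_eventuallyEq hx
    refine LinearMap.ext fun w => ?_
    have h2 : mfderivWithin 𝓘(ℝ, (Fin n → ℝ) × ℝ) (𝓡 m) (extend h) (S ×ˢ univ) z =
        (0 : (Fin n → ℝ) × ℝ →L[ℝ] EuclideanSpace ℝ (Fin m)) := by
      rw [mfderivWithin_of_mem_nhds ((hS.prod isOpen_univ).mem_nhds ⟨hz, mem_univ _⟩)]
      exact h1.mfderiv
    exact congrArg (fun T : (Fin n → ℝ) × ℝ →L[ℝ] EuclideanSpace ℝ (Fin m) => T w) h2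
  have key : ∀ (y : M), y = x → ∀ L : ((Fin n → ℝ) × ℝ) →ₗ[ℝ] TangentSpace (𝓡 m) y, L = 0 →
      D.connMat x y L p = zform (D.A₀mat x) p := by
    rintro y rfl L rfl
    ext1 w
    rcases p with _ | p
    · change tw 0 • toMat (ι := ι) y y y y (D.A 0 y _) = toMat (ι := ι) y y y y (D.A 0 y ![])
      rw [tw_zero, one_smul]
      congr 2
      exact Subsingleton.elim _ _
    · exact (D.formMat y (p + 1) y).map_coord_zero 0 rfl
  exact key _ hx.self_of_nhds _ h0

end Superconnection

end Families

section Algebra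

variable {ι : Type} [Fintype ι] [DecidableEq ι]
  {X Y : Type*} [NormedAddCommGroup X] [NormedSpace ℝ X] [FiniteDimensional ℝ X]
  [NormedAddCommGroup Y] [NormedSpace ℝ Y] [FiniteDimensional ℝ Y]

theorem contDiffAt_defect {A : Mat ι} {a Y : ∀ n, X → X [⋀^Fin n]→L[ℝ] Mat ι} {x : X}
    (ha : ∀ n, ContDiffAt ℝ ∞ (a n) x) (hY : ∀ n, ContDiffAt ℝ ∞ (Y n) x) (n : ℕ) :
    ContDiffAt ℝ ∞ (defect (mulB ι) (rightMul A) a Y n) x := by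
  refine ((contDiffAt_star (mulB ι) n ha hY).sub ?_).sub (contDiffAt_dext hY (by simp) n)
  have h : ContDiffAt ℝ ∞ (fun x => (ContinuousLinearMap.compContinuousAlternatingMapCLM ℝ X (Mat ι)
    (Mat ι) (Fin n) (rightMul A)) (Y n x)) x :=
    (ContinuousLinearMap.contDiff _).contDiffAt.comp x (hY n)
  exact ContDiffAt.const_smul ((-1 : ℝ) ^ n) h

theorem pull_zform (f : Y →L[ℝ] X) (A : Mat ι) (n : ℕ) :
    pull f (zform A) n = zform A n := by
  rcases n with _ | n <;> rfl

theorem defect_pull (A : Mat ι) {f : Y → X} {a Y' : ∀ n, X → X [⋀^Fin n]→L[ℝ] Mat ι} {y : Y}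
    (hf : ContDiffAt ℝ 2 f y) (hY : ∀ n, DifferentiableAt ℝ (Y' n) (f y)) (n : ℕ) :
    defect (mulB ι) (rightMul A) (fun n y => pull (fderiv ℝ f y) (fun n => a n (f y)) n)
      (fun n y => pull (fderiv ℝ f y) (fun n => Y' n (f y)) n) n y =
    pull (fderiv ℝ f y) (fun n => defect (mulB ι) (rightMul A) a Y' n (f y)) n := by
  have h : ∀ n, pull (fderiv ℝ f y) (fun n => defect (mulB ι) (rightMul A) a Y' n (f y)) n =
      pull (fderiv ℝ f y) (star (mulB ι) (fun n => a n (f y)) (fun n => Y' n (f y))) n -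
      pull (fderiv ℝ f y) (eps fun n => (rightMul A).compContinuousAlternatingMap (Y' n (f y))) n -
      pull (fderiv ℝ f y) (fun n => dext Y' n (f y)) n := fun n => rfl
  rw [h, ← dext_pull hf hY, pull_star]
  rfl

theorem defect_zform_one (A : Mat ι) (x : X) (n : ℕ) :
    defect (mulB ι) (rightMul A) (fun n _ => zform A n) (fun n _ => zform (1 : Mat ι) n) n x = 0 := by
  have h1 : dext (fun n (_ : X) => zform (X := X) (1 : Mat ι) n) n x = 0 := by
    by_cases hn : n = 1
    · subst hn
      rw [dext_zform_one (fun _ : X => (1 : Mat ι)) x]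
      rw [fderiv_fun_const]
      rfl
    · exact dext_zform_of_ne (fun _ : X => (1 : Mat ι)) x hn
  have h2 : (fun n => (rightMul A).compContinuousAlternatingMap (zform (X := X) (1 : Mat ι) n)) =
      zform A := by
    funext n
    rcases n with _ | n
    · ext1 w
      exact one_mul A
    · ext1 w
      exact map_zero (rightMul A)
  rw [defect, h1, h2, eps_zform, star_zform_left, sub_zero]
  rcases n with _ | n
  · ext1 w
    change A * 1 - A = 0
    rw [mul_one, sub_self]
  · ext1 w
    change A * 0 - 0 = 0
    rw [mul_zero, sub_self]

end Algebra

/-! ### The curvature in a chart, and the passage from structure equations to path spaces -/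

section Families

variable {ι : Type} [Fintype ι] [DecidableEq ι] {m : ℕ}
  {M : Type*} [TopologicalSpace M] [ChartedSpace (EuclideanSpace ℝ (Fin m)) M]
  {V : M → Type*} [TopologicalSpace (TotalSpace (ι → ℝ) V)]
  [∀ x, AddCommGroup (V x)] [∀ x, Module ℝ (V x)] [∀ x, TopologicalSpace (V x)]
  [∀ x, IsTopologicalAddGroup (V x)] [∀ x, ContinuousSMul ℝ (V x)]
  [FiberBundle (ι → ℝ) V] [VectorBundle ℝ (ι → ℝ) V]
  [IsManifold (𝓡 m) ∞ M] [ContMDiffVectorBundle ∞ (ι → ℝ) V (𝓡 m)]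
  {G : Grading (ι := ι) V}
  {n : ℕ} {S : Set (Fin n → ℝ)} {h : (Fin n → ℝ) → ℝ → M}

namespace Superconnection

variable (D : Superconnection (ι := ι) (m := m) G)

/-- The curvature of `D` in the chart at `c`. -/
def chartCurv (c : M) (q : ℕ) (y : EuclideanSpace ℝ (Fin m)) :
    EuclideanSpace ℝ (Fin m) [⋀^Fin q]→L[ℝ] Mat ι :=
  curv (mulB ι) (D.signedForm c) q y

/-- The two sides of S_q differ from the terms of the curvature in degree q + 1 by the common sign
`-tw (q + 1)`. For the products this is `tw_add` together with the sign ε in the first factor; for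
the derivative it is `tw_succ`. -/
theorem chartCurv_eq (c : M) (y : EuclideanSpace ℝ (Fin m)) (q : ℕ) :
    (D.chartCurv c (q + 1) y).toAlternatingMap = -tw (q + 1) •
      ((-1 : ℝ) ^ (q + 1) • (extDeriv (D.chartForm c q) y).toAlternatingMap -
      ∑ i : Fin (q + 1 + 1), (-1 : ℝ) ^ ((i : ℕ) * (q + 1 - i + 1)) •
        wedge (LinearMap.mul ℝ ((ι → ℝ) →L[ℝ] (ι → ℝ))) (Nat.add_sub_of_le i.is_le)
          (D.chartForm c i y).toAlternatingMap (D.chartForm c (q + 1 - i) y).toAlternatingMap) := by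
  have h1 : extDeriv (D.signedForm c q) y = tw q • extDeriv (D.chartForm c q) y :=
    extDeriv_smul (tw q) (D.chartForm c q)
  have h2 : ∀ i : Fin (q + 1 + 1), wedge (mulB ι) (Nat.add_sub_of_le i.is_le)
      (eps (fun n => D.signedForm c n y) i).toAlternatingMap
      (D.signedForm c (q + 1 - i) y).toAlternatingMap =
      (tw (q + 1) * (-1 : ℝ) ^ ((i : ℕ) * (q + 1 - i + 1))) •
        wedge (mulB ι) (Nat.add_sub_of_le i.is_le)
          (D.chartForm c i y).toAlternatingMap (D.chartForm c (q + 1 - i) y).toAlternatingMap :=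
      fun i => by
    have h3 : ∀ (α : EuclideanSpace ℝ (Fin m) [⋀^Fin i]→ₗ[ℝ] Mat ι)
        (β : EuclideanSpace ℝ (Fin m) [⋀^Fin (q + 1 - i)]→ₗ[ℝ] Mat ι) (r r' : ℝ),
        wedgeₗ (mulB ι) (Nat.add_sub_of_le i.is_le) (r • α) (r' • β) =
          r' • r • wedgeₗ (mulB ι) (Nat.add_sub_of_le i.is_le) α β := fun α β r r' => by
      rw [map_smul, LinearMap.map_smul₂]
    have h4 := h3 (D.chartForm c i y).toAlternatingMap (D.chartForm c (q + 1 - i) y).toAlternatingMap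
      ((-1 : ℝ) ^ (i : ℕ) * tw i) (tw (q + 1 - i))
    rw [smul_smul] at h4
    have h5 := tw_add i (q + 1 - i)
    rw [Nat.add_sub_of_le i.is_le] at h5
    have h6 : tw (q + 1) * (-1 : ℝ) ^ ((i : ℕ) * (q + 1 - i + 1)) =
        tw (q + 1 - i) * ((-1 : ℝ) ^ (i : ℕ) * tw i) := by
      rw [h5, mul_add, pow_add, mul_one]
      have : ((-1 : ℝ) ^ ((i : ℕ) * (q + 1 - i))) * (-1 : ℝ) ^ ((i : ℕ) * (q + 1 - i)) = 1 := by
        rw [← mul_pow]; norm_num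
      linear_combination (tw i * tw (q + 1 - i) * (-1 : ℝ) ^ (i : ℕ)) * this
    rw [h6]
    refine Eq.trans ?_ h4
    change wedgeₗ (mulB ι) _ (((-1 : ℝ) ^ (i : ℕ)) • (tw i • (D.chartForm c i y).toAlternatingMap))
      (tw (q + 1 - i) • (D.chartForm c (q + 1 - i) y).toAlternatingMap) = _
    rw [smul_smul]
  have h7 : (D.chartCurv c (q + 1) y) = tw q • extDeriv (D.chartForm c q) y +
      ∑ i : Fin (q + 1 + 1), toCont ((tw (q + 1) * (-1 : ℝ) ^ ((i : ℕ) * (q + 1 - i + 1))) •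
        wedge (mulB ι) (Nat.add_sub_of_le i.is_le)
          (D.chartForm c i y).toAlternatingMap (D.chartForm c (q + 1 - i) y).toAlternatingMap) := by
    rw [chartCurv, curv, star_eq_sum_fin, ← h1]
    simp only [h2]
    rfl
  have h8 : -tw (q + 1) * (-1) ^ (q + 1) = tw q := by
    rw [tw_succ, pow_succ]
    have : (-1 : ℝ) ^ q * (-1 : ℝ) ^ q = 1 := by rw [← mul_pow]; norm_num
    linear_combination (tw q) * this
  ext1 w
  change D.chartCurv c (q + 1) y w = -tw (q + 1) • ((-1 : ℝ) ^ (q + 1) •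
    extDeriv (D.chartForm c q) y w - (∑ i : Fin (q + 1 + 1),
      (-1 : ℝ) ^ ((i : ℕ) * (q + 1 - i + 1)) • wedge (mulB ι) (Nat.add_sub_of_le i.is_le)
          (D.chartForm c i y).toAlternatingMap (D.chartForm c (q + 1 - i) y).toAlternatingMap) w)
  rw [h7, alternatingMap_sum_apply, smul_sub, smul_smul, h8, sub_eq_add_neg, Finset.smul_sum,
    ← Finset.sum_neg_distrib]
  change tw q • extDeriv (D.chartForm c q) y w + (∑ i : Fin (q + 1 + 1), toCont
    ((tw (q + 1) * (-1 : ℝ) ^ ((i : ℕ) * (q + 1 - i + 1))) •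
        wedge (mulB ι) (Nat.add_sub_of_le i.is_le)
          (D.chartForm c i y).toAlternatingMap (D.chartForm c (q + 1 - i) y).toAlternatingMap)) w = _
  rw [ContinuousAlternatingMap.sum_apply]
  congr 1
  refine Finset.sum_congr rfl fun i _ => ?_
  rw [toCont_apply, AlternatingMap.smul_apply, AlternatingMap.smul_apply, neg_smul, neg_neg, smul_smul]

theorem structureEq_iff (q : ℕ) (z : M) : D.StructureEq q z ↔ ∀ c, z ∈ patch ι m V c →
    D.chartCurv c (q + 1) (chartAt (EuclideanSpace ℝ (Fin m)) c z) = 0 := by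
  have key : ∀ c, z ∈ patch ι m V c →
      (D.chartCurv c (q + 1) (chartAt (EuclideanSpace ℝ (Fin m)) c z) = 0 ↔
      (-1 : ℝ) ^ (q + 1) • (extDeriv (D.chartForm c q)
        (chartAt (EuclideanSpace ℝ (Fin m)) c z)).toAlternatingMap =
      ∑ i : Fin (q + 1 + 1), (-1 : ℝ) ^ ((i : ℕ) * (q + 1 - i + 1)) •
        wedge (LinearMap.mul ℝ ((ι → ℝ) →L[ℝ] (ι → ℝ))) (Nat.add_sub_of_le i.is_le)
          (D.chartForm c i (chartAt (EuclideanSpace ℝ (Fin m)) c z)).toAlternatingMap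
          (D.chartForm c (q + 1 - i)
            (chartAt (EuclideanSpace ℝ (Fin m)) c z)).toAlternatingMap) := fun c hc => by
    rw [← sub_eq_zero (a := (-1 : ℝ) ^ (q + 1) • _)]
    have h1 := D.chartCurv_eq c (chartAt (EuclideanSpace ℝ (Fin m)) c z) q
    constructor
    · intro h0
      rw [h0] at h1
      exact (smul_eq_zero.1 h1.symm).resolve_left (neg_ne_zero.2 (tw_ne_zero _))
    · intro h0
      rw [h0, smul_zero] at h1
      exact ContinuousAlternatingMap.toAlternatingMap_injective h1
  exact ⟨fun H c hc => (key c hc).2 (H c hc.1 hc.2), fun H c h1 h2 => (key c ⟨h1, h2⟩).1 (H c ⟨h1, h2⟩)⟩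

variable {D} {x₀ : M} {c : M} {z : (Fin n → ℝ) × ℝ}

/-- The curvature commutes with pull-backs, so the source term in the evolution of the defect is
governed by the structure equations at the points of the path. -/
theorem curv_extMat (hf : IsOpenFamily m S h x₀) (hz : z.1 ∈ S) (hc : extend h z ∈ patch ι m V c)
    (q : ℕ) : curv (mulB ι) (D.extMat S h c) q z =
      pull (fderiv ℝ (chartAt (EuclideanSpace ℝ (Fin m)) c ∘ extend h) z)
        (fun q => D.chartCurv c q (chartAt (EuclideanSpace ℝ (Fin m)) c (extend h z))) q := by
  have hO : IsOpen (S ×ˢ (univ : Set ℝ)) := hf.isOpen.prod isOpen_univ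
  have h1 := contDiffWithinAt_chart_comp (contMDiffOn_extend hf.smooth) ⟨hz, mem_univ z.2⟩ hc.1
  have h2 := h1.contDiffAt (hO.mem_nhds ⟨hz, mem_univ z.2⟩)
  refine Eq.trans (curv_congr (mulB ι) (fun q => ?_) q) (curv_pull (mulB ι)
    (f := chartAt (EuclideanSpace ℝ (Fin m)) c ∘ extend h) (a := D.signedForm c)
    (h2.of_le (mod_cast le_top : ((2 : ℕ∞) : WithTop ℕ∞) ≤ ∞))
    (fun q => (D.contDiffAt_signedForm (chart_mem_chartDomain hc) q).differentiableAt (by simp)) q)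
  filter_upwards [eventually_extend_mem hf.isOpen hf.smooth hz (isOpen_patch c) hc] with z' hz'
  have h3 := D.pullMat_eq (contMDiffOn_extend hf.smooth) hO.uniqueDiffOn ⟨hz'.1, mem_univ z'.2⟩
    hz'.2.1 q
  rw [fderivWithin_of_mem_nhds (hO.mem_nhds ⟨hz'.1, mem_univ z'.2⟩)] at h3
  exact h3

theorem contDiffAt_pathDefect (hf : IsOpenFamily m S h x₀) (hz : z.1 ∈ S)
    (hz' : z.2 ∈ Icc (-1 : ℝ) 2) (hc : extend h z ∈ patch ι m V c) (p : ℕ) :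
    ContDiffAt ℝ ∞ (D.pathDefect S h x₀ c p) z :=
  contDiffAt_defect (fun p => D.contDiffAt_extMat hf.isOpen hf.smooth hz hc p)
    (fun p => contDiffAt_hatMat hf hz hz' hc.2 p) p

theorem hasDerivAt_pathDefect (hf : IsOpenFamily m S h x₀) {u : Fin n → ℝ} (hu : u ∈ S) {t : ℝ}
    (ht : t ∈ Ioo (-1 : ℝ) 2) (hc : extend h (u, t) ∈ patch ι m V c) (p : ℕ) :
    HasDerivAt (fun t => D.pathDefect S h x₀ c p (u, t))
      (star (mulB ι) (eps (iota (timeDir n) fun p => D.extMat S h c p (u, t)))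
        (fun p => D.pathDefect S h x₀ c p (u, t)) p +
      star (mulB ι) (iota (timeDir n) fun p => curv (mulB ι) (D.extMat S h c) p (u, t))
        (fun p => D.hatMat S h x₀ c p (u, t)) p) t := by
  rw [← fderiv_pathDefect hf hu ht hc]
  have h1 := ((contDiffAt_pathDefect (D := D) hf (z := (u, t)) hu (Ioo_subset_Icc_self ht) hc
    p).differentiableAt (by simp)).hasFDerivAt
  have h2 : HasDerivAt (fun t : ℝ => (u, t)) (timeDir n) t :=
    (hasDerivAt_const _ _).prodMk (hasDerivAt_id _)
  exact h1.comp_hasDerivAt t h2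

/-- At negative times the path rests at `x₀` and the transport is the identity, so the two terms
with A₀ cancel. -/
theorem pathDefect_init (hf : IsOpenFamily m S h x₀) {u : Fin n → ℝ} (hu : u ∈ S) {t : ℝ}
    (ht : t ∈ Ioo (-1 : ℝ) 0) (p : ℕ) : D.pathDefect S h x₀ x₀ p (u, t) = 0 := by
  have hev : ∀ᶠ z in nhds (u, t), z.1 ∈ S ∧ z.2 < 0 :=
    (hf.isOpen.prod isOpen_Iio).mem_nhds ⟨hu, ht.2⟩
  have hext : ∀ z : (Fin n → ℝ) × ℝ, z.1 ∈ S ∧ z.2 < 0 → extend h z = x₀ := fun z hz => by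
    simp only [extend, Real.smoothTransition.zero_of_nonpos hz.2.le, hf.source z.1 hz.1]
  refine (defect_congr (fun p => extMat_of_eventually_const (z := (u, t)) hu hf.isOpen
    (hev.mono hext) p) (fun p => ?_) p).trans (defect_zform_one (D.A₀mat x₀) (u, t) p)
  filter_upwards [hev] with z hz
  have h1 : (fun p => D.parMat S h x₀ x₀ p z) = zform 1 := funext fun p =>
    D.parMat_of_nonpos hf.isOpen hf.smooth hz.1 (by
      rw [hf.source _ hz.1]; exact FiberBundle.mem_baseSet_trivializationAt' _) hz.2.le p
  rw [hatMat, h1, pull_zform]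

theorem pathDefect_final (hf : IsOpenFamily m S h x₀) {x₁ : M} (hx₁ : ∀ u ∈ S, h u 1 = x₁)
    {u : Fin n → ℝ} (hu : u ∈ S) {t : ℝ} (ht : t ∈ Ioo (1 : ℝ) 2) (p : ℕ) :
    D.pathDefect S h x₀ x₁ p (u, t) = pull (ContinuousLinearMap.fst ℝ (Fin n → ℝ) ℝ)
      (fun p => defect (mulB ι) (rightMul (D.A₀mat x₀)) (fun p _ => zform (D.A₀mat x₁) p)
        (fun p u => tw p • D.Psi S h x₀ x₁ p u) p u) p := by
  have hev : ∀ᶠ z in nhds (u, t), z.1 ∈ S ∧ 1 < z.2 :=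
    (hf.isOpen.prod isOpen_Ioi).mem_nhds ⟨hu, ht.1⟩
  have hext : ∀ z : (Fin n → ℝ) × ℝ, z.1 ∈ S ∧ 1 < z.2 → extend h z = x₁ := fun z hz => by
    simp only [extend, Real.smoothTransition.one_of_one_le hz.2.le, hx₁ z.1 hz.1]
  have hfst : ∀ z : (Fin n → ℝ) × ℝ, fderiv ℝ (Prod.fst : (Fin n → ℝ) × ℝ → Fin n → ℝ) z =
      ContinuousLinearMap.fst ℝ (Fin n → ℝ) ℝ := fun z => fderiv_fst
  have hdiff : ∀ p, DifferentiableAt ℝ (fun u => tw p • D.Psi S h x₀ x₁ p u) u := fun p => by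
    have h1 := (D.contDiffAt_parMat hf.isOpen hf.smooth hf.source hu t ⟨by linarith [ht.1], ht.2.le⟩
      x₁ (by rw [hext (u, t) ⟨hu, ht.1⟩]; exact FiberBundle.mem_baseSet_trivializationAt' _)
      p).differentiableAt (by simp)
    have h2 : DifferentiableAt ℝ (fun u => D.parMat S h x₀ x₁ p (u, t)) u :=
      DifferentiableAt.comp (f := fun u => (u, t)) u h1
        (differentiableAt_id.prodMk (differentiableAt_const t))
    simpa only [D.parMat_of_one_le ht.1.le] using h2
  have h1 := defect_pull (D.A₀mat x₀) (f := (Prod.fst : (Fin n → ℝ) × ℝ → Fin n → ℝ))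
    (a := fun p _ => zform (D.A₀mat x₁) p) (Y' := fun p u => tw p • D.Psi S h x₀ x₁ p u)
    (y := (u, t)) contDiffAt_fst hdiff p
  simp only [hfst] at h1
  refine Eq.trans (defect_congr (fun p => ?_) (fun p => ?_) p) h1
  · rw [extMat_of_eventually_const (z := (u, t)) hu hf.isOpen (hev.mono hext) p]
    exact (pull_zform _ _ p).symm
  · filter_upwards [hev] with z hz
    have h1 : (fun p => D.parMat S h x₀ x₁ p z) = fun p => tw p • D.Psi S h x₀ x₁ p z.1 :=
      funext fun p => D.parMat_of_one_le hz.2.le p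
    rw [hatMat, h1]

/-- The sign (-1)^(p-1) in `dPsi` is the quotient of `tw p` and `tw (p - 1)`, so a common factor `tw
p` comes out of all three terms. -/
theorem defect_Psi {x₁ : M} {u : Fin n → ℝ} (p : ℕ) (w : Fin p → Fin n → ℝ) :
    defect (mulB ι) (rightMul (D.A₀mat x₀)) (fun p _ => zform (D.A₀mat x₁) p)
      (fun p u => tw p • D.Psi S h x₀ x₁ p u) p u w =
    tw p • ((D.A₀mat x₁).comp (D.Psi S h x₀ x₁ p u w) -
          (-1 : ℝ) ^ p • (D.Psi S h x₀ x₁ p u w).comp (D.A₀mat x₀) -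
        D.dPsi S h x₀ x₁ p u w) := by
  have h1 : dext (fun p u => tw p • D.Psi S h x₀ x₁ p u) p u = tw p • D.dPsi S h x₀ x₁ p u := by
    rcases p with _ | p
    · exact (smul_zero _).symm
    · have h2 : extDeriv (fun u => tw p • D.Psi S h x₀ x₁ p u) u =
          tw p • extDeriv (D.Psi S h x₀ x₁ p) u := extDeriv_smul (tw p) (D.Psi S h x₀ x₁ p)
      refine h2.trans ?_
      rw [dPsi, smul_smul, tw_succ]
      congr 1
      have : (-1 : ℝ) ^ p * (-1 : ℝ) ^ p = 1 := by rw [← mul_pow]; norm_num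
      linear_combination -(tw p) * this
  rw [defect, h1, star_zform_left]
  change D.A₀mat x₁ * (tw p • D.Psi S h x₀ x₁ p u w) -
    (-1 : ℝ) ^ p • ((tw p • D.Psi S h x₀ x₁ p u w) * D.A₀mat x₀) - tw p • D.dPsi S h x₀ x₁ p u w =
    tw p • (D.A₀mat x₁ * D.Psi S h x₀ x₁ p u w -
      (-1 : ℝ) ^ p • (D.Psi S h x₀ x₁ p u w * D.A₀mat x₀) - D.dPsi S h x₀ x₁ p u w)
  rw [mul_smul_comm, smul_mul_assoc, smul_comm, smul_sub, smul_sub]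

/-- The defect at a final time vanishes if and only if the equation on the path space holds. -/
theorem pathDefect_final_eq_zero_iff (hf : IsOpenFamily m S h x₀) {x₁ : M}
    (hx₁ : ∀ u ∈ S, h u 1 = x₁) {u : Fin n → ℝ} (hu : u ∈ S) {t : ℝ} (ht : t ∈ Ioo (1 : ℝ) 2)
    (p : ℕ) : D.pathDefect S h x₀ x₁ p (u, t) = 0 ↔ ∀ w : Fin p → Fin n → ℝ,
      (D.A₀mat x₁).comp (D.Psi S h x₀ x₁ p u w) -
          (-1 : ℝ) ^ p • (D.Psi S h x₀ x₁ p u w).comp (D.A₀mat x₀) = D.dPsi S h x₀ x₁ p u w := by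
  rw [pathDefect_final hf hx₁ hu ht]
  constructor
  · intro H w
    have h1 := congrArg (fun α => α fun i => ((w i, 0) : (Fin n → ℝ) × ℝ)) H
    have h2 := (defect_Psi (D := D) (S := S) (h := h) (x₀ := x₀) (x₁ := x₁) (u := u) p w).symm.trans h1
    exact sub_eq_zero.1 ((smul_eq_zero.1 h2).resolve_left (tw_ne_zero p))
  · intro H
    ext1 w
    refine (defect_Psi (D := D) (S := S) (h := h) (x₀ := x₀) (x₁ := x₁) (u := u) p
      fun i => (w i).1).trans ?_
    rw [H, sub_self, smul_zero]
    rfl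

/-- The defect vanishes if the structure equations hold along the paths. -/
theorem pathDefect_eq_zero (hf : IsOpenFamily m S h x₀) {u : Fin n → ℝ} (hu : u ∈ S) {k : ℕ}
    (hk : ∀ t, ∀ c, extend h (u, t) ∈ patch ι m V c → ∀ q < k,
      D.chartCurv c (q + 1) (chartAt (EuclideanSpace ℝ (Fin m)) c (extend h (u, t))) = 0) :
    ∀ t ∈ Icc (-1 / 2 : ℝ) (3 / 2), ∀ c, extend h (u, t) ∈ base ι V c → ∀ p < k,
      D.pathDefect S h x₀ c p (u, t) = 0 := by
  have hgauge : ∀ t ∈ Icc (-1 / 2 : ℝ) (3 / 2), ∀ c, extend h (u, t) ∈ base ι V c →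
      (∀ p < k, D.pathDefect S h x₀ c p (u, t) = 0) → ∀ c', extend h (u, t) ∈ base ι V c' →
      ∀ p < k, D.pathDefect S h x₀ c' p (u, t) = 0 := fun t ht c hc H c' hc' p hp => by
    rw [pathDefect_gauge hf (z := (u, t)) hu ⟨by linarith [ht.1], by linarith [ht.2]⟩ hc hc' p,
      star_zform_left, H p hp]
    ext1 w
    exact map_zero (mulB ι (transition ι V c c' (extend h (u, t))))
  refine interval_induction ?_ fun t _ => ?_
  · refine hgauge _ ⟨le_rfl, by norm_num⟩ x₀ ?_ fun p _ =>
      pathDefect_init hf hu ⟨by norm_num, by norm_num⟩ p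
    have : extend h (u, (-1 / 2 : ℝ)) = x₀ := by
      simp only [extend]
      rw [Real.smoothTransition.zero_of_nonpos (by norm_num), hf.source u hu]
    rw [this]
    exact FiberBundle.mem_baseSet_trivializationAt' _
  · set c := extend h (u, t)
    have h1 : ∀ᶠ τ in nhds t, extend h (u, τ) ∈ patch ι m V c := by
      have h2 := eventually_extend_mem hf.isOpen hf.smooth (z := (u, t)) hu
        (isOpen_patch (ι := ι) (m := m) (V := V) c) (mem_patch_self c)
      have h3 : Continuous fun τ : ℝ => (u, τ) := by fun_prop
      exact (h3.continuousAt.eventually h2).mono fun τ hτ => hτ.2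
    rw [Metric.eventually_nhds_iff] at h1
    obtain ⟨δ, hδ, h1⟩ := h1
    refine ⟨δ, hδ, fun s s' hs hs' h2 hss h3 H => ?_⟩
    have hmem : ∀ τ ∈ Icc s s', extend h (u, τ) ∈ patch ι m V c := fun τ hτ => h1 (by
      rw [Real.dist_eq, abs_lt]; exact ⟨by linarith [hτ.1], by linarith [hτ.2]⟩)
    have hIoo : ∀ τ ∈ Icc s s', τ ∈ Ioo (-1 : ℝ) 2 := fun τ hτ =>
      ⟨by linarith [hτ.1, hs.1], by linarith [hτ.2, hs'.2]⟩
    refine hgauge s' hs' c (hmem s' (right_mem_Icc.2 hss)).2 fun p hp => ?_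
    obtain ⟨K, rfl⟩ : ∃ K, k = K + 1 := ⟨k - 1, by omega⟩
    refine graded_unique (mulB ι) (K := K) (a := s) (b := s')
      (c := fun p τ => eps (iota (timeDir n) fun p => D.extMat S h c p (u, τ)) p)
      (Y := fun p τ => D.pathDefect S h x₀ c p (u, τ)) (Z := fun p _ => 0) (fun p => ?_)
      (fun p hp τ hτ => ?_) (fun p _ τ _ => ?_) (fun p hp => ?_) p (by omega) s'
      (right_mem_Icc.2 hss)
    · refine fun τ hτ => continuousWithinAt_form fun w => ?_
      have h4 : ContinuousAt (fun τ => D.extMat S h c (p + 1) (u, τ)) τ :=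
        ContinuousAt.comp (f := fun τ : ℝ => (u, τ)) (D.contDiffAt_extMat hf.isOpen hf.smooth hu
          (hmem τ hτ) (p + 1)).continuousAt (by fun_prop)
      have h5 : ContinuousAt (fun τ => D.extMat S h c (p + 1) (u, τ)
          (Matrix.vecCons (timeDir n) w)) τ :=
        (ContinuousAlternatingMap.apply ℝ ((Fin n → ℝ) × ℝ) (Mat ι)
          (Matrix.vecCons (timeDir n) w)).continuous.continuousAt.comp h4
      exact (ContinuousAt.const_smul h5 ((-1 : ℝ) ^ p)).continuousWithinAt
    · refine (hasDerivAt_pathDefect hf hu (hIoo τ hτ) (hmem τ hτ) p).hasDerivWithinAt.congr_deriv ?_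
      -- In degree p the source involves only contractions of curvatures of degree at most p + 1 ≤
      -- k, and these vanish by hypothesis.
      have h5 : star (mulB ι) (iota (timeDir n) fun p => curv (mulB ι) (D.extMat S h c) p (u, τ))
          (fun p => D.hatMat S h x₀ c p (u, τ)) p = 0 := by
        rw [star_congr (mulB ι) (a' := fun _ => 0) (fun i hi => ?_) fun i _ => rfl]
        · exact Finset.sum_eq_zero fun q _ => wdg_zero_left _ _ _ _ _
        · rw [iota, curv_extMat hf hu (hmem τ hτ), pull, hk τ c (hmem τ hτ) i (by omega)]
          rfl
      rw [h5, add_zero]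
    · rw [star_zero_right _ _ fun _ => rfl]
      exact hasDerivWithinAt_const _ _ _
    · exact H c (hmem s (left_mem_Icc.2 hss)).2 p (by omega)

/-- The structure equations imply the equations on the path space. -/
theorem pathSpaceEq_of_structureEq {k : ℕ} {x₁ : M} (hC : ∀ q ≤ k, ∀ z ∈ connectedComponent x₀,
    D.StructureEq q z) {q : ℕ} (hq : q ≤ k) : D.PathSpaceEq q x₀ x₁ := by
  intro n S h hS hh u hu
  have hf : IsOpenFamily m S h x₀ := ⟨hS, hh.smooth, hh.source⟩
  have hcont : Continuous fun t => extend h (u, t) := continuous_iff_continuousAt.2 fun t =>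
    ContinuousAt.comp (f := fun t : ℝ => (u, t)) (g := extend h)
      (contMDiffAt_extend hS hh.smooth (z := (u, t)) hu).continuousAt (by fun_prop)
  have hC' : ∀ t, extend h (u, t) ∈ connectedComponent x₀ := fun t => by
    have h1 : extend h (u, 0) = x₀ := by
      simp only [extend, Real.smoothTransition.zero, hh.source u hu]
    have h2 := (isPreconnected_univ.image _ hcont.continuousOn).subset_connectedComponent
      (mem_image_of_mem _ (mem_univ (0 : ℝ)))
    rw [h1] at h2
    exact h2 (mem_image_of_mem _ (mem_univ t))
  -- Any time strictly between 1 and 2 would do; the path rests at x₁ there.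
  refine (pathDefect_final_eq_zero_iff hf hh.target hu (t := 3 / 2)
    ⟨by norm_num, by norm_num⟩ q).1 ?_
  refine pathDefect_eq_zero hf hu (k := k + 1) (fun t c hc q hq => ?_) (3 / 2)
    ⟨by norm_num, le_rfl⟩ x₁ ?_ q (by omega)
  · exact (D.structureEq_iff q _).1 (hC q (by omega) _ (hC' t)) c hc
  · have : extend h (u, (3 / 2 : ℝ)) = x₁ := by
      simp only [extend]
      rw [Real.smoothTransition.one_of_one_le (by norm_num), hh.target u hu]
    rw [this]
    exact FiberBundle.mem_baseSet_trivializationAt' _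

end Superconnection

end Families

/-! ## Smooth paths -/

/-- With e = `expNegInvGlue` one has e'(1/2) = 4 e(1/2), and the quotient e(x)/(e(x) + e(1 - x))
then has the derivative 8e²/(2e)² = 2. A nonzero velocity at the midpoint is essential for detecting
the curvature there. -/
theorem hasDerivAt_smoothTransition_half : HasDerivAt Real.smoothTransition 2 (1 / 2) := by
  have h1 : HasDerivAt expNegInvGlue (4 * expNegInvGlue (1 / 2)) (1 / 2) := by
    have h2 : HasDerivAt (fun x : ℝ => Real.exp (-x⁻¹)) (Real.exp (-(1 / 2 : ℝ)⁻¹) *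
        -(-((1 / 2 : ℝ) ^ 2)⁻¹)) (1 / 2) := ((hasDerivAt_inv (by norm_num)).neg).exp
    have h3 : expNegInvGlue (1 / 2) = Real.exp (-(1 / 2 : ℝ)⁻¹) := by
      rw [expNegInvGlue, if_neg (by norm_num)]
    rw [h3]
    refine (h2.congr_of_eventuallyEq ?_).congr_deriv (by norm_num; ring)
    filter_upwards [lt_mem_nhds (show (0 : ℝ) < 1 / 2 by norm_num)] with x hx
    rw [expNegInvGlue, if_neg (not_le.2 hx)]
  have hE : expNegInvGlue (1 / 2) ≠ 0 := (expNegInvGlue.pos_of_pos (by norm_num)).ne'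
  have h4 : HasDerivAt (fun x : ℝ => expNegInvGlue (1 - x))
      (4 * expNegInvGlue (1 / 2) * (-1)) (1 / 2) := by
    refine HasDerivAt.comp (h₂ := expNegInvGlue) (h := fun x : ℝ => 1 - x) (1 / 2 : ℝ) ?_
      ((hasDerivAt_id _).const_sub 1)
    rw [show (1 : ℝ) - 1 / 2 = 1 / 2 by norm_num]
    exact h1
  refine (h1.div (h1.add h4) ?_).congr_deriv ?_
  · simp only [Pi.add_apply]
    norm_num [hE]
  · simp only [Pi.add_apply]
    norm_num
    field_simp
    norm_num

section Paths

variable {m : ℕ} {M : Type*} [TopologicalSpace M] [ChartedSpace (EuclideanSpace ℝ (Fin m)) M]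

/-- A smooth path from `x` to `y` which is constant outside of the unit interval. -/
structure IsSmoothPath (m : ℕ) {M : Type*} [TopologicalSpace M]
    [ChartedSpace (EuclideanSpace ℝ (Fin m)) M] (γ : ℝ → M) (x y : M) : Prop where
  smooth : ContMDiff 𝓘(ℝ, ℝ) (𝓡 m) ∞ γ
  left : ∀ t ≤ 0, γ t = x
  right : ∀ t, 1 ≤ t → γ t = y

/-- The concatenation of three paths. -/
def concat (γ₁ γ₂ γ₃ : ℝ → M) (t : ℝ) : M :=
  if t < 2 / 5 then γ₁ (5 * t) else if t ≤ 3 / 5 then γ₂ (5 * t - 2) else γ₃ (5 * t - 4)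

variable {γ₁ γ₂ γ₃ : ℝ → M} {x y z w : M}

/-- The paths are constant outside the unit interval, so the formula of the middle piece is valid on
a neighbourhood of its own interval. The overlaps make the concatenation smooth. -/
theorem concat_of_mem_Ioo (h₁ : IsSmoothPath m γ₁ x y) (h₂ : IsSmoothPath m γ₂ y z)
    (h₃ : IsSmoothPath m γ₃ z w) {t : ℝ} (ht : t ∈ Ioo (1 / 5 : ℝ) (4 / 5)) :
    concat γ₁ γ₂ γ₃ t = γ₂ (5 * t - 2) := by
  unfold concat
  split_ifs with h h'
  · rw [h₁.right _ (by linarith [ht.1]), h₂.left _ (by linarith)]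
  · rfl
  · rw [h₂.right _ (by linarith), h₃.left _ (by linarith [ht.2])]

theorem IsSmoothPath.concat (h₁ : IsSmoothPath m γ₁ x y) (h₂ : IsSmoothPath m γ₂ y z)
    (h₃ : IsSmoothPath m γ₃ z w) : IsSmoothPath m (concat γ₁ γ₂ γ₃) x w where
  smooth t := by
    have hsm : ∀ {γ : ℝ → M} (_ : ContMDiff 𝓘(ℝ, ℝ) (𝓡 m) ∞ γ) (r : ℝ),
        ContMDiff 𝓘(ℝ, ℝ) (𝓡 m) ∞ fun t => γ (5 * t - r) := fun hγ r =>
      hγ.comp (ContDiff.contMDiff (by fun_prop))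
    rcases lt_or_ge t (2 / 5) with h | h
    · refine (hsm h₁.smooth 0 t).congr_of_eventuallyEq ?_
      filter_upwards [gt_mem_nhds h] with τ hτ
      rw [SuperTransport.concat, if_pos hτ, sub_zero]
    rcases lt_or_ge (3 / 5) t with h' | h'
    · refine (hsm h₃.smooth 4 t).congr_of_eventuallyEq ?_
      filter_upwards [lt_mem_nhds h'] with τ hτ
      rw [SuperTransport.concat, if_neg (by linarith), if_neg (by linarith)]
    · refine (hsm h₂.smooth 2 t).congr_of_eventuallyEq ?_
      filter_upwards [Ioo_mem_nhds (show (1 / 5 : ℝ) < t by linarith)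
        (show t < 4 / 5 by linarith)] with τ hτ
      exact concat_of_mem_Ioo h₁ h₂ h₃ hτ
  left t ht := by
    rw [SuperTransport.concat, if_pos (by linarith), h₁.left _ (by linarith)]
  right t ht := by
    rw [SuperTransport.concat, if_neg (by linarith), if_neg (by linarith), h₃.right _ (by linarith)]

/-- A path which is a straight line in the chart at `c`. -/
def chartLine (c : M) (a b : EuclideanSpace ℝ (Fin m)) (t : ℝ) : M :=
  (chartAt (EuclideanSpace ℝ (Fin m)) c).symm (a + Real.smoothTransition t • (b - a))

theorem add_smoothTransition_smul_mem {a b y : EuclideanSpace ℝ (Fin m)} {R : ℝ}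
    (ha : a ∈ Metric.ball y R) (hb : b ∈ Metric.ball y R) (t : ℝ) :
    a + Real.smoothTransition t • (b - a) ∈ Metric.ball y R :=
  (convex_ball y R).add_smul_sub_mem ha hb (smoothTransition_mem_Icc t)

variable [IsManifold (𝓡 m) ∞ M]

theorem isSmoothPath_const (x : M) : IsSmoothPath m (fun _ => x) x x :=
  ⟨contMDiff_const, fun _ _ => rfl, fun _ _ => rfl⟩

theorem isSmoothPath_chartLine {c : M} {a b y : EuclideanSpace ℝ (Fin m)} {R : ℝ}
    (hR : Metric.ball y R ⊆ (chartAt (EuclideanSpace ℝ (Fin m)) c).target)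
    (ha : a ∈ Metric.ball y R) (hb : b ∈ Metric.ball y R) :
    IsSmoothPath m (chartLine c a b) ((chartAt (EuclideanSpace ℝ (Fin m)) c).symm a)
      ((chartAt (EuclideanSpace ℝ (Fin m)) c).symm b) where
  smooth t := by
    have h1 := (contMDiffOn_chart_symm (I := 𝓡 m) (n := ∞) (x := c)).contMDiffAt
      ((chartAt (EuclideanSpace ℝ (Fin m)) c).open_target.mem_nhds
        (hR (add_smoothTransition_smul_mem ha hb t)))
    have h2 : ContDiff ℝ ∞ fun t : ℝ => a + Real.smoothTransition t • (b - a) :=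
      contDiff_const.add (Real.smoothTransition.contDiff.smul contDiff_const)
    exact ContMDiffAt.comp (f := fun t : ℝ => a + Real.smoothTransition t • (b - a)) t h1
      (h2.contMDiff t)
  left t ht := by
    rw [chartLine, Real.smoothTransition.zero_of_nonpos ht, zero_smul, add_zero]
  right t ht := by
    rw [chartLine, Real.smoothTransition.one_of_one_le ht, one_smul, add_sub_cancel]

theorem exists_ball_subset_target (x : M) : ∃ R > 0,
    Metric.ball (chartAt (EuclideanSpace ℝ (Fin m)) x x) R ⊆
      (chartAt (EuclideanSpace ℝ (Fin m)) x).target :=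
  Metric.isOpen_iff.1 (chartAt (EuclideanSpace ℝ (Fin m)) x).open_target _
    (mem_chart_target _ x)

theorem eventually_exists_isSmoothPath (x : M) : ∀ᶠ y in nhds x,
    (∃ γ, IsSmoothPath m γ x y) ∧ ∃ γ, IsSmoothPath m γ y x := by
  obtain ⟨R, hR, h⟩ := exists_ball_subset_target (m := m) x
  have h1 := ((chartAt (EuclideanSpace ℝ (Fin m)) x).continuousAt (mem_chart_source _ x))
    (Metric.ball_mem_nhds _ hR)
  filter_upwards [h1, (chartAt (EuclideanSpace ℝ (Fin m)) x).open_source.mem_nhds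
    (mem_chart_source _ x)] with y hy hy'
  have h2 := isSmoothPath_chartLine h (Metric.mem_ball_self hR) hy
  have h3 := isSmoothPath_chartLine h hy (Metric.mem_ball_self hR)
  rw [OpenPartialHomeomorph.left_inv _ hy',
    OpenPartialHomeomorph.left_inv _ (mem_chart_source _ x)] at h2 h3
  exact ⟨⟨_, h2⟩, ⟨_, h3⟩⟩

/-- The set of points that can be reached by smooth paths is open and closed, since nearby points
are joined by straight lines in a chart. -/
theorem exists_isSmoothPath {x₀ x₁ : M} (h : x₁ ∈ connectedComponent x₀) :
    ∃ γ, IsSmoothPath m γ x₀ x₁ := by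
  have htrans : ∀ {x y z : M}, (∃ γ, IsSmoothPath m γ x y) → (∃ γ, IsSmoothPath m γ y z) →
      ∃ γ, IsSmoothPath m γ x z := fun {x y z} ⟨γ, h1⟩ ⟨γ', h2⟩ =>
    ⟨_, h1.concat (isSmoothPath_const y) h2⟩
  have hcl : IsClopen {y : M | ∃ γ, IsSmoothPath m γ x₀ y} := by
    refine ⟨⟨isOpen_iff_mem_nhds.2 fun y hy => ?_⟩, isOpen_iff_mem_nhds.2 fun y hy => ?_⟩
    · filter_upwards [eventually_exists_isSmoothPath (m := m) y] with y' hy' hc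
      exact hy (htrans hc hy'.2)
    · filter_upwards [eventually_exists_isSmoothPath (m := m) y] with y' hy'
      exact htrans hy hy'.1
  exact hcl.connectedComponent_subset (show x₀ ∈ {y : M | ∃ γ, IsSmoothPath m γ x₀ y} from
    ⟨_, isSmoothPath_const x₀⟩) h

end Paths

/-! ### Products whose lower terms vanish -/

section LeadingTerms

variable {X N₁ N₂ N : Type*} [NormedAddCommGroup X] [NormedSpace ℝ X] [FiniteDimensional ℝ X]
  [NormedAddCommGroup N₁] [NormedSpace ℝ N₁] [FiniteDimensional ℝ N₁]
  [NormedAddCommGroup N₂] [NormedSpace ℝ N₂] [FiniteDimensional ℝ N₂]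
  [NormedAddCommGroup N] [NormedSpace ℝ N] [FiniteDimensional ℝ N]

theorem zform_apply_zero (a : ∀ n, X [⋀^Fin n]→L[ℝ] N) : zform (a 0 ![]) 0 = a 0 := by
  ext1 w
  exact congrArg (a 0) (Subsingleton.elim _ _)

/-- When all lower parts of one factor vanish, the first possibly nonzero part of the product is a
single term. This isolates the lowest defect and the lowest curvature in the evolution equation. -/
theorem star_of_right_vanish (B : N₁ →ₗ[ℝ] N₂ →ₗ[ℝ] N) (a : ∀ n, X [⋀^Fin n]→L[ℝ] N₁)
    {b : ∀ n, X [⋀^Fin n]→L[ℝ] N₂} {q : ℕ} (hb : ∀ j < q, b j = 0) (w : Fin q → X) :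
    star B a b q w = B (a 0 ![]) (b q w) := by
  have h1 : star B a b q = star B (zform (a 0 ![])) b q := by
    refine Finset.sum_congr rfl fun p hp => ?_
    have h2 := Finset.HasAntidiagonal.mem_antidiagonal.1 hp
    rcases Nat.eq_zero_or_pos p.1 with h3 | h3
    · obtain ⟨i, j⟩ := p
      obtain rfl : i = 0 := h3
      change wdg B 0 j q (a 0) (b j) = wdg B 0 j q (zform (a 0 ![]) 0) (b j)
      rw [zform_apply_zero]
    · rw [hb p.2 (by omega), (wdg B p.1 p.2 q _).map_zero, (wdg B p.1 p.2 q _).map_zero]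
  rw [h1, star_zform_left]
  rfl

theorem star_of_left_vanish (B : N₁ →ₗ[ℝ] N₂ →ₗ[ℝ] N) {a : ∀ n, X [⋀^Fin n]→L[ℝ] N₁}
    (b : ∀ n, X [⋀^Fin n]→L[ℝ] N₂) {q : ℕ} (ha : ∀ i < q, a i = 0) (w : Fin q → X) :
    star B a b q w = B (a q w) (b 0 ![]) := by
  have h1 : star B a b q = star B a (zform (b 0 ![])) q := by
    refine Finset.sum_congr rfl fun p hp => ?_
    have h2 := Finset.HasAntidiagonal.mem_antidiagonal.1 hp
    rcases Nat.eq_zero_or_pos p.2 with h3 | h3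
    · obtain ⟨i, j⟩ := p
      obtain rfl : j = 0 := h3
      change wdg B i 0 q (a i) (b 0) = wdg B i 0 q (a i) (zform (b 0 ![]) 0)
      rw [zform_apply_zero]
    · rw [ha p.1 (by omega), wdg_zero_left, wdg_zero_left]
  rw [h1, star_zform_right]
  rfl

end LeadingTerms

/-! ### The lowest defect, transported back to the source -/

section Holonomy

variable {ι : Type} [Fintype ι] [DecidableEq ι] {m : ℕ}
  {M : Type*} [TopologicalSpace M] [ChartedSpace (EuclideanSpace ℝ (Fin m)) M]
  {V : M → Type*} [TopologicalSpace (TotalSpace (ι → ℝ) V)]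
  [∀ x, AddCommGroup (V x)] [∀ x, Module ℝ (V x)] [∀ x, TopologicalSpace (V x)]
  [∀ x, IsTopologicalAddGroup (V x)] [∀ x, ContinuousSMul ℝ (V x)]
  [FiberBundle (ι → ℝ) V] [VectorBundle ℝ (ι → ℝ) V]
  [IsManifold (𝓡 m) ∞ M] [ContMDiffVectorBundle ∞ (ι → ℝ) V (𝓡 m)]
  {G : Grading (ι := ι) V}
  {n : ℕ} {S : Set (Fin n → ℝ)} {h : (Fin n → ℝ) → ℝ → M}

namespace Superconnection

variable (D : Superconnection (ι := ι) (m := m) G)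

/-- The matrix of the parallel transport of the connection along an extended path. -/
def baseMat (S : Set (Fin n → ℝ)) (h : (Fin n → ℝ) → ℝ → M) (c₀ c : M) (z : (Fin n → ℝ) × ℝ) :
    Mat ι :=
  D.parMat S h c₀ c 0 z ![]

/-- The matrix of the connection form on the velocity of an extended path. -/
def velMat (S : Set (Fin n → ℝ)) (h : (Fin n → ℝ) → ℝ → M) (c : M) (z : (Fin n → ℝ) × ℝ) :
    Mat ι :=
  D.extMat S h c 1 z ![timeDir n]

variable {D} {x₀ : M} {c c' : M} {z : (Fin n → ℝ) × ℝ}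

theorem hasDerivAt_baseMat (hf : IsOpenFamily m S h x₀) {u : Fin n → ℝ} (hu : u ∈ S) {t : ℝ}
    (hc : extend h (u, t) ∈ base ι V c) : HasDerivAt (fun t => D.baseMat S h x₀ c (u, t))
      (D.velMat S h c (u, t) * D.baseMat S h x₀ c (u, t)) t := by
  have h1 := D.hasDerivAt_parMat hf.isOpen hf.smooth hu (c₀ := x₀)
    (by rw [hf.source u hu]; exact FiberBundle.mem_baseSet_trivializationAt' _) hc 0
  have h2 := (ContinuousAlternatingMap.apply ℝ (Fin n → ℝ) (Mat ι)
    ![]).hasFDerivAt.comp_hasDerivAt t h1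
  refine h2.congr_deriv ?_
  refine Eq.trans (star_of_right_vanish (mulB ι) _ (fun j hj => absurd hj (Nat.not_lt_zero j)) ![]) ?_
  refine congrArg₂ (fun A B : Mat ι => A * B) ?_ rfl
  exact congrArg (D.extMat S h c 1 (u, t)) (by ext1 i; fin_cases i; rfl)

theorem baseMat_gauge (hc : extend h z ∈ base ι V c) :
    D.baseMat S h x₀ c' z = transition ι V c c' (extend h z) * D.baseMat S h x₀ c z := by
  rw [baseMat, D.parMat_gauge hc, star_zform_left]
  rfl

/-- Lower defects and lower curvatures being zero, each product in the evolution equation has one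
surviving term. What is left is an inhomogeneous linear equation for a single matrix, with the same
homogeneous part as the equation for `baseMat`. -/
theorem hasDerivAt_pathDefect_apply (hf : IsOpenFamily m S h x₀) {u : Fin n → ℝ} (hu : u ∈ S)
    {t : ℝ} (ht : t ∈ Ioo (-1 : ℝ) 2) (hc : extend h (u, t) ∈ patch ι m V c) {q : ℕ}
    (hE : ∀ p < q, D.pathDefect S h x₀ c p (u, t) = 0)
    (hK : ∀ p ≤ q, D.chartCurv c p (chartAt (EuclideanSpace ℝ (Fin m)) c (extend h (u, t))) = 0)
    (w : Fin q → (Fin n → ℝ) × ℝ) :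
    HasDerivAt (fun t => D.pathDefect S h x₀ c q (u, t) w)
      (D.velMat S h c (u, t) * D.pathDefect S h x₀ c q (u, t) w +
        curv (mulB ι) (D.extMat S h c) (q + 1) (u, t) (Matrix.vecCons (timeDir n) w) *
          D.baseMat S h x₀ c (u, t)) t := by
  have h1 := (ContinuousAlternatingMap.apply ℝ ((Fin n → ℝ) × ℝ) (Mat ι)
    w).hasFDerivAt.comp_hasDerivAt t (hasDerivAt_pathDefect (D := D) hf hu ht hc q)
  refine h1.congr_deriv ?_
  change star (mulB ι) (eps (iota (timeDir n) fun p => D.extMat S h c p (u, t)))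
      (fun p => D.pathDefect S h x₀ c p (u, t)) q w +
    star (mulB ι) (iota (timeDir n) fun p => curv (mulB ι) (D.extMat S h c) p (u, t))
        (fun p => D.hatMat S h x₀ c p (u, t)) q w = _
  rw [star_of_right_vanish (mulB ι) _ hE, star_of_left_vanish (mulB ι) _ fun i hi => by
    rw [iota, curv_extMat hf hu hc, pull, hK (i + 1) (by omega)]; rfl]
  refine congrArg₂ (fun A B : Mat ι => A + B) ?_ ?_
  · refine congrArg₂ (fun A B : Mat ι => A * B) ?_ rfl
    refine (one_smul ℝ _).trans ?_
    exact congrArg (D.extMat S h c 1 (u, t)) (by ext1 i; fin_cases i; rfl)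
  · refine congrArg₂ (fun A B : Mat ι => A * B) rfl ?_
    exact congrArg (D.parMat S h x₀ c 0 (u, t)) (Subsingleton.elim _ _)

theorem isUnit_transition {c c' x : M} (hc : x ∈ base ι V c) (hc' : x ∈ base ι V c') :
    IsUnit (transition ι V c c' x) :=
  ⟨⟨_, _, transition_mul_transition hc' hc, transition_mul_transition hc hc'⟩, rfl⟩

theorem continuousAt_velMat (hf : IsOpenFamily m S h x₀) {u : Fin n → ℝ} (hu : u ∈ S) {t : ℝ}
    (hc : extend h (u, t) ∈ patch ι m V c) :
    ContinuousAt (fun t => D.velMat S h c (u, t)) t := by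
  have h4 : ContinuousAt (fun τ => D.extMat S h c 1 (u, τ)) t :=
    ContinuousAt.comp (f := fun τ : ℝ => (u, τ)) (D.contDiffAt_extMat hf.isOpen hf.smooth hu
      hc 1).continuousAt (by fun_prop)
  exact (ContinuousAlternatingMap.apply ℝ ((Fin n → ℝ) × ℝ) (Mat ι)
    ![timeDir n]).continuous.continuousAt.comp h4

theorem exists_patch_extend (hf : IsOpenFamily m S h x₀) {u : Fin n → ℝ} (hu : u ∈ S) {t : ℝ}
    (hc : extend h (u, t) ∈ patch ι m V c) :
    ∃ δ > 0, ∀ τ, t - δ < τ → τ < t + δ → extend h (u, τ) ∈ patch ι m V c := by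
  have h2 := eventually_extend_mem hf.isOpen hf.smooth (z := (u, t)) hu
    (isOpen_patch (ι := ι) (m := m) (V := V) c) hc
  have h3 : Continuous fun τ : ℝ => (u, τ) := by fun_prop
  have h1 : ∀ᶠ τ in nhds t, extend h (u, τ) ∈ patch ι m V c :=
    (h3.continuousAt.eventually h2).mono fun τ hτ => hτ.2
  obtain ⟨δ, hδ, h1⟩ := Metric.eventually_nhds_iff.1 h1
  exact ⟨δ, hδ, fun τ hτ hτ' => h1 (by rw [Real.dist_eq, abs_lt]; constructor <;> linarith)⟩

/-- By uniqueness for the reversed equation, a vector annihilated at a later time is annihilated at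
the earlier one. In finite dimension injectivity suffices. -/
theorem isUnit_baseMat (hf : IsOpenFamily m S h x₀) {u : Fin n → ℝ} (hu : u ∈ S) :
    ∀ t ∈ Icc (-1 : ℝ) 2, ∀ c, extend h (u, t) ∈ base ι V c →
      IsUnit (D.baseMat S h x₀ c (u, t)) := by
  have hgauge : ∀ t c c', extend h (u, t) ∈ base ι V c → extend h (u, t) ∈ base ι V c' →
      IsUnit (D.baseMat S h x₀ c (u, t)) → IsUnit (D.baseMat S h x₀ c' (u, t)) :=
    fun t c c' hc hc' H => by
      rw [baseMat_gauge (c := c) (c' := c') hc]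
      exact (isUnit_transition hc hc').mul H
  refine interval_induction (fun c hc => ?_) fun t _ => ?_
  · have h1 : extend h (u, (-1 : ℝ)) = x₀ := by
      simp only [extend]
      rw [Real.smoothTransition.zero_of_nonpos (by norm_num), hf.source u hu]
    refine hgauge _ x₀ c (by rw [h1]; exact FiberBundle.mem_baseSet_trivializationAt' _) hc ?_
    rw [baseMat, D.parMat_of_nonpos hf.isOpen hf.smooth hu (by
      rw [hf.source _ hu]; exact FiberBundle.mem_baseSet_trivializationAt' _) (by norm_num)]
    exact isUnit_one
  · set c := extend h (u, t)
    obtain ⟨δ, hδ, h1⟩ := exists_patch_extend (ι := ι) (V := V) hf hu (t := t) (mem_patch_self c)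
    refine ⟨δ, hδ, fun s s' hs hs' h2 hss h3 H c' hc' => ?_⟩
    have hmem : ∀ τ ∈ Icc s s', extend h (u, τ) ∈ patch ι m V c := fun τ hτ =>
      h1 τ (by linarith [hτ.1]) (by linarith [hτ.2])
    refine hgauge s' c c' (hmem s' (right_mem_Icc.2 hss)).2 hc' ?_
    have hs1 := H c (hmem s (left_mem_Icc.2 hss)).2
    have hinj : ∀ v : ι → ℝ, D.baseMat S h x₀ c (u, s') v = 0 → v = 0 := fun v hv => by
      -- Time is reflected in the interval because the uniqueness theorem starts from the left end
      -- point.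
      have hrev : ∀ τ ∈ Icc s s', s + s' - τ ∈ Icc s s' := fun τ hτ =>
        ⟨by linarith [hτ.2], by linarith [hτ.1]⟩
      have h4 := linearODE_unique (a := s) (b := s')
        (L := fun τ => -(D.velMat S h c (u, s + s' - τ)))
        (y := fun τ => D.baseMat S h x₀ c (u, s + s' - τ) v) (z := fun _ => 0)
        (fun τ hτ => ?_) (fun τ hτ => ?_) (fun τ _ => ?_) ?_ (right_mem_Icc.2 hss)
      · have h5 : D.baseMat S h x₀ c (u, s) v = 0 := by simpa using h4
        obtain ⟨U, hU⟩ := hs1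
        have h6 : (↑U⁻¹ * (U : Mat ι)) v = 0 := by
          change (↑U⁻¹ : Mat ι) ((U : Mat ι) v) = 0
          rw [hU, h5, map_zero]
        rwa [Units.inv_mul] at h6
      · have h5 := continuousAt_velMat (D := D) hf hu (hmem _ (hrev τ hτ))
        exact (ContinuousAt.comp (f := fun τ : ℝ => s + s' - τ) h5
          (by fun_prop)).neg.continuousWithinAt
      · have h5 := hasDerivAt_baseMat (D := D) hf hu (hmem _ (hrev τ hτ)).2
        have h6 := (ContinuousLinearMap.apply ℝ (ι → ℝ) v).hasFDerivAt.comp_hasDerivAt _ h5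
        have h7 := HasDerivAt.scomp (h := fun τ : ℝ => s + s' - τ) τ h6
          ((hasDerivAt_id τ).const_sub (s + s'))
        refine h7.hasDerivWithinAt.congr_deriv ?_
        change (-1 : ℝ) • ((D.velMat S h c (u, s + s' - τ)) _) = -((D.velMat S h c (u, s + s' - τ)) _)
        rw [neg_one_smul]
        rfl
      · rw [map_zero]
        exact hasDerivWithinAt_const _ _ _
      · simpa using hv
    rw [ContinuousLinearMap.isUnit_iff_bijective]
    have h5 : Function.Injective (D.baseMat S h x₀ c (u, s')).toLinearMap :=
      (injective_iff_map_eq_zero _).2 hinj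
    exact ⟨h5, LinearMap.injective_iff_surjective.1 h5⟩

/-- The defect, transported back to the source. -/
def holonomyDefect (D : Superconnection (ι := ι) (m := m) G) (S : Set (Fin n → ℝ))
    (h : (Fin n → ℝ) → ℝ → M) (x₀ : M) (q : ℕ) (u : Fin n → ℝ) (w : Fin q → (Fin n → ℝ) × ℝ)
    (t : ℝ) : Mat ι :=
  Ring.inverse (D.baseMat S h x₀ (extend h (u, t)) (u, t)) *
    D.pathDefect S h x₀ (extend h (u, t)) q (u, t) w

/-- A change of frames multiplies both `baseMat` and `pathDefect` on the left by the same transition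
matrix, which cancels. The quotient is therefore one function of time along the whole path, even if
the path leaves every single chart. -/
theorem holonomyDefect_eq (hf : IsOpenFamily m S h x₀) {u : Fin n → ℝ} (hu : u ∈ S) {t : ℝ}
    (ht : t ∈ Icc (-1 : ℝ) 2) (hc : extend h (u, t) ∈ base ι V c) {q : ℕ}
    (w : Fin q → (Fin n → ℝ) × ℝ) : D.holonomyDefect S h x₀ q u w t =
      Ring.inverse (D.baseMat S h x₀ c (u, t)) * D.pathDefect S h x₀ c q (u, t) w := by
  have hs : extend h (u, t) ∈ base ι V (extend h (u, t)) :=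
    FiberBundle.mem_baseSet_trivializationAt' _
  obtain ⟨U, hU⟩ := isUnit_baseMat (D := D) hf hu t ht c hc
  obtain ⟨g, hg⟩ := isUnit_transition (ι := ι) (V := V) hc hs
  rw [holonomyDefect, baseMat_gauge (c := c) hc, pathDefect_gauge hf (z := (u, t)) hu ht hc hs,
    star_zform_left, ← hU, ← hg, ← Units.val_mul, Ring.inverse_unit, Ring.inverse_unit]
  change (((g * U)⁻¹ : (Mat ι)ˣ) : Mat ι) * ((g : Mat ι) * D.pathDefect S h x₀ c q (u, t) w) = _
  rw [mul_inv_rev, Units.val_mul, mul_assoc, Units.inv_mul_cancel_left]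

/-- Variation of constants: T' = A T and E' = A E + κ T imply (T⁻¹ E)' = T⁻¹ κ T. The derivative
sees nothing but the curvature of degree q + 1. -/
theorem hasDerivAt_holonomyDefect (hf : IsOpenFamily m S h x₀) {u : Fin n → ℝ} (hu : u ∈ S)
    {t : ℝ} (ht : t ∈ Ioo (-1 : ℝ) 2) (hc : extend h (u, t) ∈ patch ι m V c) {q : ℕ}
    (hE : ∀ p < q, D.pathDefect S h x₀ c p (u, t) = 0)
    (hK : ∀ p ≤ q, D.chartCurv c p (chartAt (EuclideanSpace ℝ (Fin m)) c (extend h (u, t))) = 0)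
    (w : Fin q → (Fin n → ℝ) × ℝ) :
    HasDerivAt (D.holonomyDefect S h x₀ q u w) (Ring.inverse (D.baseMat S h x₀ c (u, t)) *
      (curv (mulB ι) (D.extMat S h c) (q + 1) (u, t) (Matrix.vecCons (timeDir n) w) *
        D.baseMat S h x₀ c (u, t))) t := by
  obtain ⟨U, hU⟩ := isUnit_baseMat (D := D) hf hu t (Ioo_subset_Icc_self ht) c hc.2
  have h1 := hasDerivAt_pathDefect_apply (D := D) hf hu ht hc hE hK w
  have h2 := hasDerivAt_baseMat (D := D) hf hu hc.2
  have h3 : HasFDerivAt Ring.inverse _ (D.baseMat S h x₀ c (u, t)) :=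
    hU ▸ hasFDerivAt_ringInverse (𝕜 := ℝ) U
  have h4 := (h3.comp_hasDerivAt t h2).mul h1
  obtain ⟨δ, hδ, h5⟩ := exists_patch_extend (ι := ι) (V := V) hf hu (t := t) hc
  refine (h4.congr_of_eventuallyEq ?_).congr_deriv ?_
  · filter_upwards [Ioo_mem_nhds ht.1 ht.2,
      Ioo_mem_nhds (show t - δ < t by linarith) (show t < t + δ by linarith)] with τ hτ hτ'
    exact holonomyDefect_eq (D := D) hf hu (Ioo_subset_Icc_self hτ) (h5 τ hτ'.1 hτ'.2).2 w
  · rw [← hU]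
    simp only [neg_apply, ContinuousLinearMap.mulLeftRight_apply,
      Function.comp_apply, Ring.inverse_unit, mul_add, mul_assoc]
    rw [← hU]
    simp only [Ring.inverse_unit, Units.mul_inv, mul_one]
    have key : ∀ {R : Type} [Ring R] (a b e f : R), -(a * b) * e + (a * (b * e) + f) = f :=
      fun a b e f => by rw [neg_mul, mul_assoc, neg_add_cancel_left]
    exact key _ _ _ _

end Superconnection

end Holonomy

/-! ### Dependence of the base transport on the path, and initial pieces of paths -/

section Reparametrization

variable {ι : Type} [Fintype ι] [DecidableEq ι] {m : ℕ}
  {M : Type*} [TopologicalSpace M] [ChartedSpace (EuclideanSpace ℝ (Fin m)) M]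
  {V : M → Type*} [TopologicalSpace (TotalSpace (ι → ℝ) V)]
  [∀ x, AddCommGroup (V x)] [∀ x, Module ℝ (V x)] [∀ x, TopologicalSpace (V x)]
  [∀ x, IsTopologicalAddGroup (V x)] [∀ x, ContinuousSMul ℝ (V x)]
  [FiberBundle (ι → ℝ) V] [VectorBundle ℝ (ι → ℝ) V]
  [IsManifold (𝓡 m) ∞ M] [ContMDiffVectorBundle ∞ (ι → ℝ) V (𝓡 m)]
  {G : Grading (ι := ι) V}
  {n : ℕ} {S : Set (Fin n → ℝ)} {h : (Fin n → ℝ) → ℝ → M}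

namespace Superconnection

variable (D : Superconnection (ι := ι) (m := m) G)

theorem IsRegular.comp_linear {D : Superconnection (ι := ι) (m := m) G}
    {X X' : Type} [NormedAddCommGroup X] [NormedSpace ℝ X]
    [FiniteDimensional ℝ X] [NormedAddCommGroup X'] [NormedSpace ℝ X'] [FiniteDimensional ℝ X']
    {γ : ℝ → M} {η : ∀ t, X →ₗ[ℝ] TangentSpace (𝓡 m) (γ t)} (hr : D.IsRegular γ η)
    (ℓ : X' →L[ℝ] X) : D.IsRegular γ fun t => η t ∘ₗ ℓ.toLinearMap where
  mdiff := hr.mdiff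
  coef t ht c hc n :=
    (ContinuousAlternatingMap.compContinuousLinearMapCLM ℓ :
      (X [⋀^Fin n]→L[ℝ] Mat ι) →L[ℝ] (X' [⋀^Fin n]→L[ℝ] Mat ι)).continuous.continuousAt.comp_continuousWithinAt (hr.coef t ht c hc n)

/-- The part of degree 0 has no arguments, so it does not change under pull-back along the zero map,
which forgets the variation fields. -/
theorem IsRegular.transport_zero {D : Superconnection (ι := ι) (m := m) G}
    {X : Type} [NormedAddCommGroup X] [NormedSpace ℝ X] [FiniteDimensional ℝ X]
    {γ : ℝ → M} {η : ∀ t, X →ₗ[ℝ] TangentSpace (𝓡 m) (γ t)} (hr : D.IsRegular γ η) {t : ℝ}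
    (ht : t ∈ Icc (0 : ℝ) 1) : D.transport γ η 0 0 t ![] =
      D.transport γ (fun τ => (0 : (Fin 0 → ℝ) →ₗ[ℝ] TangentSpace (𝓡 m) (γ τ))) 0 0 t ![] := by
  have h1 := hr.transport_comp (0 : (Fin 0 → ℝ) →L[ℝ] X) (hr.comp_linear _) ht 0
  have h2 : (fun t => η t ∘ₗ (0 : (Fin 0 → ℝ) →L[ℝ] X).toLinearMap) =
      fun τ => (0 : (Fin 0 → ℝ) →ₗ[ℝ] TangentSpace (𝓡 m) (γ τ)) := by
    funext τ
    exact LinearMap.comp_zero _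
  rw [h2] at h1
  rw [h1]
  exact congrArg (D.transport γ η 0 0 t) (Subsingleton.elim _ _)

variable {D} {x₀ : M} {c c' : M} {z : (Fin n → ℝ) × ℝ}

theorem baseMat_eq_of_path {n' : ℕ} {S' : Set (Fin n' → ℝ)} {h' : (Fin n' → ℝ) → ℝ → M}
    (hf : IsOpenFamily m S h x₀) (hf' : IsOpenFamily m S' h' x₀) {u : Fin n → ℝ} (hu : u ∈ S)
    {u' : Fin n' → ℝ} (hu' : u' ∈ S') (hp : h' u' = h u) (t : ℝ) :
    D.baseMat S' h' x₀ c (u', t) = D.baseMat S h x₀ c (u, t) := by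
  have key : ∀ {n : ℕ} {S : Set (Fin n → ℝ)} {h : (Fin n → ℝ) → ℝ → M}
      (_ : IsOpenFamily m S h x₀) {u : Fin n → ℝ} (_ : u ∈ S) {γ : ℝ → M} (_ : h u = γ),
      D.baseMat S h x₀ c (u, t) =
        tw 0 • toMat (ι := ι) x₀ c (γ 0) (γ (Real.smoothTransition t)) (D.transport γ
          (fun τ => (0 : (Fin 0 → ℝ) →ₗ[ℝ] TangentSpace (𝓡 m) (γ τ))) 0 0
            (Real.smoothTransition t) ![]) := fun {n S h} hf {u} hu {γ} hγ => by
    subst hγ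
    exact congrArg (fun A => tw 0 • toMat (ι := ι) x₀ c (h u 0) (h u (Real.smoothTransition t)) A)
      ((D.isRegular_family hf.isOpen.uniqueDiffOn hf.smooth hu).transport_zero
        (smoothTransition_mem_Icc t))
  rw [key hf' hu' hp, key hf hu rfl]

theorem velMat_eq (hf : IsOpenFamily m S h x₀) {u : Fin n → ℝ} (hu : u ∈ S) {t : ℝ}
    (hc : extend h (u, t) ∈ patch ι m V c) {v : EuclideanSpace ℝ (Fin m)}
    (hv : HasDerivAt (fun t => chartAt (EuclideanSpace ℝ (Fin m)) c (extend h (u, t))) v t) :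
    D.velMat S h c (u, t) =
      D.signedForm c 1 (chartAt (EuclideanSpace ℝ (Fin m)) c (extend h (u, t))) ![v] := by
  have hO : IsOpen (S ×ˢ (univ : Set ℝ)) := hf.isOpen.prod isOpen_univ
  have hz : ((u, t) : (Fin n → ℝ) × ℝ) ∈ S ×ˢ (univ : Set ℝ) := ⟨hu, mem_univ t⟩
  have h1 := D.pullMat_eq (contMDiffOn_extend hf.smooth) hO.uniqueDiffOn hz hc.1 1
  have h2 := (contDiffWithinAt_chart_comp (contMDiffOn_extend hf.smooth) hz hc.1).contDiffAt
    (hO.mem_nhds hz)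
  have h3 := (h2.differentiableAt (by simp)).hasFDerivAt
  have h4 : HasDerivAt (fun t : ℝ => (u, t)) (timeDir n) t :=
    (hasDerivAt_const _ _).prodMk (hasDerivAt_id _)
  have h5 := (h3.comp_hasDerivAt t h4).unique hv
  rw [velMat, extMat, h1, fderivWithin_of_mem_nhds (hO.mem_nhds hz), ← h5]
  exact congrArg (D.signedForm c 1 _) (by ext1 i; fin_cases i; rfl)

theorem pathDefect_zero_apply (w : Fin 0 → (Fin n → ℝ) × ℝ) : D.pathDefect S h x₀ c 0 z w =
    D.formMat c 0 (extend h z) ![] * D.baseMat S h x₀ c z -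
      D.baseMat S h x₀ c z * D.A₀mat x₀ := by
  have hw : D.hatMat S h x₀ c 0 z w = D.baseMat S h x₀ c z :=
    congrArg (D.parMat S h x₀ c 0 z) (Subsingleton.elim _ _)
  have hw' : D.extMat S h c 0 z ![] = D.formMat c 0 (extend h z) ![] :=
    congrArg (D.formMat c 0 (extend h z)) (Subsingleton.elim _ _)
  have h1 : star (mulB ι) (fun n => D.extMat S h c n z) (fun n => D.hatMat S h x₀ c n z) 0 w =
      D.extMat S h c 0 z ![] * D.hatMat S h x₀ c 0 z w :=
    star_of_right_vanish (mulB ι) _ (fun j hj => absurd hj (Nat.not_lt_zero j)) w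
  change star (mulB ι) (fun n => D.extMat S h c n z) (fun n => D.hatMat S h x₀ c n z) 0 w -
    (-1 : ℝ) ^ 0 • (D.hatMat S h x₀ c 0 z w * D.A₀mat x₀) - 0 = _
  rw [h1, hw, hw', pow_zero, one_smul, sub_zero]

/-- The transport along an initial piece of a path, run at a different speed. -/
theorem baseMat_reparametrize {γ : ℝ → M} (hγ : ContMDiff 𝓘(ℝ, ℝ) (𝓡 m) ∞ γ)
    (hx : γ 0 = x₀) (hc : ∀ t, γ t ∈ patch ι m V c) (τ : ℝ) :
    D.baseMat (univ : Set (Fin 0 → ℝ)) (fun _ s => γ (Real.smoothTransition (τ * s))) x₀ c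
      (0, 3 / 2) = D.baseMat (univ : Set (Fin 0 → ℝ)) (fun _ => γ) x₀ c (0, τ) := by
  have hS : ContMDiff 𝓘(ℝ, ℝ) (𝓡 m) ∞ fun s => γ (Real.smoothTransition (τ * s)) :=
    hγ.comp (Real.smoothTransition.contDiff.comp (contDiff_const.mul contDiff_id)).contMDiff
  have hfam : ∀ {γ : ℝ → M} (_ : ContMDiff 𝓘(ℝ, ℝ) (𝓡 m) ∞ γ) (_ : γ 0 = x₀),
      IsOpenFamily m (univ : Set (Fin 0 → ℝ)) (fun _ => γ) x₀ := fun hγ hx =>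
    ⟨isOpen_univ, (hγ.comp contDiff_snd.contMDiff).contMDiffOn, fun _ _ => hx⟩
  have hf := hfam hγ hx
  have hf' := hfam hS (by simp [hx])
  have hu := mem_univ (0 : Fin 0 → ℝ)
  set h : (Fin 0 → ℝ) → ℝ → M := fun _ => γ
  set h' : (Fin 0 → ℝ) → ℝ → M := fun _ s => γ (Real.smoothTransition (τ * s))
  have hext : ∀ t, extend h' (0, t) = extend h (0, τ * Real.smoothTransition t) := fun t => rfl
  have hc1 : ∀ t, extend h (0, t) ∈ patch ι m V c := fun t => hc _
  have hc2 : ∀ t, extend h' (0, t) ∈ patch ι m V c := fun t => hc _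
  -- Both sides solve the same linear equation: by the chain rule the velocity of the slowed path is
  -- that of γ times the speed factor. At the extended time 0 both are the frame change at x₀.
  have h3 := linearODE_unique (a := 0) (b := 3 / 2)
    (L := fun t => ContinuousLinearMap.mul ℝ (Mat ι) (D.velMat univ h' c (0, t)))
    (y := fun t => D.baseMat univ h' x₀ c (0, t))
    (z := fun t => D.baseMat univ h x₀ c (0, τ * Real.smoothTransition t)) (fun t _ => ?_)
    (fun t _ => ?_) (fun t _ => ?_) ?_ (right_mem_Icc.2 (by norm_num))
  · refine h3.trans ?_
    simp only [Real.smoothTransition.one_of_one_le (show (1 : ℝ) ≤ 3 / 2 by norm_num), mul_one]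
  · exact ((ContinuousLinearMap.mul ℝ (Mat ι)).continuous.continuousAt.comp
      (continuousAt_velMat (D := D) hf' hu (hc2 t))).continuousWithinAt
  · exact (hasDerivAt_baseMat (D := D) hf' hu (hc2 t).2).hasDerivWithinAt
  · have h4 := hasDerivAt_baseMat (D := D) hf hu (hc1 (τ * Real.smoothTransition t)).2
    have h5 := (hasDerivAt_smoothTransition t).const_mul τ
    have h6 := HasDerivAt.scomp t h4 h5
    refine h6.hasDerivWithinAt.congr_deriv ?_
    have h7 : DifferentiableAt ℝ (fun t => chartAt (EuclideanSpace ℝ (Fin m)) c (extend h (0, t)))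
        (τ * Real.smoothTransition t) := by
      have hz : ((0, τ * Real.smoothTransition t) : (Fin 0 → ℝ) × ℝ) ∈
        (univ : Set (Fin 0 → ℝ)) ×ˢ (univ : Set ℝ) := ⟨hu, mem_univ _⟩
      have h2 := (contDiffWithinAt_chart_comp (contMDiffOn_extend hf.smooth) hz (hc1 _).1).contDiffAt
        ((isOpen_univ.prod isOpen_univ).mem_nhds hz)
      exact DifferentiableAt.comp (f := fun t : ℝ => ((0, t) : (Fin 0 → ℝ) × ℝ))
        (g := chartAt (EuclideanSpace ℝ (Fin m)) c ∘ extend h) _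
        (h2.differentiableAt (by simp)) (by fun_prop)
    have h8 := HasDerivAt.scomp t h7.hasDerivAt h5
    rw [velMat_eq (D := D) hf hu (hc1 _) h7.hasDerivAt]
    change _ = D.velMat univ h' c (0, t) * _
    rw [velMat_eq (D := D) hf' hu (hc2 t) h8]
    have h9 : ∀ (y v : EuclideanSpace ℝ (Fin m)) (r : ℝ),
        D.signedForm c 1 y ![r • v] = r • D.signedForm c 1 y ![v] := fun y v r => by
      have h10 : ![r • v] = fun i => (fun _ : Fin 1 => r) i • ![v] i := by
        ext1 i; fin_cases i; rfl
      rw [h10]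
      refine ((D.signedForm c 1 y).toMultilinearMap.map_smul_univ (fun _ => r) ![v]).trans ?_
      rw [Fin.prod_univ_one]
      rfl
    rw [h9]
    exact (smul_mul_assoc _ _ _).symm
  · have h4 : ∀ {h : (Fin 0 → ℝ) → ℝ → M} (_ : IsOpenFamily m univ h x₀),
        D.baseMat univ h x₀ c (0, 0) = transition ι V x₀ c x₀ * 1 := fun {h} hf => by
      have h5 : extend h (0, 0) = x₀ := by
        simp only [extend, Real.smoothTransition.zero, hf.source 0 hu]
      have h6 : x₀ ∈ base ι V x₀ := FiberBundle.mem_baseSet_trivializationAt' _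
      rw [baseMat_gauge (c := x₀) (c' := c) (by rw [h5]; exact h6), h5, baseMat,
        D.parMat_of_nonpos hf.isOpen hf.smooth hu (by rw [hf.source 0 hu]; exact h6) le_rfl]
      rfl
    simp only [Real.smoothTransition.zero, mul_zero]
    rw [h4 hf, h4 hf']

/-- The defect at an intermediate time is the final defect of the initial piece of γ, rescaled to a
path of its own. Its end point moves along γ, which is the reason for requiring the condition in
degree 0 at all pairs of end points. -/
theorem pathDefect_zero_of_pathSpaceEq {γ : ℝ → M} (hγ : ContMDiff 𝓘(ℝ, ℝ) (𝓡 m) ∞ γ)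
    (hx : γ 0 = x₀) (hc : ∀ t, γ t ∈ patch ι m V c) {t : ℝ}
    (H : D.PathSpaceEq 0 x₀ (γ (Real.smoothTransition t))) :
    D.pathDefect (univ : Set (Fin 0 → ℝ)) (fun _ => γ) x₀ c 0 (0, t) = 0 := by
  have hS : ContMDiff 𝓘(ℝ, ℝ) (𝓡 m) ∞ fun s => γ (Real.smoothTransition (t * s)) :=
    hγ.comp (Real.smoothTransition.contDiff.comp (contDiff_const.mul contDiff_id)).contMDiff
  have hf : IsOpenFamily m (univ : Set (Fin 0 → ℝ))
      (fun _ s => γ (Real.smoothTransition (t * s))) x₀ :=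
    ⟨isOpen_univ, (hS.comp contDiff_snd.contMDiff).contMDiffOn, fun _ _ => by simp [hx]⟩
  have hu := mem_univ (0 : Fin 0 → ℝ)
  have htar : ∀ u ∈ (univ : Set (Fin 0 → ℝ)),
      (fun (_ : Fin 0 → ℝ) s => γ (Real.smoothTransition (t * s))) u 1 =
        γ (Real.smoothTransition t) := fun u _ => by simp
  have h1 := (pathDefect_final_eq_zero_iff (D := D) hf htar hu (t := 3 / 2)
    ⟨by norm_num, by norm_num⟩ 0).2 (H 0 univ _ isOpen_univ ⟨hf.smooth, hf.source, htar⟩ 0 hu)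
  have hext : extend (fun (_ : Fin 0 → ℝ) s => γ (Real.smoothTransition (t * s))) (0, 3 / 2) =
      γ (Real.smoothTransition t) := by
    simp only [extend, Real.smoothTransition.one_of_one_le (show (1 : ℝ) ≤ 3 / 2 by norm_num),
      mul_one]
  have h2 := pathDefect_gauge (D := D) hf (z := (0, 3 / 2)) hu ⟨by norm_num, by norm_num⟩
    (c := γ (Real.smoothTransition t)) (c' := c)
    (by rw [hext]; exact FiberBundle.mem_baseSet_trivializationAt' _) (by rw [hext]; exact (hc _).2) 0
  rw [star_zform_left, h1] at h2
  ext1 w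
  have h3 := congrArg (fun α => α w) h2
  refine Eq.trans ?_ (h3.trans (map_zero (mulB ι _)))
  rw [pathDefect_zero_apply, pathDefect_zero_apply, baseMat_reparametrize hγ hx hc t, hext]
  rfl

/-- In degree 0 the curvature has no derivative term. The condition A₀² = 0 is thus the structure
equation one degree below S_0, and it starts the induction. -/
theorem chartCurv_zero_apply {y : EuclideanSpace ℝ (Fin m)} (hy : y ∈ chartDomain (ι := ι) V c)
    (w : Fin 0 → EuclideanSpace ℝ (Fin m)) : D.chartCurv c 0 y w = toMat (ι := ι) c c
      ((chartAt (EuclideanSpace ℝ (Fin m)) c).symm y)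
      ((chartAt (EuclideanSpace ℝ (Fin m)) c).symm y)
      (D.A₀ ((chartAt (EuclideanSpace ℝ (Fin m)) c).symm y) ∘ₗ
        D.A₀ ((chartAt (EuclideanSpace ℝ (Fin m)) c).symm y)) := by
  have h0 : D.signedForm c 0 y ![] = toMat (ι := ι) c c
      ((chartAt (EuclideanSpace ℝ (Fin m)) c).symm y)
      ((chartAt (EuclideanSpace ℝ (Fin m)) c).symm y)
      (D.A₀ ((chartAt (EuclideanSpace ℝ (Fin m)) c).symm y)) := by
    refine (one_smul ℝ _).trans ?_
    exact congrArg (fun w => toMat (ι := ι) c c _ _ (D.A 0 _ w)) (Subsingleton.elim _ _)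
  change (0 + star (mulB ι) (eps fun n => D.signedForm c n y) (fun n => D.signedForm c n y) 0) w = _
  rw [zero_add, star_of_right_vanish (mulB ι) _ (fun j hj => absurd hj (Nat.not_lt_zero j)) w]
  have h1 : D.signedForm c 0 y w = D.signedForm c 0 y ![] := congrArg _ (Subsingleton.elim _ _)
  have h2 : eps (fun n => D.signedForm c n y) 0 ![] = D.signedForm c 0 y ![] := one_smul ℝ _
  rw [h1, h2, h0]
  exact (toMat_comp (ι := ι) (V := V) (c := c) (c'' := c) hy.2 _ _).symm

theorem chartCurv_zero (hA : ∀ x, D.A₀ x ∘ₗ D.A₀ x = 0) {y : EuclideanSpace ℝ (Fin m)}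
    (hy : y ∈ chartDomain (ι := ι) V c) : D.chartCurv c 0 y = 0 := by
  ext1 w
  rw [chartCurv_zero_apply hy, hA, map_zero]
  rfl

end Superconnection

end Reparametrization

/-! ## The structure equations from the equations on the path spaces -/

theorem smoothTransition_half : Real.smoothTransition (1 / 2) = 1 / 2 := by
  have h : expNegInvGlue (1 / 2) ≠ 0 := (expNegInvGlue.pos_of_pos (by norm_num)).ne'
  rw [Real.smoothTransition, show (1 : ℝ) - 1 / 2 = 1 / 2 by norm_num]
  field_simp
  norm_num

/-- Monotonicity and the positive derivative at 1/2 show that values near 1/2 are taken only near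
1/2. The bump below is a function of the path parameter, whereas the sign of the integrand is
controlled in the extended time; this estimate compares the two. -/
theorem exists_abs_smoothTransition_sub_le {ε : ℝ} (hε : 0 < ε) :
    ∃ δ > 0, ∀ t, |Real.smoothTransition t - 1 / 2| ≤ δ → |t - 1 / 2| < ε := by
  have h1 := hasDerivAt_iff_tendsto_slope.1 hasDerivAt_smoothTransition_half
  have h2 := h1.eventually (lt_mem_nhds (show (0 : ℝ) < 2 by norm_num))
  rw [eventually_nhdsWithin_iff, Metric.eventually_nhds_iff] at h2
  obtain ⟨η, hη, h2⟩ := h2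
  have h3 : ∀ t, |t - 1 / 2| < η → t ≠ 1 / 2 →
      0 < slope Real.smoothTransition (1 / 2) t := fun t ht ht' => h2 (by rwa [Real.dist_eq]) ht'
  set r := min η ε / 2 with hr
  have hr0 : 0 < r := by positivity
  have hrη : r < η := by have := min_le_left η ε; linarith [lt_min hη hε]
  have hrε : r < ε := by have := min_le_right η ε; linarith [lt_min hη hε]
  have h4 := h3 (1 / 2 + r) (by rw [add_sub_cancel_left, abs_of_pos hr0]; exact hrη) (by linarith)
  have h5 := h3 (1 / 2 - r) (by rw [sub_sub_cancel_left, abs_neg, abs_of_pos hr0]; exact hrη)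
    (by linarith)
  rw [slope_def_field, smoothTransition_half, add_sub_cancel_left] at h4
  rw [slope_def_field, smoothTransition_half, sub_sub_cancel_left] at h5
  have h4' : 0 < Real.smoothTransition (1 / 2 + r) - 1 / 2 := by
    by_contra hc
    exact absurd h4 (not_lt.2 (div_nonpos_of_nonpos_of_nonneg (not_lt.1 hc) hr0.le))
  have h5' : 0 < 1 / 2 - Real.smoothTransition (1 / 2 - r) := by
    by_contra hc
    exact absurd h5 (not_lt.2 (div_nonpos_of_nonneg_of_nonpos (by linarith) (by linarith)))
  refine ⟨min (Real.smoothTransition (1 / 2 + r) - 1 / 2)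
    (1 / 2 - Real.smoothTransition (1 / 2 - r)) / 2, by positivity, fun t ht => ?_⟩
  have h6 := lt_min h4' h5'
  have h7 := min_le_left (Real.smoothTransition (1 / 2 + r) - 1 / 2)
    (1 / 2 - Real.smoothTransition (1 / 2 - r))
  have h8 := min_le_right (Real.smoothTransition (1 / 2 + r) - 1 / 2)
    (1 / 2 - Real.smoothTransition (1 / 2 - r))
  rw [abs_le] at ht
  refine lt_trans (abs_lt.2 ⟨?_, ?_⟩ : |t - 1 / 2| < r) hrε
  · by_contra hc
    have := Real.smoothTransition.monotone (show t ≤ 1 / 2 - r by linarith)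
    linarith [ht.1]
  · by_contra hc
    have := Real.smoothTransition.monotone (show 1 / 2 + r ≤ t by linarith)
    linarith [ht.2]

theorem hasDerivAt_smoothTransition_comp (t : ℝ) :
    HasDerivAt (fun t => Real.smoothTransition (5 * Real.smoothTransition t - 2))
      (deriv Real.smoothTransition (5 * Real.smoothTransition t - 2) *
        (5 * deriv Real.smoothTransition t)) t :=
  HasDerivAt.comp (h₂ := Real.smoothTransition) t (hasDerivAt_smoothTransition _)
    (((hasDerivAt_smoothTransition t).const_mul 5).sub_const 2)

section Alternating

variable {X N : Type*} [NormedAddCommGroup X] [NormedSpace ℝ X]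
  [NormedAddCommGroup N] [NormedSpace ℝ N]

theorem apply_vecCons_smul {q : ℕ} (α : X [⋀^Fin (q + 1)]→L[ℝ] N) (r b : ℝ) (v : X)
    (w : Fin q → X) : α (Matrix.vecCons (r • v) fun i => b • w i) =
      (r * b ^ q) • α (Matrix.vecCons v w) := by
  have h1 : α (Matrix.vecCons (r • v) fun i => b • w i) =
      r • α (Matrix.vecCons v fun i => b • w i) :=
    congrArg (fun β => β fun i => b • w i) (α.curryLeft.map_smul r v)
  have h2 : α (Matrix.vecCons v fun i => b • w i) = (∏ _i : Fin q, b) • α (Matrix.vecCons v w) :=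
    (α.curryLeft v).toMultilinearMap.map_smul_univ (fun _ => b) w
  rw [h1, h2, Finset.prod_const, Finset.card_univ, Fintype.card_fin, smul_smul]

end Alternating

section Necessity

variable {ι : Type} [Fintype ι] [DecidableEq ι] {m : ℕ}
  {M : Type*} [TopologicalSpace M] [ChartedSpace (EuclideanSpace ℝ (Fin m)) M]
  {V : M → Type*} [TopologicalSpace (TotalSpace (ι → ℝ) V)]
  [∀ x, AddCommGroup (V x)] [∀ x, Module ℝ (V x)] [∀ x, TopologicalSpace (V x)]
  [∀ x, IsTopologicalAddGroup (V x)] [∀ x, ContinuousSMul ℝ (V x)]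
  [FiberBundle (ι → ℝ) V] [VectorBundle ℝ (ι → ℝ) V]
  [IsManifold (𝓡 m) ∞ M] [ContMDiffVectorBundle ∞ (ι → ℝ) V (𝓡 m)]
  {G : Grading (ι := ι) V}
  {n : ℕ} {S : Set (Fin n → ℝ)} {h : (Fin n → ℝ) → ℝ → M}

theorem mem_connectedComponent_of_continuous {γ : ℝ → M} (hγ : Continuous γ) (s t : ℝ) :
    γ t ∈ connectedComponent (γ s) :=
  (isPreconnected_univ.image γ hγ.continuousOn).subset_connectedComponent
    (mem_image_of_mem _ (mem_univ s)) (mem_image_of_mem _ (mem_univ t))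

namespace Superconnection

variable {D : Superconnection (ι := ι) (m := m) G} {x₀ : M} {c : M}

theorem curv_extMat_apply (hf : IsOpenFamily m S h x₀) {u : Fin n → ℝ} (hu : u ∈ S) {t : ℝ}
    (hc : extend h (u, t) ∈ patch ι m V c) {q : ℕ} {v : EuclideanSpace ℝ (Fin m)}
    {w : Fin q → EuclideanSpace ℝ (Fin m)} {W : Fin q → Fin n → ℝ}
    (hv : HasDerivAt (fun t => chartAt (EuclideanSpace ℝ (Fin m)) c (extend h (u, t))) v t)
    (hw : ∀ j, HasDerivAt (fun τ : ℝ => chartAt (EuclideanSpace ℝ (Fin m)) c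
      (extend h (u + τ • W j, t))) (w j) 0) :
    curv (mulB ι) (D.extMat S h c) (q + 1) (u, t)
        (Matrix.vecCons (timeDir n) fun j => ((W j, 0) : (Fin n → ℝ) × ℝ)) =
      D.chartCurv c (q + 1) (chartAt (EuclideanSpace ℝ (Fin m)) c (extend h (u, t)))
        (Matrix.vecCons v w) := by
  have hO : IsOpen (S ×ˢ (univ : Set ℝ)) := hf.isOpen.prod isOpen_univ
  have hz : ((u, t) : (Fin n → ℝ) × ℝ) ∈ S ×ˢ (univ : Set ℝ) := ⟨hu, mem_univ t⟩
  have h2 := (contDiffWithinAt_chart_comp (contMDiffOn_extend hf.smooth) hz hc.1).contDiffAt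
    (hO.mem_nhds hz)
  have h3 := (h2.differentiableAt (by simp)).hasFDerivAt
  have h4 : HasDerivAt (fun t : ℝ => (u, t)) (timeDir n) t :=
    (hasDerivAt_const _ _).prodMk (hasDerivAt_id _)
  have h5 := (h3.comp_hasDerivAt t h4).unique hv
  have h6 : ∀ j, fderiv ℝ (chartAt (EuclideanSpace ℝ (Fin m)) c ∘ extend h) (u, t)
      ((W j, 0) : (Fin n → ℝ) × ℝ) = w j := fun j => by
    have h7 : HasDerivAt (fun τ : ℝ => ((u + τ • W j, t) : (Fin n → ℝ) × ℝ)) (W j, 0) 0 := by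
      refine HasDerivAt.prodMk ?_ (hasDerivAt_const _ _)
      simpa using ((hasDerivAt_id (0 : ℝ)).smul_const (W j)).const_add u
    have h8 : ((u + (0 : ℝ) • W j, t) : (Fin n → ℝ) × ℝ) = (u, t) := by rw [zero_smul, add_zero]
    exact (h3.comp_hasDerivAt_of_eq (0 : ℝ) h7 h8.symm).unique (hw j)
  rw [curv_extMat hf hu hc]
  refine congrArg (D.chartCurv c (q + 1) _) ?_
  ext1 i
  refine Fin.cases ?_ (fun j => ?_) i
  · exact h5
  · exact h6 j

theorem isOpenFamily_const {γ : ℝ → M} (hγ : ContMDiff 𝓘(ℝ, ℝ) (𝓡 m) ∞ γ) :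
    IsOpenFamily m (univ : Set (Fin n → ℝ)) (fun _ => γ) (γ 0) :=
  ⟨isOpen_univ, (hγ.comp contDiff_snd.contMDiff).contMDiffOn, fun _ _ => rfl⟩

/-- The vector is scaled so that the segment stays in the ball of half the radius. The other half is
room for variations of the segment. -/
theorem exists_line (x : M) (hc : x ∈ patch ι m V c) (v : EuclideanSpace ℝ (Fin m)) :
    ∃ R > 0, ∃ r > 0, Metric.ball (chartAt (EuclideanSpace ℝ (Fin m)) c x) R ⊆
        chartDomain (ι := ι) V c ∧
      ∀ s ∈ Icc (-1 : ℝ) 1, chartAt (EuclideanSpace ℝ (Fin m)) c x + (s * r) • v ∈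
        Metric.ball (chartAt (EuclideanSpace ℝ (Fin m)) c x) (R / 2) := by
  obtain ⟨R, hR, hR'⟩ := Metric.isOpen_iff.1 (isOpen_chartDomain (ι := ι) (V := V) c) _
    (chart_mem_chartDomain hc)
  refine ⟨R, hR, R / 2 / (‖v‖ + 1), by positivity, hR', fun s hs => ?_⟩
  rw [Metric.mem_ball, dist_eq_norm, add_sub_cancel_left, norm_smul, norm_mul, Real.norm_eq_abs,
    Real.norm_eq_abs, abs_of_pos (show 0 < R / 2 / (‖v‖ + 1) by positivity)]
  have h1 : |s| ≤ 1 := abs_le.2 hs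
  have h2 : R / 2 / (‖v‖ + 1) * ‖v‖ < R / 2 := by
    rw [div_mul_eq_mul_div, div_lt_iff₀ (by positivity)]
    nlinarith [norm_nonneg v]
  calc |s| * (R / 2 / (‖v‖ + 1)) * ‖v‖ ≤ 1 * (R / 2 / (‖v‖ + 1)) * ‖v‖ := by gcongr
    _ < R / 2 := by rwa [one_mul]

theorem eq_zero_of_inverse_mul {T K : Mat ι} (hT : IsUnit T) (h : Ring.inverse T * (K * T) = 0) :
    K = 0 := by
  obtain ⟨U, rfl⟩ := hT
  rw [Ring.inverse_unit] at h
  have h1 : (U : Mat ι) * (↑U⁻¹ * (K * (U : Mat ι))) * ↑U⁻¹ = 0 := by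
    rw [h]
    exact (congrArg (· * (↑U⁻¹ : Mat ι)) (mul_zero (U : Mat ι))).trans (zero_mul _)
  rwa [Units.mul_inv_cancel_left, mul_assoc, Units.mul_inv, mul_one] at h1

/-- If the parallel transport commutes with `A₀`, then `A₀` is covariantly constant. -/
theorem chartCurv_one_eq_zero (hA : ∀ x, D.A₀ x ∘ₗ D.A₀ x = 0) {z : M} (hc : z ∈ patch ι m V c)
    (H : ∀ y₀ ∈ connectedComponent z, ∀ y₁ ∈ connectedComponent z, D.PathSpaceEq 0 y₀ y₁) :
    D.chartCurv c 1 (chartAt (EuclideanSpace ℝ (Fin m)) c z) = 0 := by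
  suffices hv : ∀ v, D.chartCurv c 1 (chartAt (EuclideanSpace ℝ (Fin m)) c z)
      (Matrix.vecCons v ![]) = 0 by
    ext1 w
    refine Eq.trans (congrArg _ ?_) (hv (w 0))
    ext1 i; fin_cases i; rfl
  intro v
  obtain ⟨R, hR, r, hr, hball, hmem⟩ := exists_line (ι := ι) (V := V) z hc v
  set y := chartAt (EuclideanSpace ℝ (Fin m)) c z with hy
  have hsub := Metric.ball_subset_ball (x := y) (show R / 2 ≤ R by linarith)
  have hball' := (hsub.trans hball).trans inter_subset_left
  have ha := hmem (-1) (by norm_num)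
  have hb := hmem 1 (by norm_num)
  set a := y + (-1 * r) • v with ha'
  set b := y + (1 * r) • v with hb'
  have hba : b - a = (2 * r) • v := by rw [ha', hb']; module
  have hγ := isSmoothPath_chartLine hball' ha hb
  have hpatch : ∀ t, chartLine c a b t ∈ patch ι m V c := fun t =>
    symm_mem_patch (hball (hsub (add_smoothTransition_smul_mem ha hb t)))
  have hchart : ∀ t, chartAt (EuclideanSpace ℝ (Fin m)) c (chartLine c a b t) =
      a + Real.smoothTransition t • (b - a) := fun t =>
    OpenPartialHomeomorph.right_inv _ (hball' (add_smoothTransition_smul_mem ha hb t))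
  have hz : chartLine c a b (1 / 2) = z := by
    rw [chartLine, smoothTransition_half, hba, ha']
    have : y + (-1 * r) • v + (1 / 2 : ℝ) • (2 * r) • v = y := by module
    rw [this]
    exact OpenPartialHomeomorph.left_inv _ hc.1
  have hcomp : ∀ t, chartLine c a b t ∈ connectedComponent z := fun t => by
    have := mem_connectedComponent_of_continuous hγ.smooth.continuous (1 / 2) t
    rwa [hz] at this
  set γ := chartLine c a b
  have hf := isOpenFamily_const (n := 0) hγ.smooth
  have hu := mem_univ (0 : Fin 0 → ℝ)
  have hd := hasDerivAt_holonomyDefect (D := D) hf hu (t := 1 / 2) (by norm_num) (c := c)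
    (hpatch _) (q := 0) (fun p hp => absurd hp (Nat.not_lt_zero p)) (fun p hp => by
      obtain rfl : p = 0 := by omega
      exact chartCurv_zero hA (chart_mem_chartDomain (hpatch _))) (fun j => (j.elim0, 0))
  -- The condition in degree 0 applies to every initial piece of the path, so the function vanishes
  -- identically near 1/2. Its derivative, a conjugate of the contracted curvature, is therefore
  -- zero.
  have h0 : HasDerivAt (D.holonomyDefect univ (fun _ => γ) (γ 0) 0 (0 : Fin 0 → ℝ)
      (fun j => (j.elim0, 0))) 0 (1 / 2) := by
    refine (hasDerivAt_const (1 / 2 : ℝ) (0 : Mat ι)).congr_of_eventuallyEq ?_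
    filter_upwards [Ioo_mem_nhds (show (0 : ℝ) < 1 / 2 by norm_num)
      (show (1 / 2 : ℝ) < 1 by norm_num)] with t ht
    rw [holonomyDefect_eq (D := D) hf hu ⟨by linarith [ht.1], by linarith [ht.2]⟩ (hpatch _).2,
      pathDefect_zero_of_pathSpaceEq hγ.smooth rfl hpatch (H _ (hcomp _) _ (hcomp _))]
    exact mul_zero _
  have h1 := eq_zero_of_inverse_mul
    (isUnit_baseMat (D := D) hf hu (1 / 2) (by norm_num) c (hpatch _).2) (hd.unique h0)
  -- The transition function is applied twice, by `extend` and by `chartLine`, each time with the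
  -- derivative 2 at 1/2; along the displacement (2r)v the velocity becomes (8r)v.
  have h2 : HasDerivAt (fun t => chartAt (EuclideanSpace ℝ (Fin m)) c
      (extend (fun _ => γ) ((0 : Fin 0 → ℝ), t))) ((8 * r) • v) (1 / 2) := by
    have h3 : HasDerivAt (fun t => Real.smoothTransition (Real.smoothTransition t)) (2 * 2)
        (1 / 2) := HasDerivAt.comp (h₂ := Real.smoothTransition) (1 / 2 : ℝ)
      (by rw [smoothTransition_half]; exact hasDerivAt_smoothTransition_half)
      hasDerivAt_smoothTransition_half
    have h4 := (h3.smul_const (b - a)).const_add a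
    simp only [extend, hchart]
    refine h4.congr_deriv ?_
    rw [hba]; module
  have h3 := curv_extMat_apply (D := D) hf hu (hpatch _) (q := 0) (w := fun j => j.elim0)
    (W := fun j => j.elim0) h2 (fun j => j.elim0)
  have h4 : extend (fun _ => γ) ((0 : Fin 0 → ℝ), (1 / 2 : ℝ)) = z := by
    simp only [extend]; rw [smoothTransition_half, hz]
  rw [h4] at h3
  have h5 := (h3.symm.trans h1)
  have h6 := apply_vecCons_smul (D.chartCurv c 1 y) (8 * r) 1 v ![]
  have h7 : (8 * r * 1 ^ 0 : ℝ) ≠ 0 := by positivity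
  refine (smul_eq_zero.1 (h6.symm.trans (Eq.trans (congrArg _ ?_) h5))).resolve_left h7
  ext1 i; fin_cases i; rfl

end Superconnection

end Necessity

/-! ### Variations of a path supported near one point -/

section BumpFamily

variable {m : ℕ} {M : Type*} [TopologicalSpace M] [ChartedSpace (EuclideanSpace ℝ (Fin m)) M]
  {n : ℕ}

open Classical in
/-- A family of variations of a path `γ`, in the chart at `c` and near to the time `1 / 2`. -/
def bumpFamily (γ : ℝ → M) (c : M) (a e : EuclideanSpace ℝ (Fin m))
    (w : Fin n → EuclideanSpace ℝ (Fin m)) (β : ℝ → ℝ) (u : Fin n → ℝ) (s : ℝ) : M :=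
  if s ∈ Ioo (1 / 5 : ℝ) (4 / 5) then (chartAt (EuclideanSpace ℝ (Fin m)) c).symm
    (a + Real.smoothTransition (5 * s - 2) • e + β s • ∑ j, u j • w j)
  else γ s

variable {γ : ℝ → M} {c : M} {a e : EuclideanSpace ℝ (Fin m)}
  {w : Fin n → EuclideanSpace ℝ (Fin m)} {β : ℝ → ℝ}

theorem bumpFamily_of_mem {s : ℝ} (hs : s ∈ Ioo (1 / 5 : ℝ) (4 / 5)) (u : Fin n → ℝ) :
    bumpFamily γ c a e w β u s = (chartAt (EuclideanSpace ℝ (Fin m)) c).symm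
      (a + Real.smoothTransition (5 * s - 2) • e + β s • ∑ j, u j • w j) :=
  if_pos hs

theorem bumpFamily_of_eq_zero (hγ : ∀ s ∈ Ioo (1 / 5 : ℝ) (4 / 5), γ s =
      (chartAt (EuclideanSpace ℝ (Fin m)) c).symm (a + Real.smoothTransition (5 * s - 2) • e))
    {u : Fin n → ℝ} {s : ℝ} (hs : β s = 0 ∨ u = 0) : bumpFamily γ c a e w β u s = γ s := by
  by_cases h : s ∈ Ioo (1 / 5 : ℝ) (4 / 5)
  · have h1 : β s • ∑ j, u j • w j = 0 := by
      rcases hs with hs | hs <;> simp [hs]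
    rw [bumpFamily_of_mem h, hγ s h, h1, add_zero]
  · exact if_neg h

theorem bumpFamily_mem_ball {y : EuclideanSpace ℝ (Fin m)} {R : ℝ}
    (ha : a ∈ Metric.ball y (R / 2)) (hae : a + e ∈ Metric.ball y (R / 2))
    (hβ : ∀ s, β s ∈ Icc (0 : ℝ) 1) {u : Fin n → ℝ} (hu : ‖∑ j, u j • w j‖ < R / 2) (s : ℝ) :
    a + Real.smoothTransition (5 * s - 2) • e + β s • ∑ j, u j • w j ∈ Metric.ball y R := by
  have h1 := add_smoothTransition_smul_mem ha hae (5 * s - 2)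
  rw [add_sub_cancel_left] at h1
  rw [Metric.mem_ball, dist_eq_norm] at h1 ⊢
  have h2 : ‖β s • ∑ j, u j • w j‖ ≤ ‖∑ j, u j • w j‖ := by
    rw [norm_smul, Real.norm_eq_abs, abs_of_nonneg (hβ s).1]
    exact mul_le_of_le_one_left (norm_nonneg _) (hβ s).2
  have h3 : a + Real.smoothTransition (5 * s - 2) • e + β s • ∑ j, u j • w j - y =
      (a + Real.smoothTransition (5 * s - 2) • e - y) + β s • ∑ j, u j • w j := by abel
  rw [h3]
  linarith [norm_add_le (a + Real.smoothTransition (5 * s - 2) • e - y) (β s • ∑ j, u j • w j)]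

/-- The bump vanishes for |s - 1/2| ≥ 1/10, so the two formulas agree on open sets around the ends
of (1/5, 4/5). The bound on the parameters keeps the varied path inside the ball in the chart. -/
theorem contMDiffAt_bumpFamily [IsManifold (𝓡 m) ∞ M] (hγs : ContMDiff 𝓘(ℝ, ℝ) (𝓡 m) ∞ γ)
    (hγ : ∀ s ∈ Ioo (1 / 5 : ℝ) (4 / 5), γ s =
      (chartAt (EuclideanSpace ℝ (Fin m)) c).symm (a + Real.smoothTransition (5 * s - 2) • e))
    {y : EuclideanSpace ℝ (Fin m)} {R : ℝ}
    (hR : Metric.ball y R ⊆ (chartAt (EuclideanSpace ℝ (Fin m)) c).target)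
    (ha : a ∈ Metric.ball y (R / 2)) (hae : a + e ∈ Metric.ball y (R / 2))
    (hβ : ∀ s, β s ∈ Icc (0 : ℝ) 1) (hβs : ContDiff ℝ ∞ β)
    (hβ0 : ∀ s, 1 / 10 ≤ |s - 1 / 2| → β s = 0)
    {z : (Fin n → ℝ) × ℝ} (hz : ‖∑ j, z.1 j • w j‖ < R / 2) :
    ContMDiffAt 𝓘(ℝ, (Fin n → ℝ) × ℝ) (𝓡 m) ∞ (fun z => bumpFamily γ c a e w β z.1 z.2) z := by
  by_cases h : z.2 ∈ Ioo (1 / 5 : ℝ) (4 / 5)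
  · have h1 := (contMDiffOn_chart_symm (I := 𝓡 m) (n := ∞) (x := c)).contMDiffAt
      ((chartAt (EuclideanSpace ℝ (Fin m)) c).open_target.mem_nhds
        (hR (bumpFamily_mem_ball ha hae hβ hz z.2)))
    have h2 : ContDiff ℝ ∞ fun z : (Fin n → ℝ) × ℝ =>
        a + Real.smoothTransition (5 * z.2 - 2) • e + β z.2 • ∑ j, z.1 j • w j := by
      have h3 : ContDiff ℝ ∞ fun z : (Fin n → ℝ) × ℝ => Real.smoothTransition (5 * z.2 - 2) :=
        Real.smoothTransition.contDiff.comp ((contDiff_const.mul contDiff_snd).sub contDiff_const)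
      have h4 : ContDiff ℝ ∞ fun z : (Fin n → ℝ) × ℝ => ∑ j, z.1 j • w j :=
        ContDiff.sum fun j _ =>
          ((contDiff_apply ℝ ℝ j).comp contDiff_fst).smul contDiff_const
      exact (contDiff_const.add (h3.smul contDiff_const)).add ((hβs.comp contDiff_snd).smul h4)
    refine (ContMDiffAt.comp (f := fun z : (Fin n → ℝ) × ℝ =>
      a + Real.smoothTransition (5 * z.2 - 2) • e + β z.2 • ∑ j, z.1 j • w j) z h1
      (h2.contMDiff z)).congr_of_eventuallyEq ?_
    filter_upwards [(isOpen_Ioo.preimage continuous_snd).mem_nhds h] with z' hz'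
    exact bumpFamily_of_mem hz' z'.1
  · refine ((hγs.comp contDiff_snd.contMDiff) z).congr_of_eventuallyEq ?_
    have h1 : ∀ᶠ z' : (Fin n → ℝ) × ℝ in nhds z, 1 / 10 < |z'.2 - 1 / 2| := by
      refine (isOpen_lt continuous_const (by fun_prop)).mem_nhds ?_
      by_contra hc
      have := abs_le.1 (not_lt.1 (show ¬ 1 / 10 < |z.2 - 1 / 2| from hc))
      exact h ⟨by linarith [this.1], by linarith [this.2]⟩
    filter_upwards [h1] with z' hz'
    exact bumpFamily_of_eq_zero hγ (Or.inl (hβ0 _ hz'.le))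

end BumpFamily

/-! ### From the equations on path spaces to the structure equations in positive degree -/

section Necessity

variable {ι : Type} [Fintype ι] [DecidableEq ι] {m : ℕ}
  {M : Type*} [TopologicalSpace M] [ChartedSpace (EuclideanSpace ℝ (Fin m)) M]
  {V : M → Type*} [TopologicalSpace (TotalSpace (ι → ℝ) V)]
  [∀ x, AddCommGroup (V x)] [∀ x, Module ℝ (V x)] [∀ x, TopologicalSpace (V x)]
  [∀ x, IsTopologicalAddGroup (V x)] [∀ x, ContinuousSMul ℝ (V x)]
  [FiberBundle (ι → ℝ) V] [VectorBundle ℝ (ι → ℝ) V]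
  [IsManifold (𝓡 m) ∞ M] [ContMDiffVectorBundle ∞ (ι → ℝ) V (𝓡 m)]
  {G : Grading (ι := ι) V} {n : ℕ} {S : Set (Fin n → ℝ)} {h : (Fin n → ℝ) → ℝ → M}

namespace Superconnection

variable {D : Superconnection (ι := ι) (m := m) G} {x₀ x₁ : M} {c : M}

theorem chartCurv_le_eq_zero (hA : ∀ x, D.A₀ x ∘ₗ D.A₀ x = 0) {q : ℕ} {x : M}
    (hS : ∀ p < q, D.StructureEq p x) (hc : x ∈ patch ι m V c) :
    ∀ p ≤ q, D.chartCurv c p (chartAt (EuclideanSpace ℝ (Fin m)) c x) = 0 := fun p hp => by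
  rcases p with _ | p
  · exact chartCurv_zero hA (chart_mem_chartDomain hc)
  · exact (D.structureEq_iff p x).1 (hS p hp) c hc

theorem holonomyDefect_init (hf : IsOpenFamily m S h x₀) {u : Fin n → ℝ} (hu : u ∈ S) {q : ℕ}
    (w : Fin q → (Fin n → ℝ) × ℝ) : D.holonomyDefect S h x₀ q u w (-1 / 2) = 0 := by
  have h1 : extend h (u, (-1 / 2 : ℝ)) = x₀ := by
    simp only [extend]
    rw [Real.smoothTransition.zero_of_nonpos (by norm_num), hf.source u hu]
  rw [holonomyDefect_eq (D := D) hf hu (by norm_num) (c := x₀)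
    (by rw [h1]; exact FiberBundle.mem_baseSet_trivializationAt' _),
    pathDefect_init hf hu (by norm_num)]
  exact mul_zero _

theorem holonomyDefect_final (hf : IsOpenFamily m S h x₀) (hx₁ : ∀ u ∈ S, h u 1 = x₁)
    {u : Fin n → ℝ} (hu : u ∈ S) {q : ℕ} (H : D.PathSpaceEq q x₀ x₁)
    (w : Fin q → (Fin n → ℝ) × ℝ) : D.holonomyDefect S h x₀ q u w (3 / 2) = 0 := by
  have h1 : extend h (u, (3 / 2 : ℝ)) = x₁ := by
    simp only [extend]
    rw [Real.smoothTransition.one_of_one_le (by norm_num), hx₁ u hu]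
  rw [holonomyDefect_eq (D := D) hf hu (by norm_num) (c := x₁)
    (by rw [h1]; exact FiberBundle.mem_baseSet_trivializationAt' _),
    (pathDefect_final_eq_zero_iff hf hx₁ hu (t := 3 / 2) (by norm_num) q).2
      (H n S h hf.isOpen ⟨hf.smooth, hf.source, hx₁⟩ u hu)]
  exact mul_zero _

/-- A function with a nonnegative derivative and the same values at both ends has the derivative
zero. -/
theorem deriv_eq_zero_of_nonneg {f f' : ℝ → ℝ} {a b t : ℝ}
    (hc : ContinuousOn f (Icc a b)) (hf : ∀ t ∈ Ioo a b, HasDerivAt f (f' t) t)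
    (hf' : ∀ t ∈ Ioo a b, 0 ≤ f' t) (hab : f a = f b) (ht : t ∈ Ioo a b) : f' t = 0 := by
  have hle := (ht.1.trans ht.2).le
  have hmono : MonotoneOn f (Icc a b) := monotoneOn_of_deriv_nonneg (convex_Icc a b) hc
    (by rw [interior_Icc]; exact fun t ht => (hf t ht).differentiableAt.differentiableWithinAt)
    (by rw [interior_Icc]; exact fun t ht => (hf t ht).deriv ▸ hf' t ht)
  have hconst : ∀ τ ∈ Icc a b, f τ = f a := fun τ hτ => le_antisymm
    (hab ▸ hmono hτ (right_mem_Icc.2 hle) hτ.2) (hmono (left_mem_Icc.2 hle) hτ hτ.1)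
  refine (hf t ht).unique ((hasDerivAt_const t (f a)).congr_of_eventuallyEq ?_)
  filter_upwards [Icc_mem_nhds ht.1 ht.2] with τ hτ using hconst τ hτ

theorem contDiffAt_chartCurv {y : EuclideanSpace ℝ (Fin m)}
    (hy : y ∈ chartDomain (ι := ι) V c) (q : ℕ) : ContDiffAt ℝ ∞ (D.chartCurv c q) y := by
  have h1 : ∀ n, ContDiffAt ℝ ∞ (D.signedForm c n) y := fun n => D.contDiffAt_signedForm hy n
  exact (contDiffAt_dext h1 (by simp) q).add (contDiffAt_star (mulB ι) q
    (a := fun n y => eps (fun n => D.signedForm c n y) n)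
    (fun n => ContDiffAt.const_smul ((-1 : ℝ) ^ n) (h1 n)) h1)

theorem exists_hasDerivAt_chart_extend (hf : IsOpenFamily m S h x₀) {u : Fin n → ℝ} (hu : u ∈ S)
    {t : ℝ} (hc : extend h (u, t) ∈ patch ι m V c) : ∃ v : EuclideanSpace ℝ (Fin m),
      HasDerivAt (fun t => chartAt (EuclideanSpace ℝ (Fin m)) c (extend h (u, t))) v t := by
  have hO : IsOpen (S ×ˢ (univ : Set ℝ)) := hf.isOpen.prod isOpen_univ
  have hz : ((u, t) : (Fin n → ℝ) × ℝ) ∈ S ×ˢ (univ : Set ℝ) := ⟨hu, mem_univ t⟩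
  have h2 := (contDiffWithinAt_chart_comp (contMDiffOn_extend hf.smooth) hz hc.1).contDiffAt
    (hO.mem_nhds hz)
  exact ⟨_, ((h2.differentiableAt (by simp)).hasFDerivAt).comp_hasDerivAt t
    ((hasDerivAt_const _ _).prodMk (hasDerivAt_id _))⟩

/-- A straight line through z in the chart is joined to `x₀` and `x₁` by smooth paths. This is why a
condition at one pair of end points controls the curvature on the whole component. -/
theorem exists_path_through (hx₁ : x₁ ∈ connectedComponent x₀) {z : M}
    (hz : z ∈ connectedComponent x₀) (hc : z ∈ (chartAt (EuclideanSpace ℝ (Fin m)) c).source)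
    {a e : EuclideanSpace ℝ (Fin m)} {R : ℝ}
    (hball : Metric.ball (chartAt (EuclideanSpace ℝ (Fin m)) c z) R ⊆
      (chartAt (EuclideanSpace ℝ (Fin m)) c).target)
    (ha : a ∈ Metric.ball (chartAt (EuclideanSpace ℝ (Fin m)) c z) R)
    (hae : a + e ∈ Metric.ball (chartAt (EuclideanSpace ℝ (Fin m)) c z) R)
    (hmid : a + (1 / 2 : ℝ) • e = chartAt (EuclideanSpace ℝ (Fin m)) c z) :
    ∃ γ : ℝ → M, IsSmoothPath m γ x₀ x₁ ∧ ∀ s ∈ Ioo (1 / 5 : ℝ) (4 / 5), γ s =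
      (chartAt (EuclideanSpace ℝ (Fin m)) c).symm (a + Real.smoothTransition (5 * s - 2) • e) := by
  have h1 := isSmoothPath_chartLine hball ha hae
  have hline : IsSmoothPath m (chartLine c a (a + e)) (chartLine c a (a + e) 0)
      (chartLine c a (a + e) 1) :=
    ⟨h1.smooth, fun t ht => (h1.left t ht).trans (h1.left 0 le_rfl).symm,
      fun t ht => (h1.right t ht).trans (h1.right 1 le_rfl).symm⟩
  have hlz : chartLine c a (a + e) (1 / 2) = z := by
    rw [chartLine, smoothTransition_half, add_sub_cancel_left, hmid]
    exact OpenPartialHomeomorph.left_inv _ hc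
  have hcomp : ∀ t, chartLine c a (a + e) t ∈ connectedComponent x₀ := fun t => by
    have := mem_connectedComponent_of_continuous hline.smooth.continuous (1 / 2) t
    rw [hlz, ← connectedComponent_eq hz] at this
    exact this
  obtain ⟨γ₁, hγ₁⟩ := exists_isSmoothPath (m := m) (hcomp 0)
  obtain ⟨γ₃, hγ₃⟩ := exists_isSmoothPath (m := m) (x₀ := chartLine c a (a + e) 1) (x₁ := x₁)
    (by rwa [← connectedComponent_eq (hcomp 1)])
  refine ⟨_, hγ₁.concat hline hγ₃, fun s hs => ?_⟩
  rw [concat_of_mem_Ioo hγ₁ hline hγ₃ hs, chartLine, add_sub_cancel_left]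

/-- If the curvature were nonzero on (v, w) at z, a path through z with velocity along v, varied by
a narrow bump in the directions w_j, would give a transported defect whose derivative is T⁻¹ κ T
times a nonnegative factor supported near z. A functional makes it nonnegative, and positive at the
midpoint. But the defect is 0 at the start by construction and 0 at the end by the equation on the
path space. -/
theorem structure_equation_step (hA : ∀ x, D.A₀ x ∘ₗ D.A₀ x = 0) {q : ℕ} (hq : 1 ≤ q)
    (hx₁ : x₁ ∈ connectedComponent x₀) (H : D.PathSpaceEq q x₀ x₁)
    (hS : ∀ p < q, ∀ x ∈ connectedComponent x₀, D.StructureEq p x) {z : M}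
    (hz : z ∈ connectedComponent x₀) (hc : z ∈ patch ι m V c) :
    D.chartCurv c (q + 1) (chartAt (EuclideanSpace ℝ (Fin m)) c z) = 0 := by
  by_contra hne
  obtain ⟨v, w, hvw⟩ : ∃ v w, D.chartCurv c (q + 1) (chartAt (EuclideanSpace ℝ (Fin m)) c z)
      (Matrix.vecCons v w) ≠ 0 := by
    by_contra hall
    push Not at hall
    refine hne ?_
    ext1 w
    refine Eq.trans (congrArg _ ?_) (hall (w 0) fun i => w i.succ)
    ext1 i
    refine Fin.cases rfl (fun j => rfl) i
  obtain ⟨R, hR, r, hr, hball, hmem⟩ := exists_line (ι := ι) (V := V) z hc v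
  set y := chartAt (EuclideanSpace ℝ (Fin m)) c z with hy
  have hsub := Metric.ball_subset_ball (x := y) (show R / 2 ≤ R by linarith)
  have hballt := hball.trans inter_subset_left
  have ha := hmem (-1) (by norm_num)
  have hb := hmem 1 (by norm_num)
  set a := y + (-1 * r) • v with ha'
  -- The displacement from y - r v to y + r v, so that y is the middle of the segment.
  obtain ⟨e, he⟩ : ∃ e, e = (2 * r) • v := ⟨_, rfl⟩
  have hae' : a + e = y + (1 * r) • v := by rw [he, ha']; module
  have hae : a + e ∈ Metric.ball y (R / 2) := by rwa [hae']
  have hmid : a + (1 / 2 : ℝ) • e = y := by rw [he, ha']; module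
  obtain ⟨γ, hγ, hγform⟩ := exists_path_through hx₁ hz hc.1 (hsub.trans hballt) ha hae hmid
  have hγC : ∀ t, γ t ∈ connectedComponent x₀ := fun t => by
    have := mem_connectedComponent_of_continuous hγ.smooth.continuous 0 t
    rwa [hγ.left 0 le_rfl] at this
  have hf₀ : IsOpenFamily m (univ : Set (Fin q → ℝ)) (fun _ => γ) x₀ :=
    ⟨isOpen_univ, (isOpenFamily_const hγ.smooth).smooth, fun _ _ => hγ.left 0 le_rfl⟩
  -- the position in the chart, and its velocity
  obtain ⟨Y, hY⟩ : ∃ Y : ℝ → EuclideanSpace ℝ (Fin m), Y = fun t =>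
    a + Real.smoothTransition (5 * Real.smoothTransition t - 2) • e := ⟨_, rfl⟩
  have hYball : ∀ t, Y t ∈ Metric.ball y (R / 2) := fun t => by
    have h1 := add_smoothTransition_smul_mem ha hae (5 * Real.smoothTransition t - 2)
    rw [add_sub_cancel_left] at h1
    rw [hY]
    exact h1
  have hYdom : ∀ t, Y t ∈ chartDomain (ι := ι) V c := fun t => hball (hsub (hYball t))
  have hYmid : Y (1 / 2) = y := by
    rw [hY]
    simp only [smoothTransition_half]
    rw [show (5 * (1 / 2) - 2 : ℝ) = 1 / 2 by norm_num, smoothTransition_half, hmid]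
  obtain ⟨ρ', hρ'⟩ : ∃ ρ' : ℝ → ℝ, ρ' = fun t =>
    deriv Real.smoothTransition (5 * Real.smoothTransition t - 2) *
        (5 * deriv Real.smoothTransition t) := ⟨_, rfl⟩
  have hρ : ∀ t, HasDerivAt Y ((ρ' t * (2 * r)) • v) t := fun t => by
    have h1 := ((hasDerivAt_smoothTransition_comp t).smul_const e).const_add a
    rw [hY]
    refine h1.congr_deriv ?_
    rw [hρ', he, smul_smul]
  have hρ0 : ∀ t, 0 ≤ ρ' t := fun t => by
    rw [hρ']
    have h1 : ∀ t, 0 ≤ deriv Real.smoothTransition t := fun t =>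
      Real.smoothTransition.monotone.deriv_nonneg
    have := h1 t
    exact mul_nonneg (h1 _) (by positivity)
  -- The factor 5 comes from the concatenation, and each of the two transition functions contributes
  -- 2.
  have hρmid : ρ' (1 / 2) = 20 := by
    rw [hρ']
    simp only [smoothTransition_half]
    rw [show (5 * (1 / 2) - 2 : ℝ) = 1 / 2 by norm_num, hasDerivAt_smoothTransition_half.deriv]
    norm_num
  have hγY : ∀ t, Real.smoothTransition t ∈ Ioo (1 / 5 : ℝ) (4 / 5) →
      γ (Real.smoothTransition t) = (chartAt (EuclideanSpace ℝ (Fin m)) c).symm (Y t) :=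
    fun t ht => by rw [hγform _ ht, hY]
  have hpatchY : ∀ t, (chartAt (EuclideanSpace ℝ (Fin m)) c).symm (Y t) ∈ patch ι m V c :=
    fun t => symm_mem_patch (hYdom t)
  have hchartY : ∀ t, chartAt (EuclideanSpace ℝ (Fin m)) c
      ((chartAt (EuclideanSpace ℝ (Fin m)) c).symm (Y t)) = Y t :=
    fun t => OpenPartialHomeomorph.right_inv _ (hYdom t).1
  -- the derivative of the defect, transported back, up to a nonnegative factor
  have hmidmem : Real.smoothTransition (1 / 2) ∈ Ioo (1 / 5 : ℝ) (4 / 5) := by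
    rw [smoothTransition_half]; norm_num
  obtain ⟨T, hT⟩ : ∃ T : ℝ → Mat ι, T = fun t =>
    D.baseMat univ (fun _ : Fin q → ℝ => γ) x₀ c (0, t) := ⟨_, rfl⟩
  obtain ⟨κ, hκ⟩ : ∃ κ : ℝ → Mat ι, κ = fun t =>
    D.chartCurv c (q + 1) (Y t) (Matrix.vecCons v w) := ⟨_, rfl⟩
  have hmidpatch : extend (fun _ : Fin q → ℝ => γ) (0, (1 / 2 : ℝ)) ∈ patch ι m V c := by
    change γ (Real.smoothTransition (1 / 2)) ∈ _
    rw [hγY _ hmidmem]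
    exact hpatchY _
  have hTmid : IsUnit (T (1 / 2)) := by
    rw [hT]
    exact isUnit_baseMat (D := D) hf₀ (mem_univ _) _ (by norm_num) c hmidpatch.2
  have hne' : Ring.inverse (T (1 / 2)) * (κ (1 / 2) * T (1 / 2)) ≠ 0 := fun h0 => by
    have h1 := eq_zero_of_inverse_mul hTmid h0
    rw [hκ] at h1
    simp only [hYmid] at h1
    exact hvw h1
  -- The matrix-valued derivative is reduced to a real one, normalized to 1 at the midpoint; by
  -- continuity it stays positive nearby.
  obtain ⟨ℓ, hℓ⟩ := SeparatingDual.exists_eq_one (R := ℝ) hne'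
  obtain ⟨g, hg⟩ : ∃ g : ℝ → ℝ, g = fun t => ℓ (Ring.inverse (T t) * (κ t * T t)) := ⟨_, rfl⟩
  have hgcont : ContinuousAt g (1 / 2) := by
    have h1 : ContinuousAt T (1 / 2) := by
      rw [hT]
      exact (hasDerivAt_baseMat (D := D) hf₀ (mem_univ _) hmidpatch.2).continuousAt
    have h2 : ContinuousAt κ (1 / 2) := by
      rw [hκ]
      have h3 : ContinuousAt (fun t => D.chartCurv c (q + 1) (Y t)) (1 / 2) :=
        ContinuousAt.comp (f := Y) (contDiffAt_chartCurv (D := D) (hYdom _) (q + 1)).continuousAt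
          (hρ _).continuousAt
      exact (ContinuousAlternatingMap.apply ℝ (EuclideanSpace ℝ (Fin m)) (Mat ι)
        (Matrix.vecCons v w)).continuous.continuousAt.comp h3
    have h3 : ContinuousAt (fun t => Ring.inverse (T t)) (1 / 2) := by
      obtain ⟨U, hU⟩ := hTmid
      exact ContinuousAt.comp (f := T) (hU ▸ NormedRing.inverse_continuousAt U) h1
    rw [hg]
    exact ℓ.continuous.continuousAt.comp (h3.mul (h2.mul h1))
  have hgmid : g (1 / 2) = 1 := by rw [hg]; exact hℓ
  obtain ⟨ε, hε, hgε⟩ := Metric.eventually_nhds_iff.1 (hgcont.eventually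
    (lt_mem_nhds (show 0 < g (1 / 2) by rw [hgmid]; exact one_pos)))
  obtain ⟨δ, hδ, hδε⟩ := exists_abs_smoothTransition_sub_le hε
  have hδ' : 0 < min δ (1 / 10) := lt_min hδ (by norm_num)
  -- The outer radius is at most δ, so that β lives where g is positive, and at most 1/10, so that
  -- the varied paths can be glued to γ.
  obtain ⟨β, hβ⟩ : ∃ β : ContDiffBump (1 / 2 : ℝ), β.rOut = min δ (1 / 10) :=
    ⟨⟨min δ (1 / 10) / 2, min δ (1 / 10), half_pos hδ', half_lt_self hδ'⟩, rfl⟩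
  have hβ0 : ∀ s, min δ (1 / 10) ≤ |s - 1 / 2| → β s = 0 := fun s hs =>
    β.zero_of_le_dist (by rw [hβ, Real.dist_eq]; exact hs)
  have hβ01 : ∀ s, β s ∈ Icc (0 : ℝ) 1 := fun s => ⟨β.nonneg, β.le_one⟩
  have hβmid : β (1 / 2) = 1 := β.one_of_mem_closedBall (Metric.mem_closedBall_self β.rIn_pos.le)
  obtain ⟨h, hh⟩ : ∃ h : (Fin q → ℝ) → ℝ → M, h = bumpFamily γ c a e w β := ⟨_, rfl⟩
  have hfix : ∀ u s, (β s = 0 ∨ u = 0) → h u s = γ s := fun u s hs => by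
    rw [hh]; exact bumpFamily_of_eq_zero hγform hs
  have hh0 : h 0 = γ := funext fun s => hfix 0 s (Or.inr rfl)
  have hβend : ∀ s, s = 0 ∨ s = 1 → β s = 0 := fun s hs => hβ0 s ((min_le_right _ _).trans (by
    rcases hs with rfl | rfl <;> norm_num [abs_of_nonneg, abs_of_nonpos]))
  -- The parameters are small enough for the variation to remain in the ball of radius R around y.
  set S : Set (Fin q → ℝ) := {u | ‖∑ j, u j • w j‖ < R / 2} with hSdef
  have hf : IsOpenFamily m S h x₀ := by
    refine ⟨isOpen_lt (by fun_prop) continuous_const, fun z hz => ?_, fun u _ => ?_⟩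
    · rw [hh]
      exact (contMDiffAt_bumpFamily hγ.smooth hγform hballt ha hae hβ01 β.contDiff
        (fun s hs => hβ0 s ((min_le_right _ _).trans hs)) hz.1).contMDiffWithinAt
    · rw [hfix u 0 (Or.inl (hβend 0 (Or.inl rfl))), hγ.left 0 le_rfl]
  have hx₁' : ∀ u ∈ S, h u 1 = x₁ := fun u _ => by
    rw [hfix u 1 (Or.inl (hβend 1 (Or.inr rfl))), hγ.right 1 le_rfl]
  have hu : (0 : Fin q → ℝ) ∈ S := by
    rw [hSdef]; simpa using half_pos hR
  obtain ⟨W, hW⟩ : ∃ W : Fin q → Fin q → ℝ, W = fun j => Pi.single j 1 := ⟨_, rfl⟩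
  have hsumW : ∀ (j : Fin q) (τ : ℝ), ∑ i, ((0 : Fin q → ℝ) + τ • W j) i • w i = τ • w j :=
    fun j τ => by
      rw [Finset.sum_eq_single j]
      · simp [hW]
      · intro i _ hij
        simp [hW, hij]
      · simp
  have hext0 : ∀ t, extend h (0, t) = γ (Real.smoothTransition t) := fun t =>
    hfix 0 _ (Or.inr rfl)
  -- The velocity is ρ' · 2r times v, and each of the q variation fields is β times w_j.
  -- Multilinearity produces the factor ρ' · 2r · β^q in front of the curvature on (v, w).
  have hderiv : ∀ t ∈ Icc (-1 / 2 : ℝ) (3 / 2), HasDerivAt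
      (fun t => ℓ (D.holonomyDefect S h x₀ q 0 (fun j => (W j, 0)) t))
      (ρ' t * (2 * r) * (β (Real.smoothTransition t)) ^ q * g t) t := fun t ht => by
    have hstr : ∀ t, ∀ c, extend h (0, t) ∈ patch ι m V c → ∀ p ≤ q,
        D.chartCurv c p (chartAt (EuclideanSpace ℝ (Fin m)) c (extend h (0, t))) = 0 :=
      fun t c hc => chartCurv_le_eq_zero hA (fun p hp => hS p hp _ (by
        rw [hext0]; exact hγC _)) hc
    have hE : ∀ c, extend h (0, t) ∈ patch ι m V c → ∀ p < q, D.pathDefect S h x₀ c p (0, t) = 0 :=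
      fun c hc p hp => pathDefect_eq_zero hf hu
        (fun t c hc p hp => hstr t c hc (p + 1) hp) t ht c hc.2 p hp
    have ht' : t ∈ Ioo (-1 : ℝ) 2 := ⟨by linarith [ht.1], by linarith [ht.2]⟩
    by_cases hσ : Real.smoothTransition t ∈ Ioo (1 / 5 : ℝ) (4 / 5)
    · have hext : extend h (0, t) = (chartAt (EuclideanSpace ℝ (Fin m)) c).symm (Y t) := by
        rw [hext0, hγY t hσ]
      have hp : extend h (0, t) ∈ patch ι m V c := by rw [hext]; exact hpatchY t
      have h1 := hasDerivAt_holonomyDefect (D := D) hf hu ht' hp (hE c hp) (hstr t c hp)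
        fun j => (W j, 0)
      have h2 : HasDerivAt (fun t => chartAt (EuclideanSpace ℝ (Fin m)) c (extend h (0, t)))
          ((ρ' t * (2 * r)) • v) t := by
        refine (hρ t).congr_of_eventuallyEq ?_
        filter_upwards [(isOpen_Ioo.preimage Real.smoothTransition.continuous).mem_nhds hσ] with τ hτ
        rw [hext0, hγY τ hτ, hchartY]
      have h3 : ∀ j, HasDerivAt (fun τ : ℝ => chartAt (EuclideanSpace ℝ (Fin m)) c
          (extend h (0 + τ • W j, t))) (β (Real.smoothTransition t) • w j) 0 := fun j => by
        have h4 : ∀ᶠ τ : ℝ in nhds 0, ‖τ • w j‖ < R / 2 :=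
          (isOpen_lt (by fun_prop) continuous_const).mem_nhds (by simpa using half_pos hR)
        have h5 := ((hasDerivAt_id (0 : ℝ)).smul_const
          (β (Real.smoothTransition t) • w j)).const_add (Y t)
        refine (h5.congr_of_eventuallyEq ?_).congr_deriv (one_smul _ _)
        filter_upwards [h4] with τ hτ
        have h6 := bumpFamily_mem_ball ha hae hβ01 (w := w) (u := 0 + τ • W j)
          (by rw [hsumW]; exact hτ) (Real.smoothTransition t)
        change chartAt (EuclideanSpace ℝ (Fin m)) c (h (0 + τ • W j) (Real.smoothTransition t)) = _
        rw [hh, bumpFamily_of_mem hσ, OpenPartialHomeomorph.right_inv _ (hballt h6), hsumW, hY]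
        simp only [id_eq]
        rw [smul_comm]
      have h4 := curv_extMat_apply (D := D) hf hu hp h2 h3
      rw [h4, apply_vecCons_smul, hext, hchartY] at h1
      have h5 := ℓ.hasFDerivAt.comp_hasDerivAt t h1
      refine h5.congr_deriv ?_
      have h6 : D.baseMat S h x₀ c (0, t) = T t := by
        rw [hT]; exact baseMat_eq_of_path hf₀ hf (mem_univ _) hu hh0 t
      rw [h6, hg, hκ]
      have h7 : ∀ (s : ℝ) (K : Mat ι), Ring.inverse (T t) * ((s • K) * T t) =
          s • (Ring.inverse (T t) * (K * T t)) := fun s K => by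
        rw [smul_mul_assoc, mul_smul_comm]
      rw [h7, map_smul]
      rfl
    · set c' := extend h (0, t)
      have hp : extend h (0, t) ∈ patch ι m V c' := mem_patch_self _
      have hβt : β (Real.smoothTransition t) = 0 := hβ0 _ ((min_le_right _ _).trans (by
        by_contra hcon
        have := abs_lt.1 (not_le.1 hcon)
        exact hσ ⟨by linarith [this.1], by linarith [this.2]⟩))
      have h1 := hasDerivAt_holonomyDefect (D := D) hf hu ht' hp (hE c' hp) (hstr t c' hp)
        fun j => (W j, 0)
      obtain ⟨v', h2⟩ := exists_hasDerivAt_chart_extend (ι := ι) (V := V) hf hu hp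
      have h3 : ∀ j, HasDerivAt (fun τ : ℝ => chartAt (EuclideanSpace ℝ (Fin m)) c'
          (extend h (0 + τ • W j, t))) ((0 : ℝ) • w j) 0 := fun j => by
        have h4 : (fun τ : ℝ => chartAt (EuclideanSpace ℝ (Fin m)) c'
            (extend h (0 + τ • W j, t))) = fun _ => chartAt (EuclideanSpace ℝ (Fin m)) c'
              (γ (Real.smoothTransition t)) := funext fun τ => by
          simp only [extend]
          rw [hfix _ _ (Or.inl hβt)]
        rw [h4, zero_smul]
        exact hasDerivAt_const _ _
      have h4 := curv_extMat_apply (D := D) hf hu hp h2 h3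
      -- Away from the segment the variation fields vanish. As q ≥ 1, the curvature has at least one
      -- such argument, whatever the velocity v' is; this is the factor 0^q.
      have h5 := apply_vecCons_smul (D.chartCurv c' (q + 1)
        (chartAt (EuclideanSpace ℝ (Fin m)) c' (extend h (0, t)))) 1 0 v' w
      rw [one_smul, one_mul, zero_pow (by omega), zero_smul] at h5
      rw [h4.trans h5] at h1
      have h6 := ℓ.hasFDerivAt.comp_hasDerivAt t h1
      refine h6.congr_deriv ?_
      have h7 : Ring.inverse (D.baseMat S h x₀ c' (0, t)) *
          ((0 : Mat ι) * D.baseMat S h x₀ c' (0, t)) = 0 := by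
        rw [zero_mul, mul_zero]
      rw [h7, map_zero, hβt, zero_pow (by omega), mul_zero, zero_mul]
  -- A function with nonnegative derivative and equal end values is constant, so the derivative at
  -- 1/2 vanishes; but it equals 20 · 2r · 1 · 1.
  have hzero := deriv_eq_zero_of_nonneg (a := -1 / 2) (b := 3 / 2) (t := 1 / 2)
    (f := fun t => ℓ (D.holonomyDefect S h x₀ q 0 (fun j => (W j, 0)) t))
    (f' := fun t => ρ' t * (2 * r) * (β (Real.smoothTransition t)) ^ q * g t)
    (fun t ht => (hderiv t ht).continuousAt.continuousWithinAt)
    (fun t ht => hderiv t (Ioo_subset_Icc_self ht)) (fun t _ => ?_)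
    (by rw [holonomyDefect_init hf hu, holonomyDefect_final hf hx₁' hu H])
    (by norm_num)
  · simp only [hρmid, smoothTransition_half, hβmid, hgmid, one_pow, mul_one] at hzero
    linarith
  -- Either the bump is zero, or the path parameter is within δ of 1/2, the time is within ε of 1/2,
  -- and g is positive.
  · rcases eq_or_ne (β (Real.smoothTransition t)) 0 with hb0 | hb0
    · simp only [hb0, zero_pow (show q ≠ 0 by omega), mul_zero, zero_mul, le_refl]
    · have h1 : |Real.smoothTransition t - 1 / 2| ≤ δ := by
        by_contra hcon
        exact hb0 (hβ0 _ ((min_le_left _ _).trans (not_le.1 hcon).le))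
      have h2 : 0 < g t := hgε (by rw [Real.dist_eq]; exact hδε t h1)
      have h3 := hρ0 t
      have h4 := (hβ01 (Real.smoothTransition t)).1
      positivity

/-- The equations on the path spaces imply the structure equations. -/
theorem structureEq_of_pathSpaceEq (hA : ∀ x, D.A₀ x ∘ₗ D.A₀ x = 0) {k : ℕ}
    (hx₁ : x₁ ∈ connectedComponent x₀)
    (H₀ : ∀ y₀ ∈ connectedComponent x₀, ∀ y₁ ∈ connectedComponent x₀, D.PathSpaceEq 0 y₀ y₁)
    (H : ∀ q, 1 ≤ q → q ≤ k → D.PathSpaceEq q x₀ x₁) :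
    ∀ q ≤ k, ∀ z ∈ connectedComponent x₀, D.StructureEq q z := by
  intro q
  induction q using Nat.strong_induction_on with
  | _ q ih =>
    intro hq z hz
    refine (D.structureEq_iff q z).2 fun c hc => ?_
    rcases Nat.eq_zero_or_pos q with rfl | hq'
    · refine chartCurv_one_eq_zero hA hc ?_
      rwa [← connectedComponent_eq hz]
    · exact structure_equation_step hA hq' hx₁ (H q hq' hq)
        (fun p hp x hx => ih p hp (by omega) x hx) hz hc

end Superconnection

end Necessity

/-! ## Integrals over cubes -/

theorem uniqueDiffOn_cube (n : ℕ) : UniqueDiffOn ℝ (Icc (0 : Fin n → ℝ) 1) := by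
  rw [← pi_univ_Icc]
  exact UniqueDiffOn.univ_pi fun _ => uniqueDiffOn_Icc_zero_one

section Cubes

variable {ι : Type} [Fintype ι] [DecidableEq ι] {m : ℕ}
  {M : Type*} [TopologicalSpace M] [ChartedSpace (EuclideanSpace ℝ (Fin m)) M]
  {V : M → Type*} [TopologicalSpace (TotalSpace (ι → ℝ) V)]
  [∀ x, AddCommGroup (V x)] [∀ x, Module ℝ (V x)] [∀ x, TopologicalSpace (V x)]
  [∀ x, IsTopologicalAddGroup (V x)] [∀ x, ContinuousSMul ℝ (V x)]
  [FiberBundle (ι → ℝ) V] [VectorBundle ℝ (ι → ℝ) V]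
  [IsManifold (𝓡 m) ∞ M] [ContMDiffVectorBundle ∞ (ι → ℝ) V (𝓡 m)]
  {G : Grading (ι := ι) V}
  {n n' : ℕ} {S : Set (Fin n → ℝ)} {S' : Set (Fin n' → ℝ)} {h : (Fin n → ℝ) → ℝ → M} {x₀ x₁ : M}

theorem IsPathFamily.comp (hh : IsPathFamily m S h x₀ x₁) {f : (Fin n' → ℝ) → Fin n → ℝ}
    (hf : ContDiffOn ℝ ∞ f S') (hS : MapsTo f S' S) :
    IsPathFamily m S' (fun u => h (f u)) x₀ x₁ where
  smooth := by
    have h1 : ContDiffOn ℝ ∞ (fun z : (Fin n' → ℝ) × ℝ => (f z.1, z.2)) (S' ×ˢ Icc 0 1) :=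
      (hf.comp contDiff_fst.contDiffOn fun z hz => hz.1).prodMk contDiff_snd.contDiffOn
    exact ContMDiffOn.comp (g := fun z : (Fin n → ℝ) × ℝ => h z.1 z.2) hh.smooth h1.contMDiffOn
      fun z hz => ⟨hS hz.1, hz.2⟩
  source u hu := hh.source _ (hS hu)
  target u hu := hh.target _ (hS hu)

namespace Superconnection

variable {D : Superconnection (ι := ι) (m := m) G}

theorem IsTransport.congr {X : Type*} [AddCommGroup X] [Module ℝ X] {γ : ℝ → M}
    {η η' : ∀ t, X →ₗ[ℝ] TangentSpace (𝓡 m) (γ t)} {s : ℝ}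
    {Ψ : ∀ (p : ℕ) (t : ℝ), X [⋀^Fin p]→ₗ[ℝ] (V (γ s) →ₗ[ℝ] V (γ t))}
    (hΨ : D.IsTransport γ η s Ψ) (h : ∀ t ∈ Icc s 1, η t = η' t) : D.IsTransport γ η' s Ψ where
  init_zero := hΨ.init_zero
  init_pos := hΨ.init_pos
  ode p t ht c hc w v := by
    rw [← h t ht]
    exact hΨ.ode p t ht c hc w v

theorem tangentLinear_comp (hh : IsPathFamily m S h x₀ x₁) (hS' : UniqueDiffOn ℝ S')
    {f : (Fin n' → ℝ) → Fin n → ℝ} (hf : ContDiffOn ℝ ∞ f S') (hmaps : MapsTo f S' S)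
    {u : Fin n' → ℝ} (hu : u ∈ S') {t : ℝ} (ht : t ∈ Icc (0 : ℝ) 1) :
    tangentLinear m (fun v => h (f v) t) S' u =
      tangentLinear m (fun v => h v t) S (f u) ∘ₗ (fderivWithin ℝ f S' u).toLinearMap := by
  have h1 : ContMDiffOn 𝓘(ℝ, Fin n → ℝ) (𝓡 m) ∞ (fun v => h v t) S :=
    ContMDiffOn.comp (g := fun z : (Fin n → ℝ) × ℝ => h z.1 z.2)
      (f := fun v : Fin n → ℝ => (v, t)) hh.smooth
      (contDiff_id.prodMk contDiff_const).contMDiff.contMDiffOn fun v hv => ⟨hv, ht⟩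
  have h2 := ((h1 (f u) (hmaps hu)).mdifferentiableWithinAt (by simp)).hasMFDerivWithinAt.comp u
    (hasMFDerivWithinAt_iff_hasFDerivWithinAt.2
      ((hf u hu).differentiableWithinAt (by simp)).hasFDerivWithinAt) hmaps
  have h3 := h2.mfderivWithin (hS' u hu).uniqueMDiffWithinAt
  refine LinearMap.ext fun w => ?_
  exact congrArg (fun T : (Fin n' → ℝ) →L[ℝ] EuclideanSpace ℝ (Fin m) => T w) h3

/-- Under a change of parameters the variation fields are composed with its derivative, by the chain
rule. Naturality of the transport under linear maps does the rest. -/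
theorem Psi_comp (hh : IsPathFamily m S h x₀ x₁) (hS : UniqueDiffOn ℝ S) (hS' : UniqueDiffOn ℝ S')
    {f : (Fin n' → ℝ) → Fin n → ℝ} (hf : ContDiffOn ℝ ∞ f S') (hmaps : MapsTo f S' S)
    {u : Fin n' → ℝ} (hu : u ∈ S') (p : ℕ) :
    D.Psi S' (fun u => h (f u)) x₀ x₁ p u =
      (D.Psi S h x₀ x₁ p (f u)).compContinuousLinearMap (fderivWithin ℝ f S' u) := by
  have hr := D.isRegular_family hS hh.smooth (hmaps hu)
  have hr' := D.isRegular_family (h := fun u => h (f u)) hS' (hh.comp hf hmaps).smooth hu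
  have h1 := hr'.transport_eq ((hr.comp_linear (fderivWithin ℝ f S' u)).isTransport_transport.congr
    fun t ht => (tangentLinear_comp hh hS' hf hmaps hu ht).symm)
    (right_mem_Icc.2 (zero_le_one' ℝ)) p
  have h2 := hr.transport_comp (fderivWithin ℝ f S' u) (hr.comp_linear _)
    (right_mem_Icc.2 (zero_le_one' ℝ)) p
  exact congrArg (fun A => toCont ((toMat (ι := ι) x₀ x₁ (h (f u) 0)
    (h (f u) 1)).compAlternatingMap A)) (h1.trans h2)

/-- Up to the sign `tw p`, the form is the slice at the time 2 of the jointly smooth transport of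
the extended family. -/
theorem contDiffAt_Psi (hh : IsPathFamily m S h x₀ x₁) (hS : IsOpen S) {u : Fin n → ℝ}
    (hu : u ∈ S) (p : ℕ) : ContDiffAt ℝ ∞ (D.Psi S h x₀ x₁ p) u := by
  have h0 : extend h (u, 2) = x₁ := by
    simp only [extend, Real.smoothTransition.one_of_one_le one_le_two, hh.target u hu]
  have h1 := D.contDiffAt_parMat hS hh.smooth hh.source hu 2 (by norm_num) x₁
    (by rw [h0]; exact FiberBundle.mem_baseSet_trivializationAt' _) p
  have h2 : ContDiffAt ℝ ∞ (fun u => D.parMat S h x₀ x₁ p (u, 2)) u :=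
    ContDiffAt.comp (f := fun u : Fin n → ℝ => (u, (2 : ℝ))) u h1
      (contDiffAt_id.prodMk contDiffAt_const)
  simp only [D.parMat_of_one_le (one_le_two (α := ℝ))] at h2
  have h3 : ContDiffAt ℝ ∞ (fun u => tw p • tw p • D.Psi S h x₀ x₁ p u) u :=
    ContDiffAt.const_smul (tw p) h2
  simpa only [smul_smul, tw_mul_self, one_smul] using h3

/-- The integral over the cube, for a family parametrized by a neighbourhood of the cube. -/
theorem cubeIntegral_comp {f : (Fin n' → ℝ) → Fin n → ℝ} (hh : IsPathFamily m S h x₀ x₁)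
    (hS : UniqueDiffOn ℝ S) (hf : ContDiffOn ℝ ∞ f (Icc 0 1)) (hmaps : MapsTo f (Icc 0 1) S) :
    D.cubeIntegral (fun u => h (f u)) x₀ x₁ = ∫ u in Icc (0 : Fin n' → ℝ) 1,
      D.Psi S h x₀ x₁ n' (f u) fun j => fderivWithin ℝ f (Icc 0 1) u (Pi.single j 1) := by
  refine setIntegral_congr_fun measurableSet_Icc fun u hu => ?_
  rw [Psi_comp hh hS (uniqueDiffOn_cube n') hf hmaps hu]
  rfl

theorem cubeIntegral_eq (hh : IsPathFamily m S h x₀ x₁) (hS : IsOpen S)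
    (hcube : Icc (0 : Fin n → ℝ) 1 ⊆ S) : D.cubeIntegral h x₀ x₁ =
      ∫ u in Icc (0 : Fin n → ℝ) 1, D.Psi S h x₀ x₁ n u fun j => Pi.single j 1 := by
  refine (cubeIntegral_comp (f := id) hh hS.uniqueDiffOn contDiffOn_id hcube).trans ?_
  refine setIntegral_congr_fun measurableSet_Icc fun u hu => ?_
  simp only [fderivWithin_id (uniqueDiffOn_cube n u hu)]
  rfl

theorem insertNth_mem_cube {q : ℕ} (i : Fin (q + 1)) {r : ℝ} (hr : r ∈ Icc (0 : ℝ) 1)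
    {u : Fin q → ℝ} (hu : u ∈ Icc (0 : Fin q → ℝ) 1) :
    (i.insertNth r u : Fin (q + 1) → ℝ) ∈ Icc (0 : Fin (q + 1) → ℝ) 1 := by
  rw [← pi_univ_Icc] at hu ⊢
  intro j _
  refine Fin.succAboveCases i ?_ (fun k => ?_) j
  · simpa using hr
  · simpa using hu k (mem_univ k)

theorem contDiff_insertNth {q : ℕ} (i : Fin (q + 1)) (r : ℝ) :
    ContDiff ℝ ∞ fun u : Fin q → ℝ => (i.insertNth r u : Fin (q + 1) → ℝ) := by
  refine contDiff_pi.2 fun j => ?_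
  refine Fin.succAboveCases i ?_ (fun k => ?_) j
  · simpa using contDiff_const
  · simpa using contDiff_apply ℝ ℝ k

theorem fderivWithin_insertNth {q : ℕ} (i : Fin (q + 1)) (r : ℝ) {u : Fin q → ℝ}
    (hu : u ∈ Icc (0 : Fin q → ℝ) 1) (j : Fin q) :
    fderivWithin ℝ (fun u : Fin q → ℝ => (i.insertNth r u : Fin (q + 1) → ℝ)) (Icc 0 1) u
      (Pi.single j 1) = Pi.single (i.succAbove j) 1 := by
  have h1 := ((contDiff_insertNth i r).differentiable (by simp)) u
  rw [h1.fderivWithin (uniqueDiffOn_cube q u hu)]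
  have h2 : HasDerivAt (fun τ : ℝ => u + τ • (Pi.single j 1 : Fin q → ℝ)) (Pi.single j 1) 0 := by
    simpa using ((hasDerivAt_id (0 : ℝ)).smul_const (Pi.single j 1 : Fin q → ℝ)).const_add u
  have h3 := h1.hasFDerivAt.comp_hasDerivAt_of_eq (0 : ℝ) h2 (by simp)
  refine h3.unique ?_
  have h4 : (fun u : Fin q → ℝ => (i.insertNth r u : Fin (q + 1) → ℝ)) ∘
      (fun τ : ℝ => u + τ • (Pi.single j 1 : Fin q → ℝ)) = fun τ : ℝ =>
        (i.insertNth r u : Fin (q + 1) → ℝ) + τ • (Pi.single (i.succAbove j) 1 : Fin (q + 1) → ℝ) := by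
    funext τ k
    refine Fin.succAboveCases i ?_ (fun l => ?_) k
    · simp [(Fin.succAbove_ne i j).symm]
    · simp [Pi.single_apply]
  rw [h4]
  simpa using ((hasDerivAt_id (0 : ℝ)).smul_const
    (Pi.single (i.succAbove j) 1 : Fin (q + 1) → ℝ)).const_add (i.insertNth r u : Fin (q + 1) → ℝ)

/-- Stokes' theorem on the cube. -/
theorem boundaryIntegral_eq {q : ℕ} {O : Set (Fin q → ℝ)} {h : (Fin q → ℝ) → ℝ → M}
    (hh : IsPathFamily m O h x₀ x₁) (hO : IsOpen O) (hcube : Icc (0 : Fin q → ℝ) 1 ⊆ O) :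
    D.boundaryIntegral h x₀ x₁ =
      ∫ u in Icc (0 : Fin q → ℝ) 1, D.dPsi O h x₀ x₁ q u fun j => Pi.single j 1 := by
  rcases q with _ | q
  · exact (integral_zero _ _).symm
  have hω : ∀ u ∈ O, ContDiffAt ℝ ∞ (D.Psi O h x₀ x₁ q) u := fun u hu => contDiffAt_Psi hh hO hu q
  have hcont : ∀ u ∈ Icc (0 : Fin (q + 1) → ℝ) 1, ∀ w : Fin q → Fin (q + 1) → ℝ,
      ContDiffAt ℝ ∞ (fun u => D.Psi O h x₀ x₁ q u w) u := fun u hu w =>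
    (ContinuousAlternatingMap.apply ℝ (Fin (q + 1) → ℝ) (Mat ι) w).contDiff.contDiffAt.comp u
      (hω u (hcube hu))
  have hface : ∀ (i : Fin (q + 1)) {r : ℝ}, r ∈ Icc (0 : ℝ) 1 →
      D.cubeIntegral (fun u => h (i.insertNth r u)) x₀ x₁ = ∫ u in Icc (0 : Fin q → ℝ) 1,
        D.Psi O h x₀ x₁ q (i.insertNth r u) fun j => Pi.single (i.succAbove j) 1 := fun i r hr => by
    refine (cubeIntegral_comp (f := fun u : Fin q → ℝ => (i.insertNth r u : Fin (q + 1) → ℝ)) hh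
      hO.uniqueDiffOn (contDiff_insertNth i r).contDiffOn
      fun u hu => hcube (insertNth_mem_cube i hr hu)).trans ?_
    refine setIntegral_congr_fun measurableSet_Icc fun u hu => ?_
    simp only [fderivWithin_insertNth i r hu]
  -- The divergence theorem is applied to the vector field whose i-th component is (-1)^i times the
  -- value of Ψ_q on the basis vectors other than the i-th. Its divergence is dΨ_q on the standard
  -- basis.
  have hdiv := integral_divergence_of_hasFDerivAt_off_countable' (E := Mat ι)
    (0 : Fin (q + 1) → ℝ) 1 zero_le_one
    (fun i u => (-1 : ℝ) ^ (i : ℕ) • D.Psi O h x₀ x₁ q u fun j => Pi.single (i.succAbove j) 1)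
    (fun i u => (-1 : ℝ) ^ (i : ℕ) •
      fderiv ℝ (fun u => D.Psi O h x₀ x₁ q u fun j => Pi.single (i.succAbove j) 1) u) ∅
    countable_empty
    (fun i u hu => (ContDiffAt.const_smul ((-1 : ℝ) ^ (i : ℕ))
      (hcont u hu _)).continuousAt.continuousWithinAt)
    (fun u hu i => by
      have hu' : u ∈ Icc (0 : Fin (q + 1) → ℝ) 1 := by
        rw [← pi_univ_Icc]; exact fun j _ => Ioo_subset_Icc_self (hu.1 j (mem_univ j))
      have h1 := ((hcont u hu' fun j => Pi.single (i.succAbove j) 1).differentiableAt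
        (by simp)).hasFDerivAt
      exact HasFDerivAt.const_smul h1 ((-1 : ℝ) ^ (i : ℕ)))
    (by
      refine ContinuousOn.integrableOn_compact isCompact_Icc fun u hu => ?_
      refine ContinuousAt.continuousWithinAt (tendsto_finsetSum _ fun i _ => ?_)
      have h1 : ContinuousAt (fderiv ℝ fun u => D.Psi O h x₀ x₁ q u
          fun j => Pi.single (i.succAbove j) 1) u :=
        ((hcont u hu _).fderiv_right (m := 0) (by simp)).continuousAt
      have h2 : ContinuousAt (fun u => fderiv ℝ (fun u => D.Psi O h x₀ x₁ q u
          fun j => Pi.single (i.succAbove j) 1) u (Pi.single i 1)) u :=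
        h1.clm_apply continuousAt_const
      exact ContinuousAt.const_smul h2 ((-1 : ℝ) ^ (i : ℕ)))
  have hint : ∀ u ∈ Icc (0 : Fin (q + 1) → ℝ) 1,
      (∑ i : Fin (q + 1), ((-1 : ℝ) ^ (i : ℕ) • fderiv ℝ (fun u => D.Psi O h x₀ x₁ q u
        fun j => Pi.single (i.succAbove j) 1) u) (Pi.single i 1)) =
      extDeriv (D.Psi O h x₀ x₁ q) u fun j => Pi.single j 1 := fun u hu => by
    rw [extDeriv_apply ((hω u (hcube hu)).differentiableAt (by simp))]
    refine Finset.sum_congr rfl fun i _ => ?_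
    rcases Nat.even_or_odd (i : ℕ) with hi | hi
    · rw [hi.neg_one_pow, hi.neg_one_pow, one_smul, one_smul]
      rfl
    · rw [hi.neg_one_pow, hi.neg_one_pow, neg_one_smul]
      exact neg_one_smul ℝ _
  have hE : ∫ u in Icc (0 : Fin (q + 1) → ℝ) 1, D.dPsi O h x₀ x₁ (q + 1) u (fun j => Pi.single j 1) =
      (-1 : ℝ) ^ q • ∫ u in Icc (0 : Fin (q + 1) → ℝ) 1,
        extDeriv (D.Psi O h x₀ x₁ q) u fun j => Pi.single j 1 :=
    integral_smul ((-1 : ℝ) ^ q) _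
  rw [hE, ← setIntegral_congr_fun measurableSet_Icc hint]
  refine Eq.trans ?_ (congrArg (fun A : Mat ι => (-1 : ℝ) ^ q • A) hdiv.symm)
  rw [Finset.smul_sum, boundaryIntegral]
  refine Finset.sum_congr rfl fun i _ => ?_
  rw [hface i (right_mem_Icc.2 zero_le_one), hface i (left_mem_Icc.2 zero_le_one)]
  -- The sign convention for the boundary combines the (-1)^q in `dPsi` with the (-1)^i of the
  -- divergence theorem; the index i starts from 0.
  have hs : (-1 : ℝ) ^ (q - (i : ℕ)) = (-1 : ℝ) ^ q * (-1 : ℝ) ^ (i : ℕ) := by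
    obtain ⟨l, hl⟩ := Nat.exists_eq_add_of_le i.is_le
    have h2 : (-1 : ℝ) ^ (i : ℕ) * (-1 : ℝ) ^ (i : ℕ) = 1 := by rw [← mul_pow]; norm_num
    have h3 : (-1 : ℝ) ^ q = (-1 : ℝ) ^ (i : ℕ) * (-1 : ℝ) ^ l := by rw [← pow_add, ← hl]
    have h4 : q - (i : ℕ) = l := by omega
    rw [h3, h4, mul_right_comm, h2, one_mul]
  rw [hs, mul_smul, smul_sub ((-1 : ℝ) ^ (i : ℕ))]
  congr 2
  · exact (integral_smul ((-1 : ℝ) ^ (i : ℕ)) _).symm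
  · exact (integral_smul ((-1 : ℝ) ^ (i : ℕ)) _).symm

end Superconnection

end Cubes

/-- A smooth map of `ℝ` onto `[0, 1]` which is bijective on `[0, 1]`. -/
def fold (s : ℝ) : ℝ := (1 - Real.cos (Real.pi * s)) / 2

theorem fold_mem (s : ℝ) : fold s ∈ Icc (0 : ℝ) 1 := by
  have h1 := Real.cos_le_one (Real.pi * s)
  have h2 := Real.neg_one_le_cos (Real.pi * s)
  constructor <;> simp only [fold] <;> linarith

theorem fold_zero : fold 0 = 0 := by simp [fold]

theorem fold_one : fold 1 = 1 := by norm_num [fold]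

theorem hasDerivAt_fold (s : ℝ) :
    HasDerivAt fold (Real.pi / 2 * Real.sin (Real.pi * s)) s := by
  have h1 : HasDerivAt (fun s : ℝ => Real.pi * s) Real.pi s := by
    simpa using (hasDerivAt_id s).const_mul Real.pi
  refine ((h1.cos.const_sub 1).div_const 2).congr_deriv ?_
  ring

theorem contDiff_fold : ContDiff ℝ ∞ fold :=
  (contDiff_const.sub (Real.contDiff_cos.comp (contDiff_const.mul contDiff_id))).div_const 2

theorem fold_deriv_nonneg {s : ℝ} (hs : s ∈ Icc (0 : ℝ) 1) :
    0 ≤ Real.pi / 2 * Real.sin (Real.pi * s) :=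
  mul_nonneg (by positivity) (Real.sin_nonneg_of_nonneg_of_le_pi
    (mul_nonneg Real.pi_pos.le hs.1) (by nlinarith [Real.pi_pos, hs.2]))

theorem injOn_fold : InjOn fold (Icc 0 1) := by
  intro s hs t ht h
  have h1 : Real.cos (Real.pi * s) = Real.cos (Real.pi * t) := by
    simp only [fold] at h; linarith
  have h2 := Real.injOn_cos ⟨mul_nonneg Real.pi_pos.le hs.1, by nlinarith [Real.pi_pos, hs.2]⟩
    ⟨mul_nonneg Real.pi_pos.le ht.1, by nlinarith [Real.pi_pos, ht.2]⟩ h1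
  exact mul_left_cancel₀ Real.pi_ne_zero h2

theorem surjOn_fold : SurjOn fold (Icc 0 1) (Icc 0 1) := by
  have h := intermediate_value_Icc (zero_le_one' ℝ) contDiff_fold.continuous.continuousOn
  rwa [fold_zero, fold_one] at h

/-- A smooth map of `ℝⁿ` onto the cube which is bijective on the cube. -/
def cubeFold {n : ℕ} (u : Fin n → ℝ) : Fin n → ℝ := fun i => fold (u i)

theorem cubeFold_mem {n : ℕ} (u : Fin n → ℝ) : cubeFold u ∈ Icc (0 : Fin n → ℝ) 1 :=
  ⟨fun i => (fold_mem (u i)).1, fun i => (fold_mem (u i)).2⟩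

theorem contDiff_cubeFold {n : ℕ} : ContDiff ℝ ∞ (cubeFold (n := n)) :=
  contDiff_pi.2 fun i => contDiff_fold.comp (contDiff_apply ℝ ℝ i)

theorem cubeFold_insertNth {q : ℕ} (i : Fin (q + 1)) (r : ℝ) (u : Fin q → ℝ) :
    cubeFold (i.insertNth r u : Fin (q + 1) → ℝ) = i.insertNth (fold r) (cubeFold u) := by
  funext j
  refine Fin.succAboveCases i ?_ (fun k => ?_) j <;> simp [cubeFold]

theorem image_cubeFold {n : ℕ} : cubeFold '' Icc (0 : Fin n → ℝ) 1 = Icc 0 1 := by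
  refine subset_antisymm (image_subset_iff.2 fun u _ => cubeFold_mem u) fun v hv => ?_
  choose u hu hv' using fun i => surjOn_fold (a := v i) ⟨hv.1 i, hv.2 i⟩
  exact ⟨u, ⟨fun i => (hu i).1, fun i => (hu i).2⟩, funext hv'⟩

theorem injOn_cubeFold {n : ℕ} : InjOn cubeFold (Icc (0 : Fin n → ℝ) 1) := fun _ hu _ hv h =>
  funext fun i => injOn_fold ⟨hu.1 i, hu.2 i⟩ ⟨hv.1 i, hv.2 i⟩ (congrFun h i)

/-- The derivative of `cubeFold`. -/
def cubeFoldDeriv {n : ℕ} (u : Fin n → ℝ) : (Fin n → ℝ) →L[ℝ] (Fin n → ℝ) :=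
  LinearMap.toContinuousLinearMap (Matrix.toLin'
    (Matrix.diagonal fun i => Real.pi / 2 * Real.sin (Real.pi * u i)))

theorem cubeFoldDeriv_apply {n : ℕ} (u v : Fin n → ℝ) (i : Fin n) :
    cubeFoldDeriv u v i = Real.pi / 2 * Real.sin (Real.pi * u i) * v i := by
  simp [cubeFoldDeriv, Matrix.mulVec_diagonal]

theorem hasFDerivAt_cubeFold {n : ℕ} (u : Fin n → ℝ) :
    HasFDerivAt cubeFold (cubeFoldDeriv u) u := by
  refine hasFDerivAt_pi'.2 fun i => ?_
  have h1 : HasFDerivAt (fun u : Fin n → ℝ => u i) (ContinuousLinearMap.proj i) u :=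
    (ContinuousLinearMap.proj (R := ℝ) (φ := fun _ : Fin n => ℝ) i).hasFDerivAt
  refine ((hasDerivAt_fold (u i)).hasFDerivAt.comp u h1).congr_fderiv ?_
  ext v
  simp [cubeFoldDeriv_apply, mul_comm]

theorem cubeFoldDeriv_det {n : ℕ} {u : Fin n → ℝ} (hu : u ∈ Icc (0 : Fin n → ℝ) 1) :
    |(cubeFoldDeriv u).det| = ∏ i, Real.pi / 2 * Real.sin (Real.pi * u i) := by
  have h1 : (cubeFoldDeriv u).det = ∏ i, Real.pi / 2 * Real.sin (Real.pi * u i) := by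
    rw [ContinuousLinearMap.det, cubeFoldDeriv, LinearMap.coe_toContinuousLinearMap,
      LinearMap.det_toLin', Matrix.det_diagonal]
  rw [h1, abs_of_nonneg (Finset.prod_nonneg fun i _ => fold_deriv_nonneg ⟨hu.1 i, hu.2 i⟩)]

/-- The derivative of `cubeFold` is diagonal with nonnegative entries on the cube. The top form is
multiplied by their product, which is also the absolute value of the Jacobian determinant. -/
theorem integral_cubeFold {n : ℕ} {E : Type*} [NormedAddCommGroup E] [NormedSpace ℝ E]
    (g : (Fin n → ℝ) → (Fin n → ℝ) [⋀^Fin n]→L[ℝ] E) :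
    ∫ u in Icc (0 : Fin n → ℝ) 1, g (cubeFold u) (fun j =>
      fderivWithin ℝ cubeFold (Icc 0 1) u (Pi.single j 1)) =
    ∫ u in Icc (0 : Fin n → ℝ) 1, g u fun j => Pi.single j 1 := by
  have h1 := integral_image_eq_integral_abs_det_fderiv_smul volume measurableSet_Icc
    (fun u _ => (hasFDerivAt_cubeFold u).hasFDerivWithinAt) (injOn_cubeFold (n := n))
    (fun u => g u fun j => Pi.single j 1)
  rw [image_cubeFold] at h1
  rw [h1]
  refine setIntegral_congr_fun measurableSet_Icc fun u hu => ?_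
  have h2 : ∀ j, fderivWithin ℝ cubeFold (Icc (0 : Fin n → ℝ) 1) u (Pi.single j 1) =
      (Real.pi / 2 * Real.sin (Real.pi * u j)) • (Pi.single j 1 : Fin n → ℝ) := fun j => by
    rw [(hasFDerivAt_cubeFold u).hasFDerivWithinAt.fderivWithin (uniqueDiffOn_cube n u hu)]
    ext i
    rw [cubeFoldDeriv_apply]
    by_cases hij : i = j
    · subst hij; simp
    · simp [hij]
  simp only [h2, cubeFoldDeriv_det hu]
  exact (g (cubeFold u)).toMultilinearMap.map_smul_univ _ _

/-! ### The integrated conditions are equivalent to the equations on path spaces -/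

section Cubes

variable {ι : Type} [Fintype ι] [DecidableEq ι] {m : ℕ}
  {M : Type*} [TopologicalSpace M] [ChartedSpace (EuclideanSpace ℝ (Fin m)) M]
  {V : M → Type*} [TopologicalSpace (TotalSpace (ι → ℝ) V)]
  [∀ x, AddCommGroup (V x)] [∀ x, Module ℝ (V x)] [∀ x, TopologicalSpace (V x)]
  [∀ x, IsTopologicalAddGroup (V x)] [∀ x, ContinuousSMul ℝ (V x)]
  [FiberBundle (ι → ℝ) V] [VectorBundle ℝ (ι → ℝ) V]
  [IsManifold (𝓡 m) ∞ M] [ContMDiffVectorBundle ∞ (ι → ℝ) V (𝓡 m)]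
  {G : Grading (ι := ι) V}
  {n n' : ℕ} {S : Set (Fin n → ℝ)} {h : (Fin n → ℝ) → ℝ → M} {x₀ x₁ : M}

namespace Superconnection

variable {D : Superconnection (ι := ι) (m := m) G}

/-- A family that is smooth only on the closed cube is replaced, without changing its integral, by
one defined on all of ℝⁿ. Derivatives of Ψ are then available up to the boundary of the cube. -/
theorem cubeIntegral_cubeFold (hh : IsPathFamily m (Icc 0 1) h x₀ x₁) :
    D.cubeIntegral (fun u => h (cubeFold u)) x₀ x₁ = D.cubeIntegral h x₀ x₁ :=
  (cubeIntegral_comp hh (uniqueDiffOn_cube n) contDiff_cubeFold.contDiffOn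
    fun u _ => cubeFold_mem u).trans (integral_cubeFold _)

theorem boundaryIntegral_cubeFold (hh : IsPathFamily m (Icc 0 1) h x₀ x₁) :
    D.boundaryIntegral (fun u => h (cubeFold u)) x₀ x₁ = D.boundaryIntegral h x₀ x₁ := by
  rcases n with _ | q
  · rfl
  simp only [boundaryIntegral, cubeFold_insertNth, fold_zero, fold_one]
  refine Finset.sum_congr rfl fun i _ => ?_
  have hf : ∀ r ∈ Icc (0 : ℝ) 1, IsPathFamily m (Icc 0 1)
      (fun u => h (i.insertNth r u : Fin (q + 1) → ℝ)) x₀ x₁ := fun r hr =>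
    hh.comp (contDiff_insertNth i r).contDiffOn fun u hu => insertNth_mem_cube i hr hu
  rw [cubeIntegral_cubeFold (hf 1 (right_mem_Icc.2 zero_le_one)),
    cubeIntegral_cubeFold (hf 0 (left_mem_Icc.2 zero_le_one))]

variable (D) in
/-- Up to a sign, `A₀ Ψ_p - Ψ_p A₀ - dΨ_{p-1}`, pulled back to `S`. -/
def PsiDefect (S : Set (Fin n → ℝ)) (h : (Fin n → ℝ) → ℝ → M) (x₀ x₁ : M) :
    ∀ (p : ℕ) (_ : Fin n → ℝ), (Fin n → ℝ) [⋀^Fin p]→L[ℝ] Mat ι :=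
  defect (mulB ι) (rightMul (D.A₀mat x₀)) (fun p _ => zform (D.A₀mat x₁) p)
    (fun p u => tw p • D.Psi S h x₀ x₁ p u)

theorem contDiffAt_tw_Psi (hh : IsPathFamily m S h x₀ x₁) (hS : IsOpen S) {u : Fin n → ℝ}
    (hu : u ∈ S) (p : ℕ) : ContDiffAt ℝ ∞ (fun u => tw p • D.Psi S h x₀ x₁ p u) u :=
  ContDiffAt.const_smul (tw p) (contDiffAt_Psi hh hS hu p)

theorem contDiffAt_PsiDefect (hh : IsPathFamily m S h x₀ x₁) (hS : IsOpen S) {u : Fin n → ℝ}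
    (hu : u ∈ S) (p : ℕ) : ContDiffAt ℝ ∞ (D.PsiDefect S h x₀ x₁ p) u :=
  contDiffAt_defect (fun _ => contDiffAt_const) (fun p => contDiffAt_tw_Psi hh hS hu p) p

theorem PsiDefect_comp (hh : IsPathFamily m S h x₀ x₁) (hS : IsOpen S)
    {f : (Fin n' → ℝ) → Fin n → ℝ} (hf : ContDiff ℝ ∞ f) {u : Fin n' → ℝ} (hu : f u ∈ S) (p : ℕ) :
    D.PsiDefect (f ⁻¹' S) (fun u => h (f u)) x₀ x₁ p u =
      (D.PsiDefect S h x₀ x₁ p (f u)).compContinuousLinearMap (fderiv ℝ f u) := by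
  have hO : IsOpen (f ⁻¹' S) := hS.preimage hf.continuous
  refine Eq.trans ?_ (defect_pull (D.A₀mat x₀) (a := fun p _ => zform (D.A₀mat x₁) p)
    (Y' := fun p u => tw p • D.Psi S h x₀ x₁ p u) (hf.contDiffAt.of_le (by norm_cast))
    (fun p => (contDiffAt_tw_Psi hh hS hu p).differentiableAt (by simp)) p)
  refine defect_congr (fun p => (pull_zform _ _ p).symm) (fun p => ?_) p
  filter_upwards [hO.mem_nhds hu] with v hv
  rw [Psi_comp hh hS.uniqueDiffOn hO.uniqueDiffOn hf.contDiffOn (fun _ h => h) hv,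
    (hf.differentiable (by simp) v).fderivWithin (hO.uniqueDiffOn v hv)]
  rfl

/-- The terms with A₀ are integrated by linearity, and the term dΨ by Stokes' theorem in
`boundaryIntegral_eq`. -/
theorem integral_PsiDefect (hh : IsPathFamily m S h x₀ x₁) (hS : IsOpen S)
    (hcube : Icc (0 : Fin n → ℝ) 1 ⊆ S) :
    ∫ u in Icc (0 : Fin n → ℝ) 1, D.PsiDefect S h x₀ x₁ n u (fun j => Pi.single j 1) =
      tw n • ((D.A₀mat x₁).comp (D.cubeIntegral h x₀ x₁) -
        (-1 : ℝ) ^ n • (D.cubeIntegral h x₀ x₁).comp (D.A₀mat x₀) -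
          D.boundaryIntegral h x₀ x₁) := by
  have hint : ∀ {F : (Fin n → ℝ) → (Fin n → ℝ) [⋀^Fin n]→L[ℝ] Mat ι},
      (∀ u ∈ S, ContinuousAt F u) → IntegrableOn (fun u => F u fun j => Pi.single j 1)
        (Icc (0 : Fin n → ℝ) 1) := fun {F} hF =>
    ContinuousOn.integrableOn_compact isCompact_Icc fun u hu =>
      (ContinuousAt.comp (f := F) (ContinuousAlternatingMap.apply ℝ (Fin n → ℝ) (Mat ι)
        fun j => Pi.single j 1).continuous.continuousAt (hF u (hcube hu))).continuousWithinAt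
  have h1 := hint fun u hu => (contDiffAt_Psi (D := D) hh hS hu n).continuousAt
  have h2 : ∀ u ∈ S, ContinuousAt (D.dPsi S h x₀ x₁ n) u := by
    rcases n with _ | n
    · exact fun u _ => continuousAt_const
    · intro u hu
      have h3 : ContDiffAt ℝ 0 (extDeriv (D.Psi S h x₀ x₁ n)) u :=
        contDiffAt_extDeriv (contDiffAt_Psi hh hS hu n) (by simp)
      exact ContinuousAt.const_smul h3.continuousAt ((-1 : ℝ) ^ n)
  have h2' := hint h2
  rw [cubeIntegral_eq hh hS hcube, boundaryIntegral_eq hh hS hcube]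
  have h4 : (D.A₀mat x₁).comp (∫ u in Icc (0 : Fin n → ℝ) 1, D.Psi S h x₀ x₁ n u
      fun j => Pi.single j 1) = ∫ u in Icc (0 : Fin n → ℝ) 1,
        (D.A₀mat x₁).comp (D.Psi S h x₀ x₁ n u fun j => Pi.single j 1) :=
    (ContinuousLinearMap.integral_comp_comm
      (ContinuousLinearMap.compL ℝ (ι → ℝ) (ι → ℝ) (ι → ℝ) (D.A₀mat x₁)) h1).symm
  have h5 : (∫ u in Icc (0 : Fin n → ℝ) 1, D.Psi S h x₀ x₁ n u
      fun j => Pi.single j 1).comp (D.A₀mat x₀) = ∫ u in Icc (0 : Fin n → ℝ) 1,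
        (D.Psi S h x₀ x₁ n u fun j => Pi.single j 1).comp (D.A₀mat x₀) :=
    (ContinuousLinearMap.integral_comp_comm
      ((ContinuousLinearMap.compL ℝ (ι → ℝ) (ι → ℝ) (ι → ℝ)).flip (D.A₀mat x₀)) h1).symm
  have h6 : IntegrableOn (fun u => (D.A₀mat x₁).comp (D.Psi S h x₀ x₁ n u
      fun j => Pi.single j 1)) (Icc (0 : Fin n → ℝ) 1) :=
    (ContinuousLinearMap.compL ℝ (ι → ℝ) (ι → ℝ) (ι → ℝ) (D.A₀mat x₁)).integrable_comp h1
  have h7 : IntegrableOn (fun u => (D.Psi S h x₀ x₁ n u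
      fun j => Pi.single j 1).comp (D.A₀mat x₀)) (Icc (0 : Fin n → ℝ) 1) :=
    ((ContinuousLinearMap.compL ℝ (ι → ℝ) (ι → ℝ) (ι → ℝ)).flip (D.A₀mat x₀)).integrable_comp h1
  have h8 : IntegrableOn (fun u => (-1 : ℝ) ^ n • (D.Psi S h x₀ x₁ n u
      fun j => Pi.single j 1).comp (D.A₀mat x₀)) (Icc (0 : Fin n → ℝ) 1) :=
    Integrable.smul ((-1 : ℝ) ^ n) h7
  have h9 : IntegrableOn (fun u => (D.A₀mat x₁).comp (D.Psi S h x₀ x₁ n u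
      fun j => Pi.single j 1) - (-1 : ℝ) ^ n • (D.Psi S h x₀ x₁ n u
      fun j => Pi.single j 1).comp (D.A₀mat x₀)) (Icc (0 : Fin n → ℝ) 1) := h6.sub h8
  rw [h4, h5, ← integral_smul, ← integral_sub h6 h8, ← integral_sub h9 h2', ← integral_smul]
  exact setIntegral_congr_fun measurableSet_Icc fun u _ => defect_Psi n _

/-- The equation on the path space speaks of open parameter sets. The cube is therefore first
folded; then the integrand of `integral_PsiDefect` vanishes. -/
theorem nullHomotopy_of_pathSpaceEq {q : ℕ} (H : D.PathSpaceEq q x₀ x₁) :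
    D.NullHomotopy q x₀ x₁ := by
  intro h hh
  rw [← cubeIntegral_cubeFold hh, ← boundaryIntegral_cubeFold hh]
  have hk : IsPathFamily m univ (fun u => h (cubeFold u)) x₀ x₁ :=
    hh.comp contDiff_cubeFold.contDiffOn fun u _ => cubeFold_mem u
  have h1 := integral_PsiDefect (D := D) hk isOpen_univ (subset_univ _)
  have h2 : ∀ u, D.PsiDefect univ (fun u => h (cubeFold u)) x₀ x₁ q u
      (fun j => Pi.single j 1) = 0 := fun u => by
    rw [PsiDefect, defect_Psi, H q univ _ isOpen_univ hk u (mem_univ u), sub_self, smul_zero]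
  simp only [h2, integral_zero] at h1
  exact sub_eq_zero.1 ((smul_eq_zero.1 h1.symm).resolve_left (tw_ne_zero q))

/-- If the defect were nonzero at `u₀` on `w`, a functional of it would be positive near `u₀`. Its
integral over a small parallelepiped at `u₀` spanned by multiples of the `w j` would be positive
too, whereas it is zero by the condition on cubes. -/
theorem pathSpaceEq_of_nullHomotopy {q : ℕ} (H : D.NullHomotopy q x₀ x₁) :
    D.PathSpaceEq q x₀ x₁ := by
  intro n S h hS hh u₀ hu₀ w
  suffices h0 : D.PsiDefect S h x₀ x₁ q u₀ w = 0 by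
    rw [PsiDefect, defect_Psi] at h0
    exact sub_eq_zero.1 ((smul_eq_zero.1 h0).resolve_left (tw_ne_zero q))
  by_contra hne
  obtain ⟨ℓ, hℓ⟩ := SeparatingDual.exists_eq_one (R := ℝ) hne
  obtain ⟨W, hW⟩ : ∃ W : (Fin q → ℝ) →L[ℝ] (Fin n → ℝ), ∀ j, W (Pi.single j 1) = w j :=
    ⟨LinearMap.toContinuousLinearMap (Fintype.linearCombination ℝ w), fun j => by
      simp [Fintype.linearCombination_apply_single]⟩
  have hc1 : ContinuousAt (fun u => ℓ (D.PsiDefect S h x₀ x₁ q u w)) u₀ :=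
    ℓ.continuous.continuousAt.comp ((ContinuousAlternatingMap.apply ℝ (Fin n → ℝ) (Mat ι)
      w).continuous.continuousAt.comp (contDiffAt_PsiDefect hh hS hu₀ q).continuousAt)
  have hnear : ∀ᶠ u in nhds u₀, u ∈ S ∧ 0 < ℓ (D.PsiDefect S h x₀ x₁ q u w) :=
    Filter.Eventually.and (hS.mem_nhds hu₀)
      (hc1.eventually_const_lt (by simp only [hℓ, zero_lt_one]))
  obtain ⟨r, hr, hball⟩ := Metric.eventually_nhds_iff.1 hnear
  -- The unit cube has sup norm at most 1, so its image under u₀ + εW stays within distance r of u₀.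
  obtain ⟨ε, hε, hεW⟩ : ∃ ε : ℝ, 0 < ε ∧ ε * ‖W‖ < r :=
    ⟨r / (‖W‖ + 1), by positivity, by
      rw [div_mul_eq_mul_div, div_lt_iff₀ (by positivity)]; nlinarith [norm_nonneg W]⟩
  obtain ⟨f, hf⟩ : ∃ f : (Fin q → ℝ) → Fin n → ℝ, f = fun a => u₀ + ε • W a := ⟨_, rfl⟩
  have hfd : ∀ a, HasFDerivAt f (ε • W) a := fun a => by
    rw [hf]; exact (W.hasFDerivAt.const_smul ε).const_add u₀
  have hfs : ContDiff ℝ ∞ f := by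
    rw [hf]; exact contDiff_const.add (W.contDiff.const_smul ε)
  have hmem : ∀ a ∈ Icc (0 : Fin q → ℝ) 1, f a ∈ S ∧ 0 < ℓ (D.PsiDefect S h x₀ x₁ q (f a) w) :=
      fun a ha => by
    refine hball ?_
    have h1 : ‖a‖ ≤ 1 := (pi_norm_le_iff_of_nonneg zero_le_one).2 fun i => by
      rw [Real.norm_eq_abs, abs_of_nonneg (ha.1 i)]; exact ha.2 i
    rw [hf, dist_eq_norm, add_sub_cancel_left, norm_smul, Real.norm_of_nonneg hε.le]
    calc ε * ‖W a‖ ≤ ε * (‖W‖ * 1) := by gcongr; exact (W.le_opNorm a).trans (by gcongr)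
      _ < r := by rwa [mul_one]
  have hO : IsOpen (f ⁻¹' S) := hS.preimage hfs.continuous
  have hk : IsPathFamily m (f ⁻¹' S) (fun a => h (f a)) x₀ x₁ :=
    hh.comp hfs.contDiffOn fun _ ha => ha
  have hcube : Icc (0 : Fin q → ℝ) 1 ⊆ f ⁻¹' S := fun a ha => (hmem a ha).1
  have h1 := integral_PsiDefect (D := D) hk hO hcube
  rw [H _ ⟨hk.smooth.mono (prod_mono hcube subset_rfl), fun a ha => hk.source a (hcube ha),
    fun a ha => hk.target a (hcube ha)⟩, sub_self, smul_zero] at h1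
  have hint : IntegrableOn (fun a => D.PsiDefect (f ⁻¹' S) (fun a => h (f a)) x₀ x₁ q a
      fun j => Pi.single j 1) (Icc (0 : Fin q → ℝ) 1) :=
    ContinuousOn.integrableOn_compact isCompact_Icc fun a ha =>
      (ContinuousAt.comp (f := D.PsiDefect (f ⁻¹' S) (fun a => h (f a)) x₀ x₁ q)
        (ContinuousAlternatingMap.apply ℝ (Fin q → ℝ) (Mat ι)
        fun j => Pi.single j 1).continuous.continuousAt
          (contDiffAt_PsiDefect hk hO (hcube ha) q).continuousAt).continuousWithinAt
  have h2 := ℓ.integral_comp_comm hint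
  rw [h1, map_zero] at h2
  have h3 : ∀ a ∈ Icc (0 : Fin q → ℝ) 1, 0 < ℓ (D.PsiDefect (f ⁻¹' S) (fun a => h (f a)) x₀ x₁ q a
      fun j => Pi.single j 1) := fun a ha => by
    rw [PsiDefect_comp hh hS hfs (hcube ha), (hfd a).fderiv]
    -- The affine map has the constant derivative εW, which sends the standard basis to the vectors
    -- ε w_j; the positive factor ε^q does not affect the sign.
    have h4 : (D.PsiDefect S h x₀ x₁ q (f a)).compContinuousLinearMap (ε • W)
        (fun j => Pi.single j 1) = ε ^ q • D.PsiDefect S h x₀ x₁ q (f a) w := by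
      have h5 := (D.PsiDefect S h x₀ x₁ q (f a)).toMultilinearMap.map_smul_univ (fun _ => ε) w
      simp only [Finset.prod_const, Finset.card_univ, Fintype.card_fin] at h5
      refine Eq.trans ?_ h5
      refine congrArg (D.PsiDefect S h x₀ x₁ q (f a)) (funext fun j => ?_)
      exact congrArg (fun v => ε • v) (hW j)
    rw [h4, map_smul]
    exact mul_pos (pow_pos hε q) (hmem a ha).2
  have h6 : (0 : ℝ) < ∫ a in Icc (0 : Fin q → ℝ) 1,
      ℓ (D.PsiDefect (f ⁻¹' S) (fun a => h (f a)) x₀ x₁ q a fun j => Pi.single j 1) := by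
    rw [setIntegral_pos_iff_support_of_nonneg_ae
      ((ae_restrict_iff' measurableSet_Icc).2 (Filter.Eventually.of_forall fun a ha => (h3 a ha).le))
      (ℓ.integrable_comp hint)]
    have h7 : Icc (0 : Fin q → ℝ) 1 ⊆ Function.support fun a =>
        ℓ (D.PsiDefect (f ⁻¹' S) (fun a => h (f a)) x₀ x₁ q a fun j => Pi.single j 1) :=
      fun a ha => (h3 a ha).ne'
    rw [inter_eq_right.2 h7, Real.volume_Icc_pi]
    simp
  exact h6.ne' h2

end Superconnection

end Cubes

/-! ## Flatness -/

variable (ι : Type) [Fintype ι] in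
/-- The action of matrices on vectors. -/
def evalB : Mat ι →ₗ[ℝ] (ι → ℝ) →ₗ[ℝ] (ι → ℝ) := ContinuousLinearMap.coeLM ℝ

section Flatness

variable {ι : Type} [Fintype ι] [DecidableEq ι] {m : ℕ}
  {M : Type*} [TopologicalSpace M] [ChartedSpace (EuclideanSpace ℝ (Fin m)) M]
  {V : M → Type*} [TopologicalSpace (TotalSpace (ι → ℝ) V)]
  [∀ x, AddCommGroup (V x)] [∀ x, Module ℝ (V x)] [∀ x, TopologicalSpace (V x)]
  [∀ x, IsTopologicalAddGroup (V x)] [∀ x, ContinuousSMul ℝ (V x)]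
  [FiberBundle (ι → ℝ) V] [VectorBundle ℝ (ι → ℝ) V]
  [IsManifold (𝓡 m) ∞ M] [ContMDiffVectorBundle ∞ (ι → ℝ) V (𝓡 m)]
  {G : Grading (ι := ι) V} {c : M} {y : EuclideanSpace ℝ (Fin m)}

theorem Grading.parity_single (G : Grading (ι := ι) V) (a : ι) :
    G.parity (Pi.single a 1) = (-1 : ℝ) ^ G.deg a • (Pi.single a 1 : ι → ℝ) := by
  ext b
  by_cases hb : b = a
  · subst hb; simp [Grading.parity]
  · simp [Grading.parity, hb]

theorem Grading.parity_mul_self (G : Grading (ι := ι) V) : G.parity * G.parity = 1 := by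
  ext v b
  change (-1 : ℝ) ^ G.deg b * ((-1 : ℝ) ^ G.deg b * v b) = v b
  rw [← mul_assoc, ← mul_zpow]
  norm_num

theorem Grading.parity_pow_mul_self (G : Grading (ι := ι) V) (n : ℕ) :
    G.parity ^ n * G.parity ^ n = 1 := by
  rw [← (Commute.refl G.parity).mul_pow, G.parity_mul_self, one_pow]

theorem symmₗ_mem_piece (G : Grading (ι := ι) V) (c : M) (a : ι) (x : M) :
    (trivializationAt (ι → ℝ) V c).symmₗ ℝ x (Pi.single a 1) ∈ G.piece (G.deg a) x := by
  by_cases hx : x ∈ base ι V c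
  · rw [G.mem_piece_iff c x hx]
    intro b hb
    rw [Trivialization.symmₗ_apply _ hx, (trivializationAt (ι → ℝ) V c).apply_mk_symm hx]
    exact Pi.single_eq_of_ne (fun h => hb (by rw [h])) 1
  · rw [Trivialization.symmₗ_apply_of_notMem _ hx]
    exact zero_mem (G.piece (G.deg a) x)

namespace Superconnection

variable {D : Superconnection (ι := ι) (m := m) G}

/-- The endomorphism degree of A_p is 1 - p, so only matrix entries between frame members whose
degrees differ by 1 - p can be nonzero. For p = 1 this holds because the connection preserves the
grading. -/
theorem chartForm_apply_eq_zero (hy : y ∈ chartDomain (ι := ι) V c) (p : ℕ)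
    (w : Fin p → EuclideanSpace ℝ (Fin m)) {a b : ι} (hab : G.deg b ≠ G.deg a + 1 - p) :
    D.chartForm c p y w (Pi.single a 1) b = 0 := by
  obtain ⟨x, hx⟩ : ∃ x, x = (chartAt (EuclideanSpace ℝ (Fin m)) c).symm y := ⟨_, rfl⟩
  have hxb : x ∈ base ι V c := by rw [hx]; exact hy.2
  suffices h : ∀ w : Fin p → TangentSpace (𝓡 m) x,
      toMat (ι := ι) c c x x (D.frameForm c p x w) (Pi.single a 1) b = 0 by
    subst hx
    exact h _
  intro w
  have hcoord : ∀ v ∈ G.piece (G.deg a + 1 - p) x,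
      (trivializationAt (ι → ℝ) V c).linearMapAt ℝ x v b = 0 := fun v hv => by
    rw [Trivialization.coe_linearMapAt_of_mem _ hxb]
    exact (G.mem_piece_iff c x hxb _ v).1 hv b hab
  have hA : ∀ w : Fin p → TangentSpace (𝓡 m) x,
      toMat (ι := ι) c c x x (D.A p x w) (Pi.single a 1) b = 0 := fun w => by
    rw [toMat_apply]
    exact hcoord _ (D.A_degree p x w _ _ (symmₗ_mem_piece G c a x))
  match p, w, hA, hcoord with
  | 0, w, hA, _ => exact hA w
  | 1, w, _, hcoord =>
    change toMat (ι := ι) c c x x (D.connForm c x (w 0)) (Pi.single a 1) b = 0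
    rw [toMat_connForm_apply _ c hxb, Pi.neg_apply, neg_eq_zero]
    refine hcoord _ ?_
    -- `conn_degree` asks for a section that is homogeneous at every point. The section given by
    -- `symmₗ` is zero outside the base set, hence homogeneous everywhere, and it agrees with the
    -- frame member near x.
    have h1 : ∀ᶠ z in nhds x, (trivializationAt (ι → ℝ) V c).symmₗ ℝ z (Pi.single a 1) =
        frame c a z := by
      filter_upwards [(trivializationAt (ι → ℝ) V c).open_baseSet.mem_nhds hxb] with z hz
      rw [Trivialization.symmₗ_apply _ hz]
      rfl
    have h2 : MDifferentiableAt (𝓡 m) ((𝓡 m).prod 𝓘(ℝ, ι → ℝ)) (fun z =>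
        (⟨z, (trivializationAt (ι → ℝ) V c).symmₗ ℝ z (Pi.single a 1)⟩ :
          TotalSpace (ι → ℝ) V)) x := by
      refine (mdifferentiableAt_frame hxb a).congr_of_eventuallyEq ?_
      filter_upwards [h1] with z hz
      rw [hz]
    rw [← D.conn.isCovariantDerivativeOnUniv.congr_of_eventuallyEq h2
      (mdifferentiableAt_frame hxb a) Filter.univ_mem h1,
      show G.deg a + 1 - ((1 : ℕ) : ℤ) = G.deg a by push_cast; ring]
    exact D.conn_degree _ _ (symmₗ_mem_piece G c a) x h2 (w 0)
  | p + 2, w, hA, _ => exact hA w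

/-- Conjugation by the parity multiplies an endomorphism of degree d by (-1)^d, and 1 - p has the
parity of p + 1. -/
theorem parity_conj_chartForm (hy : y ∈ chartDomain (ι := ι) V c) (p : ℕ)
    (w : Fin p → EuclideanSpace ℝ (Fin m)) : G.parity * D.chartForm c p y w * G.parity =
      (-1 : ℝ) ^ (p + 1) • D.chartForm c p y w := by
  apply ContinuousLinearMap.coe_injective
  refine LinearMap.pi_ext' fun a => LinearMap.ext_ring ?_
  change G.parity (D.chartForm c p y w (G.parity (Pi.single a 1))) =
    (-1 : ℝ) ^ (p + 1) • D.chartForm c p y w (Pi.single a 1)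
  rw [G.parity_single, map_smul, map_smul]
  ext b
  change (-1 : ℝ) ^ G.deg a * ((-1 : ℝ) ^ G.deg b * D.chartForm c p y w (Pi.single a 1) b) =
    (-1 : ℝ) ^ (p + 1) * D.chartForm c p y w (Pi.single a 1) b
  by_cases hab : G.deg b = G.deg a + 1 - p
  · rw [← mul_assoc, hab]
    congr 1
    rw [← zpow_natCast, ← zpow_add₀ (by norm_num)]
    rcases Int.even_or_odd (G.deg a) with h | h <;> rcases Int.even_or_odd (p : ℤ) with h' | h'
    all_goals
      obtain ⟨r, hr⟩ := h
      obtain ⟨s, hs⟩ := h'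
      push_cast
      rw [hr, hs]
    · rw [Odd.neg_one_zpow ⟨2 * r - s, by ring⟩, Odd.neg_one_zpow ⟨s, by ring⟩]
    · rw [Even.neg_one_zpow ⟨2 * r - s, by ring⟩, Even.neg_one_zpow ⟨s + 1, by ring⟩]
    · rw [Odd.neg_one_zpow ⟨2 * r - s + 1, by ring⟩, Odd.neg_one_zpow ⟨s, by ring⟩]
    · rw [Even.neg_one_zpow ⟨2 * r - s + 1, by ring⟩, Even.neg_one_zpow ⟨s + 1, by ring⟩]
  · rw [chartForm_apply_eq_zero hy p w hab]
    simp

theorem parity_pow_conj_chartForm (hy : y ∈ chartDomain (ι := ι) V c) (p k : ℕ)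
    (w : Fin p → EuclideanSpace ℝ (Fin m)) : G.parity ^ k * D.chartForm c p y w * G.parity ^ k =
      (-1 : ℝ) ^ (k * (p + 1)) • D.chartForm c p y w := by
  induction k with
  | zero =>
    rw [pow_zero, zero_mul, pow_zero, one_smul]
    ext; rfl
  | succ k ih =>
    have h : ∀ {R : Type} [Ring R] (a b : R), a ^ (k + 1) * b * a ^ (k + 1) =
        a ^ k * (a * b * a) * a ^ k := fun a b => by
      conv_lhs => rw [pow_succ a k, mul_assoc (a ^ k), mul_assoc, ← pow_succ, pow_succ' a k]
      simp only [mul_assoc]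
    have h2 : ∀ {R : Type} [Ring R] [Algebra ℝ R] (r : ℝ) (a b : R), a * (r • b) * a =
        r • (a * b * a) := fun r a b => by rw [mul_smul_comm, smul_mul_assoc]
    refine (h _ _).trans ?_
    rw [parity_conj_chartForm hy]
    refine (h2 _ _ _).trans ?_
    rw [ih, smul_smul, ← pow_add]
    congr 2
    ring

/-- The exponents combine to j plus the even numbers 2ij and i(i + 1). This is the sign left when
the parity operators are moved across A_i in `twist_wedge`. -/
theorem neg_one_pow_twist (i j : ℕ) :
    tw (i + j) * (-1 : ℝ) ^ ((i + j) * (i + 1)) = tw i * ((-1) ^ j * tw j) := by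
  have h1 : (-1 : ℝ) ^ (i * j) * (-1 : ℝ) ^ ((i + j) * (i + 1)) = (-1) ^ j := by
    rw [← pow_add, show i * j + (i + j) * (i + 1) = j + (2 * (i * j) + i * (i + 1)) by ring, pow_add,
      pow_add, (Nat.even_mul_succ_self i).neg_one_pow, (even_two_mul _).neg_one_pow]
    ring
  rw [tw_add]
  linear_combination tw i * tw j * h1

/-- A change of signs which turns `D` into a covariant derivative. -/
def twist (G : Grading (ι := ι) V) {X : Type} [NormedAddCommGroup X] [NormedSpace ℝ X]
    (θ : ∀ p : ℕ, X → X [⋀^Fin p]→L[ℝ] (ι → ℝ)) (n : ℕ) (y : X) : X [⋀^Fin n]→L[ℝ] (ι → ℝ) :=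
  tw n • (G.parity ^ n).compContinuousAlternatingMap (θ n y)

theorem twist_twist {X : Type} [NormedAddCommGroup X] [NormedSpace ℝ X]
    (θ : ∀ p : ℕ, X → X [⋀^Fin p]→L[ℝ] (ι → ℝ)) (n : ℕ) (y : X) :
    twist G (twist G θ) n y = θ n y := by
  ext1 w
  change tw n • (G.parity ^ n) (tw n • (G.parity ^ n) (θ n y w)) = θ n y w
  rw [map_smul, smul_smul, tw_mul_self, one_smul]
  exact congrArg (fun A : Mat ι => A (θ n y w)) (G.parity_pow_mul_self n)

theorem contDiffAt_twist {X : Type} [NormedAddCommGroup X] [NormedSpace ℝ X]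
    {θ : ∀ p : ℕ, X → X [⋀^Fin p]→L[ℝ] (ι → ℝ)} {n : ℕ} {y : X} {r : WithTop ℕ∞}
    (hθ : ContDiffAt ℝ r (θ n) y) : ContDiffAt ℝ r (twist G θ n) y := by
  have h : ContDiffAt ℝ r (fun y => (ContinuousLinearMap.compContinuousAlternatingMapCLM ℝ X (ι → ℝ)
    (ι → ℝ) (Fin n) (G.parity ^ n)) (θ n y)) y :=
    (ContinuousLinearMap.contDiff _).contDiffAt.comp y hθ
  exact ContDiffAt.const_smul (tw n) h

/-- In degree n = i + j the power of the parity is moved through A_i by conjugation. Together with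
the factor `G.parity ^ i` of the sign rule it leaves the j-th power, since squares of parities are
trivial. -/
theorem twist_wedge (hy : y ∈ chartDomain (ι := ι) V c) {i j n : ℕ} (h : i + j = n)
    (β : EuclideanSpace ℝ (Fin m) [⋀^Fin j]→ₗ[ℝ] (ι → ℝ)) :
    tw n • (G.parity ^ n).toLinearMap.compAlternatingMap (wedge (evalB ι) h
      (D.chartForm c i y).toAlternatingMap ((G.parity ^ i).toLinearMap.compAlternatingMap β)) =
    wedge (evalB ι) h (D.signedForm c i y).toAlternatingMap
      ((-1 : ℝ) ^ j • tw j • (G.parity ^ j).toLinearMap.compAlternatingMap β) := by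
  let Ad : Mat ι →ₗ[ℝ] Mat ι :=
    LinearMap.mulLeft ℝ (G.parity ^ n) ∘ₗ LinearMap.mulRight ℝ (G.parity ^ n)
  have h1 := wedge_comp_values (evalB ι) (evalB ι) (G.parity ^ n).toLinearMap Ad
    (G.parity ^ n).toLinearMap (fun A v => by
      change (G.parity ^ n) (A v) = (G.parity ^ n) (A ((G.parity ^ n) ((G.parity ^ n) v)))
      rw [show (G.parity ^ n) ((G.parity ^ n) v) = v from
        congrArg (fun A : Mat ι => A v) (G.parity_pow_mul_self n)]) h
    (D.chartForm c i y).toAlternatingMap ((G.parity ^ i).toLinearMap.compAlternatingMap β)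
  have h2 : Ad.compAlternatingMap (D.chartForm c i y).toAlternatingMap =
      (-1 : ℝ) ^ (n * (i + 1)) • (D.chartForm c i y).toAlternatingMap := by
    ext1 w
    refine Eq.trans ?_ (parity_pow_conj_chartForm hy i n w)
    exact (mul_assoc _ _ _).symm
  have h3 : (G.parity ^ n).toLinearMap.compAlternatingMap
      ((G.parity ^ i).toLinearMap.compAlternatingMap β) =
      (G.parity ^ j).toLinearMap.compAlternatingMap β := by
    ext1 w
    have h4 : G.parity ^ n * G.parity ^ i = G.parity ^ j := by
      rw [← h, ← pow_add, show i + j + i = i + i + j by ring, pow_add, pow_add, G.parity_pow_mul_self]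
      exact one_mul _
    exact congrArg (fun A : Mat ι => A (β w)) h4
  have h5 : ∀ (r s t : ℝ) (α : EuclideanSpace ℝ (Fin m) [⋀^Fin i]→ₗ[ℝ] Mat ι)
      (β : EuclideanSpace ℝ (Fin m) [⋀^Fin j]→ₗ[ℝ] (ι → ℝ)),
      wedge (evalB ι) h (r • α) (s • t • β) = (r * (s * t)) • wedge (evalB ι) h α β :=
    fun r s t α β => by
      have h6 := LinearMap.map_smul₂ (wedgeₗ (evalB ι) h) r α ((s * t) • β)
      rw [smul_smul]
      refine h6.trans (Eq.trans ?_ (mul_smul r (s * t) (wedge (evalB ι) h α β)).symm)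
      exact congrArg (fun x => r • x) (map_smul (wedgeₗ (evalB ι) h α) (s * t) β)
  have h6 := h5 ((-1 : ℝ) ^ (n * (i + 1))) 1 1 (D.chartForm c i y).toAlternatingMap
    ((G.parity ^ j).toLinearMap.compAlternatingMap β)
  rw [one_smul, one_smul, mul_one, mul_one] at h6
  rw [h1, h2, h3, h6, smul_smul]
  refine Eq.trans (congrArg (fun r : ℝ => r • wedge (evalB ι) h (D.chartForm c i y).toAlternatingMap
    ((G.parity ^ j).toLinearMap.compAlternatingMap β)) ?_) (h5 _ _ _ _ _).symm
  rw [← h, neg_one_pow_twist]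

/-- With φ = ε(`twist` θ), the operator D becomes dφ - a * φ: both the parity in front of the
exterior derivative and the powers of the parity in the products are absorbed by the change of
signs. -/
theorem twist_op (hy : y ∈ chartDomain (ι := ι) V c)
    {θ : ∀ p : ℕ, EuclideanSpace ℝ (Fin m) → EuclideanSpace ℝ (Fin m) [⋀^Fin p]→L[ℝ] (ι → ℝ)}
    (hθ : ∀ n, DifferentiableAt ℝ (θ n) y) (n : ℕ) :
    twist G (D.op c θ) n y = dext (fun n y => eps (fun n => twist G θ n y) n) n y -
      star (evalB ι) (fun n => D.signedForm c n y) (eps fun n => twist G θ n y) n := by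
  have h1 : D.op c θ n y = G.parity.compContinuousAlternatingMap (dext θ n y) -
      toCont (∑ i : Fin (n + 1), wedge (evalB ι) (Nat.add_sub_of_le i.is_le)
        (D.chartForm c i y).toAlternatingMap
        (((G.parity ^ (i : ℕ)).toLinearMap).compAlternatingMap (θ (n - i) y).toAlternatingMap)) := by
    rcases n with _ | n
    · have h0 : G.parity.compContinuousAlternatingMap (dext θ 0 y) = 0 := by
        ext1 w
        exact map_zero G.parity
      rw [h0, zero_sub]
      rfl
    · rfl
  have h2 : dext (fun n y => eps (fun n => twist G θ n y) n) n y =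
      tw n • (G.parity ^ n).compContinuousAlternatingMap
        (G.parity.compContinuousAlternatingMap (dext θ n y)) := by
    rcases n with _ | n
    · ext1 w
      change 0 = tw 0 • (G.parity ^ 0) (G.parity 0)
      rw [map_zero, map_zero, smul_zero]
    · have h3 : extDeriv (fun y => eps (fun n => twist G θ n y) n) y =
          (-1 : ℝ) ^ n • tw n • (G.parity ^ n).compContinuousAlternatingMap (extDeriv (θ n) y) := by
        refine (extDeriv_smul ((-1 : ℝ) ^ n) (twist G θ n)).trans (congrArg _ ?_)
        refine (extDeriv_smul (tw n)
          fun y => (G.parity ^ n).compContinuousAlternatingMap (θ n y)).trans (congrArg _ ?_)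
        exact extDeriv_comp (G.parity ^ n) (hθ n)
      refine h3.trans ?_
      rw [smul_smul, tw_succ]
      congr 1
      ext1 w
      have h4 : G.parity ^ n = G.parity ^ (n + 1) * G.parity := by
        rw [pow_succ, mul_assoc, G.parity_mul_self, mul_one]
      exact congrArg (fun A : Mat ι => A (extDeriv (θ n) y w)) h4
  rw [h2, star_eq_sum_fin]
  ext1 w
  have h3 : ∀ i : Fin (n + 1), _ := fun i : Fin (n + 1) =>
    congrArg (fun α => α w) (twist_wedge (D := D) hy (Nat.add_sub_of_le i.is_le)
      (θ (n - i) y).toAlternatingMap)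
  rw [twist, h1]
  change tw n • (G.parity ^ n) (_ - (∑ i : Fin (n + 1), _ : AlternatingMap _ _ _ _) w) =
    _ - (∑ i : Fin (n + 1), _ : ContinuousAlternatingMap _ _ _ _) w
  rw [map_sub, smul_sub, ContinuousAlternatingMap.sum_apply, alternatingMap_sum_apply, map_sum,
    Finset.smul_sum]
  congr 1
  exact Finset.sum_congr rfl fun i _ => h3 i

theorem contDiffAt_eps_twist
    {θ : ∀ p : ℕ, EuclideanSpace ℝ (Fin m) → EuclideanSpace ℝ (Fin m) [⋀^Fin p]→L[ℝ] (ι → ℝ)}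
    (hθ : ∀ n, ContDiffAt ℝ ∞ (θ n) y) (n : ℕ) :
    ContDiffAt ℝ ∞ (fun y => eps (fun n => twist G θ n y) n) y :=
  ContDiffAt.const_smul ((-1 : ℝ) ^ n) (contDiffAt_twist (hθ n))

/-- The square of `D` is the action of the curvature. -/
theorem twist_op_op (hy : y ∈ chartDomain (ι := ι) V c)
    {θ : ∀ p : ℕ, EuclideanSpace ℝ (Fin m) → EuclideanSpace ℝ (Fin m) [⋀^Fin p]→L[ℝ] (ι → ℝ)}
    (hθ : ∀ n, ContDiffOn ℝ ∞ (θ n) (chartDomain (ι := ι) V c)) (n : ℕ) :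
    twist G (D.op c (D.op c θ)) n y =
      eps (star (evalB ι) (fun n => D.chartCurv c n y) (eps fun n => twist G θ n y)) n := by
  have hO := isOpen_chartDomain (ι := ι) (m := m) (V := V) c
  have hθ' : ∀ z ∈ chartDomain (ι := ι) V c, ∀ n, ContDiffAt ℝ ∞ (θ n) z := fun z hz n =>
    (hθ n).contDiffAt (hO.mem_nhds hz)
  obtain ⟨φ, hφ⟩ : ∃ φ : ∀ p : ℕ, EuclideanSpace ℝ (Fin m) →
    EuclideanSpace ℝ (Fin m) [⋀^Fin p]→L[ℝ] (ι → ℝ), φ =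
      fun n y => eps (fun n => twist G θ n y) n := ⟨_, rfl⟩
  have hφs : ∀ z ∈ chartDomain (ι := ι) V c, ∀ n, ContDiffAt ℝ ∞ (φ n) z := fun z hz n => by
    rw [hφ]; exact contDiffAt_eps_twist (hθ' z hz) n
  obtain ⟨ψ, hψ⟩ : ∃ ψ : ∀ p : ℕ, EuclideanSpace ℝ (Fin m) →
    EuclideanSpace ℝ (Fin m) [⋀^Fin p]→L[ℝ] (ι → ℝ), ψ = fun n y => dext φ n y -
      star (evalB ι) (fun n => D.signedForm c n y) (fun n => φ n y) n := ⟨_, rfl⟩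
  have hop : ∀ z ∈ chartDomain (ι := ι) V c, ∀ n, twist G (D.op c θ) n z = ψ n z :=
    fun z hz n => by
      rw [twist_op hz fun n => (hθ' z hz n).differentiableAt (by simp), hψ, hφ]
  have hop' : ∀ n, twist G (D.op c θ) n =ᶠ[nhds y] ψ n := fun n => by
    filter_upwards [hO.mem_nhds hy] with z hz using hop z hz n
  have hψs : ∀ n, ContDiffAt ℝ ∞ (ψ n) y := fun n => by
    rw [hψ]
    exact (contDiffAt_dext (hφs y hy) (by simp) n).sub
      (contDiffAt_star (evalB ι) n (fun k => D.contDiffAt_signedForm hy k) (hφs y hy))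
  have hops : ∀ n, DifferentiableAt ℝ (D.op c θ n) y := fun n => by
    have h1 := (contDiffAt_twist (G := G) (hψs n)).differentiableAt (by simp)
    refine h1.congr_of_eventuallyEq ?_
    filter_upwards [hop' n] with z hz
    rw [← twist_twist (G := G) (D.op c θ), twist, hz]
    rfl
  -- Applying D twice inserts a sign ε between the two covariant derivatives. Moved to the left, it
  -- turns the second one into d + ε(a) *, up to a sign, which is the form in `covariant_square`.
  have hsq : dext ψ n y + star (evalB ι) (eps fun n => D.signedForm c n y) (fun n => ψ n y) n =
      -star (evalB ι) (fun n => D.chartCurv c n y) (fun n => φ n y) n := by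
    rw [hψ]
    exact covariant_square (B₀ := mulB ι) (B := evalB ι) (fun A A' v => rfl)
      (fun n => (D.contDiffAt_signedForm hy n).of_le (by norm_cast))
      (fun n => (hφs y hy n).of_le (by norm_cast)) n
  have e1 : (fun n => dext (twist G (D.op c θ)) n y) = fun n => dext ψ n y :=
    funext fun n => dext_congr n fun k _ => hop' k
  have e2 : (fun n => twist G (D.op c θ) n y) = fun n => ψ n y := funext fun n => hop y hy n
  have e3 : (eps fun n => twist G θ n y) = fun n => φ n y := by rw [hφ]
  have e4 : eps (eps fun n => D.signedForm c n y) = fun n => D.signedForm c n y :=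
    funext fun n => eps_eps _ n
  have e5 := eps_star (evalB ι) (eps fun n => D.signedForm c n y) (fun n => ψ n y) n
  rw [e4] at e5
  rw [twist_op hy hops, dext_eps, e1, e2, e3, ← e5, eps, eps, eps, ← neg_eq_iff_eq_neg.2 hsq]
  module

/-- Constant sections suffice to detect the curvature: on a form with only the constant part v of
degree 0, D² gives, up to sign, the values of the curvature applied to v. -/
theorem isFlat_iff : D.IsFlat ↔ ∀ c, ∀ y ∈ chartDomain (ι := ι) V c, ∀ p, D.chartCurv c p y = 0 := by
  constructor
  · intro H c y hy p
    ext1 w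
    ext1 v
    have h1 := twist_op_op (D := D) hy (θ := fun p _ => zform v p) (fun p => contDiffOn_const) p
    have h2 : twist G (D.op c (D.op c fun p _ => zform v p)) p y = 0 := by
      rw [twist, H c _ (fun p => contDiffOn_const) p y hy]
      ext1 w
      change tw p • (G.parity ^ p) 0 = 0
      rw [map_zero, smul_zero]
    have h3 : (eps fun n => twist G (fun p (_ : EuclideanSpace ℝ (Fin m)) => zform v p) n y) =
        zform v := by
      funext n
      rcases n with _ | n
      · ext1 w
        change (-1 : ℝ) ^ 0 • tw 0 • (G.parity ^ 0) v = v
        rw [pow_zero, one_smul, tw_zero, one_smul, pow_zero]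
        rfl
      · ext1 w
        change (-1 : ℝ) ^ (n + 1) • tw (n + 1) • (G.parity ^ (n + 1)) 0 = 0
        rw [map_zero, smul_zero, smul_zero]
    rw [h2, h3, eps, star_zform_right] at h1
    have h4 := (smul_eq_zero.1 h1.symm).resolve_left (pow_ne_zero p (by norm_num))
    exact congrArg (fun α => α w) h4
  · intro H c θ hθ p y hy
    have h1 : twist G (D.op c (D.op c θ)) p y = 0 := by
      rw [twist_op_op hy hθ, eps, star_congr (evalB ι) (fun i _ => H c y hy i) fun _ _ => rfl]
      simp only [star, wdg_zero_left, Finset.sum_const_zero, smul_zero]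
    rw [← twist_twist (G := G) (D.op c (D.op c θ)), twist, h1]
    ext1 w
    change tw p • (G.parity ^ p) 0 = 0
    rw [map_zero, smul_zero]

theorem A₀_sq_of_chartCurv_zero (H : ∀ c, ∀ y ∈ chartDomain (ι := ι) V c, D.chartCurv c 0 y = 0)
    (x : M) : D.A₀ x ∘ₗ D.A₀ x = 0 := by
  have hx : x ∈ patch ι m V x := ⟨mem_chart_source _ x, FiberBundle.mem_baseSet_trivializationAt' x⟩
  have hy := chart_mem_chartDomain hx
  have h1 := H x _ hy
  have h2 := chartCurv_zero_apply (D := D) hy ![]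
  rw [h1, OpenPartialHomeomorph.left_inv _ hx.1] at h2
  refine toMat_injective hx.2 hx.2 ?_
  rw [map_zero]
  exact h2.symm

theorem isFlat_iff_structureEq :
    D.IsFlat ↔ (∀ x, D.A₀ x ∘ₗ D.A₀ x = 0) ∧ ∀ q z, D.StructureEq q z := by
  rw [isFlat_iff]
  constructor
  · exact fun H => ⟨A₀_sq_of_chartCurv_zero fun c y hy => H c y hy 0, fun q z =>
      (D.structureEq_iff q z).2 fun c hc => H c _ (chart_mem_chartDomain hc) _⟩
  · rintro ⟨hA, H⟩ c y hy p
    rcases p with _ | q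
    · exact chartCurv_zero hA hy
    · have h1 := (D.structureEq_iff q _).1 (H q _) c (symm_mem_patch hy)
      rwa [OpenPartialHomeomorph.right_inv _ hy.1] at h1

end Superconnection

end Flatness

end SuperTransport

end

theorem theorem3p5 {ι : Type} [Fintype ι] [DecidableEq ι] {m : ℕ}
    {M : Type*} [TopologicalSpace M] [T2Space M] [SecondCountableTopology M]
    [ChartedSpace (EuclideanSpace ℝ (Fin m)) M] [IsManifold (𝓡 m) ∞ M]
    {V : M → Type*} [TopologicalSpace (TotalSpace (ι → ℝ) V)]
    [∀ x, AddCommGroup (V x)] [∀ x, Module ℝ (V x)] [∀ x, TopologicalSpace (V x)]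
    [∀ x, IsTopologicalAddGroup (V x)] [∀ x, ContinuousSMul ℝ (V x)]
    [FiberBundle (ι → ℝ) V] [VectorBundle ℝ (ι → ℝ) V]
    [ContMDiffVectorBundle ∞ (ι → ℝ) V (𝓡 m)]
    (G : SuperTransport.Grading (ι := ι) V)
    (D : SuperTransport.Superconnection (ι := ι) (m := m) G) :
    ((∀ x, D.A₀ x ∘ₗ D.A₀ x = 0) →
      ∀ k : ℕ, 1 ≤ k → ∀ x₀ x₁ : M, x₁ ∈ connectedComponent x₀ →
        List.TFAE [
          (∀ y₀ ∈ connectedComponent x₀, ∀ y₁ ∈ connectedComponent x₀, D.NullHomotopy 0 y₀ y₁) ∧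
            ∀ q, 1 ≤ q → q ≤ k → D.NullHomotopy q x₀ x₁,
          (∀ y₀ ∈ connectedComponent x₀, ∀ y₁ ∈ connectedComponent x₀, D.PathSpaceEq 0 y₀ y₁) ∧
            ∀ q, 1 ≤ q → q ≤ k → D.PathSpaceEq q x₀ x₁,
          ∀ q ≤ k, ∀ z ∈ connectedComponent x₀, D.StructureEq q z]) ∧
    (((∀ x, D.A₀ x ∘ₗ D.A₀ x = 0) ∧ ∀ k : ℕ, 1 ≤ k →
        ∀ x₀ x₁ : M, x₁ ∈ connectedComponent x₀ → ∀ q ≤ k, D.NullHomotopy q x₀ x₁) ↔ D.IsFlat) ∧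
    (((∀ x, D.A₀ x ∘ₗ D.A₀ x = 0) ∧ ∀ k : ℕ, 1 ≤ k →
        ∀ x₀ x₁ : M, x₁ ∈ connectedComponent x₀ → ∀ q ≤ k, D.PathSpaceEq q x₀ x₁) ↔ D.IsFlat) ∧
    (((∀ x, D.A₀ x ∘ₗ D.A₀ x = 0) ∧ ∀ k : ℕ, 1 ≤ k → ∀ q ≤ k, ∀ z, D.StructureEq q z) ↔
      D.IsFlat) := by
  have hHP : ∀ q x₀ x₁, D.NullHomotopy q x₀ x₁ ↔ D.PathSpaceEq q x₀ x₁ := fun q x₀ x₁ =>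
    ⟨SuperTransport.Superconnection.pathSpaceEq_of_nullHomotopy,
      SuperTransport.Superconnection.nullHomotopy_of_pathSpaceEq⟩
  have hPS : (∀ x, D.A₀ x ∘ₗ D.A₀ x = 0) → ∀ k : ℕ, ∀ x₀ x₁ : M, x₁ ∈ connectedComponent x₀ →
      (((∀ y₀ ∈ connectedComponent x₀, ∀ y₁ ∈ connectedComponent x₀, D.PathSpaceEq 0 y₀ y₁) ∧
        ∀ q, 1 ≤ q → q ≤ k → D.PathSpaceEq q x₀ x₁) ↔
        ∀ q ≤ k, ∀ z ∈ connectedComponent x₀, D.StructureEq q z) := by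
    intro hA k x₀ x₁ hx₁
    constructor
    · rintro ⟨H₀, H⟩
      exact SuperTransport.Superconnection.structureEq_of_pathSpaceEq hA hx₁ H₀ H
    · intro H
      refine ⟨fun y₀ hy₀ y₁ _ => ?_, fun q _ hq =>
        SuperTransport.Superconnection.pathSpaceEq_of_structureEq H hq⟩
      refine SuperTransport.Superconnection.pathSpaceEq_of_structureEq (k := k) ?_ (Nat.zero_le k)
      rwa [← connectedComponent_eq hy₀]
  have hP : ((∀ x, D.A₀ x ∘ₗ D.A₀ x = 0) ∧ ∀ k : ℕ, 1 ≤ k →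
      ∀ x₀ x₁ : M, x₁ ∈ connectedComponent x₀ → ∀ q ≤ k, D.PathSpaceEq q x₀ x₁) ↔ D.IsFlat := by
    rw [SuperTransport.Superconnection.isFlat_iff_structureEq]
    refine and_congr_right fun hA => ⟨fun H q z => ?_, fun H k _ x₀ x₁ _ q hq => ?_⟩
    -- Loops at z are enough, and k = q + 1 is used because k = 0 is excluded. The end points needed
    -- in degree 0 lie in one component, so the hypothesis applies to them directly.
    · refine (hPS hA (q + 1) z z mem_connectedComponent).1 ⟨fun y₀ hy₀ y₁ hy₁ => ?_,
        fun p _ hp => H (q + 1) q.succ_pos z z mem_connectedComponent p hp⟩ q q.le_succ z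
        mem_connectedComponent
      rw [connectedComponent_eq hy₀] at hy₁
      exact H 1 le_rfl y₀ y₁ hy₁ 0 zero_le_one
    · exact SuperTransport.Superconnection.pathSpaceEq_of_structureEq (fun q _ z _ => H q z) hq
  refine ⟨fun hA k _ x₀ x₁ hx₁ => ?_, ?_, hP, ?_⟩
  · have h1 := hPS hA k x₀ x₁ hx₁
    simp only [hHP]
    tfae_have 1 ↔ 2 := Iff.rfl
    tfae_have 2 ↔ 3 := h1
    tfae_finish
  · simp only [hHP]
    exact hP
  · rw [SuperTransport.Superconnection.isFlat_iff_structureEq]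
    refine and_congr_right fun _ => ⟨fun H q z => H (q + 1) q.succ_pos q q.le_succ z,
      fun H k _ q _ z => H q z⟩
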